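/- **Setting.** A parallel service system has finitely many servers $s\in\mathcal S$ and customer types $c\in\mathcal C$, a compatibility graph $\mathcal G\subseteq\mathcal S\times\mathcal C$ in which every type has at least one server, type probabilities $\alpha_c>0$ with $\sum_c\alpha_c=1$, and service rates $\mu_{s,c}>0$ for $(s,c)\in\mathcal G$. Customers arrive in a renewal stream of rate $\lambda$ (after an initial residual time) and have i.i.d. types; the service times of server $s$ with type $c$ are i.i.d. with mean $1/\mu_{s,c}$; all these sequences are independent, and their distributions are otherwise arbitrary. For a graph $G\subseteq\mathcal G$, FCFS on $G$ means: a server that becomes free takes the longest waiting $G$-compatible customer, and an arriving customer goes to the longest idle $G$-compatible server, if there is one. $P_s(t)$ is the index, in the arrival stream, of the customer that $s$ serves at time $t$; the $k$ idle servers have positions $A(t)+1,\dots,A(t)+k$, where $A(t)$ is the number of arrivals in $(0,t]$. A fluid limit $(\bar P_s)$ is a limit along a subsequence of $P^n_s(nt)/n$, uniformly on compact subsets of $(0,\infty)$, for systems with common primitives whose initial positions satisfy $P^n_s(0)/n\to\bar P_s(0)\le 0$ and whose residual times at time $0$ are $o(n)$. Put $|\bar P(0)|=-\sum_s\bar P_s(0)$.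 For a set $R$ of servers, FCFS on $G$ has *complete resource pooling* on $R$ if for every $\lambda>0$ and every initial value of $|\bar P(0)|$ there is $t_0$ such that almost surely, for every fluid limit, $\max_{R}\bar P_s(t)-\min_R\bar P_s(t)=0$ for $t>t_0$. It has *complete weak resource pooling* on $R$ if instead the $\bar P_s$, $s\in R$, have equal derivatives at every $t>t_0$; it *moves at rate* $m$ if these derivatives are $\min(\lambda,m)$. It is *stable* on $R$ at arrival rate $\lambda$ if, starting from $|\bar P(0)|=1$, there is $t_0$ such that almost surely for every fluid limit $\lambda t-\min_R\bar P_s(t)=0$ for $t>t_0$. A policy on a graph $H$ is any rule allocating the servers' time to the types along the arcs of $H$ (each server gives at most the available time, completes its jobs of a given type successively, and only customers that have arrived depart); it is *stable* for a set $D$ of types if, starting from $|\bar P(0)|=1$, there is $t_0$ such that almost surely every fluid limit of the number of customers with types in $D$ vanishes for $t>t_0$. FCFS on $G$ is *throughput optimal with rate $m$ for $(R,D)$ among policies on $H$* if it is stable on $R$ for all $\lambda<m$, while for $\lambda>m$ every policy on $H$ is unstable for $D$. For $R=\mathcal S$, $D=\mathcal C$, $H=\mathcal G$ the qualification is omitted.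 For $S\subseteq\mathcal S$, $C\subseteq\mathcal C$ let $\mathrm{LP}(S,C)$ be the program $$\max\ \mu\quad\text{s.t.}\quad \sum_{c\in C}\eta_{s,c}=1\ (s\in S),\qquad \mu-\sum_{s\in S}\frac{\mu_{s,c}}{\alpha_c}\eta_{s,c}+\theta_c=0\ (c\in C),\qquad \eta,\theta\ge0,$$ with $\eta_{s,c}$ defined for the arcs $(s,c)\in\mathcal G$ with $s\in S$, $c\in C$. A basic solution comes with a basis: $|S|+|C|$ variables, including the free variable $\mu$, with linearly independent columns; the other variables vanish. $\mathcal S(C)$ denotes the set of servers compatible with some type in $C$. **Theorem.** Let $(\eta,\mu^*,\theta)$ be an optimal basic solution of $\mathrm{LP}(\mathcal S,\mathcal C)$. (i) Suppose that all $\theta_c=0$, the basic arcs form a tree on $\mathcal S\cup\mathcal C$, and $\eta_{s,c}>0$ on all basic arcs. Then FCFS on the graph of the basic arcs has complete resource pooling and is throughput optimal with rate $\mu^*$. (ii) Suppose that all $\theta_c=0$ and the basic arcs form a tree on $\mathcal S\cup\mathcal C$, but $\eta_{s,c}=0$ for some basic arc. Then FCFS on the graph of the basic arcs with $\eta_{s,c}\neq0$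 has complete weak resource pooling and is throughput optimal with rate $\mu^*$. (iii) Suppose that some $\theta_c>0$, let $C_1=\{c:\theta_c=0\}$, $S_1=\mathcal S(C_1)$, and suppose that the basic arcs between $S_1$ and $C_1$ form a connected graph on $S_1\cup C_1$. Then no arc with $\eta_{s,c}>0$ joins $S_1\cup C_1$ to the remaining nodes. The restriction of $(\eta,\mu^*,0)$ to $(S_1,C_1)$ is an optimal basic solution of $\mathrm{LP}(S_1,C_1)$, whose basic arcs are those of the given basis and form a tree on $S_1\cup C_1$. FCFS on the arcs of this tree with $\eta_{s,c}\ne0$ has complete resource pooling on $S_1$ if all arcs of the tree are positive, has complete weak resource pooling on $S_1$ in any case, moves at rate $\mu^*$ on $S_1$, and is throughput optimal with rate $\mu^*$ for $(S_1,C_1)$ among all policies on $\mathcal G$. (iv) In the case of (iii), the optimal value $\mu_2$ of $\mathrm{LP}(\mathcal S\setminus S_1,\mathcal C\setminus C_1)$ exists and $\mu_2>\mu^*$. Moreover (without the assumptions of (iii)) there is exactly one decomposition of the system into blocks $(S_1,C_1),\dots,(S_L,C_L)$ with rates $\mu_1<\dots<\mu_L$ such that $(S_\ell)$ and $(C_\ell)$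 are partitions of $\mathcal S$ and $\mathcal C$, each $C_\ell$ is nonempty, and for every $\ell$: $S_\ell=\mathcal S(C_\ell)\setminus(S_1\cup\dots\cup S_{\ell-1})$; $\mu_\ell$ is the optimal value both of $\mathrm{LP}(S_\ell\cup\dots\cup S_L,\,C_\ell\cup\dots\cup C_L)$ and of $\mathrm{LP}(S_\ell,C_\ell)$; and every optimal solution of $\mathrm{LP}(S_\ell,C_\ell)$ has zero slacks. It has $L\ge2$ if some $\theta_c>0$. In the case of (iii), if the complementary dual solution of the given basis is dual feasible, its first block is the pair $(S_1,C_1)$ of (iii), with rate $\mu^*$. Every $\mathrm{LP}(S_\ell,C_\ell)$ has an optimal basic solution, and one whose basic arcs form a tree on $S_\ell\cup C_\ell$ if the subgraph of $\mathcal G$ on $S_\ell\cup C_\ell$ is connected. For any choice of optimal basic solutions of all $\mathrm{LP}(S_\ell,C_\ell)$, consider FCFS on the graph of all their positive arcs. For each $\ell$ it has complete weak resource pooling on $S_\ell$, and complete resource pooling on $S_\ell$ if the positive arcs of block $\ell$ connect $S_\ell\cup C_\ell$; it moves at rate $\mu_\ell$ on $S_\ell$; and it is throughput optimal with rate $\mu_\ell$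 for $(S_\ell,C_\ell)$ among all policies on the arcs of $\mathcal G$ that do not use the servers in $S_1\cup\dots\cup S_{\ell-1}$ (which are retained by the earlier blocks). -/

import Mathlib

open MeasureTheory ProbabilityTheory Filter Topology

noncomputable section

namespace FCFS

/-! ## The network: servers `S`, customer types `C`, compatibility graph, first-order data -/

/-- A parallel service system: the compatibility graph, the probabilities `frac c` of the customer
types and the service rates `speed s c` (reciprocal mean service times). -/
structure Network (S C : Type*) [Fintype C] where
  compat : S → C → Prop
  frac : C → ℝ
  speed : S → C → ℝ
  frac_pos : ∀ c, 0 < frac c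
  frac_sum : ∑ c, frac c = 1
  speed_pos : ∀ s c, compat s c → 0 < speed s c
  has_server : ∀ c, ∃ s, compat s c

/-! ## Sample-path dynamics under first come first served, assign longest idle server -/

/-- The data that drive one sample path: the residual time until the first arrival after time `0`,
the later interarrival times, the types of all customers (customer `ℓ` with `ℓ ≤ 0` arrived up to
time `0`), and, for every server and type, the successive service times. -/
structure Input (S C : Type*) where
  first : ℝ
  inter : ℕ → ℝ
  kind : ℤ → C
  serv : S → C → ℕ → ℝ

/-- All the times in the input are nonnegative. -/
structure Input.Nonneg {S C : Type*} (inp : Input S C) : Prop where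
  first : 0 ≤ inp.first
  inter : ∀ k, 0 ≤ inp.inter k
  serv : ∀ s c k, 0 ≤ inp.serv s c k

/-- Arrival time of customer `k + 1`. -/
def Input.arrivalTime {S C : Type*} (inp : Input S C) (k : ℕ) : ℝ :=
  inp.first + ∑ i ∈ Finset.range k, inp.inter i

/-- State of the system just after an event: the time of the event, the number of arrivals in
`(0, time]`, the customer served by each server (`none` if idle), the completion times of the
services in progress, the idle servers (the one that became idle last comes first in the list), the
customers that are present and not in service, and the numbers of services of each kind started
after time `0`. -/
structure State (S C : Type*) where
  time : ℝ
  arrived : ℕ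
  job : S → Option ℤ
  finish : S → ℝ
  idle : List S
  waiting : Set ℤ
  started : S → C → ℕ

section Dynamics

variable {S C : Type*} [DecidableEq S] [DecidableEq C]

/-- The position of a server: the customer he is serving; the idle servers have the positions
`A + 1, …, A + k`, where `A` is the number of arrivals, the longest idle one being last. -/
def State.pos (x : State S C) (s : S) : ℤ :=
  match x.job s with
  | some l => l
  | none => (x.arrived : ℤ) + 1 + (x.idle.idxOf s : ℤ)

/-- Server `s` starts at time `t` to serve customer `l`. -/
def State.begin (inp : Input S C) (x : State S C) (s : S) (l : ℤ) (t : ℝ) : State S C :=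
  { x with
    time := t
    job := Function.update x.job s (some l)
    finish := Function.update x.finish s
      (t + inp.serv s (inp.kind l) (x.started s (inp.kind l)))
    started := Function.update x.started s
      (Function.update (x.started s) (inp.kind l) (x.started s (inp.kind l) + 1)) }

/-- The next event is the arrival of the next customer. -/
def State.ArrivalNext (inp : Input S C) (x : State S C) : Prop :=
  ∀ s, x.job s ≠ none → inp.arrivalTime x.arrived ≤ x.finish s

/-- The next event is the end of the service at server `s`. -/
def State.CompletionNext (inp : Input S C) (x : State S C) (s : S) : Prop :=
  x.job s ≠ none ∧ x.finish s ≤ inp.arrivalTime x.arrived ∧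
    ∀ s', x.job s' ≠ none → x.finish s ≤ x.finish s'

/-- One event of the FCFS-ALIS system with compatibility graph `G` (simultaneous events may be
taken in any order). -/
inductive Step (G : S → C → Prop) (inp : Input S C) : State S C → State S C → Prop
  /-- an arrival that finds no compatible idle server -/
  | arrivalWait (x : State S C) (hx : x.ArrivalNext inp)
      (hidle : ∀ s ∈ x.idle, ¬ G s (inp.kind (x.arrived + 1))) :
      Step G inp x { x with
        time := inp.arrivalTime x.arrived
        arrived := x.arrived + 1
        waiting := insert ((x.arrived : ℤ) + 1) x.waiting }
  /-- an arrival that is assigned to the longest idle compatible server -/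
  | arrivalServe (x : State S C) (s : S) (l₁ l₂ : List S) (hx : x.ArrivalNext inp)
      (hidle : x.idle = l₁ ++ s :: l₂) (hs : G s (inp.kind (x.arrived + 1)))
      (hlong : ∀ s' ∈ l₂, ¬ G s' (inp.kind (x.arrived + 1))) :
      Step G inp x
        { x.begin inp s ((x.arrived : ℤ) + 1) (inp.arrivalTime x.arrived) with
          arrived := x.arrived + 1
          idle := l₁ ++ l₂ }
  /-- a completion, after which the server takes the longest waiting compatible customer -/
  | completeServe (x : State S C) (s : S) (l : ℤ) (hx : x.CompletionNext inp s)
      (hl : IsLeast {i ∈ x.waiting | G s (inp.kind i)} l) :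
      Step G inp x
        { x.begin inp s l (x.finish s) with
          waiting := x.waiting \ {l} }
  /-- a completion, after which the server becomes idle -/
  | completeIdle (x : State S C) (s : S) (hx : x.CompletionNext inp s)
      (hl : ∀ i ∈ x.waiting, ¬ G s (inp.kind i)) :
      Step G inp x { x with
        time := x.finish s
        job := Function.update x.job s none
        idle := s :: x.idle }

/-- Admissible states at time `0`: the busy servers serve distinct compatible customers that
arrived earlier, the other servers are idle, and a customer is waiting exactly when he is not in
service and no compatible server has moved beyond him. -/
structure IsInitial (G : S → C → Prop) (inp : Input S C) (x : State S C) : Prop where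
  time_zero : x.time = 0
  arrived_zero : x.arrived = 0
  job_old : ∀ s l, x.job s = some l → l ≤ 0 ∧ G s (inp.kind l)
  job_inj : ∀ s s' l, x.job s = some l → x.job s' = some l → s = s'
  finish_nonneg : ∀ s, 0 ≤ x.finish s
  idle_nodup : x.idle.Nodup
  mem_idle : ∀ s, s ∈ x.idle ↔ x.job s = none
  mem_waiting : ∀ l, l ∈ x.waiting ↔
    l ≤ 0 ∧ (∀ s, x.job s ≠ some l) ∧ ∀ s, G s (inp.kind l) → x.pos s < l
  started_zero : ∀ s c, x.started s c = 0

/-- A sample path of the FCFS-ALIS system: the sequence of its states after successive events. -/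
structure IsPath (G : S → C → Prop) (inp : Input S C) (st : ℕ → State S C) : Prop where
  initial : IsInitial G inp (st 0)
  step : ∀ k, Step G inp (st k) (st (k + 1))
  nonexplosive : Tendsto (fun k => (st k).time) atTop atTop

/-- The state at time `t ≥ 0` (after all the events at times `≤ t`). -/
def stateAt (st : ℕ → State S C) (t : ℝ) : State S C :=
  st (sSup {k | (st k).time ≤ t})

end Dynamics

/-! ## Stochastic primitives -/

section Stochastic

variable {S C Ω : Type*} [Fintype C] [MeasurableSpace Ω]

/-- The σ-algebras generated by the individual primitive random variables. -/
@[reducible]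
def primitiveAlgebra (inter : ℕ → Ω → ℝ) (kind : ℤ → Ω → C) (serv : S → C → ℕ → Ω → ℝ) :
    ℕ ⊕ ℤ ⊕ (S × C × ℕ) → MeasurableSpace Ω
  | Sum.inl k => MeasurableSpace.comap (inter k) inferInstance
  | Sum.inr (Sum.inl l) => MeasurableSpace.comap (kind l) ⊤
  | Sum.inr (Sum.inr (s, c, k)) => MeasurableSpace.comap (serv s c k) inferInstance

/-- Stochastic primitives with arrival rate `lam`: i.i.d. interarrival times with mean `1 / lam`,
i.i.d. customer types with law `frac`, and for every compatible pair i.i.d. service times with mean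
`1 / speed`, all independent. The distributions are otherwise arbitrary. -/
structure Primitives (N : Network S C) (P : Measure Ω) (lam : ℝ) where
  inter : ℕ → Ω → ℝ
  kind : ℤ → Ω → C
  serv : S → C → ℕ → Ω → ℝ
  inter_meas : ∀ k, Measurable (inter k)
  kind_meas : ∀ l c, MeasurableSet (kind l ⁻¹' {c})
  serv_meas : ∀ s c k, Measurable (serv s c k)
  inter_nonneg : ∀ k ω, 0 ≤ inter k ω
  serv_nonneg : ∀ s c k ω, 0 ≤ serv s c k ω
  inter_ident : ∀ k, IdentDistrib (inter k) (inter 0) P P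
  inter_int : Integrable (inter 0) P
  inter_mean : ∫ ω, inter 0 ω ∂P = 1 / lam
  kind_law : ∀ l c, P.real (kind l ⁻¹' {c}) = N.frac c
  serv_ident : ∀ s c, N.compat s c → ∀ k, IdentDistrib (serv s c k) (serv s c 0) P P
  serv_int : ∀ s c, N.compat s c → Integrable (serv s c 0) P
  serv_mean : ∀ s c, N.compat s c → ∫ ω, serv s c 0 ω ∂P = 1 / N.speed s c
  indep : iIndep (primitiveAlgebra inter kind serv) P

/-- The input of the sample path `ω`, with residual time `u` until the first arrival. -/
def Primitives.input {N : Network S C} {P : Measure Ω} {lam : ℝ} (X : Primitives N P lam)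
    (ω : Ω) (u : ℝ) : Input S C where
  first := u
  inter := fun k => X.inter k ω
  kind := fun l => X.kind l ω
  serv := fun s c k => X.serv s c k ω

end Stochastic

/-! ## Fluid limits, resource pooling and stability under FCFS -/

section Fluid

variable {S C Ω : Type*} [Fintype S] [DecidableEq S] [Fintype C] [DecidableEq C]
  [MeasurableSpace Ω]

/-- `p s t` are fluid limits of the server positions along `ω`: there is a sequence of FCFS systems
with common primitives, with residual times at time `0` that are negligible under fluid scaling,
whose scaled initial positions converge to `p s 0`, and whose scaled positions converge along a
subsequence to `p s`, uniformly on compact subsets of `(0, ∞)` (a jump at time `0+` is possible). -/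
def IsFluidLimit (G : S → C → Prop) {N : Network S C} {P : Measure Ω} {lam : ℝ}
    (X : Primitives N P lam) (ω : Ω) (p : S → ℝ → ℝ) : Prop :=
  ∃ (u : ℕ → ℝ) (st : ℕ → ℕ → State S C) (r : ℕ → ℕ),
    (∀ n, 0 ≤ u n) ∧ (∀ n, IsPath G (X.input ω (u n)) (st n)) ∧
    Tendsto (fun n => u n / n) atTop (𝓝 0) ∧
    (∀ s, Tendsto (fun n => (st n 0).finish s / n) atTop (𝓝 0)) ∧
    (∀ s, Tendsto (fun n => ((st n 0).pos s : ℝ) / n) atTop (𝓝 (p s 0))) ∧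
    StrictMono r ∧
    ∀ s, TendstoLocallyUniformlyOn
      (fun n t => ((stateAt (st (r n)) (r n * t)).pos s : ℝ) / r n) (p s) atTop (Set.Ioi 0)

/-- The lowest level among the servers in `R`. -/
def lowest (R : Finset S) (p : S → ℝ) : ℝ := ⨅ s : R, p s

/-- The highest level among the servers in `R`. -/
def highest (R : Finset S) (p : S → ℝ) : ℝ := ⨆ s : R, p s

variable (N : Network S C) (P : Measure Ω)

/-- `Q` holds eventually for all the fluid limits of FCFS on `G`: for every arrival rate and every
initial size `|p(0)| = b` there is `t₀` such that almost surely, for every fluid limit `p` with this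
initial size, `Q lam p t` holds for all `t > t₀`. -/
def EventuallyUnder (G : S → C → Prop) (Q : ℝ → (S → ℝ → ℝ) → ℝ → Prop) : Prop :=
  ∀ lam, 0 < lam → ∀ X : Primitives N P lam, ∀ b : ℝ, ∃ t₀ : ℝ, ∀ᵐ ω ∂P,
    ∀ p : S → ℝ → ℝ, IsFluidLimit G X ω p → -∑ s, p s 0 = b → ∀ t, t₀ < t → Q lam p t

/-- Complete resource pooling of the servers in `R` under FCFS on the graph `G`. -/
def CompletePooling (G : S → C → Prop) (R : Finset S) : Prop :=
  EventuallyUnder N P G fun _ p t => highest R (fun s => p s t) - lowest R (fun s => p s t) = 0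

/-- Complete weak resource pooling of the servers in `R` under FCFS on the graph `G`: eventually
they all move at the same rate. -/
def WeakPooling (G : S → C → Prop) (R : Finset S) : Prop :=
  EventuallyUnder N P G fun _ p t => ∃ v, ∀ s ∈ R, HasDerivAt (p s) v t

/-- Under FCFS on `G`, with arrival rate `lam`, the servers in `R` eventually all move at rate
`min lam m`: at rate `m`, unless they keep up with the arrivals. -/
def MovesAtRate (G : S → C → Prop) (R : Finset S) (m : ℝ) : Prop :=
  EventuallyUnder N P G fun lam p t => ∀ s ∈ R, HasDerivAt (p s) (min lam m) t

variable {N P} in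
/-- The fluid model of FCFS on `G` is stable for the servers in `R`: starting from `|p(0)| = 1`, the
lowest of their levels is eventually equal to the arrival level `lam * t`. -/
def FluidStable {lam : ℝ} (X : Primitives N P lam) (G : S → C → Prop) (R : Finset S) : Prop :=
  ∃ t₀ : ℝ, ∀ᵐ ω ∂P, ∀ p : S → ℝ → ℝ, IsFluidLimit G X ω p → -∑ s, p s 0 = 1 →
    ∀ t, t₀ < t → lam * t - lowest R (fun s => p s t) = 0

/-! ## Arbitrary policies -/

/-- The amounts of work of the successive jobs of type `c` at server `s`; if `s` serves a customer
of type `c` at time `0`, the first of them is the remaining part of this service. -/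
def jobWork (inp : Input S C) (x : State S C) (s : S) (c : C) (k : ℕ) : ℝ :=
  if (∃ l, x.job s = some l ∧ inp.kind l = c) then
    (match k with
      | 0 => x.finish s
      | j + 1 => inp.serv s c j)
  else inp.serv s c k

/-- Number of customers of type `c` in the system at time `0`. -/
def present (inp : Input S C) (x : State S C) (c : C) : ℕ :=
  {l : ℤ | l ≤ 0 ∧ inp.kind l = c ∧ (l ∈ x.waiting ∨ ∃ s, x.job s = some l)}.ncard

/-- Number of arrivals of type `c` in `(0, t]`. -/
def arrivals (inp : Input S C) (c : C) (t : ℝ) : ℕ :=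
  {k : ℕ | inp.arrivalTime k ≤ t ∧ inp.kind ((k : ℤ) + 1) = c}.ncard

/-- What a policy does on a sample path: `alloc s c t` is the time that server `s` has given to type
`c` up to time `t`, and `comp s c t` is the number of services completed in this time. -/
structure Control (S C : Type*) where
  alloc : S → C → ℝ → ℝ
  comp : S → C → ℝ → ℕ

/-- The constraints on a policy that may use the arcs of `H`: no server gives more time than there
is, each server completes the jobs of each type one after the other, and only customers that have
arrived can depart. Idling, preemption and anticipation are allowed. -/
structure Control.IsAdmissible (H : S → C → Prop) (inp : Input S C) (x : State S C)
    (K : Control S C) : Prop where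
  alloc_zero : ∀ s c, K.alloc s c 0 = 0
  alloc_mono : ∀ s c, MonotoneOn (K.alloc s c) (Set.Ici 0)
  alloc_le : ∀ s t t', 0 ≤ t → t ≤ t' → ∑ c, (K.alloc s c t' - K.alloc s c t) ≤ t' - t
  alloc_off : ∀ s c t, ¬ H s c → K.alloc s c t = 0
  comp_mono : ∀ s c, Monotone (K.comp s c)
  comp_off : ∀ s c t, ¬ H s c → K.comp s c t = 0
  work_done : ∀ s c t, 0 ≤ t → H s c →
    ∑ k ∈ Finset.range (K.comp s c t), jobWork inp x s c k ≤ K.alloc s c t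
  work_left : ∀ s c t, 0 ≤ t → H s c →
    K.alloc s c t ≤ ∑ k ∈ Finset.range (K.comp s c t + 1), jobWork inp x s c k
  comp_le : ∀ c t, 0 ≤ t → ∑ s, K.comp s c t ≤ present inp x c + arrivals inp c t

/-- A policy for the servers and arcs of the graph `H`: a rule that determines an admissible control
from the sample path and the initial state. -/
structure Policy (H : S → C → Prop) where
  rule : Input S C → State S C → Control S C
  admissible : ∀ inp x, inp.Nonneg → IsInitial H inp x → (rule inp x).IsAdmissible H inp x

/-- Number of customers with types in `W` in the system at time `t`. -/
def Control.load (K : Control S C) (inp : Input S C) (x : State S C) (W : Finset C) (t : ℝ) : ℝ :=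
  ∑ c ∈ W, ((present inp x c : ℝ) + arrivals inp c t - ∑ s, (K.comp s c t : ℝ))

variable {N P} in
/-- `q` is a fluid limit, along `ω`, of the number of customers with types in `W` under the policy
`π`, and `p₀` is the limit of the scaled initial positions. -/
def IsLoadLimit {lam : ℝ} (X : Primitives N P lam) (ω : Ω) {H : S → C → Prop} (π : Policy H)
    (W : Finset C) (p₀ : S → ℝ) (q : ℝ → ℝ) : Prop :=
  ∃ (u : ℕ → ℝ) (x : ℕ → State S C) (r : ℕ → ℕ),
    (∀ n, 0 ≤ u n) ∧ (∀ n, IsInitial H (X.input ω (u n)) (x n)) ∧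
    Tendsto (fun n => u n / n) atTop (𝓝 0) ∧
    (∀ s, Tendsto (fun n => (x n).finish s / n) atTop (𝓝 0)) ∧
    (∀ s, Tendsto (fun n => ((x n).pos s : ℝ) / n) atTop (𝓝 (p₀ s))) ∧
    StrictMono r ∧
    TendstoLocallyUniformlyOn
      (fun n t => (π.rule (X.input ω (u (r n))) (x (r n))).load
        (X.input ω (u (r n))) (x (r n)) W (r n * t) / r n) q atTop (Set.Ioi 0)

variable {N P} in
/-- The fluid model of a policy is stable for the customer types in `W`: starting from
`|p(0)| = 1`, the fluid of these types is eventually drained. -/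
def PolicyStable {lam : ℝ} (X : Primitives N P lam) {H : S → C → Prop} (π : Policy H)
    (W : Finset C) : Prop :=
  ∃ t₀ : ℝ, ∀ᵐ ω ∂P, ∀ (p₀ : S → ℝ) (q : ℝ → ℝ), IsLoadLimit X ω π W p₀ q →
    -∑ s, p₀ s = 1 → ∀ t, t₀ < t → q t = 0

/-- FCFS on the graph `G`, for the servers in `R` and the customer types in `W`, is throughput
optimal with processing rate `m`: it is stable for all arrival rates below `m`, and for arrival
rates above `m` every policy on the graph `H` is unstable. -/
def MaximumThroughput (G : S → C → Prop) (R : Finset S) (H : S → C → Prop) (W : Finset C)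
    (m : ℝ) : Prop :=
  (∀ lam, 0 < lam → lam < m → ∀ X : Primitives N P lam, FluidStable X G R) ∧
  (∀ lam, 0 < lam → m < lam → ∀ X : Primitives N P lam, ∀ π : Policy H, ¬ PolicyStable X π W)

end Fluid

/-! ## The static planning linear program -/

section LP

variable {S C : Type*} [Fintype C]

/-- Feasible points `(η, μ, θ)` of the static planning problem of the subsystem with servers `R` and
customer types `D`; `θ` are the slacks of the customer constraints. -/
structure IsFeasible (N : Network S C) (R : Finset S) (D : Finset C)
    (η : S → C → ℝ) (μ : ℝ) (θ : C → ℝ) : Prop where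
  alloc_nonneg : ∀ s c, 0 ≤ η s c
  alloc_off : ∀ s c, ¬ (s ∈ R ∧ c ∈ D ∧ N.compat s c) → η s c = 0
  slack_nonneg : ∀ c, 0 ≤ θ c
  slack_off : ∀ c, c ∉ D → θ c = 0
  server : ∀ s ∈ R, ∑ c ∈ D, η s c = 1
  customer : ∀ c ∈ D, μ - ∑ s ∈ R, N.speed s c / N.frac c * η s c + θ c = 0

/-- Optimal solutions of the static planning problem (maximize `μ`). -/
def IsOptimal (N : Network S C) (R : Finset S) (D : Finset C)
    (η : S → C → ℝ) (μ : ℝ) (θ : C → ℝ) : Prop :=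
  IsFeasible N R D η μ θ ∧ ∀ η' μ' θ', IsFeasible N R D η' μ' θ' → μ' ≤ μ

/-- `μ` is the optimal value of the static planning problem. -/
def IsOptimalValue (N : Network S C) (R : Finset S) (D : Finset C) (μ : ℝ) : Prop :=
  ∃ η θ, IsOptimal N R D η μ θ

/-- The variables of the linear program. -/
inductive Var (S C : Type*)
  | rate : Var S C
  | arc : S → C → Var S C
  | slack : C → Var S C

open Classical in
/-- The columns of the constraint matrix (rows: server and customer constraints). -/
def column (N : Network S C) (D : Finset C) : Var S C → (S ⊕ C → ℝ)
  | Var.rate => Sum.elim (fun _ => 0) (fun c => if c ∈ D then 1 else 0)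
  | Var.arc s c => Pi.single (Sum.inl s) 1 - Pi.single (Sum.inr c) (N.speed s c / N.frac c)
  | Var.slack c => Pi.single (Sum.inr c) 1

/-- The arcs with basic variables. -/
def basicArc (B : Finset (Var S C)) (s : S) (c : C) : Prop := Var.arc s c ∈ B

/-- `B` is a basis of the linear program of the subsystem `(R, D)`, containing the free variable
`μ`: its columns are linearly independent and as many as there are constraints. -/
structure IsBasis (N : Network S C) (R : Finset S) (D : Finset C) (B : Finset (Var S C)) :
    Prop where
  rate_mem : Var.rate ∈ B
  arc_mem : ∀ s c, Var.arc s c ∈ B → s ∈ R ∧ c ∈ D ∧ N.compat s c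
  slack_mem : ∀ c, Var.slack c ∈ B → c ∈ D
  indep : LinearIndepOn ℝ (column N D) (B : Set (Var S C))
  card_eq : B.card = R.card + D.card

/-- `(η, μ, θ)` is an optimal solution that is basic, with basis `B`. -/
structure IsOptimalBasic (N : Network S C) (R : Finset S) (D : Finset C) (B : Finset (Var S C))
    (η : S → C → ℝ) (μ : ℝ) (θ : C → ℝ) : Prop where
  basis : IsBasis N R D B
  optimal : IsOptimal N R D η μ θ
  arc_nonbasic : ∀ s c, Var.arc s c ∉ B → η s c = 0
  slack_nonbasic : ∀ c, Var.slack c ∉ B → θ c = 0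

/-- The complementary dual solution of the basis `B` is feasible for the dual program (`y` are the
server prices and `z` the customer prices). -/
def DualFeasible (N : Network S C) (R : Finset S) (D : Finset C) (B : Finset (Var S C)) : Prop :=
  ∃ (y : S → ℝ) (z : C → ℝ), (∀ c ∈ D, 0 ≤ z c) ∧ ∑ c ∈ D, z c = 1 ∧
    (∀ s ∈ R, ∀ c ∈ D, N.compat s c → N.speed s c / N.frac c * z c ≤ y s) ∧
    (∀ s c, Var.arc s c ∈ B → y s = N.speed s c / N.frac c * z c) ∧
    (∀ c, Var.slack c ∈ B → z c = 0)

/-- The bipartite graph on servers and customer types with the arcs `E`. -/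
def bipartite (E : S → C → Prop) : SimpleGraph (S ⊕ C) :=
  SimpleGraph.fromRel fun x y => ∃ s c, x = Sum.inl s ∧ y = Sum.inr c ∧ E s c

/-- The graph of the arcs `E` between servers in `R` and customer types in `D`. -/
def subgraphOn (E : S → C → Prop) (R : Finset S) (D : Finset C) :=
  (bipartite E).induce {x | Sum.elim (fun s => s ∈ R) (fun c => c ∈ D) x}

/-! ## Decomposition -/

/-- A subsystem of a decomposition, with its processing rate. -/
structure Block (S C : Type*) where
  servers : Finset S
  types : Finset C
  rate : ℝ

open Classical in
/-- The servers in `R` that are compatible with some customer type in `D`. -/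
def serversOf (N : Network S C) (R : Finset S) (D : Finset C) : Finset S :=
  R.filter fun s => ∃ c ∈ D, N.compat s c

open Classical in
/-- `d` is a decomposition of the system with servers `R` and customer types `D`. Its first block
consists of a nonempty set of types and all of their servers; the optimal value of the planning
problem of the block is that of the whole system, and is not compatible with positive slacks in the
block; the rates of all later blocks are larger; and the later blocks decompose the rest. -/
def IsDecomposition (N : Network S C) : Finset S → Finset C → List (Block S C) → Prop
  | R, D, [] => R = ∅ ∧ D = ∅
  | R, D, b :: d =>
    b.types ⊆ D ∧ b.types.Nonempty ∧ b.servers = serversOf N R b.types ∧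
    IsOptimalValue N R D b.rate ∧ IsOptimalValue N b.servers b.types b.rate ∧
    (∀ η θ, IsOptimal N b.servers b.types η b.rate θ → ∀ c, θ c = 0) ∧
    (∀ b' ∈ d, b.rate < b'.rate) ∧
    IsDecomposition N (R \ b.servers) (D \ b.types) d

end LP

end FCFS

end

open MeasureTheory ProbabilityTheory Filter Topology

namespace FCFS

/-! ## Lipschitz functions with one-sided bounds on the derivative -/

/-! The dynamic part rests on a deterministic fluid model. Almost surely the averages of all
primitives exist. On that event every fluid limit satisfies the equations of `FluidModel`: a type
has a level `q c`, up to which its customers have been taken into service. A server never lies above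
the level of a compatible type, works for a type only if that type has the lowest level among its
compatible ones, and is fully busy while it is below the arrival level
(`ScaledPaths.exists_fluidModel`).

Take a connected component of the graph of positive arcs of an allocation `η` that serves every type
at rate `m`, with positive prices satisfying `y s = g s c * z c` on the arcs. A unit of time of
server `s` is then worth `y s`, whatever the server does. If the levels differ, the types at the
lowest level receive all the time of every adjacent server. This is worth strictly more than `m * ∑
z`, because `η` lets some of these servers also work outside. The types at the highest level receive
time only from servers with no other choice, which is worth strictly less. So the gap between the
extreme levels shrinks at a rate bounded below until it closes (`Balanced.exists_gap`,
`FluidModel.level_eq`). Afterwards the levels move together, at rate `m` or along the arrival level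
(`Balanced.exists_time`). Different components move at the same rate without having to meet. Hence
pooling is complete when the positive arcs connect the subsystem and weak otherwise.

For instability above the optimal value, start one server at position about `-n` and the others
idle. The scaled allocations of any policy are Lipschitz, so Arzelà–Ascoli yields a fluid limit of
the load. If it vanishes at some `t > 0`, the cumulative allocation divided by `t` serves all types
at rate at least `lam`, so the program has value at least `lam` (`not_policyStable`).

The prices come from linear algebra: if the rate column is not a combination of the positive arc
columns, a functional separates them, and its values on the unit vectors are prices. A basis
excludes such a combination by independence. A program without slack in any optimal solution
excludes it because the combination would be a perturbation creating slack (`Rigid.notMem_span`). On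
a connected graph tight prices have constant sign.

For the decomposition, call a type forced if it has no slack in any optimal solution. In an optimal
solution with as many slacks as possible, the servers of forced types serve nobody else, since
otherwise shifting time would give a forced type slack. So the forced types split off as the first
block, the rest has a larger value, and one iterates (`IsBest.first_block`). Conversely the first
block of any decomposition consists of the forced types, which gives uniqueness
(`IsDecomposition.types_eq`). In case (iii) a count of independent columns against rows
(`IsBasis.card_arcsBetween_le`) shows that the basic arcs at the servers of the types without slack
form a tree and do not leave it. -/

theorem lipschitz_sub_le {f : ℝ → ℝ} {K : NNReal} (hf : LipschitzWith K f) {a b κ : ℝ}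
    (hab : a ≤ b) (h : ∀ᵐ t, t ∈ Set.Ioo a b → deriv f t ≤ κ) : f b - f a ≤ κ * (b - a) := by
  have hac : AbsolutelyContinuousOnInterval f a b :=
    (hf.lipschitzOnWith).absolutelyContinuousOnInterval
  rw [← hac.integral_deriv_eq_sub]
  have h1 : ∫ x in a..b, deriv f x ≤ ∫ _ in a..b, κ := by
    apply intervalIntegral.integral_mono_ae_restrict hab hac.intervalIntegrable_deriv
      intervalIntegrable_const
    have : (volume.restrict (Set.Icc a b)) = volume.restrict (Set.Ioo a b) :=
      (Measure.restrict_congr_set Ioo_ae_eq_Icc).symm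
    rw [this]
    exact (ae_restrict_iff' measurableSet_Ioo).2 h
  refine h1.trans (le_of_eq ?_)
  simp [mul_comm]

/-- A Lyapunov argument. Zeros of `f` beyond `a` are local minima, so `f` decreases weakly
everywhere. If it is positive at `t` it was positive on all of `[a, t]`, and so lost `κ * (t - a)`,
which is more than it had. -/
theorem eq_zero_of_ae_deriv_le {f : ℝ → ℝ} {K : NNReal} (hf : LipschitzWith K f) {a κ : ℝ}
    (hκ : 0 < κ) (h0 : ∀ t, a ≤ t → 0 ≤ f t)
    (h : ∀ᵐ t, a < t → 0 < f t → deriv f t ≤ -κ) {t : ℝ} (ht : a + f a / κ ≤ t) : f t = 0 := by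
  have hat : a ≤ t := by
    have := div_nonneg (h0 a le_rfl) hκ.le
    linarith
  have hle : ∀ᵐ t, a < t → deriv f t ≤ 0 := by
    filter_upwards [h] with x hx hax
    rcases (h0 x hax.le).eq_or_lt with h1 | h1
    · have : IsLocalMin f x := by
        filter_upwards [lt_mem_nhds hax] with u hu
        rw [← h1]
        exact h0 u hu.le
      rw [this.deriv_eq_zero]
    · have := hx hax h1
      linarith
  by_contra hne
  have hpos : 0 < f t := lt_of_le_of_ne (h0 t hat) (Ne.symm hne)
  have hpos' : ∀ x, a ≤ x → x ≤ t → 0 < f x := by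
    intro x hx hxt
    have := lipschitz_sub_le hf (κ := 0) hxt (by
      filter_upwards [hle] with u hu hux
      exact hu (lt_of_le_of_lt hx hux.1))
    linarith
  have h2 := lipschitz_sub_le hf (κ := -κ) hat (by
      filter_upwards [h] with u hu hux
      exact hu hux.1 (hpos' u hux.1.le hux.2.le))
  have h3 : f a ≤ (t - a) * κ := by
    rw [← div_le_iff₀ hκ]
    linarith
  linarith

/-! ## Subsystems in which the work can be balanced -/

/-- The servers `R` and the types `D` form a connected union of components of `G`; the allocation
`η` uses all the arcs of `G` in it, and serves all the types at the rate `m`; the prices `y`, `z`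
are tight on the arcs. -/
structure Balanced {S C : Type*} (G : S → C → Prop) (R : Finset S) (D : Finset C)
    (g η : S → C → ℝ) (y : S → ℝ) (z : C → ℝ) (m : ℝ) : Prop where
  closed : ∀ s c, G s c → (s ∈ R ↔ c ∈ D)
  pos : ∀ s ∈ R, ∀ c, G s c → 0 < η s c
  off : ∀ s ∈ R, ∀ c ∈ D, ¬ G s c → η s c = 0
  sum_one : ∀ s ∈ R, ∑ c ∈ D, η s c = 1
  rate : ∀ c ∈ D, ∑ s ∈ R, g s c * η s c = m
  y_pos : ∀ s ∈ R, 0 < y s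
  z_pos : ∀ c ∈ D, 0 < z c
  price : ∀ s ∈ R, ∀ c, G s c → y s = g s c * z c
  nonempty : D.Nonempty
  rate_pos : 0 < m
  connected : ∀ U ⊆ D, U.Nonempty → U ≠ D → ∃ s ∈ R, ∃ c ∈ U, ∃ c' ∈ D, c' ∉ U ∧ G s c ∧ G s c'

namespace Balanced

variable {S C : Type*} {G : S → C → Prop} {R : Finset S} {D : Finset C}
  {g η : S → C → ℝ} {y : S → ℝ} {z : C → ℝ} {m : ℝ}

/-- Prices convert service rates into time: a unit of time of `s` is worth `y s` on every arc. The
identity is used for the allocation `η` and for the derivatives of the fluid allocation. -/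
theorem price_sum (h : Balanced G R D g η y z m) {U : Finset C} (hU : U ⊆ D) {d : S → C → ℝ}
    (hd : ∀ s ∈ R, ∀ c ∈ D, ¬ G s c → d s c = 0) :
    ∑ c ∈ U, z c * ∑ s ∈ R, g s c * d s c = ∑ s ∈ R, y s * ∑ c ∈ U, d s c := by
  simp_rw [Finset.mul_sum]
  rw [Finset.sum_comm]
  refine Finset.sum_congr rfl fun s hs => Finset.sum_congr rfl fun c hc => ?_
  by_cases hG : G s c
  · rw [h.price s hs c hG]; ring
  · rw [hd s hs c (hU hc) hG]; ring

theorem rate_sum (h : Balanced G R D g η y z m) {U : Finset C} (hU : U ⊆ D) :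
    m * ∑ c ∈ U, z c = ∑ s ∈ R, y s * ∑ c ∈ U, η s c := by
  rw [← h.price_sum hU h.off, Finset.mul_sum]
  exact Finset.sum_congr rfl fun c hc => by rw [h.rate c (hU hc), mul_comm]

theorem η_nonneg (h : Balanced G R D g η y z m) {s : S} (hs : s ∈ R) {c : C} (hc : c ∈ D) :
    0 ≤ η s c := by
  by_cases hG : G s c
  · exact (h.pos s hs c hG).le
  · rw [h.off s hs c hc hG]

theorem exists_arc (h : Balanced G R D g η y z m) {s : S} (hs : s ∈ R) : ∃ c ∈ D, G s c := by
  by_contra! hcon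
  have := h.sum_one s hs
  rw [Finset.sum_eq_zero fun c hc => h.off s hs c hc (hcon c hc)] at this
  norm_num at this

theorem exists_server (h : Balanced G R D g η y z m) {c : C} (hc : c ∈ D) : ∃ s, G s c := by
  by_contra! hcon
  have := h.rate c hc
  rw [Finset.sum_eq_zero fun s hs => by rw [h.off s hs c hc (hcon s), mul_zero]] at this
  exact h.rate_pos.ne this

theorem z_sum_pos (h : Balanced G R D g η y z m) {U : Finset C} (hU : U ⊆ D) (hne : U.Nonempty) :
    0 < ∑ c ∈ U, z c :=
  Finset.sum_pos (fun c hc => h.z_pos c (hU hc)) hne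

open Classical in
/-- The servers that can work for `U` have more capacity than they need. -/
theorem lt_servers (h : Balanced G R D g η y z m) {U : Finset C} (hU : U ⊆ D) (hne : U.Nonempty)
    (hUD : U ≠ D) : m * ∑ c ∈ U, z c < ∑ s ∈ R with ∃ c ∈ U, G s c, y s := by
  -- The inequality is strict because of this one server: it can work for `U`, but `η` gives part of
  -- its time to a type outside `U`.
  obtain ⟨s₀, hs₀, c₀, hc₀, c₁, hc₁, hc₁U, hG₀, hG₁⟩ := h.connected U hU hne hUD
  rw [h.rate_sum hU, Finset.sum_filter]
  have hle : ∀ s ∈ R, ∑ c ∈ U, η s c ≤ 1 := fun s hs => by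
    rw [← h.sum_one s hs]
    exact Finset.sum_le_sum_of_subset_of_nonneg hU fun c hc _ => h.η_nonneg hs hc
  refine Finset.sum_lt_sum (fun s hs => ?_) ⟨s₀, hs₀, ?_⟩
  · split_ifs with hex
    · exact mul_le_of_le_one_right (h.y_pos s hs).le (hle s hs)
    · push Not at hex
      rw [Finset.sum_eq_zero fun c hc => h.off s hs c (hU hc) (hex c hc), mul_zero]
  · rw [if_pos ⟨c₀, hc₀, hG₀⟩]
    apply mul_lt_of_lt_one_right (h.y_pos s₀ hs₀)
    rw [← h.sum_one s₀ hs₀]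
    exact Finset.sum_lt_sum_of_subset hU hc₁ hc₁U (h.pos s₀ hs₀ c₁ hG₁)
      fun c hc _ => h.η_nonneg hs₀ hc

open Classical in
/-- The servers that can only work for `U` have less capacity than needed. -/
theorem servers_lt (h : Balanced G R D g η y z m) {U : Finset C} (hU : U ⊆ D) (hne : U.Nonempty)
    (hUD : U ≠ D) : ∑ s ∈ R with ∀ c, G s c → c ∈ U, y s < m * ∑ c ∈ U, z c := by
  obtain ⟨s₀, hs₀, c₀, hc₀, c₁, hc₁, hc₁U, hG₀, hG₁⟩ := h.connected U hU hne hUD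
  rw [h.rate_sum hU, Finset.sum_filter]
  refine Finset.sum_lt_sum (fun s hs => ?_) ⟨s₀, hs₀, ?_⟩
  · split_ifs with hex
    · rw [Finset.sum_subset hU fun c hc hcU => h.off s hs c hc fun hG => hcU (hex c hG),
        h.sum_one s hs, mul_one]
    · exact mul_nonneg (h.y_pos s hs).le (Finset.sum_nonneg fun c hc => h.η_nonneg hs (hU hc))
  · rw [if_neg fun hall => hc₁U (hall c₁ hG₁)]
    exact mul_pos (h.y_pos s₀ hs₀) (Finset.sum_pos' (fun c hc => h.η_nonneg hs₀ (hU hc))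
      ⟨c₀, hc₀, h.pos s₀ hs₀ c₀ hG₀⟩)

-- There are only finitely many sets `U`, and each of the two strict inequalities survives a small
-- change of `m`. Hence one `δ` serves all of them.
open Classical in
theorem exists_gap (h : Balanced G R D g η y z m) : ∃ δ > 0, ∀ U ⊆ D, U.Nonempty → U ≠ D →
    (m + δ) * ∑ c ∈ U, z c ≤ ∑ s ∈ R with ∃ c ∈ U, G s c, y s ∧
    ∑ s ∈ R with ∀ c, G s c → c ∈ U, y s ≤ (m - δ) * ∑ c ∈ U, z c := by
  have key : ∀ U ∈ D.powerset, ∀ᶠ δ in 𝓝[>] (0 : ℝ), U.Nonempty → U ≠ D →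
      (m + δ) * ∑ c ∈ U, z c ≤ ∑ s ∈ R with ∃ c ∈ U, G s c, y s ∧
      ∑ s ∈ R with ∀ c, G s c → c ∈ U, y s ≤ (m - δ) * ∑ c ∈ U, z c := by
    intro U hU
    rw [Finset.mem_powerset] at hU
    by_cases hne : U.Nonempty
    swap
    · exact Eventually.of_forall fun δ h' => absurd h' hne
    by_cases hUD : U = D
    · exact Eventually.of_forall fun δ _ h' => absurd hUD h'
    have h1 : Tendsto (fun δ => (m + δ) * ∑ c ∈ U, z c) (𝓝[>] (0 : ℝ))
        (𝓝 ((m + 0) * ∑ c ∈ U, z c)) :=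
      ((continuous_const.add continuous_id).mul continuous_const).tendsto' 0 _ rfl
        |>.mono_left nhdsWithin_le_nhds
    have h2 : Tendsto (fun δ => (m - δ) * ∑ c ∈ U, z c) (𝓝[>] (0 : ℝ))
        (𝓝 ((m - 0) * ∑ c ∈ U, z c)) :=
      ((continuous_const.sub continuous_id).mul continuous_const).tendsto' 0 _ rfl
        |>.mono_left nhdsWithin_le_nhds
    rw [add_zero] at h1
    rw [sub_zero] at h2
    filter_upwards [h1.eventually_lt_const (h.lt_servers hU hne hUD),
      h2.eventually_const_lt (h.servers_lt hU hne hUD)] with δ h3 h4 _ _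
    exact ⟨h3.le, h4.le⟩
  have := (Filter.eventually_all_finset _).2 key
  obtain ⟨δ, hδ, hδ0⟩ := (this.and self_mem_nhdsWithin).exists
  exact ⟨δ, hδ0, fun U hU => hδ U (Finset.mem_powerset.2 hU)⟩

end Balanced

end FCFS

namespace FCFS

/-! ## The fluid model of first come first served -/

/-- Fluid dynamics of FCFS on `G`: `T s c t` is the time given by `s` to `c` up to time `t`, the
customers of type `c` up to position `q c t` have been taken into service, and `p s` are the
positions of the servers. -/
structure FluidModel {S C : Type*} [Fintype S] [Fintype C] (G : S → C → Prop) (g : S → C → ℝ)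
    (lam b : ℝ) (T : S → C → ℝ → ℝ) (q : C → ℝ → ℝ) (p : S → ℝ → ℝ) : Prop where
  mono : ∀ s c, Monotone (T s c)
  zero : ∀ s c t, t ≤ 0 → T s c t = 0
  le : ∀ s t t', 0 ≤ t → t ≤ t' → ∑ c, (T s c t' - T s c t) ≤ t' - t
  off : ∀ s c t, ¬ G s c → T s c t = 0
  level : ∀ c, (∃ s, G s c) → ∀ t, q c t = q c 0 + ∑ s, g s c * T s c t
  initial_ge : ∀ c, (∃ s, G s c) → -b ≤ q c 0
  initial_le : ∀ c, (∃ s, G s c) → q c 0 ≤ 0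
  below : ∀ c, (∃ s, G s c) → ∀ t, 0 ≤ t → q c t ≤ lam * t
  pos_le : ∀ s c, G s c → ∀ t, 0 < t → p s t ≤ q c t
  hold : ∀ s c, G s c → ∀ t t', 0 < t → t ≤ t' → p s t' < q c t → T s c t' = T s c t
  busy : ∀ s t t', 0 < t → t ≤ t' → p s t' < lam * t → ∑ c, (T s c t' - T s c t) = t' - t

namespace FluidModel

variable {S C : Type*} [Fintype S] [Fintype C] {G : S → C → Prop} {g : S → C → ℝ} {lam b : ℝ}
  {T : S → C → ℝ → ℝ} {q : C → ℝ → ℝ} {p : S → ℝ → ℝ}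

theorem T_sub_le (h : FluidModel G g lam b T q p) (s : S) (c : C) {t t' : ℝ} (htt' : t ≤ t') :
    T s c t' - T s c t ≤ t' - t := by
  have key : ∀ {t t' : ℝ}, 0 ≤ t → t ≤ t' → T s c t' - T s c t ≤ t' - t := fun {t t'} h0 htt' =>
    (Finset.single_le_sum (f := fun c => T s c t' - T s c t)
      (fun c _ => sub_nonneg.2 (h.mono s c htt')) (Finset.mem_univ c)).trans (h.le s t t' h0 htt')
  rcases le_total 0 t with h0 | h0
  · exact key h0 htt'
  · rcases le_total 0 t' with h1 | h1
    · have := key le_rfl h1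
      rw [h.zero s c 0 le_rfl] at this
      rw [h.zero s c t h0]
      linarith
    · rw [h.zero s c t h0, h.zero s c t' h1]
      linarith

/-- The extension of `T` by `0` to negative times makes it Lipschitz on the whole line, hence
differentiable almost everywhere. -/
theorem lipschitz_T (h : FluidModel G g lam b T q p) (s : S) (c : C) : LipschitzWith 1 (T s c) := by
  refine LipschitzWith.of_le_add_mul 1 fun x y => ?_
  rw [NNReal.coe_one, one_mul, Real.dist_eq]
  rcases le_total x y with hxy | hxy
  · have := h.mono s c hxy
    have := abs_nonneg (x - y)
    linarith
  · have := h.T_sub_le s c hxy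
    have := le_abs_self (x - y)
    linarith

theorem lipschitz_q (h : FluidModel G g lam b T q p) {c : C} (hc : ∃ s, G s c) :
    LipschitzWith (∑ s, ‖g s c‖₊) (q c) := by
  refine LipschitzWith.of_dist_le_mul fun x y => ?_
  rw [h.level c hc x, h.level c hc y, dist_add_left, NNReal.coe_sum, Finset.sum_mul]
  refine (dist_sum_sum_le _ _ _).trans (Finset.sum_le_sum fun s _ => ?_)
  rw [Real.dist_eq, ← mul_sub, abs_mul, coe_nnnorm, Real.norm_eq_abs]
  refine mul_le_mul_of_nonneg_left ?_ (abs_nonneg _)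
  have := (h.lipschitz_T s c).dist_le_mul x y
  rwa [NNReal.coe_one, one_mul, Real.dist_eq] at this

theorem deriv_nonneg (h : FluidModel G g lam b T q p) (s : S) (c : C) (t : ℝ) :
    0 ≤ deriv (T s c) t :=
  (h.mono s c).deriv_nonneg

theorem deriv_off (h : FluidModel G g lam b T q p) {s : S} {c : C} (hG : ¬ G s c) (t : ℝ) :
    deriv (T s c) t = 0 := by
  have : T s c = fun _ => 0 := funext fun t => h.off s c t hG
  rw [this, deriv_const]

theorem hasDerivAt_q (h : FluidModel G g lam b T q p) {c : C} (hc : ∃ s, G s c) {t : ℝ}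
    (ht : ∀ s, DifferentiableAt ℝ (T s c) t) :
    HasDerivAt (q c) (∑ s, g s c * deriv (T s c) t) t := by
  have : q c = fun t => q c 0 + ∑ s, g s c * T s c t := funext (h.level c hc)
  rw [this]
  exact (HasDerivAt.fun_sum fun s _ => ((ht s).hasDerivAt.const_mul (g s c))).const_add _

theorem deriv_sum_le (h : FluidModel G g lam b T q p) (s : S) {t : ℝ} (ht0 : 0 < t)
    (ht : ∀ c, DifferentiableAt ℝ (T s c) t) : ∑ c, deriv (T s c) t ≤ 1 := by
  have hd : HasDerivAt (fun x => x - ∑ c, T s c x) (1 - ∑ c, deriv (T s c) t) t :=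
    (hasDerivAt_id t).sub (HasDerivAt.fun_sum fun c _ => (ht c).hasDerivAt)
  have hm : MonotoneOn (fun x => x - ∑ c, T s c x) (Set.Ioi 0) := by
    intro x hx x' _ hxx'
    have := h.le s x x' (le_of_lt hx) hxx'
    rw [Finset.sum_sub_distrib] at this
    simp only
    linarith
  have := hm.derivWithin_nonneg (x := t)
  rw [derivWithin_of_isOpen isOpen_Ioi ht0, hd.deriv] at this
  linarith

/-- The server is at or below the lower level `q c' t`, by `pos_le`. Until it reaches the higher
level it starts nobody of type `c`, by `hold`. By continuity this remains so on both sides of `t`,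
and `T s c` is locally constant. -/
theorem deriv_eq_zero (h : FluidModel G g lam b T q p) {s : S} {c c' : C} (hG : G s c)
    (hG' : G s c') {t : ℝ} (ht0 : 0 < t) (hlt : q c' t < q c t) : deriv (T s c) t = 0 := by
  have hcont := (h.lipschitz_q ⟨s, hG⟩).continuous
  have hcont' := (h.lipschitz_q ⟨s, hG'⟩).continuous
  obtain ⟨v, hv1, hv2⟩ := exists_between hlt
  have h1 : ∀ᶠ x in 𝓝 t, q c' x < v := hcont'.continuousAt.eventually_lt_const hv1
  have h2 : ∀ᶠ x in 𝓝 t, v < q c x := hcont.continuousAt.eventually_const_lt hv2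
  have h3 : ∀ᶠ x in 𝓝 t, 0 < x := lt_mem_nhds ht0
  have hev : T s c =ᶠ[𝓝 t] fun _ => T s c t := by
    filter_upwards [h1, h2, h3] with x hx1 hx2 hx3
    rcases le_total x t with hxt | hxt
    · exact (h.hold s c hG x t hx3 hxt
        ((h.pos_le s c' hG' t ht0).trans_lt (hv1.trans hx2))).symm
    · exact h.hold s c hG t x ht0 hxt ((h.pos_le s c' hG' x hx3).trans_lt (hx1.trans hv2))
  rw [hev.deriv_eq, deriv_const]

/-- Below the arrival level there is always work for `s`, so `busy` applies on a neighbourhood of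
`t`. -/
theorem deriv_sum_eq_one (h : FluidModel G g lam b T q p) {s : S} {c : C} (hG : G s c) {t : ℝ}
    (ht0 : 0 < t) (ht : ∀ c, DifferentiableAt ℝ (T s c) t) (hlt : q c t < lam * t) :
    ∑ c, deriv (T s c) t = 1 := by
  have hcont := (h.lipschitz_q ⟨s, hG⟩).continuous
  obtain ⟨v, hv1, hv2⟩ := exists_between hlt
  have h1 : ∀ᶠ x in 𝓝 t, q c x < v := hcont.continuousAt.eventually_lt_const hv1
  have h2 : ∀ᶠ x in 𝓝 t, v < lam * x :=
    (continuous_const.mul continuous_id).continuousAt.eventually_const_lt hv2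
  have h3 : ∀ᶠ x in 𝓝 t, 0 < x := lt_mem_nhds ht0
  have hd : HasDerivAt (fun x => ∑ c, T s c x) (∑ c, deriv (T s c) t) t :=
    HasDerivAt.fun_sum fun c _ => (ht c).hasDerivAt
  have hev : (fun x => ∑ c, T s c x) =ᶠ[𝓝 t] fun x => ∑ c, T s c t + (x - t) := by
    filter_upwards [h1, h2, h3] with x hx1 hx2 hx3
    rcases le_total x t with hxt | hxt
    · have := h.busy s x t hx3 hxt ((h.pos_le s c hG t ht0).trans_lt (hv1.trans hx2))
      rw [Finset.sum_sub_distrib] at this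
      linarith
    · have := h.busy s t x ht0 hxt ((h.pos_le s c hG x hx3).trans_lt (hx1.trans hv2))
      rw [Finset.sum_sub_distrib] at this
      linarith
  have hd' : HasDerivAt (fun x => ∑ c, T s c t + (x - t)) 1 t :=
    ((hasDerivAt_id t).sub_const t).const_add _
  exact hd.unique (hd'.congr_of_eventuallyEq hev)

/-! ### A balanced subsystem -/

variable {R : Finset S} {D : Finset C} {η : S → C → ℝ} {y : S → ℝ} {z : C → ℝ} {m : ℝ}

theorem deriv_sum_restrict (h : FluidModel G g lam b T q p) (hB : Balanced G R D g η y z m) {s : S}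
    (hs : s ∈ R) (t : ℝ) : ∑ c ∈ D, deriv (T s c) t = ∑ c, deriv (T s c) t :=
  Finset.sum_subset (Finset.subset_univ _) fun c _ hc =>
    h.deriv_off (fun hG => hc ((hB.closed s c hG).1 hs)) t

/-- The rate of the types in `U`, if these rates are equal. -/
theorem rate_eq (h : FluidModel G g lam b T q p) (hB : Balanced G R D g η y z m) {U : Finset C}
    (hU : U ⊆ D) {t v : ℝ} (hv : ∀ c ∈ U, ∑ s, g s c * deriv (T s c) t = v) :
    v * ∑ c ∈ U, z c = ∑ s ∈ R, y s * ∑ c ∈ U, deriv (T s c) t := by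
  rw [← hB.price_sum hU (d := fun s c => deriv (T s c) t) fun s _ c _ hG => h.deriv_off hG t,
    Finset.mul_sum]
  refine Finset.sum_congr rfl fun c hc => ?_
  rw [← hv c hc, mul_comm]
  congr 1
  refine (Finset.sum_subset (Finset.subset_univ _) fun s _ hs => ?_).symm
  rw [h.deriv_off (fun hG => hs ((hB.closed s c hG).2 (hU hc))), mul_zero]

end FluidModel

end FCFS

/-! ### Equalization of the levels in a balanced subsystem -/

namespace FCFS

theorem lipschitzWith_sup' {ι : Type*} {D : Finset ι} (hD : D.Nonempty) {f : ι → ℝ → ℝ}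
    {K : ι → NNReal} (hf : ∀ c ∈ D, LipschitzWith (K c) (f c)) :
    LipschitzWith (∑ c ∈ D, K c) (fun t => D.sup' hD fun c => f c t) := by
  refine LipschitzWith.of_le_add_mul _ fun x y => ?_
  refine Finset.sup'_le _ _ fun c hc => ?_
  have h1 := (hf c hc).le_add_mul x y
  have h2 : f c y ≤ D.sup' hD fun c => f c y := Finset.le_sup' (fun c => f c y) hc
  have h3 : (K c : ℝ) ≤ ((∑ c ∈ D, K c : NNReal) : ℝ) :=
    NNReal.coe_le_coe.2 (Finset.single_le_sum (fun _ _ => zero_le) hc)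
  have h4 := mul_le_mul_of_nonneg_right h3 (dist_nonneg (x := x) (y := y))
  linarith

theorem lipschitzWith_inf' {ι : Type*} {D : Finset ι} (hD : D.Nonempty) {f : ι → ℝ → ℝ}
    {K : ι → NNReal} (hf : ∀ c ∈ D, LipschitzWith (K c) (f c)) :
    LipschitzWith (∑ c ∈ D, K c) (fun t => D.inf' hD fun c => f c t) := by
  refine LipschitzWith.of_le_add_mul _ fun x y => ?_
  obtain ⟨c, hc, hcy⟩ := Finset.exists_mem_eq_inf' hD fun c => f c y
  rw [hcy]
  have h1 := (hf c hc).le_add_mul x y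
  have h2 : D.inf' hD (fun c => f c x) ≤ f c x := Finset.inf'_le (fun c => f c x) hc
  have h3 : (K c : ℝ) ≤ ((∑ c ∈ D, K c : NNReal) : ℝ) :=
    NNReal.coe_le_coe.2 (Finset.single_le_sum (fun _ _ => zero_le) hc)
  have h4 := mul_le_mul_of_nonneg_right h3 (dist_nonneg (x := x) (y := y))
  linarith

/-- The difference has a local minimum where the functions touch. This gives an extreme level the
derivative of each level that attains it. -/
theorem HasDerivAt.eq_of_le {f f' : ℝ → ℝ} {v v' t : ℝ} (hf : HasDerivAt f v t)
    (hf' : HasDerivAt f' v' t) (hle : ∀ᶠ x in 𝓝 t, f x ≤ f' x) (heq : f t = f' t) : v = v' := by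
  have hmin : IsLocalMin (fun x => f' x - f x) t := by
    filter_upwards [hle] with x hx
    linarith
  have := hmin.hasDerivAt_eq_zero (hf'.sub hf)
  linarith

namespace FluidModel

variable {S C : Type*} [Fintype S] [Fintype C] {G : S → C → Prop} {g : S → C → ℝ} {lam b : ℝ}
  {T : S → C → ℝ → ℝ} {q : C → ℝ → ℝ} {p : S → ℝ → ℝ} {R : Finset S} {D : Finset C}
  {η : S → C → ℝ} {y : S → ℝ} {z : C → ℝ} {m : ℝ}

theorem ae_differentiableAt (h : FluidModel G g lam b T q p) :
    ∀ᵐ t, ∀ s c, DifferentiableAt ℝ (T s c) t :=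
  ae_all_iff.2 fun s => ae_all_iff.2 fun c => (h.lipschitz_T s c).ae_differentiableAt_real

-- Let `U` be the types at the lowest level. Every server adjacent to `U` gives all its time to `U`:
-- its other types are higher, and it is below the arrival level because the highest level is not
-- beyond that. So `U` receives the full value of its neighbours, while all types of `U` move at the
-- same rate.
open Classical in
theorem le_deriv_inf' (h : FluidModel G g lam b T q p) (hB : Balanced G R D g η y z m) {δ : ℝ}
    (hδ : ∀ U ⊆ D, U.Nonempty → U ≠ D →
      (m + δ) * ∑ c ∈ U, z c ≤ ∑ s ∈ R with ∃ c ∈ U, G s c, y s) {t : ℝ} (ht0 : 0 < t)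
    (ht : ∀ s c, DifferentiableAt ℝ (T s c) t)
    (hL : DifferentiableAt ℝ (fun x => D.inf' hB.nonempty fun c => q c x) t)
    (hlt : D.inf' hB.nonempty (fun c => q c t) < D.sup' hB.nonempty fun c => q c t) :
    m + δ ≤ deriv (fun x => D.inf' hB.nonempty fun c => q c x) t := by
  set L := fun x => D.inf' hB.nonempty fun c => q c x with hLdef
  have hLle : ∀ c ∈ D, ∀ x, L x ≤ q c x := fun c hc x => Finset.inf'_le (fun c => q c x) hc
  set U := D.filter fun c => q c t = L t with hU
  have hUD : U ⊆ D := Finset.filter_subset _ _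
  have hne : U.Nonempty := by
    obtain ⟨c, hc, hcy⟩ := Finset.exists_mem_eq_inf' hB.nonempty fun c => q c t
    exact ⟨c, Finset.mem_filter.2 ⟨hc, hcy.symm⟩⟩
  obtain ⟨c₁, hc₁, hc₁t⟩ := Finset.exists_mem_eq_sup' hB.nonempty fun c => q c t
  have hneD : U ≠ D := fun heq => by
    have : c₁ ∈ U := heq ▸ hc₁
    have := (Finset.mem_filter.1 this).2
    rw [hc₁t] at hlt
    exact hlt.ne this.symm
  -- Each level in `U` touches the minimum from above at `t`, so the derivatives coincide.
  have hv : ∀ c ∈ U, ∑ s, g s c * deriv (T s c) t = deriv L t := fun c hc => by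
    have hc' := Finset.mem_filter.1 hc
    exact (HasDerivAt.eq_of_le hL.hasDerivAt
      (h.hasDerivAt_q (hB.exists_server hc'.1) fun s => ht s c)
      (Eventually.of_forall fun x => hLle c hc'.1 x) hc'.2.symm).symm
  have hkey := h.rate_eq hB hUD hv
  have hle := hδ U hUD hne hneD
  have hsum : ∑ s ∈ R with ∃ c ∈ U, G s c, y s ≤ ∑ s ∈ R, y s * ∑ c ∈ U, deriv (T s c) t := by
    rw [Finset.sum_filter]
    refine Finset.sum_le_sum fun s hs => ?_
    split_ifs with hex
    · obtain ⟨c, hcU, hG⟩ := hex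
      have hc' := Finset.mem_filter.1 hcU
      have : ∑ c ∈ U, deriv (T s c) t = 1 := by
        rw [← h.deriv_sum_eq_one hG ht0 (ht s), ← h.deriv_sum_restrict hB hs]
        · refine Finset.sum_subset hUD fun c₂ hc₂ hc₂U => ?_
          by_cases hG₂ : G s c₂
          · refine h.deriv_eq_zero hG₂ hG ht0 (lt_of_le_of_ne ?_ ?_)
            · rw [hc'.2]; exact hLle c₂ hc₂ t
            · intro heq
              exact hc₂U (Finset.mem_filter.2 ⟨hc₂, by rw [← heq, hc'.2]⟩)
          · exact h.deriv_off hG₂ t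
        · have := h.below c₁ (hB.exists_server hc₁) t ht0.le
          rw [hc'.2]
          rw [hc₁t] at hlt
          exact hlt.trans_le this
      rw [this, mul_one]
    · exact mul_nonneg (hB.y_pos s hs).le (Finset.sum_nonneg fun c _ => h.deriv_nonneg s c t)
  rw [← hkey] at hsum
  exact le_of_mul_le_mul_right (hle.trans hsum) (hB.z_sum_pos hUD hne)

-- Now `U` consists of the types at the highest level. A server with an arc out of `U` has a type of
-- lower level and gives no time to `U`; only the servers confined to `U` contribute.
open Classical in
theorem deriv_sup'_le (h : FluidModel G g lam b T q p) (hB : Balanced G R D g η y z m) {δ : ℝ}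
    (hδ : ∀ U ⊆ D, U.Nonempty → U ≠ D →
      ∑ s ∈ R with ∀ c, G s c → c ∈ U, y s ≤ (m - δ) * ∑ c ∈ U, z c) {t : ℝ} (ht0 : 0 < t)
    (ht : ∀ s c, DifferentiableAt ℝ (T s c) t)
    (hL : DifferentiableAt ℝ (fun x => D.sup' hB.nonempty fun c => q c x) t)
    (hlt : D.inf' hB.nonempty (fun c => q c t) < D.sup' hB.nonempty fun c => q c t) :
    deriv (fun x => D.sup' hB.nonempty fun c => q c x) t ≤ m - δ := by
  set L := fun x => D.sup' hB.nonempty fun c => q c x with hLdef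
  have hLle : ∀ c ∈ D, ∀ x, q c x ≤ L x := fun c hc x => Finset.le_sup' (fun c => q c x) hc
  set U := D.filter fun c => q c t = L t with hU
  have hUD : U ⊆ D := Finset.filter_subset _ _
  have hne : U.Nonempty := by
    obtain ⟨c, hc, hcy⟩ := Finset.exists_mem_eq_sup' hB.nonempty fun c => q c t
    exact ⟨c, Finset.mem_filter.2 ⟨hc, hcy.symm⟩⟩
  obtain ⟨c₁, hc₁, hc₁t⟩ := Finset.exists_mem_eq_inf' hB.nonempty fun c => q c t
  have hneD : U ≠ D := fun heq => by
    have : c₁ ∈ U := heq ▸ hc₁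
    have := (Finset.mem_filter.1 this).2
    rw [hc₁t] at hlt
    exact hlt.ne this
  have hv : ∀ c ∈ U, ∑ s, g s c * deriv (T s c) t = deriv L t := fun c hc => by
    have hc' := Finset.mem_filter.1 hc
    exact HasDerivAt.eq_of_le (h.hasDerivAt_q (hB.exists_server hc'.1) fun s => ht s c)
      hL.hasDerivAt (Eventually.of_forall fun x => hLle c hc'.1 x) hc'.2
  have hkey := h.rate_eq hB hUD hv
  have hle := hδ U hUD hne hneD
  have hsum : ∑ s ∈ R, y s * ∑ c ∈ U, deriv (T s c) t ≤ ∑ s ∈ R with ∀ c, G s c → c ∈ U, y s := by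
    rw [Finset.sum_filter]
    refine Finset.sum_le_sum fun s hs => ?_
    split_ifs with hall
    · refine mul_le_of_le_one_right (hB.y_pos s hs).le ((Finset.sum_le_sum_of_subset_of_nonneg
        (Finset.subset_univ U) fun c _ _ => h.deriv_nonneg s c t).trans
          (h.deriv_sum_le s ht0 (ht s)))
    · push Not at hall
      obtain ⟨c₂, hG₂, hc₂U⟩ := hall
      have hc₂ : c₂ ∈ D := (hB.closed s c₂ hG₂).1 hs
      refine (mul_eq_zero_of_right _ (Finset.sum_eq_zero fun c hc => ?_)).le
      have hc' := Finset.mem_filter.1 hc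
      by_cases hG : G s c
      · refine h.deriv_eq_zero hG hG₂ ht0 (lt_of_le_of_ne ?_ ?_)
        · rw [hc'.2]; exact hLle c₂ hc₂ t
        · intro heq
          exact hc₂U (Finset.mem_filter.2 ⟨hc₂, by rw [heq, hc'.2]⟩)
      · exact h.deriv_off hG t
  rw [← hkey] at hsum
  exact le_of_mul_le_mul_right (hsum.trans hle) (hB.z_sum_pos hUD hne)

-- The gap between the extreme levels is at most `b` at time `0` and closes at rate at least `2 * δ`
-- as long as it is positive.
open Classical in
theorem level_eq (h : FluidModel G g lam b T q p) (hB : Balanced G R D g η y z m) {δ : ℝ}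
    (hδ0 : 0 < δ) (hδ : ∀ U ⊆ D, U.Nonempty → U ≠ D →
      (m + δ) * ∑ c ∈ U, z c ≤ ∑ s ∈ R with ∃ c ∈ U, G s c, y s ∧
      ∑ s ∈ R with ∀ c, G s c → c ∈ U, y s ≤ (m - δ) * ∑ c ∈ U, z c) {t : ℝ}
    (ht : b / (2 * δ) ≤ t) {c c' : C} (hc : c ∈ D) (hc' : c' ∈ D) : q c t = q c' t := by
  have hlipL := lipschitzWith_inf' hB.nonempty (f := q)
    fun c hc => h.lipschitz_q (hB.exists_server hc)
  have hlipM := lipschitzWith_sup' hB.nonempty (f := q)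
    fun c hc => h.lipschitz_q (hB.exists_server hc)
  have hLM : ∀ x, D.inf' hB.nonempty (fun c => q c x) ≤ D.sup' hB.nonempty fun c => q c x :=
    fun x => (Finset.inf'_le (fun c => q c x) hc).trans (Finset.le_sup' (fun c => q c x) hc)
  have hlip := hlipM.sub hlipL
  have h0 : (D.sup' hB.nonempty fun c => q c 0) - D.inf' hB.nonempty (fun c => q c 0) ≤ b := by
    have h1 : (D.sup' hB.nonempty fun c => q c 0) ≤ 0 :=
      Finset.sup'_le _ _ fun c hc => h.initial_le c (hB.exists_server hc)
    have h2 : -b ≤ D.inf' hB.nonempty (fun c => q c 0) :=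
      Finset.le_inf' _ _ fun c hc => h.initial_ge c (hB.exists_server hc)
    linarith
  have hzero := eq_zero_of_ae_deriv_le hlip (a := 0) (κ := 2 * δ) (by positivity)
    (fun x _ => sub_nonneg.2 (hLM x)) (by
      filter_upwards [h.ae_differentiableAt, hlipL.ae_differentiableAt_real,
        hlipM.ae_differentiableAt_real] with x hx hxL hxM hx0 hpos
      have h1 := h.le_deriv_inf' hB (fun U a b c => (hδ U a b c).1) hx0 hx hxL (sub_pos.1 hpos)
      have h2 := h.deriv_sup'_le hB (fun U a b c => (hδ U a b c).2) hx0 hx hxM (sub_pos.1 hpos)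
      rw [(hxM.hasDerivAt.fun_sub hxL.hasDerivAt).deriv]
      linarith) (t := t) (by
      rw [zero_add]
      exact (div_le_div_of_nonneg_right h0 (by positivity)).trans ht)
  have e1 : ∀ c ∈ D, q c t = D.inf' hB.nonempty (fun c => q c t) := fun c hc => by
    have := Finset.inf'_le (fun c => q c t) hc
    have := Finset.le_sup' (fun c => q c t) hc
    apply le_antisymm <;> linarith
  rw [e1 c hc, e1 c' hc']

/-- Once the levels agree, they rise at the rate `m`, unless they have reached the arrival level. -/
theorem deriv_level_of_eq (h : FluidModel G g lam b T q p) (hB : Balanced G R D g η y z m) {a : ℝ}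
    (ha0 : 0 ≤ a) (ha : ∀ t, a ≤ t → ∀ c ∈ D, ∀ c' ∈ D, q c t = q c' t) {c : C} (hc : c ∈ D)
    {t : ℝ} (hat : a < t) (ht : ∀ s c, DifferentiableAt ℝ (T s c) t) :
    deriv (q c) t ≤ m ∧ (q c t < lam * t → deriv (q c) t = m) := by
  have hv : ∀ c' ∈ D, ∑ s, g s c' * deriv (T s c') t = deriv (q c) t := fun c' hc' => by
    have hev : q c =ᶠ[𝓝 t] q c' := by
      filter_upwards [lt_mem_nhds hat] with x hx
      exact ha x hx.le c hc c' hc'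
    rw [hev.deriv_eq, (h.hasDerivAt_q (hB.exists_server hc') fun s => ht s c').deriv]
  have hkey := h.rate_eq hB subset_rfl hv
  have hm := hB.rate_sum subset_rfl
  have hz := hB.z_sum_pos subset_rfl hB.nonempty
  have ht0 : 0 < t := ha0.trans_lt hat
  constructor
  · refine le_of_mul_le_mul_right ?_ hz
    rw [hkey, hm]
    refine Finset.sum_le_sum fun s hs => mul_le_mul_of_nonneg_left ?_ (hB.y_pos s hs).le
    rw [hB.sum_one s hs, h.deriv_sum_restrict hB hs]
    exact h.deriv_sum_le s ht0 (ht s)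
  · intro hlt
    refine mul_right_cancel₀ hz.ne' ?_
    rw [hkey, hm]
    refine Finset.sum_congr rfl fun s hs => ?_
    rw [hB.sum_one s hs, h.deriv_sum_restrict hB hs]
    obtain ⟨c', hc', hG⟩ := hB.exists_arc hs
    rw [h.deriv_sum_eq_one hG ht0 (ht s)]
    rwa [ha t hat.le c' hc' c hc]

/-- A server below the common level at `t` was, from some earlier time on, below the level of all
its types and below the arrival level. Then it would have to be busy on that interval without
working for any type. -/
theorem pos_eq_level (h : FluidModel G g lam b T q p) (hB : Balanced G R D g η y z m) {a : ℝ}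
    (ha0 : 0 ≤ a) (ha : ∀ t, a ≤ t → ∀ c ∈ D, ∀ c' ∈ D, q c t = q c' t) {c : C} (hc : c ∈ D)
    {t : ℝ} (hat : a < t) {s : S} (hs : s ∈ R) : p s t = q c t := by
  obtain ⟨c', hc', hG⟩ := hB.exists_arc hs
  have ht0 : 0 < t := ha0.trans_lt hat
  refine le_antisymm (by
    rw [ha t hat.le c hc c' hc']; exact h.pos_le s c' hG t ht0) ?_
  by_contra! hlt
  have hcont := (h.lipschitz_q (hB.exists_server hc)).continuous
  have h1 : ∀ᶠ x in 𝓝[<] t, p s t < q c x :=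
    (hcont.continuousAt.eventually_const_lt hlt).filter_mono nhdsWithin_le_nhds
  have h2 : ∀ᶠ x in 𝓝[<] t, a < x := (lt_mem_nhds hat).filter_mono nhdsWithin_le_nhds
  obtain ⟨x, ⟨hx1, hx2⟩, hx3⟩ := ((h1.and h2).and self_mem_nhdsWithin).exists
  have hx0 : 0 < x := ha0.trans_lt hx2
  have hxt : x < t := hx3
  have hb := h.busy s x t hx0 hxt.le
    (hx1.trans_le (h.below c (hB.exists_server hc) x hx0.le))
  rw [Finset.sum_eq_zero] at hb
  · linarith
  · intro c₂ _
    by_cases hG₂ : G s c₂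
    · have hc₂ : c₂ ∈ D := (hB.closed s c₂ hG₂).1 hs
      rw [h.hold s c₂ hG₂ x t hx0 hxt.le (by rwa [ha x hx2.le c₂ hc₂ c hc]), sub_self]
    · rw [h.off s c₂ _ hG₂, h.off s c₂ _ hG₂, sub_self]

end FluidModel

/-- Resource pooling in the fluid model. -/
theorem Balanced.exists_time {S C : Type*} [Fintype S] [Fintype C] {G : S → C → Prop}
    {g η : S → C → ℝ} {R : Finset S} {D : Finset C} {y : S → ℝ} {z : C → ℝ} {m : ℝ}
    (hB : Balanced G R D g η y z m) {lam : ℝ} (hlam : 0 < lam) (b : ℝ) :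
    ∃ t₀ : ℝ, ∀ T q p, FluidModel G g lam b T q p → ∀ t, t₀ < t →
      (∀ s ∈ R, HasDerivAt (p s) (min lam m) t) ∧ (∀ s ∈ R, ∀ s' ∈ R, p s t = p s' t) ∧
      (lam < m → ∀ s ∈ R, p s t = lam * t) := by
  classical
  obtain ⟨δ, hδ0, hδ⟩ := hB.exists_gap
  obtain ⟨c, hc⟩ := hB.nonempty
  have hex := hB.exists_server hc
  -- For `b < 0` there is no fluid model, since the initial levels lie between `-b` and `0`.
  rcases lt_or_ge b 0 with hb | hb
  · refine ⟨0, fun T q p h => ?_⟩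
    have := h.initial_ge c hex
    have := h.initial_le c hex
    linarith
  set a := b / (2 * δ) with ha
  have ha0 : 0 ≤ a := by positivity
  rcases lt_or_ge lam m with hlm | hlm
  -- At time `a`, when the levels have met, the distance to the arrival level is at most `lam * a +
  -- b`; from then on it shrinks at rate `m - lam`.
  · refine ⟨a + (lam * a + b) / (m - lam), fun T q p h t ht => ?_⟩
    have hpool : ∀ t, a ≤ t → ∀ c ∈ D, ∀ c' ∈ D, q c t = q c' t :=
      fun t ht c hc c' hc' => h.level_eq hB hδ0 (fun U h₁ h₂ h₃ => by convert hδ U h₁ h₂ h₃) ht hc hc'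
    have hlip : LipschitzWith (‖lam‖₊ + _) fun t => lam * t - q c t :=
      (LipschitzWith.of_dist_le_mul fun x y => by
        rw [Real.dist_eq, ← mul_sub, abs_mul, coe_nnnorm, Real.norm_eq_abs, Real.dist_eq]).sub
        (h.lipschitz_q hex)
    have hz : ∀ x, a + (lam * a + b) / (m - lam) ≤ x → lam * x - q c x = 0 := fun x hx => by
      refine eq_zero_of_ae_deriv_le hlip (a := a) (κ := m - lam) (sub_pos.2 hlm)
        (fun x hx => sub_nonneg.2 (h.below c hex x (ha0.trans hx))) ?_ (le_trans ?_ hx)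
      · filter_upwards [h.ae_differentiableAt] with x hx hax hpos
        have hd := (h.hasDerivAt_q hex fun s => hx s c).differentiableAt.hasDerivAt
        rw [(((hasDerivAt_id' x).const_mul lam).fun_sub hd).deriv,
          (h.deriv_level_of_eq hB ha0 hpool hc hax hx).2 (sub_pos.1 hpos)]
        linarith
      · have h1 : -b ≤ q c a := by
          rw [h.level c hex a]
          have h2 := h.initial_ge c hex
          have h3 : 0 ≤ ∑ s, g s c * T s c a := by
            refine Finset.sum_nonneg fun s _ => ?_
            have hT : 0 ≤ T s c a := by
              rw [← h.zero s c 0 le_rfl]; exact h.mono s c ha0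
            by_cases hG : G s c
            · have hs := (hB.closed s c hG).2 hc
              have h4 := hB.price s hs c hG
              have h5 := hB.y_pos s hs
              have h6 := hB.z_pos c hc
              have : 0 < g s c := by
                rw [h4] at h5
                exact pos_of_mul_pos_left h5 h6.le
              exact mul_nonneg this.le hT
            · rw [h.off s c a hG, mul_zero]
          linarith
        have := div_le_div_of_nonneg_right (show lam * a - q c a ≤ lam * a + b by linarith)
          (sub_pos.2 hlm).le
        linarith
    have hat : a ≤ a + (lam * a + b) / (m - lam) :=
      le_add_of_nonneg_right (div_nonneg (by positivity) (sub_pos.2 hlm).le)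
    have hp : ∀ x, a + (lam * a + b) / (m - lam) < x → ∀ s ∈ R, p s x = lam * x :=
      fun x hx s hs => by
        rw [h.pos_eq_level hB ha0 hpool hc (hat.trans_lt hx) hs]
        linarith [hz x hx.le]
    refine ⟨fun s hs => ?_, fun s hs s' hs' => by rw [hp t ht s hs, hp t ht s' hs'],
      fun _ => hp t ht⟩
    rw [min_eq_left hlm.le]
    have hd : HasDerivAt (fun x => lam * x) lam t := by
      simpa using (hasDerivAt_id t).const_mul lam
    refine hd.congr_of_eventuallyEq ?_
    filter_upwards [lt_mem_nhds ht] with x hx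
    exact hp x hx s hs
  · refine ⟨a, fun T q p h t ht => ?_⟩
    have hpool : ∀ t, a ≤ t → ∀ c ∈ D, ∀ c' ∈ D, q c t = q c' t :=
      fun t ht c hc c' hc' => h.level_eq hB hδ0 (fun U h₁ h₂ h₃ => by convert hδ U h₁ h₂ h₃) ht hc hc'
    have hlip := h.lipschitz_q hex
    have hder : ∀ᵐ x, a < x → deriv (q c) x = m := by
      filter_upwards [h.ae_differentiableAt] with x hx hax
      obtain ⟨h1, h2⟩ := h.deriv_level_of_eq hB ha0 hpool hc hax hx
      rcases (h.below c hex x (ha0.trans hax.le)).lt_or_eq with hlt | heq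
      · exact h2 hlt
      -- Where the level touches the arrival level it has derivative `lam`, which is at most `m`.
      -- Since also `m ≤ lam`, the two rates agree.
      · have hd := (h.hasDerivAt_q hex fun s => hx s c).differentiableAt.hasDerivAt
        have hl : HasDerivAt (fun x => lam * x) lam x := by
          simpa using (hasDerivAt_id x).const_mul lam
        have := HasDerivAt.eq_of_le hd hl (by
          filter_upwards [lt_mem_nhds hax] with u hu
          exact h.below c hex u (ha0.trans hu.le)) heq
        linarith
    have hq : ∀ x, a < x → q c x = q c a + m * (x - a) := fun x hx => by
      have h1 := lipschitz_sub_le hlip (κ := m) hx.le (by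
        filter_upwards [hder] with u hu hux
        exact (hu hux.1).le)
      have h2 := lipschitz_sub_le hlip.neg (κ := -m) hx.le (by
        filter_upwards [hder] with u hu hux
        rw [← hu hux.1]
        exact (deriv.neg).le)
      simp only [Pi.neg_apply] at h2
      linarith
    refine ⟨fun s hs => ?_, fun s hs s' hs' => by
      rw [h.pos_eq_level hB ha0 hpool hc ht hs, h.pos_eq_level hB ha0 hpool hc ht hs'],
      fun hlt => absurd hlt hlm.not_gt⟩
    rw [min_eq_right hlm]
    have hd : HasDerivAt (fun x => q c a + m * (x - a)) m t := by
      simpa using (((hasDerivAt_id t).sub_const a).const_mul m).const_add (q c a)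
    refine hd.congr_of_eventuallyEq ?_
    filter_upwards [lt_mem_nhds ht] with x hx
    rw [h.pos_eq_level hB ha0 hpool hc hx hs, hq x hx]

end FCFS

namespace FCFS

/-! ## Sample paths of first come first served -/

section Paths

set_option linter.unusedSectionVars false

variable {S C : Type*}

/-- The level of a server: the customer that he serves, or the next customer to arrive. Up to the
number of servers, this is his position. -/
noncomputable def State.lev (x : State S C) (s : S) : ℤ := (x.job s).elim ((x.arrived : ℤ) + 1) id

/-- The time at which a server is available. -/
noncomputable def State.clock (x : State S C) (s : S) : ℝ := (x.job s).elim x.time fun _ => x.finish s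

/-- The total amount of work of the services started by `s`. -/
noncomputable def State.work [Fintype C] (inp : Input S C) (x : State S C) (s : S) : ℝ :=
  ∑ c, ∑ k ∈ Finset.range (x.started s c), inp.serv s c k

theorem State.lev_of_none {x : State S C} {s : S} (h : x.job s = none) :
    x.lev s = x.arrived + 1 := by simp [State.lev, h]

theorem State.lev_of_some {x : State S C} {s : S} {l : ℤ} (h : x.job s = some l) :
    x.lev s = l := by simp [State.lev, h]

theorem State.clock_of_none {x : State S C} {s : S} (h : x.job s = none) :
    x.clock s = x.time := by simp [State.clock, h]

theorem State.clock_of_busy {x : State S C} {s : S} (h : x.job s ≠ none) :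
    x.clock s = x.finish s := by
  obtain ⟨l, hl⟩ := Option.ne_none_iff_exists'.1 h
  simp [State.clock, hl]

theorem Input.arrivalTime_succ (inp : Input S C) (k : ℕ) :
    inp.arrivalTime (k + 1) = inp.arrivalTime k + inp.inter k := by
  simp [Input.arrivalTime, Finset.sum_range_succ, add_assoc]

theorem Input.Nonneg.arrivalTime_mono {inp : Input S C} (h : inp.Nonneg) :
    Monotone inp.arrivalTime :=
  monotone_nat_of_le_succ fun k => by
    rw [inp.arrivalTime_succ]
    exact le_add_of_nonneg_right (h.inter k)

/-- Properties of all the states of a sample path. -/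
structure Reachable (G : S → C → Prop) (inp : Input S C) (x : State S C) : Prop where
  idle_nodup : x.idle.Nodup
  mem_idle : ∀ s, s ∈ x.idle ↔ x.job s = none
  job_le : ∀ s l, x.job s = some l → l ≤ x.arrived
  job_compat : ∀ s l, x.job s = some l → G s (inp.kind l)
  mem_waiting : ∀ l, l ∈ x.waiting ↔ l ≤ x.arrived ∧ ∀ s, G s (inp.kind l) → x.lev s < l
  time_le_finish : ∀ s, x.job s ≠ none → x.time ≤ x.finish s
  time_le_arrival : x.time ≤ inp.arrivalTime x.arrived
  arrival_le_time : ∀ k, x.arrived = k + 1 → inp.arrivalTime k ≤ x.time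
  time_nonneg : 0 ≤ x.time
  started_off : ∀ s c, ¬ G s c → x.started s c = 0

theorem Reachable.lev_le {G : S → C → Prop} {inp : Input S C} {x : State S C}
    (h : Reachable G inp x) (s : S) : x.lev s ≤ x.arrived + 1 := by
  rcases hj : x.job s with _ | l
  · rw [State.lev_of_none hj]
  · rw [State.lev_of_some hj]
    have := h.job_le s l hj
    omega

variable [DecidableEq S] [DecidableEq C] {G : S → C → Prop} {inp : Input S C} {x x' : State S C}

theorem Reachable.pos_bounds [Fintype S] (h : Reachable G inp x) (s : S) :
    x.lev s ≤ x.pos s ∧ x.pos s ≤ x.lev s + Fintype.card S := by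
  rcases hj : x.job s with _ | l
  · rw [State.lev_of_none hj, State.pos, hj]
    have h1 : x.idle.idxOf s < x.idle.length := List.idxOf_lt_length_iff.2 ((h.mem_idle s).2 hj)
    have h2 : x.idle.length ≤ Fintype.card S := h.idle_nodup.length_le_card
    simp only
    omega
  · rw [State.lev_of_some hj, State.pos, hj]
    simp

/-- An idle server is beyond all customers `l ≤ 0` whether measured by `pos` or by `lev`. The
condition that `l` is not in service need not be stated separately: the server of `l` has level `l`,
which is not less than `l`. -/
theorem IsInitial.reachable (h : IsInitial G inp x) (hinp : inp.Nonneg) : Reachable G inp x where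
  idle_nodup := h.idle_nodup
  mem_idle := h.mem_idle
  job_le s l hl := by rw [h.arrived_zero]; exact_mod_cast (h.job_old s l hl).1
  job_compat s l hl := (h.job_old s l hl).2
  mem_waiting l := by
    rw [h.mem_waiting, h.arrived_zero, Nat.cast_zero]
    refine and_congr_right fun hl => ⟨fun ⟨_, h2⟩ s hs => ?_, fun h2 => ⟨fun s hj => ?_, fun s hs => ?_⟩⟩
    · refine lt_of_le_of_lt ?_ (h2 s hs)
      rcases hj : x.job s with _ | l
      · rw [State.lev_of_none hj, State.pos, hj]
        simp
      · rw [State.lev_of_some hj, State.pos, hj]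
    · have := h2 s (h.job_old s l hj).2
      rw [State.lev_of_some hj] at this
      exact lt_irrefl _ this
    · rcases hj : x.job s with _ | l'
      · have := h2 s hs
        rw [State.lev_of_none hj] at this
        omega
      · have := h2 s hs
        rw [State.lev_of_some hj] at this
        rwa [State.pos, hj]
  time_le_finish s _ := by rw [h.time_zero]; exact h.finish_nonneg s
  time_le_arrival := by
    rw [h.time_zero, h.arrived_zero]
    simpa [Input.arrivalTime] using hinp.first
  arrival_le_time k hk := by rw [h.arrived_zero] at hk; omega
  time_nonneg := h.time_zero.ge
  started_off s c _ := h.started_zero s c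

/-- What an event does. -/
structure Advance [Fintype C] (G : S → C → Prop) (inp : Input S C) (x x' : State S C) : Prop where
  reachable : Reachable G inp x'
  lev_le : ∀ s, x.lev s ≤ x'.lev s
  arrived_le : x.arrived ≤ x'.arrived
  arrived_le' : x'.arrived ≤ x.arrived + 1
  time_le : x.time ≤ x'.time
  time_le_arrival : x'.time ≤ inp.arrivalTime x.arrived
  time_le_finish : ∀ s, x.job s ≠ none → x'.time ≤ x.finish s
  started_le : ∀ s c, x.started s c ≤ x'.started s c
  lev_of_started : ∀ s c, x.started s c < x'.started s c →
    G s c ∧ ∀ s', G s' c → x.lev s' ≤ x'.lev s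
  work_le : ∀ s, x'.work inp s - x.work inp s ≤ x'.clock s - x.clock s
  work_eq : ∀ s, x.job s ≠ none → x'.work inp s - x.work inp s = x'.clock s - x.clock s
  finish_le : ∀ s, x'.job s ≠ none → (x.job s ≠ none ∧ x'.finish s = x.finish s) ∨
    ∃ c j, G s c ∧ j < x'.started s c ∧ x'.finish s = x'.time + inp.serv s c j

theorem work_update [Fintype C] {s : S} {c : C} (h : x'.started = Function.update x.started s
      (Function.update (x.started s) c (x.started s c + 1))) :
    x'.work inp s = x.work inp s + inp.serv s c (x.started s c) ∧
      ∀ s' ≠ s, x'.work inp s' = x.work inp s' := by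
  constructor
  · rw [State.work, State.work, h, Function.update_self,
      ← Finset.add_sum_erase _ _ (Finset.mem_univ c), ← Finset.add_sum_erase
        (a := c) Finset.univ (fun c => ∑ k ∈ Finset.range (x.started s c), inp.serv s c k)
        (Finset.mem_univ c), Function.update_self, Finset.sum_range_succ]
    have : ∀ c' ∈ Finset.univ.erase c,
        ∑ k ∈ Finset.range (Function.update (x.started s) c (x.started s c + 1) c'),
          inp.serv s c' k = ∑ k ∈ Finset.range (x.started s c'), inp.serv s c' k := fun c' hc' => by
      rw [Function.update_of_ne (Finset.ne_of_mem_erase hc')]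
    rw [Finset.sum_congr rfl this]
    ring
  · intro s' hs'
    rw [State.work, State.work, h, Function.update_of_ne hs']

theorem started_update {s s' : S} {c c' : C} (h : x'.started = Function.update x.started s
      (Function.update (x.started s) c (x.started s c + 1))) :
    x.started s' c' ≤ x'.started s' c' ∧
      (x.started s' c' < x'.started s' c' → s' = s ∧ c' = c) ∧
      x'.started s c = x.started s c + 1 := by
  rw [h]
  by_cases hs : s' = s
  · subst hs
    by_cases hc : c' = c
    · subst hc; simp
    · simp [Function.update_of_ne hc]
  · simp [Function.update_of_ne hs]

theorem advance_arrivalWait [Fintype C] (h : Reachable G inp x) (hinp : inp.Nonneg)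
    (hx : x.ArrivalNext inp) (hidle : ∀ s ∈ x.idle, ¬ G s (inp.kind (x.arrived + 1))) :
    Advance G inp x { x with
        time := inp.arrivalTime x.arrived
        arrived := x.arrived + 1
        waiting := insert ((x.arrived : ℤ) + 1) x.waiting } := by
  set x' : State S C := { x with
        time := inp.arrivalTime x.arrived
        arrived := x.arrived + 1
        waiting := insert ((x.arrived : ℤ) + 1) x.waiting } with hx'
  have hjob : x'.job = x.job := rfl
  have hlev : ∀ s, (x.job s = none → x'.lev s = x.arrived + 2) ∧
      (x.job s ≠ none → x'.lev s = x.lev s) := fun s => by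
    constructor
    · intro hj
      rw [State.lev_of_none (x := x') hj]
      push_cast [hx']; ring
    · intro hj
      obtain ⟨l, hl⟩ := Option.ne_none_iff_exists'.1 hj
      rw [State.lev_of_some hl, State.lev_of_some (x := x') hl]
  have hmono := hinp.arrivalTime_mono
  refine ⟨⟨h.idle_nodup, h.mem_idle, fun s l hl => ?_, h.job_compat, fun l => ?_, hx,
    hmono (Nat.le_succ _), fun k hk => ?_, h.time_nonneg.trans h.time_le_arrival, h.started_off⟩,
    fun s => ?_, Nat.le_succ _, le_rfl, h.time_le_arrival, le_rfl, hx,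
    fun _ _ => le_rfl, fun s c hlt => absurd hlt (lt_irrefl _), fun s => ?_, fun s hs => ?_,
    fun s hs => Or.inl ⟨hs, rfl⟩⟩
  · have := h.job_le s l hl
    push_cast [hx']; omega
  · have hA : (x'.arrived : ℤ) = x.arrived + 1 := by push_cast [hx']; rfl
    rw [show x'.waiting = insert ((x.arrived : ℤ) + 1) x.waiting from rfl, Set.mem_insert_iff,
      h.mem_waiting, hA]
    constructor
    · rintro (rfl | ⟨h1, h2⟩)
      · refine ⟨le_rfl, fun s hs => ?_⟩
        have hj : x.job s ≠ none := fun hj => hidle s ((h.mem_idle s).2 hj) hs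
        obtain ⟨l, hl⟩ := Option.ne_none_iff_exists'.1 hj
        rw [(hlev s).2 hj, State.lev_of_some hl]
        have := h.job_le s l hl
        omega
      · refine ⟨by omega, fun s hs => ?_⟩
        have h3 := h2 s hs
        have hj : x.job s ≠ none := fun hj => by rw [State.lev_of_none hj] at h3; omega
        rwa [(hlev s).2 hj]
    · rintro ⟨h1, h2⟩
      rcases h1.eq_or_lt with h3 | h3
      · exact Or.inl h3
      · refine Or.inr ⟨by omega, fun s hs => ?_⟩
        have h4 := h2 s hs
        have hj : x.job s ≠ none := fun hj => by rw [(hlev s).1 hj] at h4; omega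
        rwa [(hlev s).2 hj] at h4
  · have : k = x.arrived := by simp only [hx'] at hk; omega
    rw [this]
  · by_cases hj : x.job s = none
    · rw [(hlev s).1 hj, State.lev_of_none hj]; omega
    · rw [(hlev s).2 hj]
  · rw [show x'.work inp s = x.work inp s from rfl, sub_self]
    by_cases hj : x.job s = none
    · rw [State.clock_of_none hj, State.clock_of_none (x := x') hj]
      exact sub_nonneg.2 h.time_le_arrival
    · rw [State.clock_of_busy hj, State.clock_of_busy (x := x') hj]
      exact (sub_self _).ge
  · rw [show x'.work inp s = x.work inp s from rfl, State.clock_of_busy hs,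
      State.clock_of_busy (x := x') hs]
    simp [hx']

theorem advance_completeIdle [Fintype C] (h : Reachable G inp x) {s : S}
    (hx : x.CompletionNext inp s) (hl : ∀ i ∈ x.waiting, ¬ G s (inp.kind i)) :
    Advance G inp x { x with
        time := x.finish s
        job := Function.update x.job s none
        idle := s :: x.idle } := by
  set x' : State S C := { x with
        time := x.finish s
        job := Function.update x.job s none
        idle := s :: x.idle } with hx'
  obtain ⟨hbusy, hfin, hmin⟩ := hx
  have hself : x'.job s = none := Function.update_self ..
  have hne : ∀ s' ≠ s, x'.job s' = x.job s' := fun s' hs' => Function.update_of_ne hs' ..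
  have hne' : ∀ s', x'.job s' ≠ none → s' ≠ s := fun s' hj he => hj (he ▸ hself)
  have hlev : ∀ s' ≠ s, x'.lev s' = x.lev s' := fun s' hs' => by
    rw [State.lev, State.lev, hne s' hs']
  have hlevs : x'.lev s = x.arrived + 1 := State.lev_of_none hself
  refine ⟨⟨?_, fun s' => ?_, fun s' l hl' => ?_, fun s' l hl' => ?_, fun l => ?_, fun s' hs' => ?_,
    hfin, fun k hk => (h.arrival_le_time k hk).trans (h.time_le_finish s hbusy),
    h.time_nonneg.trans (h.time_le_finish s hbusy), h.started_off⟩,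
    fun s' => ?_, le_rfl, Nat.le_succ _, h.time_le_finish s hbusy, hfin, hmin,
    fun _ _ => le_rfl, fun s c hlt => absurd hlt (lt_irrefl _), fun s' => ?_, fun s' hs' => ?_,
    fun s' hs' => Or.inl ⟨?_, rfl⟩⟩
  · exact List.nodup_cons.2 ⟨fun hs => hbusy ((h.mem_idle s).1 hs), h.idle_nodup⟩
  · rw [show x'.idle = s :: x.idle from rfl, List.mem_cons, h.mem_idle]
    by_cases hs' : s' = s
    · subst hs'; simp [hself]
    · simp [hs', hne s' hs']
  · rw [hne s' (hne' s' (by simp [hl']))] at hl'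
    exact h.job_le s' l hl'
  · rw [hne s' (hne' s' (by simp [hl']))] at hl'
    exact h.job_compat s' l hl'
  · rw [show x'.waiting = x.waiting from rfl, show x'.arrived = x.arrived from rfl]
    constructor
    · intro hw
      refine ⟨((h.mem_waiting l).1 hw).1, fun s' hs' => ?_⟩
      have hs : s' ≠ s := fun he => hl l hw (he ▸ hs')
      rw [hlev s' hs]
      exact ((h.mem_waiting l).1 hw).2 s' hs'
    · rintro ⟨h1, h2⟩
      refine (h.mem_waiting l).2 ⟨h1, fun s' hs' => ?_⟩
      have hs : s' ≠ s := fun he => by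
        have := h2 s' hs'
        rw [he, hlevs] at this
        omega
      rw [← hlev s' hs]
      exact h2 s' hs'
  · exact hmin s' (by rwa [← hne s' (hne' s' hs')])
  · by_cases hs' : s' = s
    · rw [hs', hlevs]; exact h.lev_le s
    · rw [hlev s' hs']
  · rw [show x'.work inp s' = x.work inp s' from rfl, sub_self]
    by_cases hs' : s' = s
    · rw [hs', State.clock_of_none hself, State.clock_of_busy hbusy]
      exact (sub_self _).ge
    · by_cases hj : x.job s' = none
      · rw [State.clock_of_none hj, State.clock_of_none ((hne s' hs').trans hj)]
        exact sub_nonneg.2 (h.time_le_finish s hbusy)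
      · rw [State.clock_of_busy hj, State.clock_of_busy (x := x') (by rwa [hne s' hs'])]
        exact (sub_self _).ge
  · rw [show x'.work inp s' = x.work inp s' from rfl, sub_self]
    by_cases hs : s' = s
    · rw [hs, State.clock_of_none hself, State.clock_of_busy hbusy]
      exact (sub_self _).symm
    · rw [State.clock_of_busy hs', State.clock_of_busy (x := x') (by rwa [hne s' hs])]
      exact (sub_self _).symm
  · rwa [← hne s' (hne' s' hs')]

/-- Common to an arrival that finds an idle server and to a completion followed by a new service.
The first come first served rule enters through `hlev`: no server compatible with the customer is
beyond him. -/
theorem advance_start [Fintype C] (h : Reachable G inp x) (hinp : inp.Nonneg) {s : S} {l : ℤ}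
    {c : C} (hc : inp.kind l = c) (hG : G s c)
    (hjob : x'.job = Function.update x.job s (some l))
    (hfin : x'.finish = Function.update x.finish s (x'.time + inp.serv s c (x.started s c)))
    (hst : x'.started = Function.update x.started s
      (Function.update (x.started s) c (x.started s c + 1)))
    (hlev : ∀ s', G s' c → x.lev s' ≤ l) (hl : l ≤ x'.arrived)
    (hA : x.arrived ≤ x'.arrived) (hA' : x'.arrived ≤ x.arrived + 1)
    (htime : x.time ≤ x'.time) (hbusy : x.job s ≠ none → x'.time = x.finish s)
    (harr : x'.time ≤ inp.arrivalTime x.arrived)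
    (hmin : ∀ s, x.job s ≠ none → x'.time ≤ x.finish s)
    (hnodup : x'.idle.Nodup) (hidle : ∀ s, s ∈ x'.idle ↔ x'.job s = none)
    (hwait : ∀ l, l ∈ x'.waiting ↔ l ≤ x'.arrived ∧ ∀ s, G s (inp.kind l) → x'.lev s < l)
    (hat : ∀ k, x'.arrived = k + 1 → inp.arrivalTime k ≤ x'.time) :
    Advance G inp x x' := by
  have hself : x'.job s = some l := by rw [hjob, Function.update_self]
  have hselfb : x'.job s ≠ none := by simp [hself]
  have hne : ∀ s' ≠ s, x'.job s' = x.job s' := fun s' hs' => by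
    rw [hjob, Function.update_of_ne hs']
  have hfs : x'.finish s = x'.time + inp.serv s c (x.started s c) := by
    rw [hfin, Function.update_self]
  have hfne : ∀ s' ≠ s, x'.finish s' = x.finish s' := fun s' hs' => by
    rw [hfin, Function.update_of_ne hs']
  obtain ⟨hw, hwne⟩ := work_update (inp := inp) hst
  have hsu := fun s' c' => started_update (s' := s') (c' := c') hst
  have hmono := hinp.arrivalTime_mono
  refine ⟨⟨hnodup, hidle, fun s' l' hl' => ?_, fun s' l' hl' => ?_, hwait, fun s' hs' => ?_,
    harr.trans (hmono hA), hat, h.time_nonneg.trans htime, fun s' c' hG' => ?_⟩,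
    fun s' => ?_, hA, hA', htime, harr, hmin, fun s' c' => (hsu s' c').1,
    fun s' c' hlt => ?_, fun s' => ?_, fun s' hs' => ?_, fun s' hs' => ?_⟩
  · by_cases hs : s' = s
    · rw [hs, hself, Option.some_inj] at hl'; rwa [← hl']
    · rw [hne s' hs] at hl'
      have := h.job_le s' l' hl'
      omega
  · by_cases hs : s' = s
    · rw [hs, hself, Option.some_inj] at hl'; rwa [← hl', hs, hc]
    · rw [hne s' hs] at hl'
      exact h.job_compat s' l' hl'
  · by_cases hs : s' = s
    · rw [hs, hfs]; exact le_add_of_nonneg_right (hinp.serv _ _ _)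
    · rw [hfne s' hs]
      exact hmin s' (by rwa [← hne s' hs])
  · by_contra hpos
    have h0 := h.started_off s' c' hG'
    obtain ⟨rfl, rfl⟩ := (hsu s' c').2.1 (by omega)
    exact hG' hG
  · by_cases hs : s' = s
    · rw [hs, State.lev_of_some hself]
      exact hlev s hG
    · by_cases hj : x.job s' = none
      · rw [State.lev_of_none hj, State.lev_of_none ((hne s' hs).trans hj)]
        omega
      · obtain ⟨l', hl'⟩ := Option.ne_none_iff_exists'.1 hj
        rw [State.lev_of_some hl', State.lev_of_some ((hne s' hs).trans hl')]
  · obtain ⟨rfl, rfl⟩ := (hsu s' c').2.1 hlt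
    refine ⟨hG, ?_⟩
    rw [State.lev_of_some hself]
    exact hlev
  · by_cases hs : s' = s
    · rw [hs, hw, State.clock_of_busy hselfb, hfs]
      by_cases hj : x.job s = none
      · rw [State.clock_of_none hj]; linarith
      · rw [State.clock_of_busy hj, hbusy hj]; linarith
    · rw [hwne s' hs, sub_self]
      by_cases hj : x.job s' = none
      · rw [State.clock_of_none hj, State.clock_of_none ((hne s' hs).trans hj)]
        exact sub_nonneg.2 htime
      · rw [State.clock_of_busy hj, State.clock_of_busy (x := x') (by rwa [hne s' hs]), hfne s' hs]
        exact (sub_self _).ge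
  · by_cases hs : s' = s
    · subst hs
      rw [hw, State.clock_of_busy hselfb, hfs, State.clock_of_busy hs', hbusy hs']; ring
    · rw [hwne s' hs, sub_self, State.clock_of_busy hs',
        State.clock_of_busy (x := x') (by rwa [hne s' hs]), hfne s' hs, sub_self]
  · by_cases hs : s' = s
    · subst hs
      exact Or.inr ⟨c, x.started s' c, hG, by rw [(hsu s' c).2.2]; omega, hfs⟩
    · exact Or.inl ⟨by rwa [← hne s' hs], hfne s' hs⟩

theorem Step.advance [Fintype C] (hstep : Step G inp x x') (h : Reachable G inp x)
    (hinp : inp.Nonneg) : Advance G inp x x' := by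
  cases hstep with
  | arrivalWait hx hidle => exact advance_arrivalWait h hinp hx hidle
  | completeIdle s hx hl => exact advance_completeIdle h hx hl
  | arrivalServe s l₁ l₂ hx hidle hs hlong =>
    have hnd := h.idle_nodup
    rw [hidle] at hnd
    have hnd' := List.nodup_middle.1 hnd
    have hj : x.job s = none := (h.mem_idle s).1 (by rw [hidle]; simp)
    have hcast : ((x.arrived + 1 : ℕ) : ℤ) = x.arrived + 1 := by push_cast; rfl
    refine advance_start h hinp (s := s) (l := (x.arrived : ℤ) + 1) rfl hs rfl rfl rfl
      (fun s' _ => h.lev_le s') (by simp) (Nat.le_succ _) le_rfl h.time_le_arrival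
      (fun hb => absurd hj hb) le_rfl hx (List.nodup_cons.1 hnd').2 (fun s' => ?_) (fun l => ?_)
      (fun k hk => ?_)
    · simp only [State.begin]
      by_cases hs' : s' = s
      · subst hs'
        simpa using (List.nodup_cons.1 hnd').1
      · rw [Function.update_of_ne hs', ← h.mem_idle, hidle]
        simp [hs']
    · simp only [State.begin]
      rw [h.mem_waiting, hcast]
      constructor
      · rintro ⟨h1, h2⟩
        refine ⟨by omega, fun s' hs' => ?_⟩
        have h3 := h2 s' hs'
        have hss : s' ≠ s := fun he => by rw [he, State.lev_of_none hj] at h3; omega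
        have hb : x.job s' ≠ none := fun hn => by rw [State.lev_of_none hn] at h3; omega
        obtain ⟨l', hl'⟩ := Option.ne_none_iff_exists'.1 hb
        rw [State.lev_of_some hl'] at h3
        rw [State.lev_of_some (l := l')]
        · exact h3
        · simp only; rw [Function.update_of_ne hss, hl']
      · rintro ⟨h1, h2⟩
        have hlt : l ≠ x.arrived + 1 := by
          rintro rfl
          have := h2 s hs
          rw [State.lev_of_some (l := (x.arrived : ℤ) + 1) (by simp)] at this
          exact lt_irrefl _ this
        refine ⟨by omega, fun s' hs' => ?_⟩
        have h3 := h2 s' hs'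
        have hss : s' ≠ s := fun he => by
          rw [he, State.lev_of_some (l := (x.arrived : ℤ) + 1) (by simp)] at h3; omega
        have hb : x.job s' ≠ none := fun hn => by
          rw [State.lev_of_none (by simp only; rw [Function.update_of_ne hss, hn])] at h3
          push_cast at h3
          omega
        obtain ⟨l', hl'⟩ := Option.ne_none_iff_exists'.1 hb
        rw [State.lev_of_some (l := l') (by simp only; rw [Function.update_of_ne hss, hl'])] at h3
        rwa [State.lev_of_some hl']
    · have : k = x.arrived := by simp only at hk; omega
      rw [this]
      exact le_rfl
  | completeServe s l hx hl =>
    obtain ⟨hbusy, hfin, hmin⟩ := hx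
    obtain ⟨⟨hlw, hGl⟩, hleast⟩ := hl
    have hlw' := (h.mem_waiting l).1 hlw
    refine advance_start h hinp (s := s) (l := l) rfl hGl rfl rfl rfl
      (fun s' hs' => (hlw'.2 s' hs').le) hlw'.1 le_rfl (Nat.le_succ _) (h.time_le_finish s hbusy)
      (fun _ => rfl) hfin hmin h.idle_nodup (fun s' => ?_) (fun l' => ?_)
      (fun k hk => (h.arrival_le_time k hk).trans (h.time_le_finish s hbusy))
    · simp only [State.begin]
      by_cases hs' : s' = s
      · subst hs'
        simpa [h.mem_idle] using hbusy
      · rw [Function.update_of_ne hs', ← h.mem_idle]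
    · have hlev : ∀ s' ≠ s, ∀ x'' : State S C, x''.arrived = x.arrived →
          x''.job = Function.update x.job s (some l) → x''.lev s' = x.lev s' :=
        fun s' hs' x'' hA hj => by
          rw [State.lev, State.lev, hj, hA, Function.update_of_ne hs']
      have hlevs : ∀ x'' : State S C, x''.job = Function.update x.job s (some l) →
          x''.lev s = l := fun x'' hj => State.lev_of_some (by rw [hj, Function.update_self])
      simp only [State.begin, Set.mem_sdiff, Set.mem_singleton_iff]
      rw [h.mem_waiting]
      constructor
      · rintro ⟨⟨h1, h2⟩, hne⟩
        refine ⟨h1, fun s' hs' => ?_⟩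
        by_cases hss : s' = s
        · subst hss
          rw [hlevs _ rfl]
          -- The customer taken is the first compatible one in line, so those who stay are beyond
          -- the new level of the server.
          exact lt_of_le_of_ne (hleast ⟨(h.mem_waiting l').2 ⟨h1, h2⟩, hs'⟩) (Ne.symm hne)
        · exact lt_of_eq_of_lt (hlev s' hss _ rfl rfl) (h2 s' hs')
      · rintro ⟨h1, h2⟩
        refine ⟨⟨h1, fun s' hs' => ?_⟩, fun he => ?_⟩
        · have h3 := h2 s' hs'
          by_cases hss : s' = s
          · subst hss
            rw [hlevs _ rfl] at h3
            exact (hlw'.2 s' hGl).trans h3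
          · refine lt_of_eq_of_lt (Eq.symm ?_) h3
            exact hlev s' hss _ rfl rfl
        · subst he
          have := h2 s hGl
          rw [hlevs _ rfl] at this
          exact lt_irrefl _ this

/-! ### Counting customers -/

/-- The signed number of customers of type `c` between `0` and `a`. -/
noncomputable def Input.count (inp : Input S C) (c : C) (a : ℤ) : ℤ :=
  ((Finset.Ioc 0 a).filter fun l => inp.kind l = c).card -
    ((Finset.Ioc a 0).filter fun l => inp.kind l = c).card

theorem Input.count_zero (inp : Input S C) (c : C) : inp.count c 0 = 0 := by simp [Input.count]

theorem Input.count_succ (inp : Input S C) (c : C) (a : ℤ) :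
    inp.count c (a + 1) = inp.count c a + if inp.kind (a + 1) = c then 1 else 0 := by
  rcases lt_or_ge a 0 with ha | ha
  · have h1 : Finset.Ioc 0 (a + 1) = ∅ := Finset.Ioc_eq_empty (by omega)
    have h2 : Finset.Ioc 0 a = ∅ := Finset.Ioc_eq_empty (by omega)
    have h3 : Finset.Ioc a 0 = insert (a + 1) (Finset.Ioc (a + 1) 0) := by
      ext l; simp only [Finset.mem_Ioc, Finset.mem_insert]; omega
    rw [Input.count, Input.count, h1, h2, h3, Finset.filter_insert]
    split_ifs
    · rw [Finset.card_insert_of_notMem (by simp)]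
      push_cast; ring
    · simp
  · have h1 : Finset.Ioc (a + 1) 0 = ∅ := Finset.Ioc_eq_empty (by omega)
    have h2 : Finset.Ioc a 0 = ∅ := Finset.Ioc_eq_empty (by omega)
    have h3 : Finset.Ioc 0 (a + 1) = insert (a + 1) (Finset.Ioc 0 a) := by
      ext l; simp only [Finset.mem_Ioc, Finset.mem_insert]; omega
    rw [Input.count, Input.count, h1, h2, h3, Finset.filter_insert]
    split_ifs
    · rw [Finset.card_insert_of_notMem (by simp)]
      push_cast; ring
    · simp

theorem Input.card_Ioc (inp : Input S C) (c : C) {a b : ℤ} (hab : a ≤ b) :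
    (((Finset.Ioc a b).filter fun l => inp.kind l = c).card : ℤ) =
      inp.count c b - inp.count c a := by
  induction b, hab using Int.leInduction with
  | base => simp
  | succ b hab ih =>
    have h3 : Finset.Ioc a (b + 1) = insert (b + 1) (Finset.Ioc a b) := by
      ext l; simp only [Finset.mem_Ioc, Finset.mem_insert]; omega
    rw [h3, Finset.filter_insert, inp.count_succ]
    split_ifs
    · rw [Finset.card_insert_of_notMem (by simp)]
      push_cast
      rw [ih]; ring
    · rw [ih]; ring

/-- The number of waiting customers of type `c`. -/
noncomputable def State.queue (inp : Input S C) (x : State S C) (c : C) : ℕ :=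
  {l | l ∈ x.waiting ∧ inp.kind l = c}.ncard

theorem Reachable.finite_queue (h : Reachable G inp x) {s : S} {c : C} (hG : G s c) :
    {l | l ∈ x.waiting ∧ inp.kind l = c}.Finite := by
  refine (Set.finite_Ioc (x.lev s) x.arrived).subset fun l ⟨hl, hc⟩ => ?_
  have := (h.mem_waiting l).1 hl
  exact ⟨this.2 s (hc ▸ hG), this.1⟩

/-- The waiting customers of a type are those beyond its most advanced compatible server. The
minimum is needed because an idle server has level `arrived + 1`. -/
theorem Reachable.queue_eq (h : Reachable G inp x) {c : C} {s : S} (hG : G s c)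
    (hmax : ∀ s', G s' c → x.lev s' ≤ x.lev s) :
    (x.queue inp c : ℤ) = inp.count c x.arrived - inp.count c (min (x.lev s) x.arrived) := by
  rw [← inp.card_Ioc c (min_le_right _ _), State.queue, ← Set.ncard_coe_finset]
  congr 2
  ext l
  simp only [Set.mem_ofPred_eq, Finset.coe_filter, Finset.mem_Ioc, h.mem_waiting]
  constructor
  · rintro ⟨⟨h1, h2⟩, rfl⟩
    exact ⟨⟨by have := h2 s hG; omega, h1⟩, rfl⟩
  · rintro ⟨⟨h1, h2⟩, rfl⟩
    exact ⟨⟨h2, fun s' hs' => by have := hmax s' hs'; omega⟩, rfl⟩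

theorem sum_started_update [Fintype S] {s : S} {c₀ : C}
    (h : x'.started = Function.update x.started s
      (Function.update (x.started s) c₀ (x.started s c₀ + 1))) (c : C) :
    ∑ s, x'.started s c = ∑ s, x.started s c + if c₀ = c then 1 else 0 := by
  rw [h, ← Finset.add_sum_erase _ _ (Finset.mem_univ s),
    ← Finset.add_sum_erase (a := s) Finset.univ (fun s => x.started s c) (Finset.mem_univ s),
    Function.update_self]
  have : ∀ s' ∈ Finset.univ.erase s, Function.update x.started s
      (Function.update (x.started s) c₀ (x.started s c₀ + 1)) s' c = x.started s' c :=
    fun s' hs' => by rw [Function.update_of_ne (Finset.ne_of_mem_erase hs')]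
  rw [Finset.sum_congr rfl this]
  split_ifs with hc
  · subst hc; rw [Function.update_self]; ring
  · rw [Function.update_of_ne (Ne.symm hc)]; ring

theorem Step.effect (hstep : Step G inp x x') :
    (x'.waiting = insert ((x.arrived : ℤ) + 1) x.waiting ∧ x'.arrived = x.arrived + 1 ∧
      x'.started = x.started) ∨
    (x'.waiting = x.waiting ∧ x'.arrived = x.arrived ∧ x'.started = x.started) ∨
    (∃ s, x'.waiting = x.waiting ∧ x'.arrived = x.arrived + 1 ∧
      x'.started = Function.update x.started s (Function.update (x.started s)
        (inp.kind (x.arrived + 1)) (x.started s (inp.kind (x.arrived + 1)) + 1))) ∨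
    ∃ s, ∃ l ∈ x.waiting, x'.waiting = x.waiting \ {l} ∧ x'.arrived = x.arrived ∧
      x'.started = Function.update x.started s (Function.update (x.started s)
        (inp.kind l) (x.started s (inp.kind l) + 1)) := by
  cases hstep with
  | arrivalWait hx hidle => exact Or.inl ⟨rfl, rfl, rfl⟩
  | completeIdle s hx hl => exact Or.inr (Or.inl ⟨rfl, rfl, rfl⟩)
  | arrivalServe s l₁ l₂ hx hidle hs hlong =>
    exact Or.inr (Or.inr (Or.inl ⟨s, rfl, rfl, rfl⟩))
  | completeServe s l hx hl => exact Or.inr (Or.inr (Or.inr ⟨s, l, hl.1.1, rfl, rfl, rfl⟩))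

/-- Conservation of customers: whoever of this type arrives is started at once or joins the queue,
and leaves the queue only to be started. -/
theorem Step.queue [Fintype S] (hstep : Step G inp x x') (h : Reachable G inp x) {c : C} {s₀ : S}
    (hG : G s₀ c) :
    (x'.queue inp c : ℤ) + (∑ s, x'.started s c : ℕ) - inp.count c x'.arrived =
      x.queue inp c + (∑ s, x.started s c : ℕ) - inp.count c x.arrived := by
  have hfin := h.finite_queue hG
  have hA : ((x.arrived : ℤ) + 1) ∉ x.waiting := fun hw => by
    have := ((h.mem_waiting _).1 hw).1
    omega
  rcases hstep.effect with ⟨hw, ha, hst⟩ | ⟨hw, ha, hst⟩ | ⟨s, hw, ha, hst⟩ |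
    ⟨s, l, hl, hw, ha, hst⟩
  · have hq : x'.queue inp c =
        x.queue inp c + if inp.kind (x.arrived + 1) = c then 1 else 0 := by
      rw [State.queue, State.queue, hw]
      split_ifs with hk
      · rw [← Set.ncard_insert_of_notMem (a := (x.arrived : ℤ) + 1) (fun hw => hA hw.1) hfin]
        congr 1
        ext l
        simp only [Set.mem_insert_iff, Set.mem_ofPred_eq]
        constructor
        · rintro ⟨rfl | h1, h2⟩
          · exact Or.inl rfl
          · exact Or.inr ⟨h1, h2⟩
        · rintro (rfl | ⟨h1, h2⟩)
          · exact ⟨Or.inl rfl, hk⟩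
          · exact ⟨Or.inr h1, h2⟩
      · rw [add_zero]
        congr 1
        ext l
        simp only [Set.mem_insert_iff, Set.mem_ofPred_eq]
        constructor
        · rintro ⟨rfl | h1, h2⟩
          · exact absurd h2 hk
          · exact ⟨h1, h2⟩
        · rintro ⟨h1, h2⟩
          exact ⟨Or.inr h1, h2⟩
    rw [hq, ha, hst, Nat.cast_succ, inp.count_succ]
    push_cast
    ring
  · rw [State.queue, State.queue, hw, ha, hst]
  · rw [State.queue, State.queue, hw, sum_started_update hst, ha, Nat.cast_succ, inp.count_succ]
    push_cast
    ring
  · have hq : x'.queue inp c + (if inp.kind l = c then 1 else 0) = x.queue inp c := by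
      rw [State.queue, State.queue, hw]
      split_ifs with hk
      · rw [← Set.ncard_sdiff_singleton_add_one (a := l) 
          (show l ∈ {l | l ∈ x.waiting ∧ inp.kind l = c} from ⟨hl, hk⟩) hfin]
        congr 2
        ext l'
        simp only [Set.mem_sdiff, Set.mem_singleton_iff, Set.mem_ofPred_eq]
        tauto
      · rw [add_zero]
        congr 1
        ext l'
        simp only [Set.mem_sdiff, Set.mem_singleton_iff, Set.mem_ofPred_eq]
        constructor
        · rintro ⟨⟨h1, _⟩, h2⟩
          exact ⟨h1, h2⟩
        · rintro ⟨h1, h2⟩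
          exact ⟨⟨h1, fun he => hk (he ▸ h2)⟩, h2⟩
    rw [sum_started_update hst, ← hq, ha]
    push_cast
    ring

end Paths

end FCFS

/-! ### Monotone quantities along a sample path -/

namespace FCFS

set_option linter.unusedSectionVars false

namespace IsPath

variable {S C : Type*} [Fintype S] [DecidableEq S] [Fintype C] [DecidableEq C]
  {G : S → C → Prop} {inp : Input S C} {st : ℕ → State S C}

theorem reachable (h : IsPath G inp st) (hinp : inp.Nonneg) (k : ℕ) : Reachable G inp (st k) := by
  induction k with
  | zero => exact h.initial.reachable hinp
  | succ k ih => exact ((h.step k).advance ih hinp).reachable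

theorem advance (h : IsPath G inp st) (hinp : inp.Nonneg) (k : ℕ) :
    Advance G inp (st k) (st (k + 1)) :=
  (h.step k).advance (h.reachable hinp k) hinp

theorem lev_mono (h : IsPath G inp st) (hinp : inp.Nonneg) (s : S) :
    Monotone fun k => (st k).lev s :=
  monotone_nat_of_le_succ fun k => (h.advance hinp k).lev_le s

theorem arrived_mono (h : IsPath G inp st) (hinp : inp.Nonneg) :
    Monotone fun k => (st k).arrived :=
  monotone_nat_of_le_succ fun k => (h.advance hinp k).arrived_le

theorem time_mono (h : IsPath G inp st) (hinp : inp.Nonneg) : Monotone fun k => (st k).time :=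
  monotone_nat_of_le_succ fun k => (h.advance hinp k).time_le

theorem started_mono (h : IsPath G inp st) (hinp : inp.Nonneg) (s : S) (c : C) :
    Monotone fun k => (st k).started s c :=
  monotone_nat_of_le_succ fun k => (h.advance hinp k).started_le s c

theorem work_sub_le (h : IsPath G inp st) (hinp : inp.Nonneg) (s : S) {k k' : ℕ} (hk : k ≤ k') :
    (st k').work inp s - (st k).work inp s ≤ (st k').clock s - (st k).clock s := by
  have : Monotone fun k => (st k).clock s - (st k).work inp s :=
    monotone_nat_of_le_succ fun k => by
      have := (h.advance hinp k).work_le s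
      linarith
  have := this hk
  simp only at this
  linarith

/-- An idle server has level `arrived + 1`. If the level at the later step is at most the number of
arrivals at the earlier one, monotonicity excludes idleness in between, and the clock advances only
by started work. -/
theorem work_sub_eq (h : IsPath G inp st) (hinp : inp.Nonneg) (s : S) {k k' : ℕ} (hk : k ≤ k')
    (hbusy : (st k').lev s ≤ (st k).arrived) :
    (st k').work inp s - (st k).work inp s = (st k').clock s - (st k).clock s := by
  have key : ∀ j, k ≤ j → j ≤ k' → (st j).clock s - (st j).work inp s =
      (st k).clock s - (st k).work inp s := by
    intro j hkj
    induction j, hkj using Nat.le_induction with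
    | base => intro _; rfl
    | succ j hkj ih =>
      intro hj
      rw [← ih (by omega)]
      have hb : (st j).job s ≠ none := fun hn => by
        have h1 : (st j).lev s ≤ (st k').lev s := h.lev_mono hinp s (by omega : j ≤ k')
        have h2 : (st k).arrived ≤ (st j).arrived := h.arrived_mono hinp hkj
        rw [State.lev_of_none hn] at h1
        omega
      have := (h.advance hinp j).work_eq s hb
      linarith
  have := key k' hk le_rfl
  linarith

/-- At the event that starts such a service, `s` moves to a customer whom no compatible server has
passed. Levels only increase, so earlier levels of those servers and the later level of `s` compare
in the same way. -/
theorem lev_of_started (h : IsPath G inp st) (hinp : inp.Nonneg) {s : S} {c : C} {k k' : ℕ}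
    (hlt : (st k).started s c < (st k').started s c) :
    G s c ∧ ∀ s', G s' c → (st k).lev s' ≤ (st k').lev s := by
  have hk : k ≤ k' := by
    by_contra! hk
    exact absurd (h.started_mono hinp s c hk.le) (not_le.2 hlt)
  induction k', hk using Nat.le_induction with
  | base => exact absurd hlt (lt_irrefl _)
  | succ j hkj ih =>
    rcases lt_or_ge ((st k).started s c) ((st j).started s c) with h1 | h1
    · obtain ⟨h2, h3⟩ := ih h1
      exact ⟨h2, fun s' hs' => (h3 s' hs').trans (h.lev_mono hinp s (Nat.le_succ j))⟩
    · obtain ⟨h2, h3⟩ := (h.advance hinp j).lev_of_started s c (h1.trans_lt hlt)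
      exact ⟨h2, fun s' hs' => (h.lev_mono hinp s' hkj).trans (h3 s' hs')⟩

/-- The residual service at a server is at most its initial one or a single service time of a job
already started. This keeps the clock close to the time on the fluid scale. -/
theorem finish_le (h : IsPath G inp st) (hinp : inp.Nonneg) (s : S) (k : ℕ)
    (hk : (st k).job s ≠ none) : (st k).finish s ≤ (st 0).finish s ∨
      ∃ c j, G s c ∧ j < (st k).started s c ∧ (st k).finish s ≤ (st k).time + inp.serv s c j := by
  induction k with
  | zero => exact Or.inl le_rfl
  | succ k ih =>
    rcases (h.advance hinp k).finish_le s hk with ⟨h1, h2⟩ | ⟨c, j, h1, h2, h3⟩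
    · rcases ih h1 with h3 | ⟨c, j, h3, h4, h5⟩
      · exact Or.inl (h2.trans_le h3)
      · exact Or.inr ⟨c, j, h3, h4.trans_le ((h.advance hinp k).started_le s c), by
          have := (h.advance hinp k).time_le
          linarith⟩
    · exact Or.inr ⟨c, j, h1, h2, h3.le⟩

/-- Conservation of customers, with both queues expressed by the leading levels: the customers
started are those between the initial and the present leading level. -/
theorem started_eq (h : IsPath G inp st) (hinp : inp.Nonneg) {c : C} {s₀ s₁ : S} {k : ℕ}
    (hG₀ : G s₀ c) (h₀ : ∀ s, G s c → (st 0).lev s ≤ (st 0).lev s₀)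
    (hG₁ : G s₁ c) (h₁ : ∀ s, G s c → (st k).lev s ≤ (st k).lev s₁) :
    ((∑ s, (st k).started s c : ℕ) : ℤ) =
      inp.count c (min ((st k).lev s₁) (st k).arrived) - inp.count c (min ((st 0).lev s₀) 0) := by
  have key : ∀ k, ((st k).queue inp c : ℤ) + (∑ s, (st k).started s c : ℕ) -
      inp.count c (st k).arrived = (st 0).queue inp c := by
    intro k
    induction k with
    | zero => simp [h.initial.started_zero, h.initial.arrived_zero, inp.count_zero]
    | succ k ih => rw [← ih]; exact (h.step k).queue (h.reachable hinp k) hG₀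
  have h2 := key k
  rw [(h.reachable hinp k).queue_eq hG₁ h₁, (h.reachable hinp 0).queue_eq hG₀ h₀,
    h.initial.arrived_zero, Nat.cast_zero, inp.count_zero] at h2
  linarith

/-- The index of the state at time `t`. -/
theorem exists_index (h : IsPath G inp st) (hinp : inp.Nonneg) {t : ℝ} (ht : 0 ≤ t) :
    ∃ k, stateAt st t = st k ∧ (st k).time ≤ t ∧ t < (st (k + 1)).time := by
  have hne : {k | (st k).time ≤ t}.Nonempty := ⟨0, by
    rw [Set.mem_ofPred_eq, h.initial.time_zero]; exact ht⟩
  obtain ⟨N, hN⟩ := (h.nonexplosive.eventually_gt_atTop t).exists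
  have hbdd : BddAbove {k | (st k).time ≤ t} := ⟨N, fun k hk => by
    by_contra! hlt
    exact absurd (hN.trans_le (h.time_mono hinp hlt.le)) (not_lt.2 hk)⟩
  refine ⟨sSup {k | (st k).time ≤ t}, rfl, Nat.sSup_mem hne hbdd, ?_⟩
  by_contra! hle
  have := le_csSup hbdd hle
  omega

end IsPath

end FCFS

namespace FCFS

/-! ## Scaling -/

/-- `v` is asymptotically equal to `κ • w`. -/
def AsympLinear {α : Type*} (v w : α → ℝ) (κ : ℝ) : Prop :=
  ∀ ε > 0, ∃ K, 0 ≤ K ∧ ∀ a, |v a - κ * w a| ≤ ε * |w a| + K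

theorem AsympLinear.of_tendsto {v : ℕ → ℝ} {κ : ℝ}
    (h : Tendsto (fun n : ℕ => v n / n) atTop (𝓝 κ)) :
    AsympLinear v (fun n : ℕ => (n : ℝ)) κ := by
  intro ε hε
  obtain ⟨n₀, hn₀⟩ := Metric.tendsto_atTop.1 h ε hε
  -- The constant absorbs the finitely many indices up to `n₀`, among them `0`, where the quotient
  -- is meaningless.
  refine ⟨∑ n ∈ Finset.range (n₀ + 1), |v n - κ * n|,
    Finset.sum_nonneg fun _ _ => abs_nonneg _, fun n => ?_⟩
  have hK : 0 ≤ ∑ n ∈ Finset.range (n₀ + 1), |v n - κ * n| :=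
    Finset.sum_nonneg fun _ _ => abs_nonneg _
  rcases lt_or_ge n (n₀ + 1) with hn | hn
  · have := Finset.single_le_sum (f := fun n : ℕ => |v n - κ * n|)
      (fun _ _ => abs_nonneg _) (Finset.mem_range.2 hn)
    have : 0 ≤ ε * |(n : ℝ)| := by positivity
    simp only at *
    linarith
  · have hpos : (0 : ℝ) < n := by exact_mod_cast (by omega : 0 < n)
    have h1 := hn₀ n (by omega)
    rw [Real.dist_eq, show v n / n - κ = (v n - κ * n) / n by field_simp, abs_div,
      abs_of_pos hpos, div_lt_iff₀ hpos] at h1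
    rw [abs_of_pos hpos]
    linarith

section Scaling

variable {ι α : Type*} {l : Filter ι} {N : ι → ℝ}

/-- The error may be proportional to `a i` itself: with a factor at most `1 / 2` it is absorbed in
the left-hand side. This form arises when a law of large numbers is inverted, since its error is
relative to the unknown count. -/
theorem tendsto_div_of_le (hN : Tendsto N l atTop) {a : ι → ℝ} {x : ℝ}
    (h : ∀ ε > 0, ∃ e : ι → ℝ, Tendsto (fun i => e i / N i) l (𝓝 0) ∧
      ∀ᶠ i in l, |a i - N i * x| ≤ ε * |a i| + e i) :
    Tendsto (fun i => a i / N i) l (𝓝 x) := by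
  rw [Metric.tendsto_nhds]
  intro ε hε
  set δ := min (1 / 2) (ε / (4 * (|x| + 1))) with hδ
  have hδ0 : 0 < δ := by positivity
  have hδ1 : δ ≤ 1 / 2 := min_le_left _ _
  have hδ2 : δ * (4 * (|x| + 1)) ≤ ε := by
    rw [← le_div_iff₀ (by positivity)]; exact min_le_right _ _
  obtain ⟨e, he, hle⟩ := h δ hδ0
  filter_upwards [hle, hN.eventually_gt_atTop 0,
    he.eventually_lt_const (show (0 : ℝ) < ε / 4 by positivity)] with i h1 h2 h3
  rw [div_lt_iff₀ h2] at h3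
  rw [Real.dist_eq, show a i / N i - x = (a i - N i * x) / N i by field_simp, abs_div,
    abs_of_pos h2, div_lt_iff₀ h2]
  have h4 : |a i| ≤ |a i - N i * x| + N i * |x| := by
    have := abs_add_le (a i - N i * x) (N i * x)
    rw [sub_add_cancel, abs_mul, abs_of_pos h2] at this
    exact this
  have h5 : |a i - N i * x| ≤ 2 * (δ * (N i * |x|) + e i) := by
    have := mul_le_mul_of_nonneg_left h4 hδ0.le
    have := mul_le_mul_of_nonneg_right hδ1 (abs_nonneg (a i - N i * x))
    linarith
  have h6 : δ * (4 * (|x| + 1)) * N i ≤ ε * N i := mul_le_mul_of_nonneg_right hδ2 h2.le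
  have h7 : 0 < δ * N i := mul_pos hδ0 h2
  linarith

theorem tendsto_const_div (hN : Tendsto N l atTop) (K : ℝ) :
    Tendsto (fun i => K / N i) l (𝓝 0) :=
  hN.const_div_atTop K

theorem tendsto_sub_mul_div (hN : Tendsto N l atTop) {a : ι → ℝ} {x : ℝ}
    (h : Tendsto (fun i => a i / N i) l (𝓝 x)) :
    Tendsto (fun i => |a i - N i * x| / N i) l (𝓝 0) := by
  have h1 : Tendsto (fun i => |a i / N i - x|) l (𝓝 0) := by
    simpa using (h.sub_const x).abs
  refine h1.congr' ?_
  filter_upwards [hN.eventually_gt_atTop 0] with i hi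
  rw [show a i / N i - x = (a i - N i * x) / N i by field_simp, abs_div, abs_of_pos hi]

variable {v w : α → ℝ} {κ : ℝ}

/-- The bound in `AsympLinear` holds for all arguments, so it may be evaluated along an arbitrary
family of indices, such as the random state of the system. The additive constant vanishes under
scaling. -/
theorem AsympLinear.tendsto (h : AsympLinear v w κ) (hN : Tendsto N l atTop) {a : ι → α} {x : ℝ}
    (ha : Tendsto (fun i => w (a i) / N i) l (𝓝 x)) :
    Tendsto (fun i => v (a i) / N i) l (𝓝 (κ * x)) := by
  rw [Metric.tendsto_nhds]
  intro ε hε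
  have hx := ha.abs
  have hκ := ha.const_mul κ
  set δ := ε / (4 * (|x| + 1)) with hδ
  have hδ0 : 0 < δ := by positivity
  obtain ⟨K, hK, hle⟩ := h δ hδ0
  filter_upwards [hN.eventually_gt_atTop 0, hx.eventually_lt_const (lt_add_one |x|),
    (tendsto_const_div hN K).eventually_lt_const (show (0 : ℝ) < ε / 4 by positivity),
    Metric.tendsto_nhds.1 hκ (ε / 4) (by positivity)] with i h1 h2 h3 h4
  rw [Real.dist_eq] at h4 ⊢
  have h5 : |v (a i) / N i - κ * (w (a i) / N i)| ≤ ε / 2 := by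
    rw [show v (a i) / N i - κ * (w (a i) / N i) = (v (a i) - κ * w (a i)) / N i by ring, abs_div,
      abs_of_pos h1, div_le_iff₀ h1]
    refine (hle (a i)).trans ?_
    rw [div_lt_iff₀ h1] at h3
    rw [abs_div, abs_of_pos h1, div_lt_iff₀ h1] at h2
    have h6 := mul_le_mul_of_nonneg_left h2.le hδ0.le
    have h7 : δ * ((|x| + 1) * N i) = ε / 4 * N i := by rw [hδ]; field_simp
    linarith
  calc |v (a i) / N i - κ * x| = |(v (a i) / N i - κ * (w (a i) / N i)) +
        (κ * (w (a i) / N i) - κ * x)| := by ring_nf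
    _ ≤ ε / 2 + |κ * (w (a i) / N i) - κ * x| := (abs_add_le _ _).trans (by linarith)
    _ < ε := by linarith

theorem AsympLinear.tendsto_inv (h : AsympLinear v w κ) (hκ : 0 < κ) (hN : Tendsto N l atTop)
    {a : ι → α} {x : ℝ} (ha : Tendsto (fun i => v (a i) / N i) l (𝓝 x)) :
    Tendsto (fun i => w (a i) / N i) l (𝓝 (x / κ)) := by
  refine tendsto_div_of_le hN fun ε hε => ?_
  obtain ⟨K, hK, hle⟩ := h (ε * κ) (by positivity)
  refine ⟨fun i => (|v (a i) - N i * x| + K) / κ, ?_, Eventually.of_forall fun i => ?_⟩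
  · have h1 := ((tendsto_sub_mul_div hN ha).add (tendsto_const_div hN K)).div_const κ
    rw [add_zero, zero_div] at h1
    refine h1.congr fun i => ?_
    ring
  · have h1 := hle (a i)
    have h2 : |w (a i) - N i * (x / κ)| * κ ≤ ε * |w (a i)| * κ + (|v (a i) - N i * x| + K) := by
      rw [← abs_of_pos hκ, ← abs_mul, abs_of_pos hκ]
      have : (w (a i) - N i * (x / κ)) * κ =
          -(v (a i) - κ * w (a i)) + (v (a i) - N i * x) := by field_simp; ring
      rw [this]
      refine (abs_add_le _ _).trans ?_
      rw [abs_neg]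
      linarith
    rw [← le_div_iff₀ hκ] at h2
    refine h2.trans (le_of_eq ?_)
    field_simp

end Scaling

/-- The increments of an asymptotically linear sum are small. -/
theorem AsympLinear.term_le {f : ℕ → ℝ} {κ : ℝ} (hκ : 0 < κ)
    (h : AsympLinear (fun n => ∑ k ∈ Finset.range n, f k) (fun n : ℕ => (n : ℝ)) κ)
    {ε : ℝ} (hε : 0 < ε) :
    ∃ K, 0 ≤ K ∧ ∀ j, f j ≤ ε * ∑ k ∈ Finset.range (j + 1), f k + K := by
  -- The bound `κ / 2` makes the partial sum at least `κ / 2 * (j + 1) - K`. The bound `ε * κ / 4`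
  -- makes the two errors in the difference of consecutive sums at most `ε` times that.
  set δ := min (κ / 2) (ε * κ / 4) with hδ
  have hδ0 : 0 < δ := by positivity
  have hδ1 : δ ≤ κ / 2 := min_le_left _ _
  have hδ2 : δ ≤ ε * κ / 4 := min_le_right _ _
  obtain ⟨K, hK, hle⟩ := h δ hδ0
  refine ⟨κ + 2 * K + ε * K, by positivity, fun j => ?_⟩
  have h1 := abs_le.1 (hle (j + 1))
  have h2 := abs_le.1 (hle j)
  rw [abs_of_nonneg (Nat.cast_nonneg _)] at h1 h2
  push_cast at h1 h2
  have hs : ∑ k ∈ Finset.range (j + 1), f k = ∑ k ∈ Finset.range j, f k + f j :=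
    Finset.sum_range_succ _ _
  set V := ∑ k ∈ Finset.range (j + 1), f k with hV
  have hj : (0 : ℝ) ≤ j := Nat.cast_nonneg j
  have h3 : (κ / 2) * (j + 1) ≤ V + K := by
    have := mul_le_mul_of_nonneg_right hδ1 (by linarith : (0 : ℝ) ≤ j + 1)
    linarith [h1.1]
  have h4 : ε * ((κ / 2) * (j + 1)) ≤ ε * (V + K) := mul_le_mul_of_nonneg_left h3 hε.le
  have h5 := mul_le_mul_of_nonneg_right hδ2 (by linarith : (0 : ℝ) ≤ j + 1)
  have h6 := mul_nonneg hδ0.le hj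
  have h7 : f j = V - ∑ k ∈ Finset.range j, f k := by linarith
  have h8 := mul_nonneg hε.le hK
  nlinarith [h1.2, h2.1]

end FCFS

/-! ### Arrivals, event times and clocks on the fluid scale -/

namespace FCFS

set_option linter.unusedSectionVars false

/-- The input with another residual time. -/
def Input.delay {S C : Type*} (inp : Input S C) (u : ℝ) : Input S C := { inp with first := u }

/-- The long-run averages of the input exist. -/
structure Input.Regular {S C : Type*} [Fintype C] [DecidableEq C] (inp : Input S C)
    (N : Network S C) (lam : ℝ) : Prop where
  inter : AsympLinear (fun n => ∑ i ∈ Finset.range n, inp.inter i) (fun n : ℕ => (n : ℝ)) (1 / lam)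
  count : ∀ c, AsympLinear (fun a => (inp.count c a : ℝ)) (fun a : ℤ => (a : ℝ)) (N.frac c)
  serv : ∀ s c, N.compat s c → AsympLinear (fun n => ∑ k ∈ Finset.range n, inp.serv s c k)
    (fun n : ℕ => (n : ℝ)) (1 / N.speed s c)

variable {S C : Type*} [Fintype S] [DecidableEq S] [Fintype C] [DecidableEq C]

theorem IsPath.exists_index_le {G : S → C → Prop} {inp : Input S C} {st : ℕ → State S C}
    (h : IsPath G inp st) (hinp : inp.Nonneg) {t t' : ℝ} (ht : 0 ≤ t) (htt' : t ≤ t') :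
    ∃ k k', k ≤ k' ∧ stateAt st t = st k ∧ stateAt st t' = st k' := by
  obtain ⟨k, hk, h1, h2⟩ := h.exists_index hinp ht
  obtain ⟨k', hk', h1', h2'⟩ := h.exists_index hinp (ht.trans htt')
  refine ⟨k, k', ?_, hk, hk'⟩
  by_contra! hlt
  have := h.time_mono hinp (Nat.succ_le_of_lt hlt)
  simp only [Nat.succ_eq_add_one] at this
  linarith

/-- A family of systems with common primitives, in which the residual times are negligible under
the scaling `n`. -/
structure ScaledPaths {ι : Type*} (l : Filter ι) (G : S → C → Prop) (inp : Input S C) (n u : ι → ℝ)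
    (st : ι → ℕ → State S C) : Prop where
  tendsto : Tendsto n l atTop
  scale_nonneg : ∀ i, 0 ≤ n i
  nonneg : ∀ i, (inp.delay (u i)).Nonneg
  path : ∀ i, IsPath G (inp.delay (u i)) (st i)
  first : Tendsto (fun i => u i / n i) l (𝓝 0)
  finish : ∀ s, Tendsto (fun i => (st i 0).finish s / n i) l (𝓝 0)

namespace ScaledPaths

variable {ι : Type*} {l : Filter ι} {G : S → C → Prop} {inp : Input S C} {n u : ι → ℝ}
  {st : ι → ℕ → State S C} {N : Network S C} {lam : ℝ}

theorem reachable (h : ScaledPaths l G inp n u st) (i : ι) {t : ℝ} (ht : 0 ≤ t) :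
    Reachable G (inp.delay (u i)) (stateAt (st i) t) := by
  obtain ⟨k, hk, -⟩ := (h.path i).exists_index (h.nonneg i) ht
  rw [hk]
  exact (h.path i).reachable (h.nonneg i) k

/-- Time `n i * t` lies between the arrivals of the last and of the next customer; the averages of
the interarrival times are inverted at these two epochs. -/
theorem tendsto_arrived (h : ScaledPaths l G inp n u st) (hr : inp.Regular N lam) (hlam : 0 < lam)
    {t : ℝ} (ht : 0 ≤ t) :
    Tendsto (fun i => ((stateAt (st i) (n i * t)).arrived : ℝ) / n i) l (𝓝 (lam * t)) := by
  refine tendsto_div_of_le h.tendsto fun ε hε => ?_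
  obtain ⟨K, hK, hle⟩ := hr.inter (ε / lam) (by positivity)
  refine ⟨fun i => 1 + lam * (K + u i), ?_, Eventually.of_forall fun i => ?_⟩
  · have h1 := (tendsto_const_div h.tendsto (1 + lam * K)).add (h.first.const_mul lam)
    rw [mul_zero, zero_add] at h1
    refine h1.congr fun i => ?_
    ring
  obtain ⟨k, hk, h1, h2⟩ := (h.path i).exists_index (h.nonneg i)
    (mul_nonneg (h.scale_nonneg i) ht)
  have hreach := (h.path i).reachable (h.nonneg i) k
  have hadv := (h.path i).advance (h.nonneg i) k
  have hu : 0 ≤ u i := (h.nonneg i).first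
  have harr : ∀ j, (inp.delay (u i)).arrivalTime j = u i + ∑ k ∈ Finset.range j, inp.inter k :=
    fun j => rfl
  rw [hk]
  set A := (st i k).arrived with hA
  have h3 : n i * t < u i + ∑ k ∈ Finset.range A, inp.inter k := by
    rw [← harr]; exact h2.trans_le hadv.time_le_arrival
  have h4 := abs_le.1 (hle A)
  have hcast : |(A : ℝ)| = A := abs_of_nonneg (Nat.cast_nonneg _)
  rw [hcast] at h4 ⊢
  have e1 : lam * (1 / lam * (A : ℝ)) = A := by field_simp
  have e2 : lam * (ε / lam * (A : ℝ)) = ε * A := by field_simp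
  rw [abs_le]
  constructor
  · have h5 := mul_le_mul_of_nonneg_left h4.2 hlam.le
    have h6 := mul_le_mul_of_nonneg_left h3.le hlam.le
    rw [mul_sub, e1, mul_add, e2] at h5
    nlinarith
  · rcases hA0 : A with _ | j
    · have h6 : 0 ≤ lam * (n i * t) := mul_nonneg hlam.le (mul_nonneg (h.scale_nonneg i) ht)
      have h7 := mul_nonneg hlam.le hu
      have h8 := mul_nonneg hlam.le hK
      push_cast
      nlinarith
    · have h5 := hreach.arrival_le_time j hA0
      rw [harr] at h5
      have h6 := (abs_le.1 (hle j)).1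
      rw [abs_of_nonneg (Nat.cast_nonneg _)] at h6
      have e3 : lam * (1 / lam * (j : ℝ)) = j := by field_simp
      have e4 : lam * (ε / lam * (j : ℝ)) = ε * j := by field_simp
      have h7 := mul_le_mul_of_nonneg_left h6 hlam.le
      have h8 : lam * ∑ k ∈ Finset.range j, inp.inter k ≤ lam * (n i * t) :=
        mul_le_mul_of_nonneg_left (by linarith) hlam.le
      rw [mul_sub, e3, mul_neg, mul_add, e4] at h7
      have h9 := mul_nonneg hlam.le hu
      push_cast
      nlinarith

/-- The last event up to `n i * t` is not before the last arrival. That arrival ends `arrived - 1`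
interarrival times, whose sum is about `n i * t`. The truncated subtraction covers the case of no
arrival. -/
theorem tendsto_time (h : ScaledPaths l G inp n u st) (hr : inp.Regular N lam) (hlam : 0 < lam)
    {t : ℝ} (ht : 0 ≤ t) :
    Tendsto (fun i => (stateAt (st i) (n i * t)).time / n i) l (𝓝 t) := by
  have h0 : Tendsto (fun i => (((stateAt (st i) (n i * t)).arrived - 1 : ℕ) : ℝ) / n i) l
      (𝓝 (lam * t)) := by
    refine tendsto_div_of_le h.tendsto fun ε hε => ?_
    refine ⟨fun i => |(stateAt (st i) (n i * t)).arrived - n i * (lam * t)| + 1, ?_,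
      Eventually.of_forall fun i => ?_⟩
    · have := (tendsto_sub_mul_div h.tendsto (h.tendsto_arrived hr hlam ht)).add
        (tendsto_const_div h.tendsto 1)
      rw [zero_add] at this
      exact this.congr fun i => by ring
    · have h1 : |(((stateAt (st i) (n i * t)).arrived - 1 : ℕ) : ℝ) -
          (stateAt (st i) (n i * t)).arrived| ≤ 1 := by
        rcases (stateAt (st i) (n i * t)).arrived with _ | j
        · simp
        · simp
      have h2 := abs_sub_le (((stateAt (st i) (n i * t)).arrived - 1 : ℕ) : ℝ)
        ((stateAt (st i) (n i * t)).arrived : ℝ) (n i * (lam * t))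
      have h3 : 0 ≤ ε * |(((stateAt (st i) (n i * t)).arrived - 1 : ℕ) : ℝ)| := by positivity
      linarith
  have h1 := hr.inter.tendsto h.tendsto h0
  rw [show 1 / lam * (lam * t) = t by field_simp] at h1
  refine tendsto_of_tendsto_of_tendsto_of_le_of_le' h1 tendsto_const_nhds ?_ ?_
  · filter_upwards [h.tendsto.eventually_gt_atTop 0] with i hi
    refine div_le_div_of_nonneg_right ?_ hi.le
    have hreach := h.reachable i (mul_nonneg hi.le ht)
    rcases hA : (stateAt (st i) (n i * t)).arrived with _ | j
    · simpa using hreach.time_nonneg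
    · refine le_trans ?_ (hreach.arrival_le_time j hA)
      exact le_add_of_nonneg_left (h.nonneg i).first
  · filter_upwards [h.tendsto.eventually_gt_atTop 0] with i hi
    obtain ⟨k, hk, h1, h2⟩ := (h.path i).exists_index (h.nonneg i) (mul_nonneg hi.le ht)
    rw [hk, div_le_iff₀ hi, mul_comm]
    exact h1

theorem clock_nonneg (h : ScaledPaths l G inp n u st) (i : ι) (s : S) : 0 ≤ (st i 0).clock s := by
  by_cases hj : (st i 0).job s = none
  · rw [State.clock_of_none hj, (h.path i).initial.time_zero]
  · rw [State.clock_of_busy hj]; exact (h.path i).initial.finish_nonneg s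

/-- The clock of a busy server exceeds the time by at most the initial residual service or one
service time. By `AsympLinear.term_le` a single service time is a small fraction of the work
started, plus a constant, and the work started is at most the clock. -/
theorem tendsto_clock (h : ScaledPaths l G inp n u st) (hr : inp.Regular N lam) (hlam : 0 < lam)
    (hG : ∀ s c, G s c → N.compat s c) {t : ℝ} (ht : 0 ≤ t) (s : S) :
    Tendsto (fun i => (stateAt (st i) (n i * t)).clock s / n i) l (𝓝 t) := by
  refine tendsto_div_of_le h.tendsto fun ε hε => ?_
  have hterm : ∀ c, ∃ K, 0 ≤ K ∧ (G s c → ∀ j, inp.serv s c j ≤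
      ε * ∑ k ∈ Finset.range (j + 1), inp.serv s c k + K) := fun c => by
    by_cases hc : G s c
    · obtain ⟨K, hK, hle⟩ := (hr.serv s c (hG s c hc)).term_le
        (one_div_pos.2 (N.speed_pos s c (hG s c hc))) hε
      exact ⟨K, hK, fun _ => hle⟩
    · exact ⟨0, le_rfl, fun h => absurd h hc⟩
  choose K hK hle using hterm
  refine ⟨fun i => |(stateAt (st i) (n i * t)).time - n i * t| + (st i 0).finish s + ∑ c, K c, ?_,
    Eventually.of_forall fun i => ?_⟩
  · have := ((tendsto_sub_mul_div h.tendsto (h.tendsto_time hr hlam ht)).add (h.finish s)).add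
      (tendsto_const_div h.tendsto (∑ c, K c))
    rw [zero_add, zero_add] at this
    exact this.congr fun i => by ring
  obtain ⟨k, hk, h1, h2⟩ := (h.path i).exists_index (h.nonneg i)
    (mul_nonneg (h.scale_nonneg i) ht)
  beta_reduce
  rw [hk]
  have hreach := (h.path i).reachable (h.nonneg i) k
  have hf0 := (h.path i).initial.finish_nonneg s
  have hKs : 0 ≤ ∑ c, K c := Finset.sum_nonneg fun c _ => hK c
  by_cases hj : (st i k).job s = none
  · rw [State.clock_of_none hj]
    have : 0 ≤ ε * |(st i k).time| := by positivity
    linarith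
  have hcl := State.clock_of_busy hj
  have hge := hreach.time_le_finish s hj
  have hnn : 0 ≤ (st i k).finish s := hreach.time_nonneg.trans hge
  have habs := abs_le.1 (le_refl |(st i k).time - n i * t|)
  have hε' : 0 ≤ ε * (st i k).finish s := by positivity
  rw [hcl, abs_of_nonneg hnn, abs_le]
  refine ⟨by linarith [habs.1], ?_⟩
  rcases (h.path i).finish_le (h.nonneg i) s k hj with h3 | ⟨c, j, hc, hjlt, h3⟩
  · have := mul_nonneg (h.scale_nonneg i) ht
    have := abs_nonneg ((st i k).time - n i * t)
    linarith
  · have h4 := hle c hc j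
    have h5 : ∑ k ∈ Finset.range (j + 1), inp.serv s c k ≤ (st i k).finish s := by
      have h6 : ∑ k ∈ Finset.range (j + 1), inp.serv s c k ≤
          ∑ k ∈ Finset.range ((st i k).started s c), inp.serv s c k :=
        Finset.sum_le_sum_of_subset_of_nonneg (Finset.range_mono hjlt)
          fun k _ _ => (h.nonneg i).serv s c k
      have h7 : ∑ k ∈ Finset.range ((st i k).started s c), inp.serv s c k ≤
          (st i k).work (inp.delay (u i)) s :=
        Finset.single_le_sum (f := fun c => ∑ k ∈ Finset.range ((st i k).started s c),
          inp.serv s c k) (fun c _ => Finset.sum_nonneg fun k _ => (h.nonneg i).serv s c k)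
          (Finset.mem_univ c)
      have h8 := (h.path i).work_sub_le (h.nonneg i) s (Nat.zero_le k)
      have h9 : (st i 0).work (inp.delay (u i)) s = 0 := by
        simp [State.work, (h.path i).initial.started_zero]
      have h10 := h.clock_nonneg i s
      rw [hcl] at h8
      linarith
    have h6 := mul_le_mul_of_nonneg_left h5 hε.le
    have h7 : K c ≤ ∑ c, K c := Finset.single_le_sum (fun c _ => hK c) (Finset.mem_univ c)
    have h8 : (inp.delay (u i)).serv s c j = inp.serv s c j := rfl
    rw [h8] at h3
    linarith [habs.2]

end ScaledPaths

end FCFS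

/-! ### From scaled sample paths to the fluid model -/

namespace FCFS

set_option linter.unusedSectionVars false

variable {S C : Type*} [Fintype S] [DecidableEq S] [Fintype C] [DecidableEq C]

namespace ScaledPaths

variable {ι : Type*} {l : Filter ι} {G : S → C → Prop} {inp : Input S C} {n u : ι → ℝ}
  {st : ι → ℕ → State S C} {N : Network S C} {lam : ℝ}

theorem tendsto_lev (h : ScaledPaths l G inp n u st) {x : ι → State S C}
    (hx : ∀ i, Reachable G (inp.delay (u i)) (x i)) {s : S} {a : ℝ}
    (ha : Tendsto (fun i => ((x i).pos s : ℝ) / n i) l (𝓝 a)) :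
    Tendsto (fun i => ((x i).lev s : ℝ) / n i) l (𝓝 a) := by
  have h1 : Tendsto (fun i => (((x i).pos s : ℝ) - (x i).lev s) / n i) l (𝓝 0) := by
    refine squeeze_zero' ?_ ?_ (tendsto_const_div h.tendsto (Fintype.card S))
    · refine Eventually.of_forall fun i => div_nonneg ?_ (h.scale_nonneg i)
      have := ((hx i).pos_bounds s).1
      rw [sub_nonneg]
      exact_mod_cast this
    · refine Eventually.of_forall fun i => div_le_div_of_nonneg_right ?_ (h.scale_nonneg i)
      have := ((hx i).pos_bounds s).2
      rw [sub_le_iff_le_add']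
      exact_mod_cast this
  have h2 := ha.sub h1
  rw [sub_zero] at h2
  exact h2.congr fun i => by ring

theorem work_le_clock (h : ScaledPaths l G inp n u st) (i : ι) (s : S) {t : ℝ} (ht : 0 ≤ t) :
    (stateAt (st i) t).work inp s ≤ (stateAt (st i) t).clock s := by
  obtain ⟨k, hk, -⟩ := (h.path i).exists_index (h.nonneg i) ht
  rw [hk]
  have h8 := (h.path i).work_sub_le (h.nonneg i) s (Nat.zero_le k)
  have h9 : (st i 0).work (inp.delay (u i)) s = 0 := by
    simp [State.work, (h.path i).initial.started_zero]
  have h10 := h.clock_nonneg i s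
  have h11 : (st i k).work inp s = (st i k).work (inp.delay (u i)) s := rfl
  linarith

/-- The amount of work of the services of type `c` started by `s`. -/
noncomputable def _root_.FCFS.State.workOn (inp : Input S C) (x : State S C) (s : S) (c : C) : ℝ :=
  ∑ k ∈ Finset.range (x.started s c), inp.serv s c k

theorem workOn_nonneg (h : ScaledPaths l G inp n u st) (i : ι) (x : State S C) (s : S) (c : C) :
    0 ≤ x.workOn inp s c :=
  Finset.sum_nonneg fun _ _ => (h.nonneg i).serv _ _ _

theorem workOn_le (h : ScaledPaths l G inp n u st) (i : ι) (x : State S C) (s : S) (c : C) :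
    x.workOn inp s c ≤ x.work inp s :=
  Finset.single_le_sum (f := fun c => x.workOn inp s c)
    (fun c _ => h.workOn_nonneg i x s c) (Finset.mem_univ c)

theorem workOn_mono (h : ScaledPaths l G inp n u st) (i : ι) (s : S) (c : C) {t t' : ℝ}
    (ht : 0 ≤ t) (htt' : t ≤ t') :
    (stateAt (st i) t).workOn inp s c ≤ (stateAt (st i) t').workOn inp s c := by
  obtain ⟨k, k', hkk', hk, hk'⟩ := (h.path i).exists_index_le (h.nonneg i) ht htt'
  rw [hk, hk']
  exact Finset.sum_le_sum_of_subset_of_nonneg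
    (Finset.range_mono ((h.path i).started_mono (h.nonneg i) s c hkk'))
    fun k _ _ => (h.nonneg i).serv s c k

/-- The work on every type has a fluid limit along an ultrafilter. -/
theorem exists_limit {l : Ultrafilter ι} (h : ScaledPaths (l : Filter ι) G inp n u st)
    (hr : inp.Regular N lam) (hlam : 0 < lam) (hG : ∀ s c, G s c → N.compat s c) :
    ∃ T : S → C → ℝ → ℝ, (∀ s c t, t ≤ 0 → T s c t = 0) ∧ ∀ s c t, 0 ≤ t →
      Tendsto (fun i => (stateAt (st i) (n i * t)).workOn inp s c / n i) l (𝓝 (T s c t)) := by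
  have hbound : ∀ s c t, 0 ≤ t → ∀ᶠ i in (l : Filter ι),
      (stateAt (st i) (n i * t)).workOn inp s c / n i ≤
        (stateAt (st i) (n i * t)).clock s / n i := fun s c t ht => by
    filter_upwards [h.tendsto.eventually_gt_atTop 0] with i hi
    exact div_le_div_of_nonneg_right ((h.workOn_le i _ s c).trans
      (h.work_le_clock i s (mul_nonneg hi.le ht))) hi.le
  have hnn : ∀ s c t i, 0 ≤ (stateAt (st i) (n i * t)).workOn inp s c / n i := fun s c t i =>
    div_nonneg (h.workOn_nonneg i _ s c) (h.scale_nonneg i)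
  have hex : ∀ s c t, ∃ x, 0 ≤ t →
      Tendsto (fun i => (stateAt (st i) (n i * t)).workOn inp s c / n i) l (𝓝 x) := by
    intro s c t
    rcases lt_or_ge t 0 with ht | ht
    · exact ⟨0, fun h => absurd h ht.not_ge⟩
    have hmem : ∀ᶠ i in (l : Filter ι), (stateAt (st i) (n i * t)).workOn inp s c / n i ∈
        Set.Icc 0 (t + 1) := by
      filter_upwards [hbound s c t ht, (h.tendsto_clock hr hlam hG ht s).eventually_lt_const
        (lt_add_one t)] with i h1 h2
      exact ⟨hnn s c t i, h1.trans h2.le⟩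
    -- Along an ultrafilter every bounded family converges, so the limits exist for all servers,
    -- types and times at once, without extraction of subsequences.
    obtain ⟨x, -, hx⟩ := isCompact_Icc.ultrafilter_le_nhds
      (l.map fun i => (stateAt (st i) (n i * t)).workOn inp s c / n i)
      (le_principal_iff.2 hmem)
    exact ⟨x, fun _ => hx⟩
  choose T hT using hex
  refine ⟨fun s c t => if t ≤ 0 then 0 else T s c t, fun s c t ht => if_pos ht,
    fun s c t ht => ?_⟩
  beta_reduce
  rcases ht.eq_or_lt with h0 | h0
  · rw [if_pos h0.ge]
    refine squeeze_zero' (Eventually.of_forall fun i => hnn s c t i) (hbound s c t ht) ?_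
    have := h.tendsto_clock hr hlam hG ht s
    rwa [← h0] at this ⊢
  · rw [if_neg h0.not_ge]
    exact hT s c t ht

/-- The leading scaled level converges to the maximum of the limits, and counting customers of one
type up to a position multiplies it by the type probability. Cutting at `A i`, needed for idle
servers, does not matter because no limit exceeds `a`. -/
theorem tendsto_level (h : ScaledPaths l G inp n u st) (hr : inp.Regular N lam)
    {c : C} {F : Finset S} (hF : F.Nonempty) (hFG : ∀ s, s ∈ F ↔ G s c)
    {x : ι → State S C} {p : S → ℝ}
    (hp : ∀ s, Tendsto (fun i => ((x i).lev s : ℝ) / n i) l (𝓝 (p s))) {A : ι → ℤ} {a : ℝ}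
    (hA : Tendsto (fun i => (A i : ℝ) / n i) l (𝓝 a)) {s₁ : ι → S} (hs₁ : ∀ i, G (s₁ i) c)
    (hmax : ∀ i s, G s c → (x i).lev s ≤ (x i).lev (s₁ i)) (hle : ∀ s, p s ≤ a) :
    Tendsto (fun i => ((inp.count c (min ((x i).lev (s₁ i)) (A i)) : ℤ) : ℝ) / n i) l
      (𝓝 (N.frac c * F.sup' hF p)) := by
  refine (hr.count c).tendsto h.tendsto (a := fun i => min ((x i).lev (s₁ i)) (A i)) ?_
  have h1 : Tendsto (fun i => F.sup' hF fun s => ((x i).lev s : ℝ) / n i) l (𝓝 (F.sup' hF p)) :=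
    Tendsto.finset_sup'_nhds_apply hF fun s _ => hp s
  have h2 := h1.min hA
  rw [min_eq_left (Finset.sup'_le _ _ fun s _ => hle s)] at h2
  refine h2.congr fun i => ?_
  have h3 : (F.sup' hF fun s => ((x i).lev s : ℝ) / n i) = ((x i).lev (s₁ i) : ℝ) / n i := by
    refine le_antisymm (Finset.sup'_le _ _ fun s hs => ?_)
      (Finset.le_sup' (fun s => ((x i).lev s : ℝ) / n i) ((hFG _).2 (hs₁ i)))
    refine div_le_div_of_nonneg_right ?_ (h.scale_nonneg i)
    exact_mod_cast hmax i s ((hFG s).1 hs)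
  rw [h3, min_div_div_right (h.scale_nonneg i)]
  push_cast
  rfl

/-- The scaled positions satisfy the equations of the fluid model. -/
theorem exists_fluidModel {l : Ultrafilter ι} (h : ScaledPaths (l : Filter ι) G inp n u st)
    (hr : inp.Regular N lam) (hlam : 0 < lam) (hG : ∀ s c, G s c → N.compat s c)
    {p : S → ℝ → ℝ} {b : ℝ} (hb : -∑ s, p s 0 = b)
    (hp₀ : ∀ s, Tendsto (fun i => ((st i 0).pos s : ℝ) / n i) l (𝓝 (p s 0)))
    (hp : ∀ s t, 0 < t →
      Tendsto (fun i => ((stateAt (st i) (n i * t)).pos s : ℝ) / n i) l (𝓝 (p s t))) :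
    ∃ T q, FluidModel G (fun s c => N.speed s c / N.frac c) lam b T q p := by
  classical
  obtain ⟨T, hT0, hT⟩ := h.exists_limit hr hlam hG
  have hreach : ∀ t, 0 ≤ t → ∀ i, Reachable G (inp.delay (u i)) (stateAt (st i) (n i * t)) :=
    fun t ht i => h.reachable i (mul_nonneg (h.scale_nonneg i) ht)
  have hreach₀ : ∀ i, Reachable G (inp.delay (u i)) (st i 0) :=
    fun i => (h.path i).reachable (h.nonneg i) 0
  have hlev₀ := fun s => h.tendsto_lev hreach₀ (hp₀ s)
  have hlev := fun s t (ht : 0 < t) => h.tendsto_lev (hreach t ht.le) (hp s t ht)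
  have hA := fun t (ht : (0 : ℝ) ≤ t) => h.tendsto_arrived hr hlam ht
  -- levels are at most the number of arrivals
  have hple : ∀ s t, 0 < t → p s t ≤ lam * t := fun s t ht => by
    have h1 := (hA t ht.le).add (tendsto_const_div h.tendsto 1)
    rw [add_zero] at h1
    refine le_of_tendsto_of_tendsto' (hlev s t ht) h1 fun i => ?_
    rw [← add_div]
    refine div_le_div_of_nonneg_right ?_ (h.scale_nonneg i)
    exact_mod_cast (hreach t ht.le i).lev_le s
  have hp0le : ∀ s, p s 0 ≤ 0 := fun s => by
    refine le_of_tendsto_of_tendsto' (hlev₀ s) (tendsto_const_div h.tendsto 1) fun i => ?_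
    refine div_le_div_of_nonneg_right ?_ (h.scale_nonneg i)
    have := (hreach₀ i).lev_le s
    rw [(h.path i).initial.arrived_zero] at this
    exact_mod_cast this
  -- The numbers `-p s 0` are nonnegative with sum `b`, so none exceeds `b`.
  have hp0ge : ∀ s, -b ≤ p s 0 := fun s => by
    have h1 := Finset.sum_le_sum_of_subset_of_nonneg (f := fun s => -p s 0)
      (Finset.subset_univ {s}) fun s _ _ => neg_nonneg.2 (hp0le s)
    rw [Finset.sum_singleton, Finset.sum_neg_distrib] at h1
    linarith
  set F : C → Finset S := fun c => Finset.univ.filter fun s => G s c with hFdef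
  have hFG : ∀ c s, s ∈ F c ↔ G s c := fun c s => by simp [hFdef]
  have hFne : ∀ c, (∃ s, G s c) → (F c).Nonempty := fun c ⟨s, hs⟩ => ⟨s, (hFG c s).2 hs⟩
  -- The initial level of a type is that of its most advanced server; `0` is a default for types
  -- without arcs, about which the model says nothing.
  set q₀ : C → ℝ := fun c => if hc : (F c).Nonempty then (F c).sup' hc fun s => p s 0 else 0
    with hq₀
  have hq₀' : ∀ c (hc : (F c).Nonempty), q₀ c = (F c).sup' hc fun s => p s 0 :=
    fun c hc => dif_pos hc
  have hWoff : ∀ s c t, ¬ G s c → 0 ≤ t → ∀ i, (stateAt (st i) (n i * t)).started s c = 0 :=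
    fun s c t hnG ht i => (hreach t ht i).started_off s c hnG
  have hToff : ∀ s c t, ¬ G s c → T s c t = 0 := fun s c t hnG => by
    rcases le_total t 0 with ht | ht
    · exact hT0 s c t ht
    · refine tendsto_nhds_unique (hT s c t ht) ?_
      refine tendsto_const_nhds.congr fun i => ?_
      rw [State.workOn, hWoff s c t hnG ht i]
      simp
  set q : C → ℝ → ℝ := fun c t => q₀ c + ∑ s, N.speed s c / N.frac c * T s c t with hq
  have hstarted : ∀ s c t, 0 ≤ t → Tendsto
      (fun i => ((stateAt (st i) (n i * t)).started s c : ℝ) / n i) l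
      (𝓝 (N.speed s c * T s c t)) := fun s c t ht => by
    by_cases hc : G s c
    · have h1 := (hr.serv s c (hG s c hc)).tendsto_inv
        (one_div_pos.2 (N.speed_pos s c (hG s c hc))) h.tendsto (hT s c t ht)
      rwa [div_div_eq_mul_div, div_one, mul_comm] at h1
    · rw [hToff s c t hc, mul_zero]
      refine tendsto_const_nhds.congr fun i => ?_
      rw [hWoff s c t hc ht i]
      simp
  -- the customers of type `c` up to `q c t` are those that have been taken into service
  have hqsup : ∀ c (hc : (F c).Nonempty) t, 0 < t → (F c).sup' hc (fun s => p s t) = q c t := by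
    intro c hc t ht
    have hmaxex : ∀ x : State S C, ∃ s, G s c ∧ ∀ s', G s' c → x.lev s' ≤ x.lev s := fun x => by
      obtain ⟨s, hs, hmax⟩ := (F c).exists_max_image x.lev hc
      exact ⟨s, (hFG c s).1 hs, fun s' hs' => hmax s' ((hFG c s').2 hs')⟩
    choose top htop htopmax using hmaxex
    have h1 := h.tendsto_level hr hc (hFG c) (fun s => hlev s t ht)
      (A := fun i => ((stateAt (st i) (n i * t)).arrived : ℤ)) (a := lam * t)
      (by simpa using hA t ht.le) (s₁ := fun i => top (stateAt (st i) (n i * t)))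
      (fun i => htop _) (fun i => htopmax _) (fun s => hple s t ht)
    have h2 := h.tendsto_level hr hc (hFG c) hlev₀ (A := fun _ => 0) (a := 0)
      (by simp) (s₁ := fun i => top (st i 0))
      (fun i => htop _) (fun i => htopmax _) hp0le
    have h3 : Tendsto (fun i => ∑ s, ((stateAt (st i) (n i * t)).started s c : ℝ) / n i) l
        (𝓝 (∑ s, N.speed s c * T s c t)) :=
      tendsto_finsetSum _ fun s _ => hstarted s c t ht.le
    -- The number of services started has two limits: through the work done, and through the
    -- movement of the leading level by `IsPath.started_eq`.
    have h4 := tendsto_nhds_unique h3 ((h1.sub h2).congr fun i => by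
      obtain ⟨k, hk, -⟩ := (h.path i).exists_index (h.nonneg i)
        (mul_nonneg (h.scale_nonneg i) ht.le)
      have h5 := (h.path i).started_eq (h.nonneg i) (k := k) (htop (st i 0)) (htopmax (st i 0))
        (htop (st i k)) (htopmax (st i k))
      rw [hk, ← Finset.sum_div, ← sub_div]
      congr 1
      rw [← Nat.cast_sum]
      exact_mod_cast h5.symm)
    have hf := N.frac_pos c
    rw [hq]
    simp only
    rw [hq₀' c hc, ← sub_eq_iff_eq_add']
    have h6 : ∑ s, N.speed s c / N.frac c * T s c t = (∑ s, N.speed s c * T s c t) / N.frac c := by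
      rw [Finset.sum_div]
      exact Finset.sum_congr rfl fun s _ => by ring
    rw [h6, h4]
    field_simp
  have hmono : ∀ s c, Monotone (T s c) := fun s c t t' htt' => by
    have hnn : ∀ t, 0 ≤ T s c t := fun t => by
      rcases le_total t 0 with ht | ht
      · exact (hT0 s c t ht).ge
      · exact ge_of_tendsto' (hT s c t ht) fun i =>
          div_nonneg (h.workOn_nonneg i _ s c) (h.scale_nonneg i)
    rcases le_total t 0 with ht | ht
    · rw [hT0 s c t ht]; exact hnn t'
    · exact le_of_tendsto_of_tendsto' (hT s c t ht) (hT s c t' (ht.trans htt')) fun i =>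
        div_le_div_of_nonneg_right (h.workOn_mono i s c (mul_nonneg (h.scale_nonneg i) ht)
          (mul_le_mul_of_nonneg_left htt' (h.scale_nonneg i))) (h.scale_nonneg i)
  have hwork : ∀ s t, 0 ≤ t → Tendsto (fun i => (stateAt (st i) (n i * t)).work inp s / n i) l
      (𝓝 (∑ c, T s c t)) := fun s t ht => by
    have := tendsto_finsetSum Finset.univ fun c _ => hT s c t ht
    refine this.congr fun i => ?_
    rw [← Finset.sum_div]
    rfl
  have hclock := fun s t (ht : (0 : ℝ) ≤ t) => h.tendsto_clock hr hlam hG ht s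
  refine ⟨T, q, hmono, hT0, fun s t t' ht htt' => ?_, fun s c t => hToff s c t, fun c hc t => ?_,
    fun c hc => ?_, fun c hc => ?_, fun c hc t ht => ?_, fun s c hc t ht => ?_,
    fun s c hc t t' ht htt' hlt => ?_, fun s t t' ht htt' hlt => ?_⟩
  · rw [Finset.sum_sub_distrib]
    refine le_of_tendsto_of_tendsto' ((hwork s t' (ht.trans htt')).sub (hwork s t ht))
      ((hclock s t' (ht.trans htt')).sub (hclock s t ht)) fun i => ?_
    rw [← sub_div, ← sub_div]
    refine div_le_div_of_nonneg_right ?_ (h.scale_nonneg i)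
    obtain ⟨k, k', hkk', hk, hk'⟩ := (h.path i).exists_index_le (h.nonneg i)
      (mul_nonneg (h.scale_nonneg i) ht) (mul_le_mul_of_nonneg_left htt' (h.scale_nonneg i))
    rw [hk, hk']
    exact (h.path i).work_sub_le (h.nonneg i) s hkk'
  · simp only [hq, hT0 _ _ 0 le_rfl, mul_zero, Finset.sum_const_zero, add_zero]
  · simp only [hq, hT0 _ _ 0 le_rfl, mul_zero, Finset.sum_const_zero, add_zero]
    rw [hq₀' c (hFne c hc)]
    obtain ⟨s, hs⟩ := hFne c hc
    exact (hp0ge s).trans (Finset.le_sup' (fun s => p s 0) hs)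
  · simp only [hq, hT0 _ _ 0 le_rfl, mul_zero, Finset.sum_const_zero, add_zero]
    rw [hq₀' c (hFne c hc)]
    exact Finset.sup'_le _ _ fun s _ => hp0le s
  · rcases ht.eq_or_lt with h0 | h0
    · rw [← h0, mul_zero]
      simp only [hq, hT0 _ _ 0 le_rfl, mul_zero, Finset.sum_const_zero, add_zero]
      rw [hq₀' c (hFne c hc)]
      exact Finset.sup'_le _ _ fun s _ => hp0le s
    · rw [← hqsup c (hFne c hc) t h0]
      exact Finset.sup'_le _ _ fun s _ => hple s t h0
  · rw [← hqsup c (hFne c ⟨s, hc⟩) t ht]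
    exact Finset.le_sup' (fun s => p s t) ((hFG c s).2 hc)
  · have ht' := ht.trans_le htt'
    have hev : ∀ᶠ i in (l : Filter ι), (stateAt (st i) (n i * t')).started s c =
        (stateAt (st i) (n i * t)).started s c := by
      by_contra hne
      -- For an ultrafilter, not eventually means eventually not. So along it `s` starts a service
      -- of type `c` in between, hence ends beyond all levels that compatible servers had at `t`. In
      -- the limit this contradicts `p s t' < q c t`.
      rw [← Ultrafilter.eventually_not] at hne
      refine absurd hlt (not_lt.2 ?_)
      rw [← hqsup c (hFne c ⟨s, hc⟩) t ht]
      refine Finset.sup'_le _ _ fun s' hs' => ?_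
      refine le_of_tendsto_of_tendsto (hlev s' t ht) (hlev s t' ht') ?_
      filter_upwards [hne] with i hi
      refine div_le_div_of_nonneg_right ?_ (h.scale_nonneg i)
      obtain ⟨k, k', hkk', hk, hk'⟩ := (h.path i).exists_index_le (h.nonneg i)
        (mul_nonneg (h.scale_nonneg i) ht.le) (mul_le_mul_of_nonneg_left htt' (h.scale_nonneg i))
      rw [hk, hk'] at hi ⊢
      have := (h.path i).started_mono (h.nonneg i) s c hkk'
      exact_mod_cast ((h.path i).lev_of_started (h.nonneg i) (lt_of_le_of_ne this
        (Ne.symm hi))).2 s' ((hFG c s').1 hs')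
    refine tendsto_nhds_unique (hT s c t' ht'.le) ((hT s c t ht.le).congr' ?_)
    filter_upwards [hev] with i hi
    rw [State.workOn, State.workOn, hi]
  · have ht' := ht.trans_le htt'
    rw [Finset.sum_sub_distrib]
    refine tendsto_nhds_unique ((hwork s t' ht'.le).sub (hwork s t ht.le))
      (((hclock s t' ht'.le).sub (hclock s t ht.le)).congr' ?_)
    -- The level at `t'` is eventually below the number of arrivals at `t`, so the server is never
    -- idle in between.
    filter_upwards [(hlev s t' ht').eventually_lt (hA t ht.le) hlt,
      h.tendsto.eventually_gt_atTop 0] with i hi hn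
    rw [div_lt_div_iff_of_pos_right hn] at hi
    obtain ⟨k, k', hkk', hk, hk'⟩ := (h.path i).exists_index_le (h.nonneg i)
      (mul_nonneg (h.scale_nonneg i) ht.le) (mul_le_mul_of_nonneg_left htt' (h.scale_nonneg i))
    rw [hk, hk'] at hi ⊢
    rw [← sub_div, ← sub_div]
    congr 1
    exact ((h.path i).work_sub_eq (h.nonneg i) s hkk' (by exact_mod_cast hi.le)).symm

end ScaledPaths

end FCFS

namespace FCFS

set_option linter.unusedSectionVars false

/-! ## Laws of large numbers for the primitives -/

section Stochastic

variable {S C Ω : Type*} [DecidableEq S] [Fintype C] [DecidableEq C] [MeasurableSpace Ω] {P : Measure Ω}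
  [IsProbabilityMeasure P] {N : Network S C} {lam : ℝ}

/-- The law of an indicator is determined by the probability of its event. This makes the strong law
available for types, of which only the probabilities are given. -/
theorem identDistrib_indicator {A A' : Set Ω} (hA : MeasurableSet A) (hA' : MeasurableSet A')
    (h : P.real A = P.real A') :
    IdentDistrib (A.indicator fun _ => (1 : ℝ)) (A'.indicator fun _ => (1 : ℝ)) P P := by
  have hm : Measurable (A.indicator fun _ => (1 : ℝ)) := measurable_const.indicator hA
  have hm' : Measurable (A'.indicator fun _ => (1 : ℝ)) := measurable_const.indicator hA'
  have h' : P A = P A' := (measureReal_eq_measureReal_iff (measure_ne_top P A)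
    (measure_ne_top P A')).1 h
  refine ⟨hm.aemeasurable, hm'.aemeasurable, Measure.ext fun s hs => ?_⟩
  rw [Measure.map_apply hm hs, Measure.map_apply hm' hs]
  classical
  rw [Set.indicator_const_preimage_eq_union, Set.indicator_const_preimage_eq_union]
  have h'' : P Aᶜ = P A'ᶜ := by rw [prob_compl_eq_one_sub hA, prob_compl_eq_one_sub hA', h']
  by_cases h1 : (1 : ℝ) ∈ s <;> by_cases h0 : (0 : ℝ) ∈ s <;> simp [h1, h0, h', h'']

theorem Primitives.ae_serv (X : Primitives N P lam) {s : S} {c : C} (h : N.compat s c) :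
    ∀ᵐ ω ∂P, AsympLinear (fun n => ∑ k ∈ Finset.range n, X.serv s c k ω)
      (fun n : ℕ => (n : ℝ)) (1 / N.speed s c) := by
  have := strong_law_ae_real (fun k => X.serv s c k) (X.serv_int s c h)
    (fun i j hij => X.indep.indep (i := Sum.inr (Sum.inr (s, c, i)))
      (j := Sum.inr (Sum.inr (s, c, j))) (by simpa using hij)) (X.serv_ident s c h)
  filter_upwards [this] with ω hω
  rw [X.serv_mean s c h] at hω
  exact AsympLinear.of_tendsto hω

theorem Primitives.ae_inter (X : Primitives N P lam) :
    ∀ᵐ ω ∂P, AsympLinear (fun n => ∑ k ∈ Finset.range n, X.inter k ω)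
      (fun n : ℕ => (n : ℝ)) (1 / lam) := by
  have := strong_law_ae_real X.inter X.inter_int
    (fun i j hij => X.indep.indep (i := Sum.inl i) (j := Sum.inl j) (by simpa using hij))
    X.inter_ident
  filter_upwards [this] with ω hω
  rw [X.inter_mean] at hω
  exact AsympLinear.of_tendsto hω

/-- The strong law for the indicators of type `c`. An injective enumeration `e` is allowed because
the customers after time `0` and the old ones are counted in opposite directions. -/
theorem Primitives.ae_kind (X : Primitives N P lam) (c : C) {e : ℕ → ℤ}
    (he : Function.Injective e) :
    ∀ᵐ ω ∂P, AsympLinear (fun n => ∑ k ∈ Finset.range n, if X.kind (e k) ω = c then (1 : ℝ) else 0)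
      (fun n : ℕ => (n : ℝ)) (N.frac c) := by
  set f : ℕ → Ω → ℝ := fun k => (X.kind (e k) ⁻¹' {c}).indicator fun _ => 1 with hf
  have hm : ∀ k, MeasurableSet (X.kind (e k) ⁻¹' {c}) := fun k => X.kind_meas (e k) c
  have hle : ∀ k, MeasurableSpace.comap (f k) inferInstance ≤
      MeasurableSpace.comap (X.kind (e k)) ⊤ := fun k => by
    have h1 : Measurable[MeasurableSpace.comap (X.kind (e k)) ⊤] (f k) :=
      (measurable_const (a := (1 : ℝ))).indicator ⟨{c}, trivial, rfl⟩
    exact h1.comap_le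
  have := strong_law_ae_real (μ := P) f ((integrable_const (1 : ℝ)).indicator (hm 0))
    (fun i j hij => indep_of_indep_of_le_left (indep_of_indep_of_le_right
      (X.indep.indep (i := Sum.inr (Sum.inl (e i))) (j := Sum.inr (Sum.inl (e j)))
        (by simpa using fun h => hij (he h))) (hle j)) (hle i))
    (fun k => identDistrib_indicator (hm k) (hm 0) (by rw [X.kind_law, X.kind_law]))
  filter_upwards [this] with ω hω
  have hmean : ∫ ω, f 0 ω ∂P = N.frac c := by
    rw [hf]
    simp only
    rw [integral_indicator_const _ (hm 0), X.kind_law, smul_eq_mul, mul_one]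
  rw [hmean] at hω
  refine AsympLinear.of_tendsto (hω.congr fun n => ?_)
  congr 1
  refine Finset.sum_congr rfl fun k _ => ?_
  simp [hf, Set.indicator]

theorem Input.count_nat (inp : Input S C) (c : C) (n : ℕ) : (inp.count c n : ℝ) =
    ∑ k ∈ Finset.range n, if inp.kind ((k : ℤ) + 1) = c then (1 : ℝ) else 0 := by
  induction n with
  | zero => simp [Input.count_zero]
  | succ n ih =>
    rw [Finset.sum_range_succ, ← ih, Nat.cast_succ, Input.count_succ]
    push_cast
    rfl

theorem Input.count_neg_nat (inp : Input S C) (c : C) (n : ℕ) : (inp.count c (-n : ℤ) : ℝ) =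
    -∑ k ∈ Finset.range n, if inp.kind (-(k : ℤ)) = c then (1 : ℝ) else 0 := by
  induction n with
  | zero => simp [Input.count_zero]
  | succ n ih =>
    have h1 := inp.count_succ c (-((n + 1 : ℕ) : ℤ))
    rw [show -((n + 1 : ℕ) : ℤ) + 1 = -(n : ℤ) by push_cast; ring] at h1
    have h2 : ((inp.count c (-(n : ℤ)) : ℤ) : ℝ) = inp.count c (-((n + 1 : ℕ) : ℤ)) +
        if inp.kind (-(n : ℤ)) = c then (1 : ℝ) else 0 := by
      rw [h1]; push_cast; rfl
    rw [Finset.sum_range_succ]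
    linarith

theorem asympLinear_int {v : ℤ → ℝ} {κ : ℝ}
    (h1 : AsympLinear (fun n : ℕ => v n) (fun n : ℕ => (n : ℝ)) κ)
    (h2 : AsympLinear (fun n : ℕ => -v (-n)) (fun n : ℕ => (n : ℝ)) κ) :
    AsympLinear v (fun a : ℤ => (a : ℝ)) κ := by
  intro ε hε
  obtain ⟨K₁, hK₁, h1⟩ := h1 ε hε
  obtain ⟨K₂, hK₂, h2⟩ := h2 ε hε
  refine ⟨K₁ + K₂, by positivity, fun a => ?_⟩
  obtain ⟨n, rfl | rfl⟩ := a.eq_nat_or_neg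
  · have := h1 n
    push_cast
    linarith
  · have := h2 n
    rw [show -v (-n) - κ * n = -(v (-n) - κ * ((-n : ℤ) : ℝ)) by push_cast; ring, abs_neg] at this
    rw [show |((-n : ℤ) : ℝ)| = |(n : ℝ)| by push_cast; exact abs_neg _]
    linarith

/-- Regularity does not involve the residual time, so a single null set serves all the systems in
the definition of fluid limits, whatever their residual times. -/
theorem Primitives.ae_regular [Finite S] (X : Primitives N P lam) :
    ∀ᵐ ω ∂P, (X.input ω 0).Regular N lam := by
  have h1 : ∀ᵐ ω ∂P, ∀ s c, N.compat s c → AsympLinear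
      (fun n => ∑ k ∈ Finset.range n, X.serv s c k ω) (fun n : ℕ => (n : ℝ)) (1 / N.speed s c) :=
    ae_all_iff.2 fun s => ae_all_iff.2 fun c => by
      by_cases h : N.compat s c
      · filter_upwards [X.ae_serv h] with ω hω _
        exact hω
      · exact Eventually.of_forall fun ω h' => absurd h' h
  have h2 : ∀ᵐ ω ∂P, ∀ c, AsympLinear (fun n => ∑ k ∈ Finset.range n,
      if X.kind ((k : ℤ) + 1) ω = c then (1 : ℝ) else 0) (fun n : ℕ => (n : ℝ)) (N.frac c) :=
    ae_all_iff.2 fun c => X.ae_kind c (e := fun k => (k : ℤ) + 1) fun a b h => by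
      simpa using h
  have h3 : ∀ᵐ ω ∂P, ∀ c, AsympLinear (fun n => ∑ k ∈ Finset.range n,
      if X.kind (-(k : ℤ)) ω = c then (1 : ℝ) else 0) (fun n : ℕ => (n : ℝ)) (N.frac c) :=
    ae_all_iff.2 fun c => X.ae_kind c (e := fun k => -(k : ℤ)) fun a b h => by
      simpa using h
  filter_upwards [h1, h2, h3, X.ae_inter] with ω hω1 hω2 hω3 hω4
  refine ⟨hω4, fun c => asympLinear_int ?_ ?_, hω1⟩
  · have := hω2 c
    simp_rw [Input.count_nat]
    exact this
  · have := hω3 c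
    simp_rw [Input.count_neg_nat, neg_neg]
    exact this

end Stochastic

/-! ## Fluid limits satisfy the equations of the fluid model -/

section

variable {S C Ω : Type*} [Fintype S] [DecidableEq S] [Fintype C] [DecidableEq C]
  [MeasurableSpace Ω] {P : Measure Ω} {N : Network S C} {lam : ℝ}

theorem Primitives.input_nonneg (X : Primitives N P lam) (ω : Ω) {u : ℝ} (hu : 0 ≤ u) :
    (X.input ω u).Nonneg where
  first := hu
  inter k := X.inter_nonneg k ω
  serv s c k := X.serv_nonneg s c k ω

/-- Pass to the subsequence `r` and then to a nonprincipal ultrafilter: the given limits persist,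
and the limits of the work exist as well. -/
theorem IsFluidLimit.exists_fluidModel {G : S → C → Prop} {X : Primitives N P lam} {ω : Ω}
    {p : S → ℝ → ℝ} (h : IsFluidLimit G X ω p) (hr : (X.input ω 0).Regular N lam)
    (hlam : 0 < lam) (hG : ∀ s c, G s c → N.compat s c) {b : ℝ} (hb : -∑ s, p s 0 = b) :
    ∃ T q, FluidModel G (fun s c => N.speed s c / N.frac c) lam b T q p := by
  obtain ⟨u, st, r, hu, hpath, hu0, hfin, hp₀, hr', hp⟩ := h
  have hrt : Tendsto r (hyperfilter ℕ : Filter ℕ) atTop :=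
    hr'.tendsto_atTop.mono_left Nat.hyperfilter_le_atTop
  have hsc : ScaledPaths (hyperfilter ℕ : Filter ℕ) G (X.input ω 0) (fun i => (r i : ℝ))
      (fun i => u (r i)) (fun i => st (r i)) := by
    refine ⟨tendsto_natCast_atTop_atTop.comp hrt, fun i => Nat.cast_nonneg _,
      fun i => X.input_nonneg ω (hu _), fun i => hpath _, hu0.comp hrt, fun s => (hfin s).comp hrt⟩
  refine hsc.exists_fluidModel hr hlam hG hb (fun s => (hp₀ s).comp hrt) fun s t ht => ?_
  exact ((hp s).tendsto_at ht).mono_left Nat.hyperfilter_le_atTop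

variable [IsProbabilityMeasure P]

/-- Resource pooling in a balanced subsystem. -/
theorem Balanced.eventuallyUnder {G : S → C → Prop} {R : Finset S} {D : Finset C}
    {η : S → C → ℝ} {y : S → ℝ} {z : C → ℝ} {m : ℝ}
    (hB : Balanced G R D (fun s c => N.speed s c / N.frac c) η y z m)
    (hG : ∀ s c, G s c → N.compat s c) :
    EventuallyUnder N P G fun lam p t => (∀ s ∈ R, HasDerivAt (p s) (min lam m) t) ∧
      (∀ s ∈ R, ∀ s' ∈ R, p s t = p s' t) ∧ (lam < m → ∀ s ∈ R, p s t = lam * t) := by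
  intro lam hlam X b
  obtain ⟨t₀, ht₀⟩ := hB.exists_time hlam b
  refine ⟨t₀, ?_⟩
  filter_upwards [X.ae_regular] with ω hω p hp hb t ht
  obtain ⟨T, q, hF⟩ := hp.exists_fluidModel hω hlam hG hb
  exact ht₀ T q p hF t ht

end

end FCFS

namespace FCFS

/-! ## The static planning problem -/

section LP

variable {S C : Type*} [Fintype C] {N : Network S C} {R : Finset S} {D : Finset C}

theorem Network.coeff_pos (N : Network S C) {s : S} {c : C} (h : N.compat s c) :
    0 < N.speed s c / N.frac c := div_pos (N.speed_pos s c h) (N.frac_pos c)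

theorem Network.coeff_mul_nonneg (N : Network S C) {s : S} {c : C} {x : ℝ} (hx : 0 ≤ x)
    (hoff : ¬ N.compat s c → x = 0) : 0 ≤ N.speed s c / N.frac c * x := by
  by_cases h : N.compat s c
  · exact mul_nonneg (N.coeff_pos h).le hx
  · rw [hoff h, mul_zero]

theorem Network.nonempty_types (N : Network S C) : Nonempty C := by
  by_contra h
  rw [not_nonempty_iff] at h
  have := N.frac_sum
  simp at this

/-- An allocation that does not use all the time can be extended to a feasible one. -/
theorem exists_isFeasible {a : S → C → ℝ} {μ : ℝ} (h0 : ∀ s c, 0 ≤ a s c)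
    (hoff : ∀ s ∈ R, ∀ c ∈ D, ¬ N.compat s c → a s c = 0)
    (hle : ∀ s ∈ R, ∑ c ∈ D, a s c ≤ 1)
    (hrate : ∀ c ∈ D, μ ≤ ∑ s ∈ R, N.speed s c / N.frac c * a s c)
    (hR : ∀ s ∈ R, ∃ c ∈ D, N.compat s c) :
    ∃ η θ, IsFeasible N R D η μ θ ∧ ∀ s ∈ R, ∀ c ∈ D, a s c ≤ η s c := by
  classical
  have := N.nonempty_types
  choose! f hfD hfG using hR
  -- All the unused time of `s` goes to one compatible type `f s`. Rates only increase, and the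
  -- excess over `μ` becomes slack.
  set η : S → C → ℝ := fun s c => if s ∈ R ∧ c ∈ D then
    a s c + (if c = f s then 1 - ∑ c ∈ D, a s c else 0) else 0 with hη
  have hηeq : ∀ s ∈ R, ∀ c ∈ D,
      η s c = a s c + (if c = f s then 1 - ∑ c ∈ D, a s c else 0) :=
    fun s hs c hc => if_pos ⟨hs, hc⟩
  have hge : ∀ s ∈ R, ∀ c ∈ D, a s c ≤ η s c := fun s hs c hc => by
    rw [hηeq s hs c hc]
    split_ifs
    · have := hle s hs; linarith
    · linarith
  have hoff' : ∀ s ∈ R, ∀ c ∈ D, ¬ N.compat s c → η s c = 0 := fun s hs c hc hG => by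
    rw [hηeq s hs c hc, hoff s hs c hc hG, if_neg fun h : c = f s => hG (by rw [h]; exact hfG s hs), add_zero]
  have hrate' : ∀ c ∈ D, μ ≤ ∑ s ∈ R, N.speed s c / N.frac c * η s c := fun c hc => by
    refine (hrate c hc).trans (Finset.sum_le_sum fun s hs => ?_)
    by_cases hG : N.compat s c
    · exact mul_le_mul_of_nonneg_left (hge s hs c hc) (N.coeff_pos hG).le
    · rw [hoff s hs c hc hG, hoff' s hs c hc hG]
  refine ⟨η, fun c => if c ∈ D then ∑ s ∈ R, N.speed s c / N.frac c * η s c - μ else 0,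
    ⟨fun s c => ?_, fun s c h => ?_, fun c => ?_, fun c hc => if_neg hc, fun s hs => ?_,
      fun c hc => ?_⟩, hge⟩
  · by_cases h : s ∈ R ∧ c ∈ D
    · exact (h0 s c).trans (hge s h.1 c h.2)
    · rw [hη]; simp only; rw [if_neg h]
  · by_cases h' : s ∈ R ∧ c ∈ D
    · exact hoff' s h'.1 c h'.2 fun hG => h ⟨h'.1, h'.2, hG⟩
    · exact if_neg h'
  · split_ifs with hc
    · exact sub_nonneg.2 (hrate' c hc)
    · exact le_rfl
  · rw [Finset.sum_congr rfl fun c hc => hηeq s hs c hc, Finset.sum_add_distrib,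
      Finset.sum_ite_eq' D (f s), if_pos (hfD s hs)]
    ring
  · rw [if_pos hc]; ring

end LP

/-! ## Lipschitz paths are compact -/

/-- Arzelà–Ascoli in the compact-open topology: paths that start at `0` with Lipschitz constant `1`
are equicontinuous, and at time `t` they lie in the closed ball of radius `|t|`. -/
theorem exists_subseq_of_lipschitz {S C : Type*} [Fintype S] [Fintype C]
    {f : ℕ → ℝ → S → C → ℝ} (hf : ∀ n, LipschitzWith 1 (f n)) (hf0 : ∀ n, f n 0 = 0) :
    ∃ (φ : ℕ → ℕ) (g : ℝ → S → C → ℝ), StrictMono φ ∧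
      TendstoLocallyUniformly (fun n => f (φ n)) g atTop := by
  set K : Set C(ℝ, S → C → ℝ) := {g | LipschitzWith 1 g ∧ g 0 = 0} with hK
  have himage : ContinuousMap.toFun '' K = {g : ℝ → S → C → ℝ | LipschitzWith 1 g ∧ g 0 = 0} := by
    ext g
    constructor
    · rintro ⟨g, hg, rfl⟩
      exact hg
    · intro hg
      exact ⟨⟨g, hg.1.continuous⟩, hg, rfl⟩
  have hcompact : IsCompact K := by
    refine ArzelaAscoli.isCompact_of_equicontinuous K ?_ ?_
    · rw [himage]
      refine (isCompact_univ_pi fun t : ℝ =>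
        isCompact_closedBall (0 : S → C → ℝ) (dist t 0)).of_isClosed_subset ?_ ?_
      · have h1 : IsClosed {g : ℝ → S → C → ℝ | ∀ x y, dist (g x) (g y) ≤ dist x y} := by
          simp only [Set.ofPred_forall]
          exact isClosed_iInter fun x => isClosed_iInter fun y => isClosed_le
            ((continuous_apply x).dist (continuous_apply y)) continuous_const
        have h2 : IsClosed {g : ℝ → S → C → ℝ | g 0 = 0} :=
          isClosed_eq (continuous_apply 0) continuous_const
        convert h1.inter h2 using 1
        ext g
        simp [lipschitzWith_iff_dist_le_mul]
      · rintro g ⟨hg, hg0⟩ t -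
        have := hg.dist_le_mul t 0
        rw [hg0] at this
        simpa using this
    · refine LipschitzWith.uniformEquicontinuous _ 1 (fun g => g.2.1) |>.equicontinuous
  obtain ⟨g, -, φ, hφ, hlim⟩ := hcompact.tendsto_subseq
    (x := fun n => (⟨f n, (hf n).continuous⟩ : C(ℝ, S → C → ℝ))) fun n => ⟨hf n, hf0 n⟩
  refine ⟨φ, g, hφ, ?_⟩
  exact ContinuousMap.tendsto_iff_tendstoLocallyUniformly.1 hlim

end FCFS

namespace FCFS

set_option linter.unusedSectionVars false

/-! ## Instability of all policies above the optimal rate -/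

section AsympLinear

variable {α : Type*} {v w x : α → ℝ} {κ κ' : ℝ}

theorem AsympLinear.symm (h : AsympLinear v w κ) (hκ : 0 < κ) : AsympLinear w v κ⁻¹ := by
  intro ε hε
  -- The first bound lets half of the error be absorbed when `w` is estimated by `v`; the second
  -- leaves a relative error of `ε`.
  obtain ⟨K, hK, hle⟩ := h (min (κ / 2) (ε * κ ^ 2 / 2)) (by positivity)
  refine ⟨2 * K / κ, by positivity, fun a => ?_⟩
  set δ := min (κ / 2) (ε * κ ^ 2 / 2) with hδ
  have hδ1 : δ ≤ κ / 2 := min_le_left _ _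
  have hδ2 : δ ≤ ε * κ ^ 2 / 2 := min_le_right _ _
  have hδ0 : 0 < δ := by positivity
  set e := |w a - κ⁻¹ * v a| with he
  have h1 : e * κ = |v a - κ * w a| := by
    rw [he, ← abs_of_pos hκ, ← abs_mul, abs_of_pos hκ, ← abs_neg]
    congr 1
    field_simp
    ring
  have h2 : |w a| ≤ e + κ⁻¹ * |v a| := by
    have := abs_add_le (w a - κ⁻¹ * v a) (κ⁻¹ * v a)
    rwa [sub_add_cancel, abs_mul, abs_of_pos (inv_pos.2 hκ)] at this
  have h3 := hle a
  rw [← h1] at h3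
  have h4 := mul_le_mul_of_nonneg_left h2 hδ0.le
  have h5 := mul_le_mul_of_nonneg_right hδ1 (abs_nonneg (w a - κ⁻¹ * v a))
  have h6 : δ * (κ⁻¹ * |v a|) ≤ ε * κ ^ 2 / 2 * (κ⁻¹ * |v a|) :=
    mul_le_mul_of_nonneg_right hδ2 (by positivity)
  have h7 : ε * κ ^ 2 / 2 * (κ⁻¹ * |v a|) = ε * |v a| / 2 * κ := by field_simp
  have h8 : e * κ ≤ (ε * |v a| + 2 * K / κ) * κ := by
    have : 2 * K / κ * κ = 2 * K := by field_simp
    rw [add_mul, this]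
    rw [← he] at h5
    linarith
  exact le_of_mul_le_mul_right h8 hκ

theorem AsympLinear.trans (h : AsympLinear v w κ) (h' : AsympLinear w x κ') :
    AsympLinear v x (κ * κ') := by
  intro ε hε
  set δ := ε / (2 * (|κ'| + 1)) with hδ
  set δ' := min 1 (ε / (2 * (|κ| + 1))) with hδ'
  have hδ0 : 0 < δ := by positivity
  have hδ'0 : 0 < δ' := by positivity
  have hδ'1 : δ' ≤ 1 := min_le_left _ _
  have hδ'2 : δ' * (2 * (|κ| + 1)) ≤ ε := by
    rw [← le_div_iff₀ (by positivity)]; exact min_le_right _ _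
  have hδ1 : δ * (2 * (|κ'| + 1)) = ε := by rw [hδ]; field_simp
  obtain ⟨K, hK, hle⟩ := h δ hδ0
  obtain ⟨K', hK', hle'⟩ := h' δ' hδ'0
  refine ⟨K + (δ + |κ|) * K', by positivity, fun a => ?_⟩
  have h1 := hle a
  have h2 := hle' a
  have h3 : |w a| ≤ (|κ'| + 1) * |x a| + K' := by
    have := abs_add_le (w a - κ' * x a) (κ' * x a)
    rw [sub_add_cancel, abs_mul] at this
    have := mul_le_mul_of_nonneg_right hδ'1 (abs_nonneg (x a))
    linarith
  have h4 : |v a - κ * κ' * x a| ≤ |v a - κ * w a| + |κ| * |w a - κ' * x a| := by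
    have := abs_add_le (v a - κ * w a) (κ * (w a - κ' * x a))
    rw [abs_mul] at this
    refine le_trans (le_of_eq ?_) this
    congr 1
    ring
  have h5 := mul_le_mul_of_nonneg_left h2 (abs_nonneg κ)
  have h6 := mul_le_mul_of_nonneg_left h3 hδ0.le
  have h7 := mul_le_mul_of_nonneg_right hδ'2 (abs_nonneg (x a))
  have h8 : δ * (2 * (|κ'| + 1)) * |x a| = ε * |x a| := by rw [hδ1]
  have h9 : 0 ≤ δ' * |x a| := by positivity
  linarith

theorem AsympLinear.comp {β : Type*} (h : AsympLinear v w κ) (f : β → α) :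
    AsympLinear (fun b => v (f b)) (fun b => w (f b)) κ := fun ε hε => by
  obtain ⟨K, hK, hle⟩ := h ε hε
  exact ⟨K, hK, fun b => hle (f b)⟩

/-- A quantity that lies between neighbouring values of an asymptotically linear sequence. -/
theorem AsympLinear.of_between {V : ℕ → ℝ} (h : AsympLinear V (fun n : ℕ => (n : ℝ)) κ)
    {m : α → ℕ} (h1 : ∀ a, V (m a - 1) ≤ v a) (h2 : ∀ a, v a ≤ V (m a + 1)) :
    AsympLinear v (fun a => (m a : ℝ)) κ := by
  intro ε hε
  obtain ⟨K, hK, hle⟩ := h ε hε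
  refine ⟨K + |κ| + ε, by positivity, fun a => ?_⟩
  have h3 := abs_le.1 (hle (m a - 1))
  have h4 := abs_le.1 (hle (m a + 1))
  have h5 := neg_abs_le κ
  have h6 := le_abs_self κ
  have h7 := h1 a
  have h8 := h2 a
  simp only [Nat.abs_cast] at h3 h4 ⊢
  rw [abs_le]
  push_cast at h4
  refine ⟨?_, by linarith [h4.2]⟩
  rcases hm : m a with _ | j
  · rw [hm] at h3 h7
    simp only [zero_tsub, Nat.cast_zero, mul_zero, sub_zero, zero_add] at h3 h7 ⊢
    linarith [h3.1]
  · rw [hm] at h3 h7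
    simp only [add_tsub_cancel_right] at h3 h7
    push_cast
    linarith [h3.1]

end AsympLinear

section Policy

variable {S C : Type*} [Fintype S] [DecidableEq S] [Fintype C] [DecidableEq C]
  {N : Network S C} {lam : ℝ} {inp : Input S C} {H : S → C → Prop}

/-- Up to time `t` the arrivals of type `c` are those among the first `A t` customers. The number `A
t` inverts the arrival times, and the type proportions are then composed with it. The error is
uniform in `t ≥ 0`. -/
theorem Input.Regular.asympLinear_arrivals (hr : inp.Regular N lam) (hlam : 0 < lam) (hinp : inp.Nonneg)
    (h0 : inp.first = 0) (c : C) :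
    AsympLinear (fun t : {t : ℝ // 0 ≤ t} => (arrivals inp c t : ℝ)) (fun t => (t : ℝ))
      (N.frac c * lam) := by
  have harr : ∀ k, inp.arrivalTime k = ∑ i ∈ Finset.range k, inp.inter i := fun k => by
    rw [Input.arrivalTime, h0, zero_add]
  -- Arrival times are unbounded because the mean interarrival time is positive; hence `A t` is
  -- defined.
  have hex : ∀ t : ℝ, ∃ k, t < inp.arrivalTime k := fun t => by
    obtain ⟨K, hK, hle⟩ := hr.inter (1 / (2 * lam)) (by positivity)
    obtain ⟨k, hk⟩ := exists_nat_gt ((t + K) * (2 * lam))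
    refine ⟨k, ?_⟩
    have h1 := (abs_le.1 (hle k)).1
    rw [abs_of_nonneg (Nat.cast_nonneg k)] at h1
    rw [← lt_div_iff₀ (by positivity)] at hk
    rw [harr]
    have h2 : 1 / lam * (k : ℝ) - 1 / (2 * lam) * k = k / (2 * lam) := by field_simp; ring
    linarith
  classical
  set A : {t : ℝ // 0 ≤ t} → ℕ := fun t => Nat.find (hex t) with hA
  have hA1 : ∀ t : {t : ℝ // 0 ≤ t}, (t : ℝ) < inp.arrivalTime (A t) := fun t => Nat.find_spec (hex t)
  have hA2 : ∀ (t : {t : ℝ // 0 ≤ t}) k, k < A t ↔ inp.arrivalTime k ≤ t := fun t k => by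
    refine ⟨fun h => not_lt.1 (Nat.find_min (hex t) h), fun h => ?_⟩
    by_contra! hk
    exact absurd ((hA1 t).trans_le (hinp.arrivalTime_mono hk)) (not_lt.2 h)
  have h1 : AsympLinear (fun t : {t : ℝ // 0 ≤ t} => (t : ℝ)) (fun t => (A t : ℝ)) (1 / lam) := by
    refine hr.inter.of_between (fun t => ?_) fun t => ?_
    · rw [← harr]
      rcases hAt : A t with _ | j
      · rw [zero_tsub, harr]
        simpa using t.2
      · exact (hA2 t j).1 (by omega)
    · rw [← harr]
      exact (hA1 t).le.trans (hinp.arrivalTime_mono (Nat.le_succ _))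
  have h2 : ∀ t : {t : ℝ // 0 ≤ t}, (arrivals inp c t : ℝ) = inp.count c (A t) := fun t => by
    have h3 := inp.card_Ioc c (Int.natCast_nonneg (A t))
    rw [Input.count_zero, sub_zero] at h3
    rw [← h3, Int.cast_natCast, Nat.cast_inj, FCFS.arrivals, ← Set.ncard_coe_finset]
    refine Set.ncard_congr (fun k _ => (k : ℤ) + 1) ?_ ?_ ?_
    · rintro k ⟨hk, hc⟩
      have := (hA2 t k).2 hk
      simp only [Finset.coe_filter, Finset.mem_Ioc, Set.mem_ofPred_eq]
      exact ⟨⟨by omega, by omega⟩, hc⟩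
    · intro a b _ _ h
      simpa using h
    · intro l hl
      simp only [Finset.coe_filter, Finset.mem_Ioc, Set.mem_ofPred_eq] at hl
      obtain ⟨k, rfl⟩ : ∃ k : ℕ, l = (k : ℤ) + 1 := ⟨(l - 1).toNat, by omega⟩
      exact ⟨k, ⟨(hA2 t k).1 (by omega), hl.2⟩, rfl⟩
  simp_rw [h2]
  have h3 := ((hr.count c).comp fun t => (A t : ℤ)).trans
    (by simpa using h1.symm (one_div_pos.2 hlam) : AsympLinear
      (fun t : {t : ℝ // 0 ≤ t} => (((A t : ℕ) : ℤ) : ℝ)) (fun t => (t : ℝ)) lam)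
  exact h3

/-- Completions are asymptotically proportional to the time that is allocated. -/
theorem Input.Regular.asympLinear_comp (hr : inp.Regular N lam) (hinp : inp.Nonneg) {s : S} {c : C}
    (hH : H s c) (hc : N.compat s c) :
    AsympLinear (fun a : {a : State S C × Control S C × ℝ //
        (∀ s, a.1.finish s = 0) ∧ a.2.1.IsAdmissible H inp a.1 ∧ 0 ≤ a.2.2} =>
      (a.1.2.1.comp s c a.1.2.2 : ℝ)) (fun a => a.1.2.1.alloc s c a.1.2.2) (N.speed s c) := by
  -- A job in service at time `0` has no work left, so `jobWork` is the sequence of service times,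
  -- shifted by at most one.
  have key : ∀ x : State S C, x.finish s = 0 → ∀ j,
      ∑ k ∈ Finset.range (j - 1), inp.serv s c k ≤ ∑ k ∈ Finset.range j, jobWork inp x s c k ∧
      ∑ k ∈ Finset.range j, jobWork inp x s c k ≤ ∑ k ∈ Finset.range j, inp.serv s c k := by
    intro x hx j
    by_cases hj : ∃ l, x.job s = some l ∧ inp.kind l = c
    · rcases j with _ | j
      · simp
      · rw [Finset.sum_range_succ', add_tsub_cancel_right, Finset.sum_range_succ]
        simp only [jobWork, if_pos hj, hx, add_zero]
        exact ⟨le_rfl, le_add_of_nonneg_right (hinp.serv _ _ _)⟩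
    · simp only [jobWork, if_neg hj]
      exact ⟨Finset.sum_le_sum_of_subset_of_nonneg (Finset.range_mono (by omega))
        fun k _ _ => hinp.serv _ _ _, le_rfl⟩
  -- States, controls and times form the index set, so the constants do not depend on the policy or
  -- on the initial state.
  have h1 := (hr.serv s c hc).of_between
    (v := fun a : {a : State S C × Control S C × ℝ //
        (∀ s, a.1.finish s = 0) ∧ a.2.1.IsAdmissible H inp a.1 ∧ 0 ≤ a.2.2} =>
      a.1.2.1.alloc s c a.1.2.2) (m := fun a => a.1.2.1.comp s c a.1.2.2)
    (fun a => (key a.1.1 (a.2.1 s) _).1.trans (a.2.2.1.work_done s c _ a.2.2.2 hH))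
    (fun a => (a.2.2.1.work_left s c _ a.2.2.2 hH).trans (key a.1.1 (a.2.1 s) _).2)
  simpa using h1.symm (one_div_pos.2 (N.speed_pos s c hc))

end Policy

end FCFS

/-! ### Initial states for the instability argument -/

namespace FCFS

set_option linter.unusedSectionVars false

section Initial

variable {S C : Type*} [Fintype S] [DecidableEq S] [Fintype C] [DecidableEq C]
  {N : Network S C} {lam : ℝ} {inp : Input S C} {H : S → C → Prop}

/-- There are customers of every type in the remote past, at a distance that is negligible under
fluid scaling. -/
theorem Input.Regular.exists_old (hr : inp.Regular N lam) (c : C) :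
    ∃ l : ℕ → ℤ, (∀ n, l n ≤ -n) ∧ (∀ n, inp.kind (l n) = c) ∧
      Tendsto (fun n => (l n : ℝ) / n) atTop (𝓝 (-1)) := by
  have hex : ∀ n : ℕ, ∃ l : ℤ, (l ≤ -(n : ℤ) ∧ inp.kind l = c) ∧
      ∀ l' : ℤ, l' ≤ -(n : ℤ) ∧ inp.kind l' = c → l' ≤ l := fun n => by
    refine Int.exists_greatest_of_bdd ⟨-n, fun l h => h.1⟩ ?_
    -- Otherwise the count of type `c` would be constant to the left of `-n`, although it decreases
    -- linearly.
    by_contra! hno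
    have hconst : ∀ a : ℤ, a ≤ -(n : ℤ) → inp.count c a = inp.count c (-n) := fun a ha => by
      have := inp.card_Ioc c ha
      rw [Finset.filter_eq_empty_iff.2 fun l hl => hno l (Finset.mem_Ioc.1 hl).2,
        Finset.card_empty] at this
      push_cast at this
      linarith
    have hf := N.frac_pos c
    obtain ⟨K, hK, hle⟩ := hr.count c (N.frac c / 2) (by positivity)
    obtain ⟨m, hm⟩ := exists_nat_gt ((K + |(inp.count c (-n) : ℝ)|) / (N.frac c / 2))
    rw [div_lt_iff₀ (by positivity)] at hm
    have h1 := (abs_le.1 (hle (-((m + n : ℕ) : ℤ)))).2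
    beta_reduce at h1
    rw [hconst _ (by push_cast; omega)] at h1
    push_cast at h1
    rw [show |(-((m : ℝ) + n))| = m + n by rw [abs_neg, abs_of_nonneg (by positivity)]] at h1
    have h2 := neg_abs_le (inp.count c (-n) : ℝ)
    have h3 : 0 ≤ N.frac c / 2 * n := by positivity
    push_cast at *
    linarith
  choose l hl hmax using hex
  refine ⟨l, fun n => (hl n).1, fun n => (hl n).2, ?_⟩
  -- No customer of type `c` lies between the chosen one and `-n`. The counts at `l n` and `-n`
  -- agree, and inverting their asymptotics gives `l n` close to `-n`.
  have hcount : ∀ n, inp.count c (l n) = inp.count c (-n) - 0 := fun n => by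
    have := inp.card_Ioc c (hl n).1
    rw [Finset.filter_eq_empty_iff.2 fun l' hl' hc => by
      have h1 := Finset.mem_Ioc.1 hl'
      exact absurd (hmax n l' ⟨h1.2, hc⟩) (not_le.2 h1.1), Finset.card_empty] at this
    push_cast at this
    linarith
  have h1 : Tendsto (fun n : ℕ => ((-(n : ℤ) : ℤ) : ℝ) / n) atTop (𝓝 (-1)) := by
    refine tendsto_const_nhds.congr' ?_
    filter_upwards [eventually_gt_atTop 0] with n hn
    push_cast
    field_simp
  have h2 := (hr.count c).tendsto tendsto_natCast_atTop_atTop h1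
  have h3 : Tendsto (fun n : ℕ => (inp.count c (l n) : ℝ) / n) atTop (𝓝 (N.frac c * -1)) :=
    h2.congr fun n => by rw [hcount, sub_zero]
  have h4 := (hr.count c).tendsto_inv (N.frac_pos c) tendsto_natCast_atTop_atTop h3
  rwa [mul_div_cancel_left₀ _ (N.frac_pos c).ne'] at h4

/-- The initial state in which server `s₀` is about to complete the service of customer `l` and
the other servers are idle. -/
noncomputable def soloState (H : S → C → Prop) (inp : Input S C) (s₀ : S) (l : ℤ) : State S C where
  time := 0
  arrived := 0
  job s := if s = s₀ then some l else none
  finish _ := 0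
  idle := (Finset.univ.erase s₀).toList
  waiting := {i | i ≤ 0 ∧ i ≠ l ∧ ∀ s, H s (inp.kind i) →
    if s = s₀ then l < i else 1 + ((Finset.univ.erase s₀).toList.idxOf s : ℤ) < i}
  started _ _ := 0

theorem soloState_pos_self (s₀ : S) (l : ℤ) : (soloState H inp s₀ l).pos s₀ = l := by
  simp [State.pos, soloState]

theorem soloState_pos_of_ne {s₀ s : S} (h : s ≠ s₀) (l : ℤ) :
    (soloState H inp s₀ l).pos s = 1 + ((Finset.univ.erase s₀).toList.idxOf s : ℤ) := by
  simp [State.pos, soloState, h]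

theorem isInitial_soloState {s₀ : S} {l : ℤ} (hl : l ≤ 0) (hH : H s₀ (inp.kind l)) :
    IsInitial H inp (soloState H inp s₀ l) where
  time_zero := rfl
  arrived_zero := rfl
  job_old s i h := by
    by_cases hs : s = s₀
    · subst hs
      have : l = i := by simpa [soloState] using h
      exact this ▸ ⟨hl, hH⟩
    · simp [soloState, hs] at h
  job_inj s s' i h h' := by
    by_cases hs : s = s₀ <;> by_cases hs' : s' = s₀ <;> simp_all [soloState]
  finish_nonneg _ := le_rfl
  idle_nodup := Finset.nodup_toList _
  mem_idle s := by simp [soloState]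
  mem_waiting i := by
    have h1 : (∀ s, (soloState H inp s₀ l).job s ≠ some i) ↔ i ≠ l := by
      constructor
      · rintro h rfl
        exact h s₀ (by simp [soloState])
      · intro h s
        by_cases hs : s = s₀ <;> simp [soloState, hs, h.symm]
    have h2 : ∀ s, (soloState H inp s₀ l).pos s < i ↔
        if s = s₀ then l < i else 1 + ((Finset.univ.erase s₀).toList.idxOf s : ℤ) < i := fun s => by
      split_ifs with hs
      · rw [hs, soloState_pos_self]
      · rw [soloState_pos_of_ne hs]
    rw [h1]
    simp_rw [h2]
    rfl
  started_zero _ _ := rfl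

/-- Because the type has a server in `H`, its old customers lie between `l` and `0`: an idle server
has passed all of them, and the busy one has passed those before `l`. -/
theorem present_soloState_le {s₀ s : S} {c : C} {l : ℤ} (hl : l ≤ 0) (hH : H s c) :
    (present inp (soloState H inp s₀ l) c : ℝ) ≤ 1 - l := by
  have h1 : present inp (soloState H inp s₀ l) c ≤ (Finset.Icc l 0).card := by
    rw [present, ← Set.ncard_coe_finset]
    refine Set.ncard_le_ncard ?_ (Finset.finite_toSet _)
    rintro i ⟨hi, hc, hw | ⟨s', hs'⟩⟩
    · have h2 := hw.2.2 s (hc ▸ hH)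
      simp only [Finset.coe_Icc, Set.mem_Icc]
      refine ⟨?_, hi⟩
      split_ifs at h2
      · omega
      · omega
    · by_cases h : s' = s₀
      · have : l = i := by simpa [soloState, h] using hs'
        simp [← this, hl]
      · simp [soloState, h] at hs'
  rw [Int.card_Icc] at h1
  have h2 : (present inp (soloState H inp s₀ l) c : ℤ) ≤ 1 - l := by omega
  exact_mod_cast h2

theorem tendsto_soloState_pos {l : ℕ → ℤ}
    (hl : Tendsto (fun n => (l n : ℝ) / n) atTop (𝓝 (-1))) (s₀ s : S) :
    Tendsto (fun n => ((soloState H inp s₀ (l n)).pos s : ℝ) / n) atTop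
      (𝓝 (if s = s₀ then -1 else 0)) := by
  split_ifs with h
  · subst h
    simpa only [soloState_pos_self] using hl
  · simp only [soloState_pos_of_ne h]
    exact tendsto_const_div tendsto_natCast_atTop_atTop _

end Initial

end FCFS

/-! ### Fluid limits of the load and instability of policies -/

namespace FCFS

set_option linter.unusedSectionVars false

/-- The relative error `ε * t` is small near a fixed time since `ε` is free. The other two terms
vanish as `n` grows, the last one locally uniformly. -/
theorem tendstoLocallyUniformlyOn_of_bound {E : Type*} [PseudoMetricSpace E] {F : ℕ → ℝ → ℝ}
    {L : ℝ → ℝ} {A : ℕ → ℝ → E} {g : ℝ → E} {M : ℝ} (hA : TendstoLocallyUniformly A g atTop)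
    (hM : 0 ≤ M) (h : ∀ ε > 0, ∃ e : ℕ → ℝ, Tendsto e atTop (𝓝 0) ∧ ∀ᶠ n in atTop, ∀ t > 0,
      |F n t - L t| ≤ ε * t + e n + M * dist (A n t) (g t)) :
    TendstoLocallyUniformlyOn F L atTop (Set.Ioi 0) := by
  rw [Metric.tendstoLocallyUniformlyOn_iff]
  intro ε hε x hx
  have hx : 0 < x := hx
  obtain ⟨e, he, hle⟩ := h (ε / (4 * (x + 1))) (by positivity)
  obtain ⟨U, hU, hAU⟩ := Metric.tendstoLocallyUniformly_iff.1 hA (ε / (4 * (M + 1)))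
    (by positivity) x
  refine ⟨U ∩ Set.Iio (x + 1) ∩ Set.Ioi 0, Filter.inter_mem (mem_nhdsWithin_of_mem_nhds
    (Filter.inter_mem hU (Iio_mem_nhds (lt_add_one x)))) self_mem_nhdsWithin, ?_⟩
  filter_upwards [hle, hAU, he.eventually_lt_const (show (0 : ℝ) < ε / 4 by positivity)]
    with n h1 h2 h3
  rintro t ⟨⟨ht1, ht2⟩, ht3⟩
  have ht2 : t < x + 1 := ht2
  rw [dist_comm, Real.dist_eq]
  have h4 := h1 t ht3
  have h5 := h2 t ht1
  rw [dist_comm] at h5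
  have h6 : M * dist (A n t) (g t) ≤ ε / 4 := by
    have h7 := mul_le_mul_of_nonneg_left h5.le hM
    have h8 : M * (ε / (4 * (M + 1))) ≤ (M + 1) * (ε / (4 * (M + 1))) :=
      mul_le_mul_of_nonneg_right (by linarith) (by positivity)
    have h9 : (M + 1) * (ε / (4 * (M + 1))) = ε / 4 := by field_simp
    linarith
  have h7 : ε / (4 * (x + 1)) * t ≤ ε / (4 * (x + 1)) * (x + 1) :=
    mul_le_mul_of_nonneg_left ht2.le (by positivity)
  have h8 : ε / (4 * (x + 1)) * (x + 1) = ε / 4 := by field_simp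
  linarith

section Policy

variable {S C : Type*} [Fintype S] [DecidableEq S] [Fintype C] [DecidableEq C]
  {N : Network S C} {lam : ℝ} {inp : Input S C} {H : S → C → Prop}

theorem Control.IsAdmissible.sub_nonneg {x : State S C} {K : Control S C}
    (hK : K.IsAdmissible H inp x) {s : S} {c : C} {t t' : ℝ} (ht : 0 ≤ t) (h : t ≤ t') :
    0 ≤ K.alloc s c t' - K.alloc s c t :=
  _root_.sub_nonneg.2 (hK.alloc_mono s c ht (ht.trans h) h)

/-- Allocation paths on the fluid scale. -/
noncomputable def Control.scaled (K : Control S C) (n : ℕ) (t : ℝ) (s : S) (c : C) : ℝ :=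
  K.alloc s c (n * max t 0) / n

/-- A server has one unit of time per unit of time, and the scaling preserves this. For `n = 0`
division by zero gives the zero path. -/
theorem Control.IsAdmissible.lipschitz_scaled {x : State S C} {K : Control S C}
    (hK : K.IsAdmissible H inp x) (n : ℕ) : LipschitzWith 1 (K.scaled n) := by
  have key : ∀ t t', t ≤ t' → dist (K.scaled n t) (K.scaled n t') ≤ t' - t := fun t t' h => by
    have hmax : max t 0 ≤ max t' 0 := max_le_max_right 0 h
    have hn : (0 : ℝ) ≤ n := Nat.cast_nonneg n
    have h0 : (0 : ℝ) ≤ n * max t 0 := mul_nonneg hn (le_max_right _ _)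
    have h1 : (n : ℝ) * max t 0 ≤ n * max t' 0 := mul_le_mul_of_nonneg_left hmax hn
    refine (dist_pi_le_iff (by linarith)).2 fun s => (dist_pi_le_iff (by linarith)).2 fun c => ?_
    rw [dist_comm, Real.dist_eq, Control.scaled, Control.scaled, ← sub_div,
      abs_of_nonneg (div_nonneg (hK.sub_nonneg h0 h1) hn)]
    have h2 : K.alloc s c (n * max t' 0) - K.alloc s c (n * max t 0) ≤ n * (t' - t) := by
      refine (Finset.single_le_sum (f := fun c => K.alloc s c (n * max t' 0) -
        K.alloc s c (n * max t 0)) (fun c _ => hK.sub_nonneg h0 h1) (Finset.mem_univ c)).trans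
        ((hK.alloc_le s _ _ h0 h1).trans ?_)
      rw [← mul_sub]
      refine mul_le_mul_of_nonneg_left ?_ hn
      have := max_sub_max_le_max t' 0 t 0
      rw [sub_zero, max_eq_left (by linarith : (0 : ℝ) ≤ t' - t)] at this
      exact this
    rcases Nat.eq_zero_or_pos n with rfl | hpos
    · simpa using h
    · rw [div_le_iff₀ (by exact_mod_cast hpos), mul_comm (t' - t)]
      exact h2
  refine LipschitzWith.of_dist_le_mul fun t t' => ?_
  rw [NNReal.coe_one, one_mul, Real.dist_eq]
  rcases le_total t t' with h | h
  · rw [abs_sub_comm, abs_of_nonneg (_root_.sub_nonneg.2 h)]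
    exact key t t' h
  · rw [dist_comm, abs_of_nonneg (_root_.sub_nonneg.2 h)]
    exact key t' t h

theorem tendstoLocallyUniformlyOn_sum {ι : Type*} {F : ι → ℕ → ℝ → ℝ} {L : ι → ℝ → ℝ} {U : Set ℝ}
    {W : Finset ι} (h : ∀ c ∈ W, TendstoLocallyUniformlyOn (F c) (L c) atTop U) :
    TendstoLocallyUniformlyOn (fun n t => ∑ c ∈ W, F c n t) (fun t => ∑ c ∈ W, L c t) atTop U := by
  classical
  induction W using Finset.induction_on with
  | empty =>
    simp only [Finset.sum_empty]
    exact fun u hu x _ => ⟨Set.univ, univ_mem, Eventually.of_forall fun _ _ _ => refl_mem_uniformity hu⟩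
  | insert a W ha ih =>
    simp only [Finset.sum_insert ha]
    exact (h a (Finset.mem_insert_self _ _)).add (ih fun c hc => h c (Finset.mem_insert_of_mem hc))

/-- Fluid limits of the numbers of customers under arbitrary policies. -/
theorem Input.Regular.exists_loadLimit (hr : inp.Regular N lam) (hlam : 0 < lam)
    (hinp : inp.Nonneg) (h0 : inp.first = 0) (hHN : ∀ s c, H s c → N.compat s c) {W : Finset C}
    {x : ℕ → State S C} {K : ℕ → Control S C} (hfin : ∀ n s, (x n).finish s = 0)
    (hK : ∀ n, (K n).IsAdmissible H inp (x n)) {M : ℝ}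
    (hpr : ∀ n : ℕ, ∀ c ∈ W, (present inp (x n) c : ℝ) / n ≤ M) :
    ∃ (φ : ℕ → ℕ) (pr : C → ℝ) (g : ℝ → S → C → ℝ), StrictMono φ ∧ (∀ c, 0 ≤ pr c) ∧
      (∀ t s c, 0 ≤ g t s c) ∧ (∀ t s, 0 ≤ t → ∑ c, g t s c ≤ t) ∧
      (∀ t s c, ¬ H s c → g t s c = 0) ∧
      ∀ c ∈ W, TendstoLocallyUniformlyOn (fun n t => ((present inp (x (φ n)) c : ℝ) +
          arrivals inp c (φ n * t) - ∑ s, ((K (φ n)).comp s c (φ n * t) : ℝ)) / φ n)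
        (fun t => pr c + N.frac c * lam * t - ∑ s, N.speed s c * g t s c) atTop (Set.Ioi 0) := by
  -- The first subsequence makes the initial loads converge (set to `0` outside `W`, where no bound
  -- is assumed), the second one the allocations.
  obtain ⟨pr, hpr0, φ₁, hφ₁, hlim₁⟩ := (isCompact_univ_pi fun _ : C =>
    isCompact_Icc (a := (0 : ℝ)) (b := max M 0)).tendsto_subseq
    (x := fun (n : ℕ) c => if c ∈ W then (present inp (x n) c : ℝ) / n else 0) (fun n c _ => by
      beta_reduce
      split_ifs with hc
      · exact ⟨by positivity, (hpr n c hc).trans (le_max_left _ _)⟩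
      · exact ⟨le_rfl, le_max_right _ _⟩)
  obtain ⟨φ₂, g, hφ₂, hlim₂⟩ := exists_subseq_of_lipschitz
    (f := fun n => (K (φ₁ n)).scaled (φ₁ n)) (fun n => (hK _).lipschitz_scaled _) (fun n => by
      ext s c
      simp [Control.scaled, (hK _).alloc_zero])
  set φ := φ₁ ∘ φ₂ with hφ
  have hφm : StrictMono φ := hφ₁.comp hφ₂
  have hφt : Tendsto (fun n => (φ n : ℝ)) atTop atTop :=
    tendsto_natCast_atTop_atTop.comp hφm.tendsto_atTop
  have hpt : ∀ t s c, Tendsto (fun n => (K (φ n)).scaled (φ n) t s c) atTop (𝓝 (g t s c)) :=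
    fun t s c => (((hlim₂.tendstoLocallyUniformlyOn (s := Set.univ)).tendsto_at
      (Set.mem_univ t)).apply_nhds s).apply_nhds c
  have hnn : ∀ (t : ℝ) (n : ℕ), 0 ≤ (n : ℝ) * max t 0 := fun t n =>
    mul_nonneg (Nat.cast_nonneg n) (le_max_right _ _)
  have halloc : ∀ n s c t, 0 ≤ t → 0 ≤ (K n).alloc s c t := fun n s c t ht => by
    have := (hK n).sub_nonneg (s := s) (c := c) le_rfl ht
    rwa [(hK n).alloc_zero, sub_zero] at this
  have hrow : ∀ n s t, 0 ≤ t → ∑ c, (K n).alloc s c t ≤ t := fun n s t ht => by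
    have := (hK n).alloc_le s 0 t le_rfl ht
    simpa only [(hK n).alloc_zero, sub_zero] using this
  refine ⟨φ, pr, g, hφm, fun c => (hpr0 c trivial).1, fun t s c => ?_, fun t s ht => ?_,
    fun t s c hc => ?_, fun c hc => ?_⟩
  · exact ge_of_tendsto' (hpt t s c) fun n => div_nonneg (halloc _ _ _ _ (hnn _ _))
      (Nat.cast_nonneg _)
  · refine le_of_tendsto (tendsto_finsetSum _ fun c _ => hpt t s c) ?_
    filter_upwards [hφt.eventually_gt_atTop 0] with n hn
    simp only [Control.scaled]
    rw [← Finset.sum_div, div_le_iff₀ hn, mul_comm t]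
    have := hrow (φ n) s (φ n * max t 0) (hnn _ _)
    rwa [max_eq_left ht] at this ⊢
  · refine tendsto_nhds_unique (hpt t s c) (tendsto_const_nhds.congr fun n => ?_)
    rw [Control.scaled, (hK _).alloc_off s c _ hc, zero_div]
  have hprc : Tendsto (fun n => |(present inp (x (φ n)) c : ℝ) / φ n - pr c|) atTop (𝓝 0) := by
    have h1 := (hlim₁.apply_nhds c).comp hφ₂.tendsto_atTop
    have h2 := (h1.sub_const (pr c)).abs
    rw [sub_self, abs_zero] at h2
    refine h2.congr fun n => ?_
    simp [hc, hφ]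
  refine tendstoLocallyUniformlyOn_of_bound hlim₂ (M := ∑ s, |N.speed s c|)
    (Finset.sum_nonneg fun _ _ => abs_nonneg _) fun ε hε => ?_
  -- One share of the error for the arrivals and one for the completions of each server.
  set δ := ε / (Fintype.card S + 1) with hδ
  have hδ0 : 0 < δ := by positivity
  obtain ⟨K₁, hK₁, hle₁⟩ := hr.asympLinear_arrivals hlam hinp h0 c δ hδ0
  have hcomp : ∀ s, ∃ K₂, 0 ≤ K₂ ∧ ∀ n t, 0 ≤ t →
      |((K n).comp s c t : ℝ) - N.speed s c * (K n).alloc s c t| ≤ δ * t + K₂ := fun s => by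
    by_cases hs : H s c
    · obtain ⟨K₂, hK₂, hle₂⟩ := hr.asympLinear_comp hinp hs (hHN s c hs) δ hδ0
      refine ⟨K₂, hK₂, fun n t ht => (hle₂ ⟨(x n, K n, t), hfin n, hK n, ht⟩).trans ?_⟩
      beta_reduce
      rw [abs_of_nonneg (halloc n s c t ht)]
      have h1 : (K n).alloc s c t ≤ t := (Finset.single_le_sum (f := fun c => (K n).alloc s c t)
        (fun c _ => halloc n s c t ht) (Finset.mem_univ c)).trans (hrow n s t ht)
      have := mul_le_mul_of_nonneg_left h1 hδ0.le
      linarith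
    · refine ⟨0, le_rfl, fun n t ht => ?_⟩
      rw [(hK n).comp_off s c t hs, (hK n).alloc_off s c t hs]
      simp only [Nat.cast_zero, mul_zero, sub_zero, abs_zero, add_zero]
      positivity
  choose K₂ hK₂ hle₂ using hcomp
  refine ⟨fun n => |(present inp (x (φ n)) c : ℝ) / φ n - pr c| + (K₁ + ∑ s, K₂ s) / φ n, ?_, ?_⟩
  · simpa using hprc.add (tendsto_const_div hφt (K₁ + ∑ s, K₂ s))
  filter_upwards [hφt.eventually_gt_atTop 0] with n hn t ht
  have hnt : 0 ≤ φ n * t := by positivity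
  have h1 := hle₁ ⟨φ n * t, hnt⟩
  simp only [abs_of_nonneg hnt] at h1
  have hs : ∀ s, |((K (φ n)).comp s c (φ n * t) : ℝ) / φ n - N.speed s c * g t s c| ≤
      δ * t + K₂ s / φ n + |N.speed s c| * dist ((K (φ n)).scaled (φ n) t) (g t) := fun s => by
    have h2 := hle₂ s (φ n) (φ n * t) hnt
    have h3 : |(K (φ n)).scaled (φ n) t s c - g t s c| ≤ dist ((K (φ n)).scaled (φ n) t) (g t) := by
      rw [← Real.dist_eq]
      exact (dist_le_pi_dist _ _ c).trans (dist_le_pi_dist _ _ s)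
    have h4 := mul_le_mul_of_nonneg_left h3 (abs_nonneg (N.speed s c))
    rw [← abs_mul] at h4
    have h5 : (K (φ n)).scaled (φ n) t s c = (K (φ n)).alloc s c (φ n * t) / φ n := by
      rw [Control.scaled, max_eq_left (le_of_lt ht)]
    have h6 : |((K (φ n)).comp s c (φ n * t) : ℝ) / φ n -
        N.speed s c * (K (φ n)).scaled (φ n) t s c| ≤ δ * t + K₂ s / φ n := by
      rw [h5, show ((K (φ n)).comp s c (φ n * t) : ℝ) / φ n -
        N.speed s c * ((K (φ n)).alloc s c (φ n * t) / φ n) =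
        (((K (φ n)).comp s c (φ n * t) : ℝ) - N.speed s c * (K (φ n)).alloc s c (φ n * t)) / φ n
        by ring, abs_div, abs_of_pos hn, div_le_iff₀ hn, add_mul, div_mul_cancel₀ _ hn.ne']
      linarith
    have h7 := abs_add_le (((K (φ n)).comp s c (φ n * t) : ℝ) / φ n -
        N.speed s c * (K (φ n)).scaled (φ n) t s c)
      (N.speed s c * ((K (φ n)).scaled (φ n) t s c - g t s c))
    refine le_trans (le_of_eq ?_) (h7.trans (add_le_add h6 h4))
    congr 1
    ring
  have h2 : |∑ s, (((K (φ n)).comp s c (φ n * t) : ℝ) / φ n - N.speed s c * g t s c)| ≤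
      Fintype.card S * (δ * t) + (∑ s, K₂ s) / φ n +
        (∑ s, |N.speed s c|) * dist ((K (φ n)).scaled (φ n) t) (g t) := by
    refine (Finset.abs_sum_le_sum_abs _ _).trans ((Finset.sum_le_sum fun s _ => hs s).trans ?_)
    rw [Finset.sum_add_distrib, Finset.sum_add_distrib, Finset.sum_const, Finset.card_univ,
      nsmul_eq_mul, Finset.sum_div, Finset.sum_mul]
  have h3 : |(arrivals inp c (φ n * t) : ℝ) / φ n - N.frac c * lam * t| ≤ δ * t + K₁ / φ n := by
    rw [show (arrivals inp c (φ n * t) : ℝ) / φ n - N.frac c * lam * t =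
      ((arrivals inp c (φ n * t) : ℝ) - N.frac c * lam * (φ n * t)) / φ n by field_simp, abs_div,
      abs_of_pos hn, div_le_iff₀ hn, add_mul, div_mul_cancel₀ _ hn.ne']
    linarith
  have h4 : δ * t + Fintype.card S * (δ * t) = ε * t := by rw [hδ]; field_simp; ring
  have h5 : ((present inp (x (φ n)) c : ℝ) + arrivals inp c (φ n * t) -
      ∑ s, ((K (φ n)).comp s c (φ n * t) : ℝ)) / φ n -
      (pr c + N.frac c * lam * t - ∑ s, N.speed s c * g t s c) =
      ((present inp (x (φ n)) c : ℝ) / φ n - pr c) +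
      ((arrivals inp c (φ n * t) : ℝ) / φ n - N.frac c * lam * t) -
      ∑ s, (((K (φ n)).comp s c (φ n * t) : ℝ) / φ n - N.speed s c * g t s c) := by
    rw [Finset.sum_sub_distrib, ← Finset.sum_div]
    ring
  rw [h5]
  have h6 := abs_sub (((present inp (x (φ n)) c : ℝ) / φ n - pr c) +
      ((arrivals inp c (φ n * t) : ℝ) / φ n - N.frac c * lam * t))
      (∑ s, (((K (φ n)).comp s c (φ n * t) : ℝ) / φ n - N.speed s c * g t s c))
  have h7 := abs_add_le ((present inp (x (φ n)) c : ℝ) / φ n - pr c)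
      ((arrivals inp c (φ n * t) : ℝ) / φ n - N.frac c * lam * t)
  have h8 : (K₁ + ∑ s, K₂ s) / φ n = K₁ / φ n + (∑ s, K₂ s) / φ n := add_div _ _ _
  have h9 : (φ n : ℝ) = ((φ₁ ∘ φ₂) n : ℕ) := rfl
  simp only [hφ, Function.comp] at *
  linarith

end Policy

section Instability

variable {S C Ω : Type*} [Fintype S] [DecidableEq S] [Fintype C] [DecidableEq C]
  [MeasurableSpace Ω] {P : Measure Ω} [IsProbabilityMeasure P] {N : Network S C} {lam : ℝ}

/-- No policy is stable for arrival rates above the optimal value of the planning problem. -/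
theorem not_policyStable {H : S → C → Prop} {R : Finset S} {W : Finset C} {m : ℝ}
    (hHN : ∀ s c, H s c → N.compat s c) (hHR : ∀ s, ∀ c ∈ W, H s c → s ∈ R)
    (hHW : ∀ c ∈ W, ∃ s, H s c) (hW : W.Nonempty) (hR : ∀ s ∈ R, ∃ c ∈ W, N.compat s c)
    (hopt : ∀ η μ θ, IsFeasible N R W η μ θ → μ ≤ m) (hlam : 0 < lam) (hm : m < lam)
    (X : Primitives N P lam) (π : Policy H) : ¬ PolicyStable X π W := by
  rintro ⟨t₀, ht₀⟩
  -- One sample path with regular averages on which stability holds is enough for a contradiction.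
  obtain ⟨ω, hr, hω⟩ := (X.ae_regular.and ht₀).exists
  obtain ⟨c₀, hc₀⟩ := hW
  obtain ⟨s₀, hs₀⟩ := hHW c₀ hc₀
  have hinp := X.input_nonneg ω le_rfl
  obtain ⟨l, hl, hkind, hlim⟩ := hr.exists_old c₀
  have hl0 : ∀ n, l n ≤ 0 := fun n => (hl n).trans (by simp)
  set inp := X.input ω 0 with hinpdef
  set x : ℕ → State S C := fun n => soloState H inp s₀ (l n) with hx
  have hinit : ∀ n, IsInitial H inp (x n) := fun n =>
    isInitial_soloState (hl0 n) (by rw [hkind]; exact hs₀)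
  obtain ⟨M, hM⟩ : ∃ M, ∀ n : ℕ, (1 - (l n : ℝ)) / n ≤ M := by
    have h1 := (tendsto_const_div tendsto_natCast_atTop_atTop 1).sub hlim
    obtain ⟨M, hM⟩ := h1.bddAbove_range
    refine ⟨M, fun n => le_trans (le_of_eq ?_) (hM ⟨n, rfl⟩)⟩
    exact sub_div _ _ _
  obtain ⟨φ, pr, g, hφ, hpr, hg0, hgrow, hgoff, hg⟩ := hr.exists_loadLimit hlam hinp rfl hHN
    (W := W) (x := x) (K := fun n => π.rule inp (x n)) (M := M) (fun n s => rfl)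
    (fun n => π.admissible inp (x n) hinp (hinit n)) fun n c hc => by
      obtain ⟨s, hs⟩ := hHW c hc
      exact (div_le_div_of_nonneg_right (present_soloState_le (hl0 n) hs)
        (Nat.cast_nonneg n)).trans (hM n)
  -- One server starts at about `-n` and the others near `0`, so that `|p(0)| = 1`.
  set p₀ : S → ℝ := fun s => if s = s₀ then -1 else 0 with hp₀
  have hload : IsLoadLimit X ω π W p₀ fun t =>
      ∑ c ∈ W, (pr c + N.frac c * lam * t - ∑ s, N.speed s c * g t s c) := by
    refine ⟨fun _ => 0, x, φ, fun _ => le_rfl, hinit, by simp, fun s => by simp [hx, soloState],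
      fun s => tendsto_soloState_pos hlim s₀ s, hφ, ?_⟩
    refine (tendstoLocallyUniformlyOn_sum hg).congr fun n t _ => ?_
    rw [Control.load, Finset.sum_div]
  set t := max t₀ 0 + 1 with ht
  have ht0 : 0 < t := by positivity
  have hq := hω p₀ _ hload (by simp [hp₀]) t (by have := le_max_left t₀ 0; linarith)
  have hnn : ∀ c ∈ W, 0 ≤ pr c + N.frac c * lam * t - ∑ s, N.speed s c * g t s c := fun c hc => by
    refine ge_of_tendsto' ((hg c hc).tendsto_at (Set.mem_Ioi.2 ht0)) fun n => ?_
    have h1 := (π.admissible inp (x (φ n)) hinp (hinit _)).comp_le c (φ n * t) (by positivity)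
    refine div_nonneg (sub_nonneg.2 ?_) (Nat.cast_nonneg _)
    exact_mod_cast h1
  -- No fluid type load is negative, since only customers in the system can depart. A vanishing
  -- total therefore makes each of them vanish.
  have hz := (Finset.sum_eq_zero_iff_of_nonneg hnn).1 hq
  -- The time averages of the allocation up to `t` serve the initial load and all arrivals of each
  -- type, hence work at rate at least `lam`.
  obtain ⟨η, θ, hη, -⟩ := exists_isFeasible (N := N) (R := R) (D := W) (μ := lam)
    (a := fun s c => g t s c / t) (fun s c => div_nonneg (hg0 t s c) ht0.le)
    (fun s _ c _ h => by rw [hgoff t s c fun h' => h (hHN s c h'), zero_div])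
    (fun s _ => by
      rw [← Finset.sum_div, div_le_one ht0]
      exact (Finset.sum_le_sum_of_subset_of_nonneg (Finset.subset_univ W)
        fun c _ _ => hg0 t s c).trans (hgrow t s ht0.le))
    (fun c hc => by
      have h1 : ∑ s ∈ R, N.speed s c * g t s c = ∑ s, N.speed s c * g t s c :=
        Finset.sum_subset (Finset.subset_univ R) fun s _ hs => by
          rw [hgoff t s c fun h => hs (hHR s c hc h), mul_zero]
      have h2 : ∑ s ∈ R, N.speed s c / N.frac c * (g t s c / t) =
          (∑ s, N.speed s c * g t s c) / (N.frac c * t) := by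
        rw [← h1, Finset.sum_div]
        exact Finset.sum_congr rfl fun s _ => div_mul_div_comm _ _ _ _
      have hf := N.frac_pos c
      rw [h2, le_div_iff₀ (by positivity)]
      have h3 := hz c hc
      have h4 := hpr c
      nlinarith) hR
  exact absurd (hopt η lam θ hη) (not_le.2 hm)

end Instability

end FCFS

namespace FCFS

set_option linter.unusedSectionVars false

/-! ## Connectivity and components -/

section Linked

variable {S C : Type*} {E G : S → C → Prop} {R : Finset S} {D : Finset C}

/-- The arcs of `E` between `R` and `D` connect all these nodes. -/
def Linked (E : S → C → Prop) (R : Finset S) (D : Finset C) : Prop :=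
  ∀ (p : S → Prop) (q : C → Prop), (∀ s ∈ R, ∀ c ∈ D, E s c → (p s ↔ q c)) → (∃ c ∈ D, q c) →
    (∀ s ∈ R, p s) ∧ ∀ c ∈ D, q c

theorem bipartite_adj_inl_inr {s : S} {c : C} :
    (bipartite E).Adj (Sum.inl s) (Sum.inr c) ↔ E s c := by
  rw [bipartite, SimpleGraph.fromRel_adj]
  constructor
  · rintro ⟨-, ⟨s', c', h1, h2, h⟩ | ⟨s', c', h1, h2, h⟩⟩
    · rw [Sum.inl.inj h1, Sum.inr.inj h2]
      exact h
    · cases h1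
  · exact fun h => ⟨Sum.inl_ne_inr, Or.inl ⟨s, c, rfl, rfl, h⟩⟩

theorem bipartite_adj_cases {x y : S ⊕ C} (h : (bipartite E).Adj x y) :
    ∃ s c, E s c ∧ ((x = Sum.inl s ∧ y = Sum.inr c) ∨ (x = Sum.inr c ∧ y = Sum.inl s)) := by
  rw [bipartite, SimpleGraph.fromRel_adj] at h
  obtain ⟨-, ⟨s, c, h1, h2, h⟩ | ⟨s, c, h1, h2, h⟩⟩ := h
  · exact ⟨s, c, h, Or.inl ⟨h1, h2⟩⟩
  · exact ⟨s, c, h, Or.inr ⟨h2, h1⟩⟩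

theorem reachable_induction {V : Type*} {F : SimpleGraph V} {r : V → Prop}
    (hr : ∀ x y, F.Adj x y → r x → r y) {x y : V} (h : F.Reachable x y) (hx : r x) : r y := by
  obtain ⟨w⟩ := h
  induction w with
  | nil => exact hx
  | cons hadj _ ih => exact ih (hr _ _ hadj hx)

theorem linked_of_connected (h : (subgraphOn E R D).Connected) : Linked E R D := by
  rintro p q hpq ⟨c₀, hc₀, hq⟩
  have key : ∀ v : {x : S ⊕ C | Sum.elim (fun s => s ∈ R) (fun c => c ∈ D) x},
      Sum.elim p q v.1 := fun v => by
    refine reachable_induction (r := fun v : {x : S ⊕ C |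
      Sum.elim (fun s => s ∈ R) (fun c => c ∈ D) x} => Sum.elim p q v.1) ?_
      (h.preconnected ⟨Sum.inr c₀, hc₀⟩ v) hq
    rintro ⟨x, hx⟩ ⟨y, hy⟩ hadj hxr
    obtain ⟨s, c, hE, ⟨rfl, rfl⟩ | ⟨rfl, rfl⟩⟩ := bipartite_adj_cases (E := E) hadj
    · exact (hpq s hx c hy hE).1 hxr
    · exact (hpq s hy c hx hE).2 hxr
  exact ⟨fun s hs => key ⟨Sum.inl s, hs⟩, fun c hc => key ⟨Sum.inr c, hc⟩⟩

theorem linked_of_bipartite_connected [Fintype S] [Fintype C] (h : (bipartite E).Connected) :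
    Linked E Finset.univ Finset.univ := by
  rintro p q hpq ⟨c₀, -, hq⟩
  have key : ∀ v, Sum.elim p q v := fun v => by
    refine reachable_induction ?_ (h.preconnected (Sum.inr c₀) v) hq
    intro x y hadj hxr
    obtain ⟨s, c, hE, ⟨rfl, rfl⟩ | ⟨rfl, rfl⟩⟩ := bipartite_adj_cases (E := E) hadj
    · exact (hpq s (Finset.mem_univ _) c (Finset.mem_univ _) hE).1 hxr
    · exact (hpq s (Finset.mem_univ _) c (Finset.mem_univ _) hE).2 hxr
  exact ⟨fun s _ => key (Sum.inl s), fun c _ => key (Sum.inr c)⟩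

theorem Linked.mono {E' : S → C → Prop} (h : Linked E R D)
    (hE : ∀ s ∈ R, ∀ c ∈ D, E s c → E' s c) : Linked E' R D :=
  fun p q hpq => h p q fun s hs c hc hEsc => hpq s hs c hc (hE s hs c hc hEsc)

open Classical in
/-- The types that are connected with `c₀` by arcs of `G`. -/
noncomputable def component (G : S → C → Prop) (D : Finset C) (c₀ : C) : Finset C :=
  D.filter fun c => Relation.ReflTransGen (fun c c' => ∃ s, G s c ∧ G s c') c₀ c

open Classical in
/-- The servers in `R` that are adjacent to types in `K`. -/
noncomputable def neighbors (G : S → C → Prop) (R : Finset S) (K : Finset C) : Finset S :=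
  R.filter fun s => ∃ c ∈ K, G s c

theorem mem_component {c₀ c : C} : c ∈ component G D c₀ ↔
    c ∈ D ∧ Relation.ReflTransGen (fun c c' => ∃ s, G s c ∧ G s c') c₀ c := by
  classical exact Finset.mem_filter

theorem mem_neighbors {K : Finset C} {s : S} :
    s ∈ neighbors G R K ↔ s ∈ R ∧ ∃ c ∈ K, G s c := by
  classical exact Finset.mem_filter

theorem component_subset {c₀ : C} : component G D c₀ ⊆ D := fun _ h => (mem_component.1 h).1

theorem neighbors_subset {K : Finset C} : neighbors G R K ⊆ R := fun _ h => (mem_neighbors.1 h).1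

theorem self_mem_component {c₀ : C} (h : c₀ ∈ D) : c₀ ∈ component G D c₀ := by
  exact mem_component.2 ⟨h, .refl⟩

theorem mem_component_of_adj (hclosed : ∀ s c, G s c → (s ∈ R ↔ c ∈ D)) {c₀ c c' : C} {s : S}
    (hc : c ∈ component G D c₀) (h : G s c) (h' : G s c') : c' ∈ component G D c₀ := by
  obtain ⟨h1, h2⟩ := mem_component.1 hc
  exact mem_component.2 ⟨(hclosed s c' h').1 ((hclosed s c h).2 h1), h2.tail ⟨s, h, h'⟩⟩

theorem mem_component_iff (hclosed : ∀ s c, G s c → (s ∈ R ↔ c ∈ D)) {c₀ c : C} {s : S}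
    (h : G s c) : s ∈ neighbors G R (component G D c₀) ↔ c ∈ component G D c₀ := by
  constructor
  · intro hs
    obtain ⟨-, c', hc', hG⟩ := mem_neighbors.1 hs
    exact mem_component_of_adj hclosed hc' hG h
  · intro hc
    exact mem_neighbors.2 ⟨(hclosed s c h).2 (component_subset hc), c, hc, h⟩

theorem component_induction (hclosed : ∀ s c, G s c → (s ∈ R ↔ c ∈ D)) {c₀ : C} {q : C → Prop}
    (hq : ∀ s ∈ R, ∀ c ∈ component G D c₀, ∀ c' ∈ component G D c₀, G s c → G s c' → q c → q c')
    {c c' : C} (hc : c ∈ component G D c₀) (hc' : c' ∈ component G D c₀) (h : q c) : q c' := by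
  obtain ⟨h1, h2⟩ := mem_component.1 hc
  obtain ⟨h1', h2'⟩ := mem_component.1 hc'
  have hsymm : Relation.ReflTransGen (fun c c' => ∃ s, G s c ∧ G s c') c c₀ :=
    by
    have : Std.Symm fun c c' => ∃ s, G s c ∧ G s c' := ⟨fun a b ⟨s, ha, hb⟩ => ⟨s, hb, ha⟩⟩
    exact Std.Symm.symm _ _ h2
  have key := hsymm.trans h2'
  suffices c' ∈ component G D c₀ ∧ q c' from this.2
  clear hc' h1' h2'
  induction key with
  | refl => exact ⟨hc, h⟩
  | tail _ hstep ih =>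
    obtain ⟨s, ha, hb⟩ := hstep
    have hmem := mem_component_of_adj hclosed ih.1 ha hb
    exact ⟨hmem, hq s ((hclosed _ _ ha).2 (component_subset ih.1)) _ ih.1 _ hmem ha hb ih.2⟩

/-- If all the servers and types are linked, there is only one component. -/
theorem component_eq_of_linked (hclosed : ∀ s c, G s c → (s ∈ R ↔ c ∈ D)) (hL : Linked G R D)
    {c₀ : C} (hc₀ : c₀ ∈ D) :
    neighbors G R (component G D c₀) = R ∧ component G D c₀ = D := by
  obtain ⟨h1, h2⟩ := hL (fun s => s ∈ neighbors G R (component G D c₀))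
    (fun c => c ∈ component G D c₀) (fun s _ c _ h => mem_component_iff hclosed h)
    ⟨c₀, hc₀, self_mem_component hc₀⟩
  exact ⟨neighbors_subset.antisymm h1, component_subset.antisymm h2⟩

/-- Prices that are tight on connecting arcs have the same sign. -/
theorem exists_pos_price {K : Finset C} {g : S → C → ℝ} {y : S → ℝ} {z : C → ℝ}
    (hg : ∀ s c, G s c → 0 < g s c)
    (hprice : ∀ s ∈ R, ∀ c ∈ K, G s c → y s = g s c * z c) (hL : Linked G R K)
    (hz : ∃ c ∈ K, z c ≠ 0) :
    ∃ (y' : S → ℝ) (z' : C → ℝ), (∀ s ∈ R, 0 < y' s) ∧ (∀ c ∈ K, 0 < z' c) ∧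
      ∀ s ∈ R, ∀ c ∈ K, G s c → y' s = g s c * z' c := by
  obtain ⟨c₀, hc₀, hz₀⟩ := hz
  -- The coefficients are positive, so the sign of the price passes along arcs in both directions;
  -- if it is negative, change all signs.
  rcases hz₀.lt_or_gt with h | h
  · obtain ⟨h1, h2⟩ := hL (fun s => y s < 0) (fun c => z c < 0) (fun s hs c hc hG => by
      rw [hprice s hs c hc hG]
      exact smul_neg_iff_of_pos_left (hg s c hG)) ⟨c₀, hc₀, h⟩
    exact ⟨-y, -z, fun s hs => neg_pos.2 (h1 s hs), fun c hc => neg_pos.2 (h2 c hc),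
      fun s hs c hc hG => by simp [hprice s hs c hc hG]⟩
  · obtain ⟨h1, h2⟩ := hL (fun s => 0 < y s) (fun c => 0 < z c) (fun s hs c hc hG => by
      rw [hprice s hs c hc hG, mul_pos_iff_of_pos_left (hg s c hG)]) ⟨c₀, hc₀, h⟩
    exact ⟨y, z, h1, h2, hprice⟩

theorem linked_component (hclosed : ∀ s c, G s c → (s ∈ R ↔ c ∈ D)) (c₀ : C) :
    Linked G (neighbors G R (component G D c₀)) (component G D c₀) := by
  rintro p q hpq ⟨c, hc, hqc⟩
  have h2 : ∀ c' ∈ component G D c₀, q c' := fun c' hc' => by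
    refine component_induction hclosed (q := q) (fun s hs a ha b hb hsa hsb hqa => ?_) hc hc' hqc
    have hs' := (mem_component_iff hclosed hsa).2 ha
    exact (hpq s hs' b hb hsb).1 ((hpq s hs' a ha hsa).2 hqa)
  refine ⟨fun s hs => ?_, h2⟩
  obtain ⟨-, c', hc', hG⟩ := mem_neighbors.1 hs
  exact (hpq s hs c' hc' hG).2 (h2 c' hc')

end Linked

section Pooling

variable {S C Ω : Type*} [Fintype S] [DecidableEq S] [Fintype C] [DecidableEq C]
  [MeasurableSpace Ω] {P : Measure Ω} [IsProbabilityMeasure P] {N : Network S C}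
  {G : S → C → Prop} {R : Finset S} {D : Finset C} {η : S → C → ℝ} {m : ℝ}

/-- An allocation that uses exactly the arcs of `G` on the subsystem `(R, D)`, serves all its types
at the rate `m`, and for which every component of `G` has nontrivial tight prices. -/
structure Critical (N : Network S C) (G : S → C → Prop) (R : Finset S) (D : Finset C)
    (η : S → C → ℝ) (m : ℝ) : Prop where
  compat : ∀ s c, G s c → N.compat s c
  closed : ∀ s c, G s c → (s ∈ R ↔ c ∈ D)
  pos : ∀ s ∈ R, ∀ c ∈ D, G s c → 0 < η s c
  off : ∀ s ∈ R, ∀ c ∈ D, ¬ G s c → η s c = 0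
  sum_one : ∀ s ∈ R, ∑ c ∈ D, η s c = 1
  rate : ∀ c ∈ D, ∑ s ∈ R, N.speed s c / N.frac c * η s c = m
  nonempty : D.Nonempty
  rate_pos : 0 < m
  price : ∀ c₀ ∈ D, ∃ (y : S → ℝ) (z : C → ℝ),
    (∀ s ∈ R, ∀ c ∈ component G D c₀, G s c → y s = N.speed s c / N.frac c * z c) ∧
      ∃ c ∈ component G D c₀, z c ≠ 0

namespace Critical

/-- No arc leaves a component, so the time constraints and the rates restrict to it. Its prices are
nonzero somewhere and can therefore be taken positive throughout. -/
theorem balanced (h : Critical N G R D η m) {c₀ : C} (hc₀ : c₀ ∈ D) :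
    ∃ y z, Balanced G (neighbors G R (component G D c₀)) (component G D c₀)
      (fun s c => N.speed s c / N.frac c) η y z m := by
  classical
  obtain ⟨y, z, hprice, hz⟩ := h.price c₀ hc₀
  obtain ⟨y, z, hy, hz, hprice⟩ := exists_pos_price
    (fun s c hG => N.coeff_pos (h.compat s c hG))
    (fun s hs c hc hG => hprice s (neighbors_subset hs) c hc hG)
    (linked_component h.closed c₀) hz
  have hmem : ∀ s ∈ R, ∀ c ∈ D, G s c →
      (s ∈ neighbors G R (component G D c₀) ↔ c ∈ component G D c₀) :=
    fun s _ c _ hG => mem_component_iff h.closed hG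
  refine ⟨y, z, fun s c hG => mem_component_iff h.closed hG, fun s hs c hG => ?_,
    fun s hs c hc => h.off s (neighbors_subset hs) c (component_subset hc), fun s hs => ?_,
    fun c hc => ?_, hy, hz, fun s hs c hG => ?_, ⟨c₀, self_mem_component hc₀⟩, h.rate_pos, ?_⟩
  · exact h.pos s (neighbors_subset hs) c
      (component_subset ((mem_component_iff h.closed hG).1 hs)) hG
  · rw [← h.sum_one s (neighbors_subset hs)]
    refine Finset.sum_subset component_subset fun c hc hc' => ?_
    exact h.off s (neighbors_subset hs) c hc fun hG => hc' ((mem_component_iff h.closed hG).1 hs)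
  · rw [← h.rate c (component_subset hc)]
    refine Finset.sum_subset neighbors_subset fun s hs hs' => ?_
    rw [h.off s hs c (component_subset hc) fun hG => hs' ((mem_component_iff h.closed hG).2 hc),
      mul_zero]
  · exact hprice s hs c ((mem_component_iff h.closed hG).1 hs) hG
  · intro U hU hne hneq
    -- Without a server joining `U` to its complement, membership in `U` would spread over the whole
    -- component.
    by_contra! hno
    obtain ⟨c, hc⟩ := hne
    refine hneq (hU.antisymm fun c' hc' => ?_)
    refine component_induction h.closed (q := fun c => c ∈ U)
      (fun s hs a ha b hb hsa hsb hqa => ?_) (hU hc) hc' hc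
    by_contra hbU
    exact hno s ((mem_component_iff h.closed hsa).2 ha) a hqa b hb hbU hsa hsb

theorem exists_type (h : Critical N G R D η m) {s : S} (hs : s ∈ R) :
    ∃ c₀ ∈ D, s ∈ neighbors G R (component G D c₀) := by
  have h1 : ∑ c ∈ D, η s c ≠ 0 := by rw [h.sum_one s hs]; exact one_ne_zero
  obtain ⟨c, hc, hne⟩ := Finset.exists_ne_zero_of_sum_ne_zero h1
  have hG : G s c := by
    by_contra hG
    exact hne (h.off s hs c hc hG)
  exact ⟨c, hc, (mem_component_iff h.closed hG).2 (self_mem_component hc)⟩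

theorem servers_nonempty (h : Critical N G R D η m) : R.Nonempty := by
  obtain ⟨c, hc⟩ := h.nonempty
  have h1 : ∑ s ∈ R, N.speed s c / N.frac c * η s c ≠ 0 := by
    rw [h.rate c hc]; exact h.rate_pos.ne'
  obtain ⟨s, hs, -⟩ := Finset.exists_ne_zero_of_sum_ne_zero h1
  exact ⟨s, hs⟩

end Critical

/-- A finite family has a common `t₀` and a common null set. -/
theorem EventuallyUnder.forall_finset {ι : Type*} {Q : ι → ℝ → (S → ℝ → ℝ) → ℝ → Prop}
    {A : Finset ι} (h : ∀ i ∈ A, EventuallyUnder N P G (Q i)) :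
    EventuallyUnder N P G fun lam p t => ∀ i ∈ A, Q i lam p t := by
  intro lam hlam X b
  have h' : ∀ i : A, ∃ t₀ : ℝ, ∀ᵐ ω ∂P, ∀ p : S → ℝ → ℝ, IsFluidLimit G X ω p →
      -∑ s, p s 0 = b → ∀ t, t₀ < t → Q i lam p t := fun i => h i i.2 lam hlam X b
  choose t₀ ht₀ using h'
  obtain ⟨T, hT⟩ := (Set.finite_range t₀).bddAbove
  refine ⟨T, ?_⟩
  filter_upwards [ae_all_iff.2 ht₀] with ω hω p hp hb t ht i hi
  exact hω ⟨i, hi⟩ p hp hb t ((hT ⟨⟨i, hi⟩, rfl⟩).trans_lt ht)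

theorem EventuallyUnder.mono {Q Q' : ℝ → (S → ℝ → ℝ) → ℝ → Prop} (h : EventuallyUnder N P G Q)
    (hQ : ∀ lam p t, Q lam p t → Q' lam p t) : EventuallyUnder N P G Q' := by
  intro lam hlam X b
  obtain ⟨t₀, ht₀⟩ := h lam hlam X b
  refine ⟨t₀, ?_⟩
  filter_upwards [ht₀] with ω hω p hp hb t ht
  exact hQ lam p t (hω p hp hb t ht)

namespace Critical

/-- Every server lies in a component, and all components are balanced at the same rate `m`. Their
positions need not agree, unless all have reached the arrival level. -/
theorem eventuallyUnder (h : Critical N G R D η m) : EventuallyUnder N P G fun lam p t =>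
    (∀ s ∈ R, HasDerivAt (p s) (min lam m) t) ∧ (lam < m → ∀ s ∈ R, p s t = lam * t) := by
  have h1 := EventuallyUnder.forall_finset (N := N) (P := P) (G := G) (A := D) (fun c₀ hc₀ =>
    (h.balanced hc₀).choose_spec.choose_spec.eventuallyUnder h.compat)
  refine h1.mono fun lam p t hQ => ⟨fun s hs => ?_, fun hlam s hs => ?_⟩
  · obtain ⟨c₀, hc₀, hs'⟩ := h.exists_type hs
    exact (hQ c₀ hc₀).1 s hs'
  · obtain ⟨c₀, hc₀, hs'⟩ := h.exists_type hs
    exact (hQ c₀ hc₀).2.2 hlam s hs'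

theorem movesAtRate (h : Critical N G R D η m) : MovesAtRate N P G R m :=
  h.eventuallyUnder.mono fun _ _ _ hQ => hQ.1

theorem weakPooling (h : Critical N G R D η m) : WeakPooling N P G R :=
  h.eventuallyUnder.mono fun _ _ _ hQ => ⟨_, hQ.1⟩

theorem completePooling (h : Critical N G R D η m) (hL : Linked G R D) :
    CompletePooling N P G R := by
  obtain ⟨c₀, hc₀⟩ := h.nonempty
  obtain ⟨y, z, hB⟩ := h.balanced hc₀
  obtain ⟨h1, h2⟩ := component_eq_of_linked h.closed hL hc₀
  rw [h1, h2] at hB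
  refine (hB.eventuallyUnder h.compat).mono fun lam p t hQ => ?_
  obtain ⟨s₀, hs₀⟩ := h.servers_nonempty
  have hne : Nonempty R := ⟨⟨s₀, hs₀⟩⟩
  have heq : (fun s : R => p s t) = fun _ => p s₀ t := funext fun s => hQ.2.1 s s.2 s₀ hs₀
  rw [highest, lowest, heq, ciSup_const, ciInf_const, sub_self]

theorem fluidStable (h : Critical N G R D η m) {lam : ℝ} (hlam : 0 < lam) (hm : lam < m)
    (X : Primitives N P lam) : FluidStable X G R := by
  obtain ⟨t₀, ht₀⟩ := h.eventuallyUnder lam hlam X 1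
  refine ⟨t₀, ?_⟩
  obtain ⟨s₀, hs₀⟩ := h.servers_nonempty
  have hne : Nonempty R := ⟨⟨s₀, hs₀⟩⟩
  filter_upwards [ht₀] with ω hω p hp hb t ht
  have heq : (fun s : R => p s t) = fun _ => lam * t :=
    funext fun s => (hω p hp hb t ht).2 hm s s.2
  rw [lowest, heq, ciInf_const, sub_self]

/-- A policy on `H` can serve `D` only with servers in `R`, so the planning problem of `(R, D)`
bounds its rate. -/
theorem maximumThroughput (h : Critical N G R D η m) {H : S → C → Prop}
    (hHN : ∀ s c, H s c → N.compat s c) (hHR : ∀ s, ∀ c ∈ D, H s c → s ∈ R)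
    (hHD : ∀ s ∈ R, ∀ c ∈ D, N.compat s c → H s c)
    (hopt : ∀ η μ θ, IsFeasible N R D η μ θ → μ ≤ m) :
    MaximumThroughput N P G R H D m := by
  refine ⟨fun lam hlam hm X => h.fluidStable hlam hm X, fun lam hlam hm X π =>
    not_policyStable hHN hHR (fun c hc => ?_) h.nonempty (fun s hs => ?_) hopt hlam hm X π⟩
  · have h1 : ∑ s ∈ R, N.speed s c / N.frac c * η s c ≠ 0 := by
      rw [h.rate c hc]; exact h.rate_pos.ne'
    obtain ⟨s, hs, hne⟩ := Finset.exists_ne_zero_of_sum_ne_zero h1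
    refine ⟨s, hHD s hs c hc (h.compat s c ?_)⟩
    by_contra hG
    exact hne (by rw [h.off s hs c hc hG, mul_zero])
  · have h1 : ∑ c ∈ D, η s c ≠ 0 := by rw [h.sum_one s hs]; exact one_ne_zero
    obtain ⟨c, hc, hne⟩ := Finset.exists_ne_zero_of_sum_ne_zero h1
    refine ⟨c, hc, h.compat s c ?_⟩
    by_contra hG
    exact hne (h.off s hs c hc hG)

end Critical

end Pooling

end FCFS

namespace FCFS

set_option linter.unusedSectionVars false

/-! ## Allocations and the rates of the types -/

section LP

variable {S C : Type*} [Fintype S] [Fintype C] {N : Network S C} {R R₁ : Finset S} {D D₁ : Finset C}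
  {η η₁ η₂ : S → C → ℝ} {m : ℝ}

/-- The rate at which an allocation serves a type, in proportion to the arrivals of this type. -/
noncomputable def rateOf (N : Network S C) (R : Finset S) (η : S → C → ℝ) (c : C) : ℝ :=
  ∑ s ∈ R, N.speed s c / N.frac c * η s c

/-- Allocations of the time of the servers in `R` to the types in `D`. -/
structure IsAlloc (N : Network S C) (R : Finset S) (D : Finset C) (η : S → C → ℝ) : Prop where
  nonneg : ∀ s c, 0 ≤ η s c
  off : ∀ s c, ¬ (s ∈ R ∧ c ∈ D ∧ N.compat s c) → η s c = 0
  server : ∀ s ∈ R, ∑ c ∈ D, η s c = 1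

/-- The allocation `η` attains the maximal common rate `m`. -/
structure IsBest (N : Network S C) (R : Finset S) (D : Finset C) (η : S → C → ℝ) (m : ℝ) : Prop
    extends IsAlloc N R D η where
  le_rate : ∀ c ∈ D, m ≤ rateOf N R η c
  exists_le : ∀ η', IsAlloc N R D η' → ∃ c ∈ D, rateOf N R η' c ≤ m

theorem IsFeasible.isAlloc {θ : C → ℝ} (h : IsFeasible N R D η m θ) : IsAlloc N R D η :=
  ⟨h.alloc_nonneg, h.alloc_off, h.server⟩

theorem IsFeasible.slack_eq {θ : C → ℝ} (h : IsFeasible N R D η m θ) {c : C} (hc : c ∈ D) :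
    θ c = rateOf N R η c - m := by
  have := h.customer c hc
  rw [rateOf]
  linarith

theorem IsFeasible.le_rate {θ : C → ℝ} (h : IsFeasible N R D η m θ) {c : C} (hc : c ∈ D) :
    m ≤ rateOf N R η c := by
  have := h.slack_eq hc
  have := h.slack_nonneg c
  linarith

open Classical in
/-- The slacks of an allocation. -/
noncomputable def slackOf (N : Network S C) (R : Finset S) (D : Finset C) (η : S → C → ℝ) (m : ℝ)
    (c : C) : ℝ := if c ∈ D then rateOf N R η c - m else 0

theorem slackOf_mem {c : C} (hc : c ∈ D) : slackOf N R D η m c = rateOf N R η c - m := if_pos hc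

theorem IsAlloc.isFeasible (h : IsAlloc N R D η) (hm : ∀ c ∈ D, m ≤ rateOf N R η c) :
    IsFeasible N R D η m (slackOf N R D η m) where
  alloc_nonneg := h.nonneg
  alloc_off := h.off
  slack_nonneg c := by
    by_cases hc : c ∈ D
    · rw [slackOf_mem hc]; exact sub_nonneg.2 (hm c hc)
    · rw [slackOf, if_neg hc]
  slack_off c hc := if_neg hc
  server := h.server
  customer c hc := by rw [slackOf_mem hc, rateOf]; ring

theorem exists_lt_of_forall_lt (hD : D.Nonempty) {f : C → ℝ} (h : ∀ c ∈ D, m < f c) :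
    ∃ m', m < m' ∧ ∀ c ∈ D, m' ≤ f c := by
  obtain ⟨c₀, hc₀, hmin⟩ := D.exists_min_image f hD
  exact ⟨f c₀, h c₀ hc₀, hmin⟩

theorem IsOptimal.isBest {θ : C → ℝ} (h : IsOptimal N R D η m θ) (hD : D.Nonempty) :
    IsBest N R D η m where
  toIsAlloc := h.1.isAlloc
  le_rate _ hc := h.1.le_rate hc
  exists_le η' hη' := by
    by_contra! hlt
    obtain ⟨m', hm', hle⟩ := exists_lt_of_forall_lt hD hlt
    exact absurd (h.2 η' m' _ (hη'.isFeasible hle)) (not_le.2 hm')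

theorem IsBest.le (h : IsBest N R D η m) {η' : S → C → ℝ} {μ' : ℝ} {θ' : C → ℝ}
    (hf : IsFeasible N R D η' μ' θ') : μ' ≤ m := by
  obtain ⟨c, hc, hle⟩ := h.exists_le η' hf.isAlloc
  exact (hf.le_rate hc).trans hle

theorem IsBest.isOptimal (h : IsBest N R D η m) : IsOptimal N R D η m (slackOf N R D η m) :=
  ⟨h.toIsAlloc.isFeasible h.le_rate, fun _ _ _ hf => h.le hf⟩

theorem IsBest.isOptimalValue (h : IsBest N R D η m) : IsOptimalValue N R D m :=
  ⟨η, _, h.isOptimal⟩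

theorem IsBest.isBest (h : IsBest N R D η m) {η' : S → C → ℝ} (h' : IsAlloc N R D η')
    (hle : ∀ c ∈ D, m ≤ rateOf N R η' c) : IsBest N R D η' m :=
  ⟨h', hle, h.exists_le⟩

theorem IsOptimalValue.exists_isBest (h : IsOptimalValue N R D m) (hD : D.Nonempty) :
    ∃ η, IsBest N R D η m := by
  obtain ⟨η, θ, h⟩ := h
  exact ⟨η, h.isBest hD⟩

theorem IsBest.unique {η' : S → C → ℝ} {m' : ℝ} (h : IsBest N R D η m)
    (h' : IsBest N R D η' m') : m = m' :=
  le_antisymm (h'.le h.isOptimal.1) (h.le h'.isOptimal.1)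

theorem IsAlloc.exists_compat (h : IsAlloc N R D η) {s : S} (hs : s ∈ R) :
    ∃ c ∈ D, N.compat s c := by
  have h1 : ∑ c ∈ D, η s c ≠ 0 := by rw [h.server s hs]; exact one_ne_zero
  obtain ⟨c, hc, hne⟩ := Finset.exists_ne_zero_of_sum_ne_zero h1
  refine ⟨c, hc, ?_⟩
  by_contra hG
  exact hne (h.off s c fun h => hG h.2.2)

theorem IsAlloc.exists_arc {c : C} (hpos : 0 < rateOf N R η c) :
    ∃ s ∈ R, η s c ≠ 0 := by
  obtain ⟨s, hs, hne⟩ := Finset.exists_ne_zero_of_sum_ne_zero hpos.ne'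
  exact ⟨s, hs, fun h => hne (by rw [h, mul_zero])⟩

/-- An allocation of parts of the available time can be completed. -/
theorem exists_isAlloc {a : S → C → ℝ} (h0 : ∀ s c, 0 ≤ a s c)
    (hoff : ∀ s ∈ R, ∀ c ∈ D, ¬ N.compat s c → a s c = 0) (hle : ∀ s ∈ R, ∑ c ∈ D, a s c ≤ 1)
    (hR : ∀ s ∈ R, ∃ c ∈ D, N.compat s c) :
    ∃ η, IsAlloc N R D η ∧ ∀ c ∈ D, rateOf N R a c ≤ rateOf N R η c := by
  rcases D.eq_empty_or_nonempty with rfl | hD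
  · have hRe : R = ∅ := Finset.eq_empty_of_forall_notMem fun s hs => by simpa using hR s hs
    subst hRe
    exact ⟨0, ⟨fun _ _ => le_rfl, fun _ _ _ => rfl, by simp⟩, by simp⟩
  obtain ⟨c₀, hc₀, hmin⟩ := D.exists_min_image (rateOf N R a) hD
  obtain ⟨η, θ, hη, hge⟩ := exists_isFeasible h0 hoff hle hmin hR
  refine ⟨η, hη.isAlloc, fun c hc => Finset.sum_le_sum fun s hs => ?_⟩
  by_cases hG : N.compat s c
  · exact mul_le_mul_of_nonneg_left (hge s hs c hc) (N.coeff_pos hG).le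
  · rw [hoff s hs c hc hG, hη.alloc_off s c fun h => hG h.2.2]

theorem rateOf_add (c : C) : rateOf N R (η₁ + η₂) c = rateOf N R η₁ c + rateOf N R η₂ c := by
  simp only [rateOf, Pi.add_apply, mul_add, Finset.sum_add_distrib]

theorem rateOf_smul (a : ℝ) (c : C) : rateOf N R (a • η) c = a * rateOf N R η c := by
  simp only [rateOf, Pi.smul_apply, smul_eq_mul, Finset.mul_sum]
  exact Finset.sum_congr rfl fun s _ => by ring

theorem continuous_rateOf (c : C) : Continuous fun η : S → C → ℝ => rateOf N R η c := by
  unfold rateOf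
  fun_prop

theorem isCompact_isAlloc : IsCompact {η | IsAlloc N R D η} := by
  refine (isCompact_univ_pi fun _ : S => isCompact_univ_pi fun _ : C =>
    isCompact_Icc (a := (0 : ℝ)) (b := 1)).of_isClosed_subset ?_ ?_
  · have h1 : IsClosed {η : S → C → ℝ | ∀ s c, 0 ≤ η s c} := by
      simp only [Set.ofPred_forall]
      exact isClosed_iInter fun s => isClosed_iInter fun c =>
        isClosed_le continuous_const (by fun_prop)
    have h2 : IsClosed {η : S → C → ℝ | ∀ s c, ¬ (s ∈ R ∧ c ∈ D ∧ N.compat s c) → η s c = 0} := by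
      simp only [Set.ofPred_forall]
      exact isClosed_iInter fun s => isClosed_iInter fun c => isClosed_iInter fun _ =>
        isClosed_eq (by fun_prop) continuous_const
    have h3 : IsClosed {η : S → C → ℝ | ∀ s ∈ R, ∑ c ∈ D, η s c = 1} := by
      simp only [Set.ofPred_forall]
      exact isClosed_iInter fun s => isClosed_iInter fun _ =>
        isClosed_eq (by fun_prop) continuous_const
    convert h1.inter (h2.inter h3) using 1
    ext η
    exact ⟨fun h => ⟨h.nonneg, h.off, h.server⟩, fun h => ⟨h.1, h.2.1, h.2.2⟩⟩
  · intro η hη s _ c _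
    refine ⟨hη.nonneg s c, ?_⟩
    by_cases h : s ∈ R ∧ c ∈ D ∧ N.compat s c
    · rw [← hη.server s h.1]
      exact Finset.single_le_sum (f := fun c => η s c) (fun c _ => hη.nonneg s c) h.2.1
    · rw [hη.off s c h]; exact zero_le_one

/-- The planning problem has an optimal solution. -/
theorem exists_isBest (hD : D.Nonempty) (hR : ∀ s ∈ R, ∃ c ∈ D, N.compat s c) :
    ∃ η m, IsBest N R D η m := by
  obtain ⟨η₀, hη₀, -⟩ := exists_isAlloc (N := N) (R := R) (D := D) (a := 0) (fun _ _ => le_rfl)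
    (fun _ _ _ _ _ => rfl) (fun s _ => by simp) hR
  obtain ⟨η, hη, hmax⟩ := isCompact_isAlloc.exists_isMaxOn ⟨η₀, hη₀⟩
    (f := fun η => D.inf' hD fun c => rateOf N R η c)
    (Continuous.finset_inf'_apply hD fun c _ => continuous_rateOf c).continuousOn
  refine ⟨η, D.inf' hD fun c => rateOf N R η c, hη, fun c hc => Finset.inf'_le _ hc,
    fun η' hη' => ?_⟩
  obtain ⟨c, hc, hmin⟩ := D.exists_min_image (rateOf N R η') hD
  refine ⟨c, hc, le_trans ?_ (hmax hη')⟩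
  exact Finset.le_inf' hD _ hmin

/-- Giving each server's time in equal portions to its compatible types serves every type at a
positive rate. -/
theorem IsBest.pos (h : IsBest N R D η m) (hD : ∀ c ∈ D, ∃ s ∈ R, N.compat s c) : 0 < m := by
  classical
  have := N.nonempty_types
  have hcard : (0 : ℝ) < Fintype.card C := by exact_mod_cast Fintype.card_pos
  obtain ⟨η', hη', hle⟩ := exists_isAlloc (N := N) (R := R) (D := D)
    (a := fun s c => if N.compat s c then 1 / (Fintype.card C : ℝ) else 0)
    (fun s c => by split_ifs <;> positivity) (fun s _ c _ hG => if_neg hG) (fun s _ => by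
      refine (Finset.sum_le_sum (g := fun _ => 1 / (Fintype.card C : ℝ)) fun c _ => ?_).trans ?_
      · split_ifs
        · exact le_rfl
        · positivity
      · rw [Finset.sum_const, nsmul_eq_mul, mul_one_div, div_le_one hcard]
        exact_mod_cast Finset.card_le_univ D) (fun s hs => h.exists_compat hs)
  obtain ⟨c, hc, hlem⟩ := h.exists_le η' hη'
  refine lt_of_lt_of_le ?_ ((hle c hc).trans hlem)
  obtain ⟨s, hs, hG⟩ := hD c hc
  refine Finset.sum_pos' (fun s _ => N.coeff_mul_nonneg ?_ fun h => if_neg h) ⟨s, hs, ?_⟩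
  · beta_reduce
    split_ifs <;> positivity
  · beta_reduce
    rw [if_pos hG]
    exact mul_pos (N.coeff_pos hG) (by positivity)

/-! ### Restricting and combining allocations -/

open Classical in
/-- The part of an allocation in the subsystem `(R, D)`. -/
noncomputable def restrict (R : Finset S) (D : Finset C) (η : S → C → ℝ) : S → C → ℝ :=
  fun s c => if s ∈ R ∧ c ∈ D then η s c else 0

theorem restrict_mem {s : S} {c : C} (hs : s ∈ R) (hc : c ∈ D) : restrict R D η s c = η s c :=
  if_pos ⟨hs, hc⟩

theorem restrict_nonneg (h : ∀ s c, 0 ≤ η s c) (s : S) (c : C) : 0 ≤ restrict R D η s c := by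
  unfold restrict
  split_ifs
  · exact h s c
  · exact le_rfl

theorem IsAlloc.restrict (h : IsAlloc N R D η) (hR : R₁ ⊆ R) (hD : D₁ ⊆ D)
    (hsep : ∀ s ∈ R₁, ∀ c ∈ D, c ∉ D₁ → η s c = 0) : IsAlloc N R₁ D₁ (restrict R₁ D₁ η) where
  nonneg := restrict_nonneg h.nonneg
  off s c hsc := by
    by_cases hs : s ∈ R₁ ∧ c ∈ D₁
    · rw [restrict_mem hs.1 hs.2]
      exact h.off s c fun h' => hsc ⟨hs.1, hs.2, h'.2.2⟩
    · exact if_neg hs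
  server s hs := by
    rw [← h.server s (hR hs), ← Finset.sum_subset hD fun c hc hc' => hsep s hs c hc hc']
    exact Finset.sum_congr rfl fun c hc => restrict_mem hs hc

theorem rateOf_restrict (hR : R₁ ⊆ R) {c : C} (hc : c ∈ D₁)
    (hsep : ∀ s ∈ R, s ∉ R₁ → η s c = 0) :
    rateOf N R₁ (restrict R₁ D₁ η) c = rateOf N R η c := by
  rw [rateOf, rateOf, ← Finset.sum_subset hR fun s hs hs' => by rw [hsep s hs hs', mul_zero]]
  exact Finset.sum_congr rfl fun s hs => by rw [restrict_mem hs hc]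

variable [DecidableEq S] [DecidableEq C]

theorem IsAlloc.add (h₁ : IsAlloc N R₁ D₁ η₁) (h₂ : IsAlloc N (R \ R₁) (D \ D₁) η₂)
    (hR : R₁ ⊆ R) (hD : D₁ ⊆ D) : IsAlloc N R D (η₁ + η₂) where
  nonneg s c := add_nonneg (h₁.nonneg s c) (h₂.nonneg s c)
  off s c h := by
    rw [Pi.add_apply, Pi.add_apply, h₁.off s c fun h' => h ⟨hR h'.1, hD h'.2.1, h'.2.2⟩,
      h₂.off s c fun h' => h ⟨(Finset.mem_sdiff.1 h'.1).1, (Finset.mem_sdiff.1 h'.2.1).1, h'.2.2⟩,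
      add_zero]
  server s hs := by
    simp only [Pi.add_apply, Finset.sum_add_distrib]
    by_cases hs₁ : s ∈ R₁
    · rw [Finset.sum_eq_zero (f := fun c => η₂ s c) fun c _ => h₂.off s c fun h' =>
        (Finset.mem_sdiff.1 h'.1).2 hs₁, add_zero, ← h₁.server s hs₁]
      exact (Finset.sum_subset hD fun c _ hc => h₁.off s c fun h' => hc h'.2.1).symm
    · rw [Finset.sum_eq_zero (f := fun c => η₁ s c) fun c _ => h₁.off s c fun h' => hs₁ h'.1,
        zero_add, ← h₂.server s (Finset.mem_sdiff.2 ⟨hs, hs₁⟩)]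
      exact (Finset.sum_subset Finset.sdiff_subset
        fun c _ hc => h₂.off s c fun h' => hc h'.2.1).symm

theorem IsAlloc.rateOf_eq_zero (h : IsAlloc N R₁ D₁ η) {c : C} (hc : c ∉ D₁) :
    rateOf N R η c = 0 :=
  Finset.sum_eq_zero fun s _ => by rw [h.off s c fun h' => hc h'.2.1, mul_zero]

theorem IsAlloc.rateOf_eq (h : IsAlloc N R₁ D₁ η) (hR : R₁ ⊆ R) (c : C) :
    rateOf N R η c = rateOf N R₁ η c :=
  (Finset.sum_subset hR fun s _ hs => by rw [h.off s c fun h' => hs h'.1, mul_zero]).symm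

theorem IsAlloc.rateOf_add_left (h₁ : IsAlloc N R₁ D₁ η₁) (h₂ : IsAlloc N (R \ R₁) (D \ D₁) η₂)
    (hR : R₁ ⊆ R) {c : C} (hc : c ∈ D₁) : rateOf N R (η₁ + η₂) c = rateOf N R₁ η₁ c := by
  rw [rateOf_add, h₁.rateOf_eq hR, h₂.rateOf_eq_zero fun h => (Finset.mem_sdiff.1 h).2 hc, add_zero]

theorem IsAlloc.rateOf_add_right (h₁ : IsAlloc N R₁ D₁ η₁) (h₂ : IsAlloc N (R \ R₁) (D \ D₁) η₂)
    {c : C} (hc : c ∉ D₁) : rateOf N R (η₁ + η₂) c = rateOf N (R \ R₁) η₂ c := by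
  rw [rateOf_add, h₁.rateOf_eq_zero hc, zero_add, h₂.rateOf_eq Finset.sdiff_subset]

theorem IsAlloc.midpoint (h₁ : IsAlloc N R D η₁) (h₂ : IsAlloc N R D η₂) :
    IsAlloc N R D ((1 / 2 : ℝ) • (η₁ + η₂)) where
  nonneg s c := mul_nonneg (by norm_num) (add_nonneg (h₁.nonneg s c) (h₂.nonneg s c))
  off s c h := by
    simp [h₁.off s c h, h₂.off s c h]
  server s hs := by
    simp only [Pi.smul_apply, Pi.add_apply, smul_eq_mul]
    rw [← Finset.mul_sum, Finset.sum_add_distrib, h₁.server s hs, h₂.server s hs]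
    norm_num

/-! ### The types whose rate is forced -/

open Classical in
/-- The types that have no slack in any optimal solution with value `m`. -/
noncomputable def forced (N : Network S C) (R : Finset S) (D : Finset C) (m : ℝ) : Finset C :=
  D.filter fun c => ∀ η, IsBest N R D η m → rateOf N R η c = m

theorem mem_forced {c : C} :
    c ∈ forced N R D m ↔ c ∈ D ∧ ∀ η, IsBest N R D η m → rateOf N R η c = m := by
  classical exact Finset.mem_filter

theorem forced_subset : forced N R D m ⊆ D := fun _ h => (mem_forced.1 h).1

/-- There is an optimal solution in which all the slacks that can be positive are positive. -/
theorem IsBest.exists_strict (h : IsBest N R D η m) :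
    ∃ η', IsBest N R D η' m ∧ ∀ c ∈ D, c ∉ forced N R D m → m < rateOf N R η' c := by
  classical
  -- Choose an optimal solution with the largest number of slack types. The midpoint of two optimal
  -- solutions has slack wherever one of them has, so no further type can be added.
  obtain ⟨k, ⟨η', hη', hk⟩, hmax⟩ : ∃ k : ℕ, (∃ η', IsBest N R D η' m ∧
      (D.filter fun c => m < rateOf N R η' c).card = k) ∧
      ∀ k', (∃ η', IsBest N R D η' m ∧
        (D.filter fun c => m < rateOf N R η' c).card = k') → k' ≤ k := by
    have hb : ∀ k', (∃ η', IsBest N R D η' m ∧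
        (D.filter fun c => m < rateOf N R η' c).card = k') → k' ≤ D.card := by
      rintro _ ⟨η', -, rfl⟩
      exact Finset.card_filter_le _ _
    exact ⟨Nat.findGreatest _ D.card, Nat.findGreatest_spec (P := fun k' => ∃ η',
      IsBest N R D η' m ∧ (D.filter fun c => m < rateOf N R η' c).card = k')
        (hb _ ⟨η, h, rfl⟩) ⟨η, h, rfl⟩, fun k' hk' => Nat.le_findGreatest (hb k' hk') hk'⟩
  refine ⟨η', hη', fun c hc hcf => ?_⟩
  by_contra hcm
  rw [mem_forced] at hcf
  push Not at hcf
  obtain ⟨η'', hη'', hne⟩ := hcf hc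
  have hlt : m < rateOf N R η'' c := lt_of_le_of_ne (hη''.le_rate c hc) hne.symm
  have hrate : ∀ c, rateOf N R ((1 / 2 : ℝ) • (η' + η'')) c =
      (rateOf N R η' c + rateOf N R η'' c) / 2 := fun c => by
    rw [rateOf_smul, rateOf_add]; ring
  have hmid : IsBest N R D ((1 / 2 : ℝ) • (η' + η'')) m :=
    h.isBest (hη'.toIsAlloc.midpoint hη''.toIsAlloc) fun c hc => by
      rw [hrate]
      have := hη'.le_rate c hc
      have := hη''.le_rate c hc
      linarith
  have hcard := hmax _ ⟨_, hmid, rfl⟩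
  rw [← hk] at hcard
  refine absurd (Finset.card_lt_card ?_) (not_lt.2 hcard)
  refine Finset.ssubset_iff_of_subset (fun c hc => ?_) |>.2 ⟨c, ?_, ?_⟩
  · rw [Finset.mem_filter] at hc ⊢
    refine ⟨hc.1, ?_⟩
    rw [hrate]
    have := hη''.le_rate c hc.1
    linarith [hc.2]
  · rw [Finset.mem_filter, hrate]
    have := hη'.le_rate c hc
    exact ⟨hc, by linarith⟩
  · rw [Finset.mem_filter]
    exact fun h => hcm h.2

theorem IsBest.forced_nonempty (h : IsBest N R D η m) : (forced N R D m).Nonempty := by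
  obtain ⟨η', hη', hlt⟩ := h.exists_strict
  obtain ⟨c, hc, hle⟩ := h.exists_le η' hη'.toIsAlloc
  by_contra hne
  rw [Finset.not_nonempty_iff_eq_empty] at hne
  exact absurd (hlt c hc (by simp [hne])) (not_lt.2 hle)

/-- In an optimal solution with the largest possible set of slacks, the servers of the forced types
serve only these types. -/
theorem IsBest.eq_zero_of_strict (h : IsBest N R D η m)
    (hlt : ∀ c ∈ D, c ∉ forced N R D m → m < rateOf N R η c) {s : S} {c c₁ : C} (hs : s ∈ R)
    (hc₁ : c₁ ∈ forced N R D m) (hG : N.compat s c₁) (hc : c ∈ D) (hcf : c ∉ forced N R D m) :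
    η s c = 0 := by
  by_contra hne
  have hpos : 0 < η s c := lt_of_le_of_ne (h.nonneg s c) (Ne.symm hne)
  have hGc : N.compat s c := by
    by_contra hG'
    exact hne (h.off s c fun h => hG' h.2.2)
  have hgc := N.coeff_pos hGc
  have hg1 := N.coeff_pos hG
  have hcc : c ≠ c₁ := fun h => hcf (h ▸ hc₁)
  have hslack := sub_pos.2 (hlt c hc hcf)
  -- Time `ε` of `s` is moved from `c` to `c₁`; it is at most what `c` receives, and small enough
  -- that `c` keeps rate at least `m`. Then `c₁` acquires slack, although it is forced.
  set ε := min (η s c) ((rateOf N R η c - m) / (N.speed s c / N.frac c)) with hε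
  have hε0 : 0 < ε := lt_min hpos (div_pos hslack hgc)
  have hε1 : ε ≤ η s c := min_le_left _ _
  have hε2 : N.speed s c / N.frac c * ε ≤ rateOf N R η c - m := by
    rw [mul_comm, ← le_div_iff₀ hgc]
    exact min_le_right _ _
  set x : S → C → ℝ := Pi.single s (Pi.single c₁ ε - Pi.single c ε) with hx
  have hxs : x s = Pi.single c₁ ε - Pi.single c ε := Pi.single_eq_same _ _
  have hxne : ∀ s', s' ≠ s → x s' = 0 := fun s' hs' => Pi.single_eq_of_ne hs' _
  have hxc₁ : x s c₁ = ε := by rw [hxs]; simp [hcc.symm]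
  have hxc : x s c = -ε := by rw [hxs]; simp [hcc]
  have hxo : ∀ c', c' ≠ c → c' ≠ c₁ → x s c' = 0 := fun c' h1 h2 => by rw [hxs]; simp [h1, h2]
  have hrate : ∀ c', rateOf N R (η + x) c' = rateOf N R η c' + N.speed s c' / N.frac c' * x s c' :=
    fun c' => by
      rw [rateOf_add]
      congr 1
      refine Finset.sum_eq_single_of_mem s hs fun s' _ hs' => ?_
      rw [hxne s' hs', Pi.zero_apply, mul_zero]
  have halloc : IsAlloc N R D (η + x) := by
    refine ⟨fun s' c' => ?_, fun s' c' hsc => ?_, fun s' hs' => ?_⟩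
    · by_cases hs' : s' = s
      · subst hs'
        have := h.nonneg s' c'
        by_cases h1 : c' = c
        · subst h1
          rw [Pi.add_apply, Pi.add_apply, hxc]; linarith
        by_cases h2 : c' = c₁
        · subst h2
          rw [Pi.add_apply, Pi.add_apply, hxc₁]; linarith
        · rw [Pi.add_apply, Pi.add_apply, hxo c' h1 h2]; linarith
      · rw [Pi.add_apply, Pi.add_apply, hxne s' hs']
        simpa using h.nonneg s' c'
    · rw [Pi.add_apply, Pi.add_apply, h.off s' c' hsc, zero_add]
      by_cases hs' : s' = s
      · subst hs'
        refine hxo c' ?_ ?_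
        · rintro rfl; exact hsc ⟨hs, hc, hGc⟩
        · rintro rfl; exact hsc ⟨hs, forced_subset hc₁, hG⟩
      · rw [hxne s' hs', Pi.zero_apply]
    · simp only [Pi.add_apply, Finset.sum_add_distrib]
      rw [h.server s' hs']
      by_cases hss : s' = s
      · subst hss
        rw [hxs]
        simp [Pi.single_apply, hc, forced_subset hc₁]
      · simp [hxne s' hss]
  have hbest : IsBest N R D (η + x) m := h.isBest halloc fun c' hc' => by
    rw [hrate]
    have hle := h.le_rate c' hc'
    by_cases h1 : c' = c
    · subst h1
      rw [hxc]; linarith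
    by_cases h2 : c' = c₁
    · subst h2
      rw [hxc₁]
      have := mul_pos hg1 hε0
      linarith
    · rw [hxo c' h1 h2]; linarith
  have h1 := (mem_forced.1 hc₁).2 _ hbest
  rw [hrate, hxc₁, (mem_forced.1 hc₁).2 η h] at h1
  have := mul_pos hg1 hε0
  linarith

theorem mem_serversOf {s : S} : s ∈ serversOf N R D ↔ s ∈ R ∧ ∃ c ∈ D, N.compat s c := by
  classical exact Finset.mem_filter

theorem serversOf_subset : serversOf N R D ⊆ R := fun _ h => (mem_serversOf.1 h).1

end LP

end FCFS

namespace FCFS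

set_option linter.unusedSectionVars false

/-! ## The decomposition -/

section Decomposition

variable {S C : Type*} [Fintype S] [DecidableEq S] [Fintype C] [DecidableEq C] {N : Network S C}
  {R : Finset S} {D : Finset C} {η : S → C → ℝ} {m : ℝ} {b : Block S C} {d d₁ d₂ : List (Block S C)}

/-- In every optimal solution all the types are served at the same rate. -/
def Rigid (N : Network S C) (R : Finset S) (D : Finset C) (m : ℝ) : Prop :=
  ∀ η, IsBest N R D η m → ∀ c ∈ D, rateOf N R η c = m

theorem rigid_iff (hD : D.Nonempty) : Rigid N R D m ↔
    ∀ η θ, IsOptimal N R D η m θ → ∀ c, θ c = 0 := by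
  constructor
  · intro h η θ hopt c
    by_cases hc : c ∈ D
    · rw [hopt.1.slack_eq hc, h η (hopt.isBest hD) c hc, sub_self]
    · exact hopt.1.slack_off c hc
  · intro h η hbest c hc
    have := h η _ hbest.isOptimal c
    rw [slackOf_mem hc] at this
    linarith

/-- The definition takes set differences with classical decidable equality; here they use the
ambient instances. -/
theorem isDecomposition_cons : IsDecomposition N R D (b :: d) ↔
    b.types ⊆ D ∧ b.types.Nonempty ∧ b.servers = serversOf N R b.types ∧
    IsOptimalValue N R D b.rate ∧ IsOptimalValue N b.servers b.types b.rate ∧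
    (∀ η θ, IsOptimal N b.servers b.types η b.rate θ → ∀ c, θ c = 0) ∧
    (∀ b' ∈ d, b.rate < b'.rate) ∧
    IsDecomposition N (R \ b.servers) (D \ b.types) d := by
  rw [IsDecomposition]
  convert! Iff.rfl

/-- The first block of the decomposition of `(R, D)`, and what remains. -/
theorem IsBest.first_block (h : IsBest N R D η m) :
    (∃ η₁, IsBest N (serversOf N R (forced N R D m)) (forced N R D m) η₁ m) ∧
      Rigid N (serversOf N R (forced N R D m)) (forced N R D m) m ∧
      ∃ η₂, IsAlloc N (R \ serversOf N R (forced N R D m)) (D \ forced N R D m) η₂ ∧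
        ∀ c ∈ D \ forced N R D m,
          m < rateOf N (R \ serversOf N R (forced N R D m)) η₂ c := by
  obtain ⟨η₀, h₀, hlt⟩ := h.exists_strict
  set F := forced N R D m with hF
  set T := serversOf N R F with hT
  -- With `hzero'` this splits `η₀` into an allocation of the block and one of the rest.
  have hzero : ∀ s ∈ T, ∀ c ∈ D, c ∉ F → η₀ s c = 0 := fun s hs c hc hcF => by
    obtain ⟨hsR, c₁, hc₁, hG⟩ := mem_serversOf.1 hs
    exact h₀.eq_zero_of_strict hlt hsR hc₁ hG hc hcF
  have hzero' : ∀ s ∈ R, s ∉ T → ∀ c ∈ F, η₀ s c = 0 := fun s hs hsT c hc =>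
    h₀.off s c fun h' => hsT (mem_serversOf.2 ⟨hs, c, hc, h'.2.2⟩)
  have h₁ : IsAlloc N T F (restrict T F η₀) :=
    h₀.toIsAlloc.restrict serversOf_subset forced_subset hzero
  have hr₁ : ∀ c ∈ F, rateOf N T (restrict T F η₀) c = m := fun c hc => by
    rw [rateOf_restrict serversOf_subset hc fun s hs hsT => hzero' s hs hsT c hc]
    exact (mem_forced.1 hc).2 η₀ h₀
  have h₂ : IsAlloc N (R \ T) (D \ F) (restrict (R \ T) (D \ F) η₀) :=
    h₀.toIsAlloc.restrict Finset.sdiff_subset Finset.sdiff_subset fun s hs c hc hcF =>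
      hzero' s (Finset.mem_sdiff.1 hs).1 (Finset.mem_sdiff.1 hs).2 c (by simpa [hc] using hcF)
  have hr₂ : ∀ c ∈ D \ F, m < rateOf N (R \ T) (restrict (R \ T) (D \ F) η₀) c := fun c hc => by
    have hc' := Finset.mem_sdiff.1 hc
    rw [rateOf_restrict Finset.sdiff_subset hc fun s hs hsT =>
      hzero s (by simpa [hs] using hsT) c hc'.1 hc'.2]
    exact hlt c hc'.1 hc'.2
  -- An allocation of the block with rates at least `m`, combined with the rest of `η₀`, is optimal
  -- for the whole system and so has no slack on the forced types.
  have key : ∀ η', IsAlloc N T F η' → (∀ c ∈ F, m ≤ rateOf N T η' c) →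
      ∀ c ∈ F, rateOf N T η' c = m := fun η' hη' hle c hc => by
    have hb : IsBest N R D (η' + restrict (R \ T) (D \ F) η₀) m :=
      h.isBest (hη'.add h₂ serversOf_subset forced_subset) fun c hc => by
        by_cases hcF : c ∈ F
        · rw [hη'.rateOf_add_left h₂ serversOf_subset hcF]
          exact hle c hcF
        · rw [hη'.rateOf_add_right h₂ hcF]
          exact (hr₂ c (Finset.mem_sdiff.2 ⟨hc, hcF⟩)).le
    rw [← hη'.rateOf_add_left h₂ serversOf_subset hc]
    exact (mem_forced.1 hc).2 _ hb
  refine ⟨⟨_, h₁, fun c hc => (hr₁ c hc).ge, fun η' hη' => ?_⟩,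
    fun η' hη' => key η' hη'.toIsAlloc hη'.le_rate, _, h₂, hr₂⟩
  by_contra! hno
  obtain ⟨c, hc⟩ := h.forced_nonempty
  exact (hno c hc).ne' (key η' hη' (fun c hc => (hno c hc).le) c hc)

/-- The first rate is the optimal value of the whole system, hence exceeds `m`, and later rates are
larger still. -/
theorem IsDecomposition.lt_rate (hd : IsDecomposition N R D d) (hη : IsAlloc N R D η)
    (hm : ∀ c ∈ D, m < rateOf N R η c) : ∀ b ∈ d, m < b.rate := by
  rcases d with _ | ⟨b, d⟩
  · simp
  · obtain ⟨h1, h2, -, h4, -, -, h7, -⟩ := hd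
    have hD : D.Nonempty := h2.mono h1
    obtain ⟨η', hη'⟩ := h4.exists_isBest hD
    obtain ⟨c, hc, hle⟩ := hη'.exists_le η hη
    have hb := (hm c hc).trans_le hle
    intro b' hb'
    rcases List.mem_cons.1 hb' with rfl | hb'
    · exact hb
    · exact hb.trans (h7 b' hb')

/-- Split off the forced types and proceed by induction on the number of types. In the remainder
every server has a type because an allocation exists there, and every type has a server because its
rate is positive. -/
theorem exists_isDecomposition (N : Network S C) (R : Finset S) (D : Finset C)
    (hR : ∀ s ∈ R, ∃ c ∈ D, N.compat s c) (hD : ∀ c ∈ D, ∃ s ∈ R, N.compat s c) :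
    ∃ d, IsDecomposition N R D d := by
  induction hn : D.card using Nat.strong_induction_on generalizing R D with
  | _ n ih =>
    rcases D.eq_empty_or_nonempty with rfl | hne
    · refine ⟨[], Finset.eq_empty_of_forall_notMem fun s hs => by simpa using hR s hs, rfl⟩
    obtain ⟨η, m, h⟩ := exists_isBest hne hR
    have hm := h.pos hD
    obtain ⟨⟨η₁, h₁⟩, hrig, η₂, h₂, hlt⟩ := h.first_block
    have hFne := h.forced_nonempty
    set F := forced N R D m with hF
    have hFD : F ⊆ D := forced_subset
    obtain ⟨d, hd⟩ := ih (D \ F).card (by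
      rw [← hn]
      exact Finset.card_lt_card (Finset.sdiff_ssubset hFD hFne)) (R \ serversOf N R F) (D \ F)
      (fun s hs => h₂.exists_compat hs) (fun c hc => by
        obtain ⟨s, hs, hne⟩ := IsAlloc.exists_arc (hm.trans (hlt c hc))
        refine ⟨s, hs, ?_⟩
        by_contra hG
        exact hne (h₂.off s c fun h' => hG h'.2.2)) rfl
    exact ⟨⟨serversOf N R F, F, m⟩ :: d, isDecomposition_cons.2 ⟨hFD, hFne, rfl, h.isOptimalValue, h₁.isOptimalValue,
      (rigid_iff hFne).1 hrig, hd.lt_rate h₂ hlt, hd⟩⟩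

/-- An optimal solution of the whole system restricts, after completion, to an optimal one of the
rigid block, so the types of the block are forced. Conversely, an optimal solution of the block
together with one of the rest, whose value is larger, gives every other type slack. -/
theorem IsDecomposition.types_eq (hd : IsDecomposition N R D (b :: d)) :
    b.types = forced N R D b.rate := by
  obtain ⟨h1, h2, h3, h4, h5, h6, h7, h8⟩ := isDecomposition_cons.1 hd
  have hrig := (rigid_iff h2).2 h6
  obtain ⟨η₁, hη₁⟩ := h5.exists_isBest h2
  obtain ⟨η₀, hη₀⟩ := h4.exists_isBest (h2.mono h1)
  have hsR : b.servers ⊆ R := h3 ▸ serversOf_subset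
  refine Finset.Subset.antisymm (fun c hc => mem_forced.2 ⟨h1 hc, fun η hη => ?_⟩) fun c hc => ?_
  · have hrate : ∀ c ∈ b.types,
        rateOf N b.servers (restrict b.servers b.types η) c = rateOf N R η c := fun c hc =>
      rateOf_restrict hsR hc fun s hs hsb => hη.off s c fun h' =>
        hsb (h3 ▸ mem_serversOf.2 ⟨hs, c, hc, h'.2.2⟩)
    obtain ⟨η', hη', hge⟩ := exists_isAlloc (N := N) (R := b.servers) (D := b.types)
      (a := restrict b.servers b.types η) (restrict_nonneg hη.nonneg)
      (fun s hs c hc hG => by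
        rw [restrict_mem hs hc]
        exact hη.off s c fun h' => hG h'.2.2)
      (fun s hs => by
        rw [Finset.sum_congr rfl fun c hc => restrict_mem hs hc, ← hη.server s (hsR hs)]
        exact Finset.sum_le_sum_of_subset_of_nonneg h1 fun c _ _ => hη.nonneg s c)
      (fun s hs => (mem_serversOf.1 (h3 ▸ hs)).2)
    have hb : IsBest N b.servers b.types η' b.rate := hη₁.isBest hη' fun c hc =>
      (hη.le_rate c (h1 hc)).trans ((hrate c hc).ge.trans (hge c hc))
    refine le_antisymm ?_ (hη.le_rate c (h1 hc))
    rw [← hrate c hc, ← hrig η' hb c hc]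
    exact hge c hc
  · by_contra hcb
    have hcD := forced_subset hc
    rcases d with _ | ⟨b₂, d⟩
    · have := h8.2 ▸ Finset.mem_sdiff.2 ⟨hcD, hcb⟩
      simp at this
    · have hlt := h7 b₂ (List.mem_cons_self ..)
      obtain ⟨g1, g2, -, g4, -⟩ := h8
      obtain ⟨η₂, hη₂⟩ := g4.exists_isBest (g2.mono g1)
      have hb : IsBest N R D (η₁ + η₂) b.rate :=
        hη₀.isBest (hη₁.toIsAlloc.add hη₂.toIsAlloc hsR h1) fun c hc => by
          by_cases hcb : c ∈ b.types
          · rw [hη₁.toIsAlloc.rateOf_add_left hη₂.toIsAlloc hsR hcb]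
            exact hη₁.le_rate c hcb
          · rw [hη₁.toIsAlloc.rateOf_add_right hη₂.toIsAlloc hcb]
            exact hlt.le.trans (hη₂.le_rate c (Finset.mem_sdiff.2 ⟨hc, hcb⟩))
      have heq := (mem_forced.1 hc).2 _ hb
      rw [hη₁.toIsAlloc.rateOf_add_right hη₂.toIsAlloc hcb] at heq
      have := hη₂.le_rate c (Finset.mem_sdiff.2 ⟨hcD, hcb⟩)
      linarith

theorem IsDecomposition.unique (hd : IsDecomposition N R D d) :
    ∀ {d'}, IsDecomposition N R D d' → d' = d := by
  induction d generalizing R D with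
  | nil =>
    rintro (_ | ⟨b, d'⟩) hd'
    · rfl
    · have := hd'.2.1.mono hd'.1
      rw [hd.2] at this
      simp at this
  | cons b d ih =>
    rintro (_ | ⟨b', d'⟩) hd'
    · have := hd.2.1.mono hd.1
      rw [hd'.2] at this
      simp at this
    · have hne := hd.2.1.mono hd.1
      obtain ⟨η, hη⟩ := hd.2.2.2.1.exists_isBest hne
      obtain ⟨η', hη'⟩ := hd'.2.2.2.1.exists_isBest hne
      have hrate : b'.rate = b.rate := hη'.unique hη
      have htypes : b'.types = b.types := by rw [hd.types_eq, hd'.types_eq, hrate]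
      have hservers : b'.servers = b.servers := by rw [hd.2.2.1, hd'.2.2.1, htypes]
      have hb : b' = b := by
        cases b; cases b'
        simp only at hrate htypes hservers
        rw [hrate, htypes, hservers]
      subst hb
      rw [ih hd.2.2.2.2.2.2.2 hd'.2.2.2.2.2.2.2]

/-- After the removal of the leading blocks, the remaining list decomposes what they leave over. -/
theorem IsDecomposition.append (hd : IsDecomposition N R D (d₁ ++ b :: d₂)) :
    ∃ R' D', (∀ s, s ∈ R' ↔ s ∈ R ∧ ∀ b' ∈ d₁, s ∉ b'.servers) ∧
      (∀ c, c ∈ D' ↔ c ∈ D ∧ ∀ b' ∈ d₁, c ∉ b'.types) ∧ IsDecomposition N R' D' (b :: d₂) := by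
  induction d₁ generalizing R D with
  | nil => exact ⟨R, D, by simp, by simp, hd⟩
  | cons b₁ d₁ ih =>
    obtain ⟨R', D', h1, h2, h3⟩ := ih (isDecomposition_cons.1 hd).2.2.2.2.2.2.2
    refine ⟨R', D', fun s => ?_, fun c => ?_, h3⟩
    · rw [h1, Finset.mem_sdiff, List.forall_mem_cons, and_assoc]
    · rw [h2, Finset.mem_sdiff, List.forall_mem_cons, and_assoc]

theorem IsDecomposition.subset (hd : IsDecomposition N R D d) (hb : b ∈ d) :
    b.servers ⊆ R ∧ b.types ⊆ D := by
  obtain ⟨d₁, d₂, rfl⟩ := List.append_of_mem hb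
  obtain ⟨R', D', h1, h2, h3⟩ := hd.append
  exact ⟨fun s hs => ((h1 s).1 (serversOf_subset (h3.2.2.1 ▸ hs))).1,
    fun c hc => ((h2 c).1 (h3.1 hc)).1⟩

theorem IsDecomposition.disjoint (hd : IsDecomposition N R D d) {b' : Block S C} (hb : b ∈ d)
    (hb' : b' ∈ d) (h : (∃ s, s ∈ b.servers ∧ s ∈ b'.servers) ∨ ∃ c, c ∈ b.types ∧ c ∈ b'.types) :
    b = b' := by
  induction d generalizing R D with
  | nil => simp at hb
  | cons b₀ d ih =>
    have hrest := (isDecomposition_cons.1 hd).2.2.2.2.2.2.2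
    have key : ∀ b' ∈ d, ¬ ((∃ s, s ∈ b₀.servers ∧ s ∈ b'.servers) ∨
        ∃ c, c ∈ b₀.types ∧ c ∈ b'.types) := by
      rintro b' hb' (⟨s, hs, hs'⟩ | ⟨c, hc, hc'⟩)
      · exact (Finset.mem_sdiff.1 ((hrest.subset hb').1 hs')).2 hs
      · exact (Finset.mem_sdiff.1 ((hrest.subset hb').2 hc')).2 hc
    rcases List.mem_cons.1 hb with rfl | h₁ <;> rcases List.mem_cons.1 hb' with rfl | h₂
    · rfl
    · exact absurd h (key b' h₂)
    · refine absurd ?_ (key b h₁)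
      simpa only [and_comm] using h
    · exact ih hrest h₁ h₂

/-- The properties of a block. -/
theorem IsDecomposition.block (hd : IsDecomposition N R D d) (hb : b ∈ d) :
    b.types.Nonempty ∧ Rigid N b.servers b.types b.rate ∧
      ∃ η, IsBest N b.servers b.types η b.rate := by
  obtain ⟨d₁, d₂, rfl⟩ := List.append_of_mem hb
  obtain ⟨R', D', -, -, h⟩ := hd.append
  exact ⟨h.2.1, (rigid_iff h.2.1).2 h.2.2.2.2.2.1, h.2.2.2.2.1.exists_isBest h.2.1⟩

theorem IsDecomposition.rate_pos (hd : IsDecomposition N R D d)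
    (hR : ∀ s ∈ R, ∃ c ∈ D, N.compat s c) (hD : ∀ c ∈ D, ∃ s ∈ R, N.compat s c) (hb : b ∈ d) :
    0 < b.rate := by
  have hne : D.Nonempty := (hd.block hb).1.mono (hd.subset hb).2
  obtain ⟨η, m, h⟩ := exists_isBest hne hR
  exact hd.lt_rate h.toIsAlloc (fun c hc => (h.pos hD).trans_le (h.le_rate c hc)) b hb

end Decomposition

end FCFS

namespace FCFS

set_option linter.unusedSectionVars false

/-! ## Columns, prices and bases -/

section Columns

variable {S C : Type*} [Fintype S] [DecidableEq S] [Fintype C] [DecidableEq C] {N : Network S C}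
  {R : Finset S} {D K : Finset C} {η : S → C → ℝ} {m : ℝ} {E : S → C → Prop}

theorem column_rate_inl (s : S) : column N D Var.rate (Sum.inl s) = 0 := rfl

theorem column_rate_inr (c : C) : column N D Var.rate (Sum.inr c) = if c ∈ D then 1 else 0 := by
  simp [column]

theorem column_arc_inl (s s' : S) (c : C) :
    column N D (Var.arc s c) (Sum.inl s') = if s' = s then 1 else 0 := by
  simp [column, Pi.single_apply]

theorem column_arc_inr (s : S) (c c' : C) :
    column N D (Var.arc s c) (Sum.inr c') = if c' = c then -(N.speed s c / N.frac c) else 0 := by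
  by_cases h : c' = c <;> simp [column, h]

theorem column_slack_inl (s : S) (c : C) :
    column N D (Var.slack c) (Sum.inl s) = 0 := by
  simp [column]

theorem column_slack_inr (c c' : C) :
    column N D (Var.slack c) (Sum.inr c') = if c' = c then 1 else 0 := by
  simp [column, Pi.single_apply]

theorem column_arc_eq (s : S) (c : C) : column N D (Var.arc s c) =
    Pi.single (Sum.inl s) 1 - (N.speed s c / N.frac c) • Pi.single (Sum.inr c) 1 := by
  ext (s' | c')
  · rw [column_arc_inl]; simp [Pi.single_apply]
  · rw [column_arc_inr]
    by_cases h : c' = c <;> simp [h]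

theorem column_slack_eq (c : C) : column N D (Var.slack c) = Pi.single (Sum.inr c) 1 := by
  ext (s' | c')
  · rw [column_slack_inl]; simp
  · rw [column_slack_inr]; simp [Pi.single_apply]

theorem column_rate_eq : column N D Var.rate =
    ∑ c ∈ D, (Pi.single (Sum.inr c) 1 : S ⊕ C → ℝ) := by
  ext (s' | c')
  · rw [column_rate_inl, Finset.sum_apply]; simp
  · rw [column_rate_inr, Finset.sum_apply]; simp [Pi.single_apply]

/-- The variables of the arcs of `E`. -/
def arcSet (E : S → C → Prop) : Set (Var S C) :=
  (fun p : S × C => Var.arc p.1 p.2) '' {p | E p.1 p.2}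

theorem mem_arcSet {v : Var S C} : v ∈ arcSet E ↔ ∃ s c, E s c ∧ v = Var.arc s c := by
  constructor
  · rintro ⟨⟨s, c⟩, h, rfl⟩
    exact ⟨s, c, h, rfl⟩
  · rintro ⟨s, c, h, rfl⟩
    exact ⟨(s, c), h, rfl⟩

theorem arc_injective : Function.Injective fun p : S × C => (Var.arc p.1 p.2 : Var S C) := by
  rintro ⟨s, c⟩ ⟨s', c'⟩ h
  simpa using h

/-- Prices that are tight on the arcs of `E`, if the rate column is independent of the arcs. -/
theorem exists_price (h : column N K Var.rate ∉ Submodule.span ℝ (column N D '' arcSet E)) :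
    ∃ (y : S → ℝ) (z : C → ℝ), (∀ s c, E s c → y s = N.speed s c / N.frac c * z c) ∧
      ∃ c ∈ K, z c ≠ 0 := by
  -- The functional vanishes on the arc columns, which says that prices are tight, but not on the
  -- rate column, which says that they do not sum to zero over `K`.
  obtain ⟨f, hf, hker⟩ := Submodule.exists_le_ker_of_notMem h
  refine ⟨fun s => f (Pi.single (Sum.inl s) 1), fun c => f (Pi.single (Sum.inr c) 1),
    fun s c hE => ?_, ?_⟩
  · have h1 := hker (Submodule.subset_span ⟨_, mem_arcSet.2 ⟨s, c, hE, rfl⟩, rfl⟩)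
    rw [LinearMap.mem_ker, column_arc_eq, map_sub, map_smul, smul_eq_mul, sub_eq_zero] at h1
    exact h1
  · rw [column_rate_eq, map_sum] at hf
    exact Finset.exists_ne_zero_of_sum_ne_zero hf

/-- Linear combinations of arc columns. -/
theorem sum_column_inl (x : S × C → ℝ) (s : S) :
    (∑ p, x p • column N D (Var.arc p.1 p.2)) (Sum.inl s) = ∑ c, x (s, c) := by
  rw [Finset.sum_apply, Fintype.sum_prod_type, Finset.sum_eq_single_of_mem s (Finset.mem_univ s)]
  · simp [column_arc_inl]
  · intro s' _ hs'
    simp [column_arc_inl, hs'.symm]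

theorem sum_column_inr (x : S × C → ℝ) (c : C) :
    (∑ p, x p • column N D (Var.arc p.1 p.2)) (Sum.inr c) =
      -∑ s, N.speed s c / N.frac c * x (s, c) := by
  rw [Finset.sum_apply, Fintype.sum_prod_type, ← Finset.sum_neg_distrib]
  refine Finset.sum_congr rfl fun s _ => ?_
  rw [Finset.sum_eq_single_of_mem c (Finset.mem_univ c)]
  · simp [column_arc_inr, mul_comm]
  · intro c' _ hc'
    simp [column_arc_inr, hc'.symm]

theorem coeff_of_sum [DecidablePred fun p : S × C => E p.1 p.2] {x : S × C → ℝ} {w : S ⊕ C → ℝ}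
    (h : ∑ p with E p.1 p.2, x p • column N D (Var.arc p.1 p.2) = w) :
    ∃ x' : S → C → ℝ, (∀ s c, E s c → x' s c = x (s, c)) ∧ (∀ s c, ¬ E s c → x' s c = 0) ∧
      (∀ s, ∑ c, x' s c = w (Sum.inl s)) ∧
      ∀ c, ∑ s, N.speed s c / N.frac c * x' s c = -w (Sum.inr c) := by
  subst h
  rw [Finset.sum_filter, Finset.sum_congr rfl fun (p : S × C) _ =>
    show (if E p.1 p.2 then x p • column N D (Var.arc p.1 p.2) else 0) =
      (if E p.1 p.2 then x p else 0) • column N D (Var.arc p.1 p.2) by split_ifs <;> simp]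
  refine ⟨fun s c => if E (s, c).1 (s, c).2 then x (s, c) else 0, fun s c hE => if_pos hE,
    fun s c hE => if_neg hE, fun s => ?_, fun c => ?_⟩
  · rw [sum_column_inl]
  · rw [sum_column_inr, neg_neg]

theorem arcSet_eq [DecidablePred fun p : S × C => E p.1 p.2] : arcSet E =
    (fun p : S × C => Var.arc p.1 p.2) ''
      ((Finset.univ.filter fun p : S × C => E p.1 p.2 : Finset (S × C)) : Set (S × C)) := by
  rw [arcSet]
  congr 1
  ext
  simp

theorem exists_coeff_of_mem_span {w : S ⊕ C → ℝ}
    (h : w ∈ Submodule.span ℝ (column N D '' arcSet E)) :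
    ∃ x : S → C → ℝ, (∀ s c, ¬ E s c → x s c = 0) ∧ (∀ s, ∑ c, x s c = w (Sum.inl s)) ∧
      ∀ c, ∑ s, N.speed s c / N.frac c * x s c = -w (Sum.inr c) := by
  classical
  rw [arcSet_eq, Set.image_image, Submodule.mem_span_image_finset_iff_exists_fun'] at h
  obtain ⟨x, h⟩ := h
  obtain ⟨x', -, hx'⟩ := coeff_of_sum h
  exact ⟨x', hx'⟩

theorem exists_coeff_of_not_linearIndepOn
    (h : ¬ LinearIndepOn ℝ (column N D) (arcSet E)) :
    ∃ x : S → C → ℝ, (∃ s c, x s c ≠ 0) ∧ (∀ s c, ¬ E s c → x s c = 0) ∧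
      (∀ s, ∑ c, x s c = 0) ∧ ∀ c, ∑ s, N.speed s c / N.frac c * x s c = 0 := by
  classical
  have h' : ¬ LinearIndepOn ℝ (column N D ∘ fun p : S × C => Var.arc p.1 p.2)
      ((Finset.univ.filter fun p : S × C => E p.1 p.2 : Finset (S × C)) : Set (S × C)) :=
    fun hli => h (by rw [arcSet_eq]; exact hli.image_of_comp)
  rw [linearIndepOn_finset_iff] at h'
  push Not at h'
  obtain ⟨x, hx, ⟨s, c⟩, hp, hne⟩ := h'
  obtain ⟨x', h1, h2, h3, h4⟩ := coeff_of_sum (w := 0) hx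
  refine ⟨x', ⟨s, c, ?_⟩, h2, h3, fun c => by simpa using h4 c⟩
  rwa [h1 s c (Finset.mem_filter.1 hp).2]

/-- Entries that vanish are not changed, and the finitely many positive ones stay nonnegative for
small `ε`. -/
theorem IsAlloc.exists_add (h : IsAlloc N R D η) {x : S → C → ℝ}
    (hx : ∀ s c, η s c = 0 → x s c = 0) (hrow : ∀ s ∈ R, ∑ c ∈ D, x s c = 0) :
    ∃ ε : ℝ, 0 < ε ∧ IsAlloc N R D (η + ε • x) := by
  have hev : ∀ᶠ ε : ℝ in 𝓝[>] 0, ∀ p : S × C, 0 ≤ η p.1 p.2 + ε * x p.1 p.2 := by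
    rw [eventually_all]
    rintro ⟨s, c⟩
    rcases (h.nonneg s c).eq_or_lt with h0 | hpos
    · exact Eventually.of_forall fun ε => by simp [← h0, hx s c h0.symm]
    · have h1 : Tendsto (fun ε : ℝ => η s c + ε * x s c) (𝓝[>] 0) (𝓝 (η s c + 0 * x s c)) :=
        Tendsto.mono_left (Continuous.tendsto (by fun_prop) 0) nhdsWithin_le_nhds
      rw [zero_mul, add_zero] at h1
      filter_upwards [h1.eventually_const_lt hpos] with ε hε
      exact hε.le
  obtain ⟨ε, hε, hε0⟩ := (hev.and self_mem_nhdsWithin).exists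
  refine ⟨ε, hε0, fun s c => hε (s, c), fun s c hsc => ?_, fun s hs => ?_⟩
  · simp [h.off s c hsc, hx s c (h.off s c hsc)]
  · simp only [Pi.add_apply, Pi.smul_apply, smul_eq_mul, Finset.sum_add_distrib]
    rw [← Finset.mul_sum, hrow s hs, h.server s hs, mul_zero, add_zero]

/-- If the types in `K` can be accelerated by shifting work along positive arcs, an optimal solution
in which they have slack results. -/
theorem Rigid.notMem_span (hr : Rigid N R D m) (h : IsBest N R D η m) (hK : K ⊆ D)
    (hne : K.Nonempty) :
    column N K Var.rate ∉ Submodule.span ℝ (column N D '' arcSet fun s c => 0 < η s c) := by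
  intro hmem
  obtain ⟨x, hx0, hrow, hcol⟩ := exists_coeff_of_mem_span hmem
  have hx : ∀ s c, η s c = 0 → x s c = 0 := fun s c h0 => hx0 s c (by rw [h0]; exact lt_irrefl 0)
  have hx' : ∀ s c, ¬ (s ∈ R ∧ c ∈ D ∧ N.compat s c) → x s c = 0 :=
    fun s c hsc => hx s c (h.off s c hsc)
  -- The direction is `-x` because arc columns have negative entries in the rows of types: it raises
  -- the rates in `K` and no others.
  obtain ⟨ε, hε, hA⟩ := h.toIsAlloc.exists_add (x := -x) (fun s c h0 => by simp [hx s c h0])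
    fun s hs => by
      have h1 := hrow s
      rw [column_rate_inl, ← Finset.sum_subset (Finset.subset_univ D) fun c _ hc =>
        hx' s c fun h => hc h.2.1] at h1
      simp [h1]
  have hrate : ∀ c, rateOf N R (η + ε • -x) c = rateOf N R η c + ε * if c ∈ K then 1 else 0 :=
    fun c => by
      rw [rateOf_add, rateOf_smul]
      congr 2
      have h1 := hcol c
      rw [column_rate_inr, ← Finset.sum_subset (Finset.subset_univ R) fun s _ hs => by
        rw [hx' s c fun h => hs h.1, mul_zero]] at h1
      rw [← neg_eq_iff_eq_neg.2 h1, rateOf, ← Finset.sum_neg_distrib]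
      exact Finset.sum_congr rfl fun s _ => by simp
  obtain ⟨c, hc⟩ := hne
  have h1 := hr _ (h.isBest hA fun c hc => by
    rw [hrate]
    have := h.le_rate c hc
    split_ifs <;> linarith) c (hK hc)
  rw [hrate, if_pos hc, hr _ h c (hK hc)] at h1
  linarith

theorem IsBest.critical {G : S → C → Prop} (h : IsBest N R D η m)
    (hrate : ∀ c ∈ D, rateOf N R η c = m) (hm : 0 < m) (hD : D.Nonempty)
    (hGN : ∀ s c, G s c → N.compat s c) (hclosed : ∀ s c, G s c → (s ∈ R ↔ c ∈ D))
    (hpos : ∀ s ∈ R, ∀ c ∈ D, (G s c ↔ 0 < η s c))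
    (hprice : ∀ K ⊆ D, K.Nonempty → ∃ (y : S → ℝ) (z : C → ℝ),
      (∀ s ∈ R, ∀ c ∈ D, 0 < η s c → y s = N.speed s c / N.frac c * z c) ∧ ∃ c ∈ K, z c ≠ 0) :
    Critical N G R D η m where
  compat := hGN
  closed := hclosed
  pos s hs c hc := (hpos s hs c hc).1
  off s hs c hc hG := le_antisymm (not_lt.1 fun hlt => hG ((hpos s hs c hc).2 hlt)) (h.nonneg s c)
  sum_one := h.server
  rate := hrate
  nonempty := hD
  rate_pos := hm
  price c₀ hc₀ := by
    obtain ⟨y, z, hy, hz⟩ := hprice (component G D c₀) component_subset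
      ⟨c₀, self_mem_component hc₀⟩
    exact ⟨y, z, fun s hs c hc hG => hy s hs c (component_subset hc)
      ((hpos s hs c (component_subset hc)).1 hG), hz⟩

theorem IsBasis.notMem_span {B : Finset (Var S C)} (hB : IsBasis N R D B)
    (hE : ∀ s c, E s c → basicArc B s c) :
    column N D Var.rate ∉ Submodule.span ℝ (column N D '' arcSet E) := by
  refine fun hmem => hB.indep.notMem_span (Finset.mem_coe.2 hB.rate_mem)
    (Submodule.span_mono (Set.image_mono ?_) hmem)
  intro v hv
  obtain ⟨s, c, h, rfl⟩ := mem_arcSet.1 hv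
  exact ⟨hE s c h, by simp⟩

/-! ### Counting the columns of a basis -/

/-- The subspace of the rows in `X`. -/
def rowSpace (X : Finset (S ⊕ C)) : Submodule ℝ (S ⊕ C → ℝ) :=
  Submodule.span ℝ ((fun x : S ⊕ C => (Pi.single x 1 : S ⊕ C → ℝ)) '' (X : Set (S ⊕ C)))

theorem finrank_rowSpace (X : Finset (S ⊕ C)) : Module.finrank ℝ (rowSpace X) = X.card := by
  have h1 : LinearIndependent ℝ fun x : X => (Pi.single x.1 1 : S ⊕ C → ℝ) :=
    (Pi.linearIndependent_single_one (S ⊕ C) ℝ).comp _ Subtype.val_injective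
  have h2 := finrank_span_eq_card h1
  rw [Fintype.card_coe] at h2
  rw [rowSpace, ← h2]
  rw [Set.image_eq_range]
  rfl

theorem single_mem_rowSpace {X : Finset (S ⊕ C)} {x : S ⊕ C} (hx : x ∈ X) :
    (Pi.single x 1 : S ⊕ C → ℝ) ∈ rowSpace X := Submodule.subset_span ⟨x, hx, rfl⟩

theorem column_arc_mem {X : Finset (S ⊕ C)} {s : S} {c : C} (hs : Sum.inl s ∈ X)
    (hc : Sum.inr c ∈ X) : column N D (Var.arc s c) ∈ rowSpace X := by
  rw [column_arc_eq]
  exact Submodule.sub_mem _ (single_mem_rowSpace hs)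
    (Submodule.smul_mem _ _ (single_mem_rowSpace hc))

theorem column_slack_mem {X : Finset (S ⊕ C)} {c : C} (hc : Sum.inr c ∈ X) :
    column N D (Var.slack c) ∈ rowSpace X := by
  rw [column_slack_eq]
  exact single_mem_rowSpace hc

theorem column_rate_mem {X : Finset (S ⊕ C)} (h : ∀ c ∈ D, Sum.inr c ∈ X) :
    column N D Var.rate ∈ rowSpace X := by
  rw [column_rate_eq]
  exact Submodule.sum_mem _ fun c hc => single_mem_rowSpace (h c hc)

theorem finrank_span_column {B : Finset (Var S C)}
    (h : LinearIndepOn ℝ (column N D) (B : Set (Var S C))) :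
    Module.finrank ℝ (Submodule.span ℝ (column N D '' (B : Set (Var S C)))) = B.card := by
  have h1 := finrank_span_eq_card (LinearIndepOn.linearIndependent_restrict h)
  rw [Set.range_domRestrict] at h1
  rw [h1]
  simp

theorem card_le_of_linearIndepOn {B : Finset (Var S C)} {X : Finset (S ⊕ C)}
    (h : LinearIndepOn ℝ (column N D) (B : Set (Var S C)))
    (hX : ∀ v ∈ B, column N D v ∈ rowSpace X) : B.card ≤ X.card := by
  rw [← finrank_span_column h, ← finrank_rowSpace X]
  exact Submodule.finrank_mono (Submodule.span_le.2 (by rintro _ ⟨v, hv, rfl⟩; exact hX v hv))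

theorem span_column_eq_rowSpace {A : Set (Var S C)} {X : Finset (S ⊕ C)}
    (hX : ∀ v ∈ A, column N D v ∈ rowSpace X)
    (hspan : ∀ x ∈ X, (Pi.single x 1 : S ⊕ C → ℝ) ∈ Submodule.span ℝ (column N D '' A)) :
    Submodule.span ℝ (column N D '' A) = rowSpace X :=
  le_antisymm (Submodule.span_le.2 (by rintro _ ⟨v, hv, rfl⟩; exact hX v hv))
    (Submodule.span_le.2 (by rintro _ ⟨x, hx, rfl⟩; exact hspan x hx))

/-- As many columns as rows are independent if they span. -/
theorem linearIndepOn_of_span {B : Finset (Var S C)} {X : Finset (S ⊕ C)}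
    (hX : ∀ v ∈ B, column N D v ∈ rowSpace X)
    (hspan : ∀ x ∈ X, (Pi.single x 1 : S ⊕ C → ℝ) ∈
      Submodule.span ℝ (column N D '' (B : Set (Var S C)))) (hcard : B.card = X.card) :
    LinearIndepOn ℝ (column N D) (B : Set (Var S C)) := by
  have h1 := span_column_eq_rowSpace (A := (B : Set (Var S C))) hX hspan
  refine linearIndependent_iff_card_eq_finrank_span.2 ?_
  have h2 : Set.range (fun v : (B : Set (Var S C)) => column N D v) =
      column N D '' (B : Set (Var S C)) := by
    ext v; simp
  rw [Set.finrank, h2, h1, finrank_rowSpace, ← hcard]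
  simp

end Columns

end FCFS

namespace FCFS

set_option linter.unusedSectionVars false

/-! ## Optimal basic solutions -/

section Bases

variable {S C : Type*} [Fintype S] [DecidableEq S] [Fintype C] [DecidableEq C] {N : Network S C}
  {R : Finset S} {D : Finset C} {η : S → C → ℝ} {m : ℝ} {E : S → C → Prop}

/-- If the columns of the positive arcs are dependent, an optimal solution with fewer positive arcs
exists. -/
theorem IsBest.exists_smaller (h : IsBest N R D η m)
    (hdep : ¬ LinearIndepOn ℝ (column N D) (arcSet fun s c => 0 < η s c)) :
    ∃ η', IsBest N R D η' m ∧ (∀ s c, 0 < η' s c → 0 < η s c) ∧ ∃ s c, 0 < η s c ∧ η' s c = 0 := by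
  classical
  obtain ⟨x, ⟨s₀, c₀, hne⟩, hx0, hrow, hcol⟩ := exists_coeff_of_not_linearIndepOn hdep
  have hx : ∀ s c, x s c ≠ 0 → 0 < η s c := fun s c hne => by
    by_contra h0
    exact hne (hx0 s c h0)
  have hx' : ∀ s c, ¬ (s ∈ R ∧ c ∈ D ∧ N.compat s c) → x s c = 0 :=
    fun s c hsc => hx0 s c (by rw [h.off s c hsc]; exact lt_irrefl 0)
  -- The row of `x` sums to zero and is not zero, so it has a negative entry. The ratio test then
  -- gives the largest step that keeps the allocation nonnegative; it cancels a positive arc and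
  -- does not affect the rates.
  obtain ⟨c₁, -, hneg⟩ : ∃ c ∈ Finset.univ, x s₀ c < 0 := by
    by_contra! hnn
    exact hne ((Finset.sum_eq_zero_iff_of_nonneg hnn).1 (hrow s₀) c₀ (Finset.mem_univ _))
  obtain ⟨⟨s₁, c₂⟩, hmem, hmin⟩ := (Finset.univ.filter fun p : S × C => x p.1 p.2 < 0).exists_min_image
    (fun p => η p.1 p.2 / -x p.1 p.2) ⟨(s₀, c₁), by simpa using hneg⟩
  have hneg₁ : x s₁ c₂ < 0 := (Finset.mem_filter.1 hmem).2
  set t := η s₁ c₂ / -x s₁ c₂ with ht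
  have ht0 : 0 ≤ t := div_nonneg (h.nonneg _ _) (neg_nonneg.2 hneg₁.le)
  have hrate : ∀ c, rateOf N R (η + t • x) c = rateOf N R η c := fun c => by
    have h1 : rateOf N R x c = 0 := by
      rw [← hcol c]
      exact Finset.sum_subset (Finset.subset_univ R) fun s _ hs => by
        rw [hx' s c fun h => hs h.1, mul_zero]
    rw [rateOf_add, rateOf_smul, h1, mul_zero, add_zero]
  refine ⟨η + t • x, h.isBest ⟨fun s c => ?_, fun s c hsc => ?_, fun s hs => ?_⟩ fun c hc => ?_,
    fun s c hpos => ?_, s₁, c₂, hx s₁ c₂ hneg₁.ne, ?_⟩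
  · rw [Pi.add_apply, Pi.add_apply, Pi.smul_apply, Pi.smul_apply, smul_eq_mul]
    rcases le_or_gt 0 (x s c) with hxn | hxn
    · exact add_nonneg (h.nonneg s c) (mul_nonneg ht0 hxn)
    · have h1 := hmin (s, c) (by simpa using hxn)
      rw [le_div_iff₀ (neg_pos.2 hxn)] at h1
      linarith
  · simp [h.off s c hsc, hx' s c hsc]
  · simp only [Pi.add_apply, Pi.smul_apply, smul_eq_mul, Finset.sum_add_distrib]
    have h1 := hrow s
    rw [← Finset.sum_subset (Finset.subset_univ D) fun c _ hc => hx' s c fun h => hc h.2.1] at h1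
    rw [← Finset.mul_sum, h1, h.server s hs, mul_zero, add_zero]
  · rw [hrate]
    exact h.le_rate c hc
  · by_contra h0
    have h1 : η s c = 0 := le_antisymm (not_lt.1 h0) (h.nonneg s c)
    have h2 := hx0 s c h0
    simp [h1, h2] at hpos
  · rw [Pi.add_apply, Pi.add_apply, Pi.smul_apply, Pi.smul_apply, smul_eq_mul, ht]
    have := hneg₁.ne
    field_simp
    ring

/-- Cancel positive arcs as long as their columns are dependent; their number decreases. -/
theorem IsBest.exists_linearIndepOn (h : IsBest N R D η m) :
    ∃ η', IsBest N R D η' m ∧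
      LinearIndepOn ℝ (column N D) (arcSet fun s c => 0 < η' s c) := by
  classical
  induction hn : (Finset.univ.filter fun p : S × C => 0 < η p.1 p.2).card
    using Nat.strong_induction_on generalizing η with
  | _ n ih =>
    by_cases hli : LinearIndepOn ℝ (column N D) (arcSet fun s c => 0 < η s c)
    · exact ⟨η, h, hli⟩
    obtain ⟨η', h', hsub, s, c, hpos, hzero⟩ := h.exists_smaller hli
    refine ih _ ?_ h' rfl
    rw [← hn]
    refine Finset.card_lt_card (Finset.ssubset_iff_of_subset (fun p hp => ?_) |>.2
      ⟨(s, c), by simpa using hpos, by simp [hzero]⟩)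
    rw [Finset.mem_filter] at hp ⊢
    exact ⟨hp.1, hsub _ _ hp.2⟩

instance finite_var : Finite (Var S C) :=
  Finite.of_surjective (fun o : Option (S × C ⊕ C) => match o with
    | none => Var.rate
    | some (Sum.inl p) => Var.arc p.1 p.2
    | some (Sum.inr c) => Var.slack c) (by
      rintro (_ | ⟨s, c⟩ | c)
      · exact ⟨none, rfl⟩
      · exact ⟨some (Sum.inl (s, c)), rfl⟩
      · exact ⟨some (Sum.inr c), rfl⟩)

theorem Rigid.isOptimal (hr : Rigid N R D m) (h : IsBest N R D η m) : IsOptimal N R D η m 0 := by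
  have : slackOf N R D η m = 0 := funext fun c => by
    by_cases hc : c ∈ D
    · rw [slackOf_mem hc, hr η h c hc, sub_self, Pi.zero_apply]
    · exact if_neg hc
  exact this ▸ h.isOptimal

/-- A rigid planning problem has an optimal basic solution. -/
theorem Rigid.exists_isOptimalBasic (hr : Rigid N R D m) (h : IsBest N R D η m)
    (hD : D.Nonempty) : ∃ B' η', IsOptimalBasic N R D B' η' m 0 := by
  obtain ⟨η', h', hli⟩ := h.exists_linearIndepOn
  -- The rate and the positive arcs are independent and can be extended to a maximal independent set
  -- of columns of the program.
  set full : Set (Var S C) := insert Var.rate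
    ((arcSet fun s c => s ∈ R ∧ c ∈ D ∧ N.compat s c) ∪ Var.slack '' (D : Set C)) with hfull
  have hrate : Var.rate ∉ arcSet fun s c => 0 < η' s c := fun hv => by
    obtain ⟨s, c, -, h⟩ := mem_arcSet.1 hv
    cases h
  have hA : LinearIndepOn ℝ (column N D) (insert Var.rate (arcSet fun s c => 0 < η' s c)) :=
    (linearIndepOn_insert hrate).2 ⟨hli, hr.notMem_span h' subset_rfl hD⟩
  have hcompat : ∀ s c, 0 < η' s c → s ∈ R ∧ c ∈ D ∧ N.compat s c := fun s c hpos => by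
    by_contra hsc
    exact hpos.ne' (h'.off s c hsc)
  have hsub : insert Var.rate (arcSet fun s c => 0 < η' s c) ⊆ full := by
    refine Set.insert_subset_insert ((Set.image_mono ?_).trans Set.subset_union_left)
    exact fun p hp => hcompat p.1 p.2 hp
  set B' : Finset (Var S C) := (Set.toFinite (hA.extend hsub)).toFinset with hB'
  have hcoe : (B' : Set (Var S C)) = hA.extend hsub := Set.Finite.coe_toFinset _
  have hmem : ∀ v, v ∈ B' → v ∈ full := fun v hv =>
    hA.extend_subset hsub (by rw [← hcoe]; exact hv)
  have hmem' : ∀ s c, Var.arc s c ∉ B' → η' s c = 0 := fun s c hv => by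
    by_contra hne
    refine hv (Finset.mem_coe.1 ?_)
    rw [hcoe]
    exact hA.subset_extend hsub (Or.inr (mem_arcSet.2 ⟨s, c,
      lt_of_le_of_ne (h'.nonneg s c) (Ne.symm hne), rfl⟩))
  have hspan := hA.span_image_extend_eq_span_image hsub
  rw [← hcoe] at hspan
  have hfullmem : ∀ v ∈ full, column N D v ∈ rowSpace (R.disjSum D) := by
    rintro v (rfl | hv | ⟨c, hc, rfl⟩)
    · exact column_rate_mem fun c hc => Finset.inr_mem_disjSum.2 hc
    · obtain ⟨s, c, ⟨hs, hc, -⟩, rfl⟩ := mem_arcSet.1 hv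
      exact column_arc_mem (Finset.inl_mem_disjSum.2 hs) (Finset.inr_mem_disjSum.2 hc)
    · exact column_slack_mem (Finset.inr_mem_disjSum.2 hc)
  have hind : LinearIndepOn ℝ (column N D) (B' : Set (Var S C)) := by
    rw [hcoe]
    exact hA.linearIndepOn_extend hsub
  refine ⟨B', η', ⟨?_, fun s c hv => ?_, fun c hv => ?_, hind, ?_⟩, hr.isOptimal h', hmem',
    fun _ _ => rfl⟩
  · rw [← Finset.mem_coe, hcoe]
    exact hA.subset_extend hsub (Set.mem_insert _ _)
  · rcases hmem _ hv with h0 | h0 | ⟨c', -, h0⟩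
    · cases h0
    · obtain ⟨s', c', hsc, heq⟩ := mem_arcSet.1 h0
      obtain ⟨rfl, rfl⟩ : s = s' ∧ c = c' := by simpa using heq
      exact hsc
    · cases h0
  · rcases hmem _ hv with h0 | h0 | ⟨c', hc', h0⟩
    · cases h0
    · obtain ⟨s', c', -, heq⟩ := mem_arcSet.1 h0
      cases heq
    · cases h0
      exact hc'
  -- The columns span all rows: slacks give the rows of types, and an arc of each server then gives
  -- its row. Hence a basis has as many elements as there are rows.
  · have hslack : ∀ c ∈ D, (Pi.single (Sum.inr c) 1 : S ⊕ C → ℝ) ∈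
        Submodule.span ℝ (column N D '' full) := fun c hc => by
      rw [← column_slack_eq (N := N) (D := D)]
      exact Submodule.subset_span ⟨_, Or.inr (Or.inr ⟨c, hc, rfl⟩), rfl⟩
    rw [← finrank_span_column hind, hspan, span_column_eq_rowSpace hfullmem, finrank_rowSpace,
      Finset.card_disjSum]
    intro x hx
    rcases Finset.mem_disjSum.1 hx with ⟨s, hs, rfl⟩ | ⟨c, hc, rfl⟩
    · obtain ⟨c, hc, hG⟩ := h'.exists_compat hs
      have h1 : column N D (Var.arc s c) ∈ Submodule.span ℝ (column N D '' full) :=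
        Submodule.subset_span ⟨_, Or.inr (Or.inl (mem_arcSet.2 ⟨s, c, ⟨hs, hc, hG⟩, rfl⟩)), rfl⟩
      rw [column_arc_eq] at h1
      have h2 := Submodule.add_mem _ h1
        (Submodule.smul_mem _ (N.speed s c / N.frac c) (hslack c hc))
      rwa [sub_add_cancel] at h2
    · exact hslack c hc

/-! ### Trees -/

theorem card_edgeSet_subgraphOn (E : S → C → Prop) (R : Finset S) (D : Finset C) :
    Nat.card (subgraphOn E R D).edgeSet =
      Nat.card {p : S × C // p.1 ∈ R ∧ p.2 ∈ D ∧ E p.1 p.2} := by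
  symm
  refine Nat.card_eq_of_bijective (fun p => ⟨s(⟨Sum.inl p.1.1, p.2.1⟩, ⟨Sum.inr p.1.2, p.2.2.1⟩),
    bipartite_adj_inl_inr.2 p.2.2.2⟩) ⟨?_, ?_⟩
  · rintro ⟨⟨s, c⟩, h⟩ ⟨⟨s', c'⟩, h'⟩ heq
    obtain ⟨h1, h2⟩ | ⟨h1, -⟩ := Sym2.eq_iff.1 (congrArg Subtype.val heq)
    · have h3 : s = s' := Sum.inl.inj (congrArg Subtype.val h1)
      have h4 : c = c' := Sum.inr.inj (congrArg Subtype.val h2)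
      subst h3
      subst h4
      rfl
    · cases congrArg Subtype.val h1
  · rintro ⟨e, he⟩
    induction e using Sym2.ind with
    | _ x y =>
      obtain ⟨x, hx⟩ := x
      obtain ⟨y, hy⟩ := y
      have hadj : (bipartite E).Adj x y := he
      obtain ⟨s, c, hE, ⟨rfl, rfl⟩ | ⟨rfl, rfl⟩⟩ := bipartite_adj_cases hadj
      · exact ⟨⟨(s, c), hx, hy, hE⟩, rfl⟩
      · exact ⟨⟨(s, c), hy, hx, hE⟩, Subtype.ext Sym2.eq_swap⟩

theorem card_nodes (R : Finset S) (D : Finset C) :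
    Nat.card {x : S ⊕ C | Sum.elim (fun s => s ∈ R) (fun c => c ∈ D) x} = R.card + D.card := by
  rw [← Finset.card_disjSum, ← Fintype.card_coe, ← Nat.card_eq_fintype_card]
  refine Nat.card_congr (Equiv.subtypeEquivRight fun x => ?_)
  rcases x with s | c
  · exact Finset.inl_mem_disjSum.symm
  · exact Finset.inr_mem_disjSum.symm

open Classical in
/-- The variables of the rate and of the arcs in `A`. -/
noncomputable def arcBasis (A : Finset (S × C)) : Finset (Var S C) :=
  insert Var.rate (A.image fun p => Var.arc p.1 p.2)

theorem rate_mem_arcBasis {A : Finset (S × C)} : Var.rate ∈ arcBasis A := by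
  classical exact Finset.mem_insert_self _ _

theorem arc_mem_arcBasis {A : Finset (S × C)} {s : S} {c : C} :
    Var.arc s c ∈ arcBasis A ↔ (s, c) ∈ A := by
  simp [arcBasis]

theorem slack_notMem_arcBasis {A : Finset (S × C)} {c : C} : Var.slack c ∉ arcBasis A := by
  simp [arcBasis]

theorem card_arcBasis (A : Finset (S × C)) : (arcBasis A).card = A.card + 1 := by
  classical
  rw [arcBasis, Finset.card_insert_of_notMem (by simp), Finset.card_image_of_injective]
  exact arc_injective

/-- The rate and the arcs of a spanning tree form a basis. -/
theorem isBasis_arcBasis {A : Finset (S × C)} (hA : ∀ p ∈ A, p.1 ∈ R ∧ p.2 ∈ D ∧ N.compat p.1 p.2)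
    (hL : Linked (fun s c => (s, c) ∈ A) R D) (hD : D.Nonempty)
    (hcard : A.card + 1 = R.card + D.card) : IsBasis N R D (arcBasis A) := by
  refine ⟨rate_mem_arcBasis, fun s c h => hA _ (arc_mem_arcBasis.1 h),
    fun c h => absurd h slack_notMem_arcBasis, ?_, by rw [card_arcBasis, hcard]⟩
  have hfull : ∀ v ∈ arcBasis A, column N D v ∈ rowSpace (R.disjSum D) := by
    rintro (_ | ⟨s, c⟩ | c) hv
    · exact column_rate_mem fun c hc => Finset.inr_mem_disjSum.2 hc
    · obtain ⟨hs, hc, -⟩ := hA _ (arc_mem_arcBasis.1 hv)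
      exact column_arc_mem (Finset.inl_mem_disjSum.2 hs) (Finset.inr_mem_disjSum.2 hc)
    · exact absurd hv slack_notMem_arcBasis
  refine linearIndepOn_of_span hfull (fun x hx => ?_)
    (by rw [card_arcBasis, hcard, Finset.card_disjSum])
  by_contra hnot
  -- A functional that annihilates all columns consists of prices tight along the tree, hence of one
  -- sign, with sum zero over the types. They all vanish.
  obtain ⟨f, hf, hker⟩ := Submodule.exists_le_ker_of_notMem hnot
  set y : S → ℝ := fun s => f (Pi.single (Sum.inl s) 1) with hy
  set z : C → ℝ := fun c => f (Pi.single (Sum.inr c) 1) with hz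
  have hprice : ∀ s ∈ R, ∀ c ∈ D, (s, c) ∈ A → y s = N.speed s c / N.frac c * z c :=
    fun s _ c _ hsc => by
      have h1 := hker (Submodule.subset_span ⟨_, arc_mem_arcBasis.2 hsc, rfl⟩)
      rw [LinearMap.mem_ker, column_arc_eq, map_sub, map_smul, smul_eq_mul, sub_eq_zero] at h1
      exact h1
  have hsum : ∑ c ∈ D, z c = 0 := by
    have h1 := hker (Submodule.subset_span ⟨_, rate_mem_arcBasis, rfl⟩)
    rwa [LinearMap.mem_ker, column_rate_eq, map_sum] at h1
  have hz0 : ∀ c ∈ D, z c = 0 := by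
    by_contra! hex
    obtain ⟨c, hc, hne⟩ := hex
    rcases hne.lt_or_gt with hlt | hgt
    · obtain ⟨-, h2⟩ := hL (fun s => y s < 0) (fun c => z c < 0) (fun s hs c hc hsc => by
        rw [hprice s hs c hc hsc]
        exact smul_neg_iff_of_pos_left (N.coeff_pos (hA _ hsc).2.2)) ⟨c, hc, hlt⟩
      exact (Finset.sum_neg h2 hD).ne hsum
    · obtain ⟨-, h2⟩ := hL (fun s => 0 < y s) (fun c => 0 < z c) (fun s hs c hc hsc => by
        rw [hprice s hs c hc hsc]
        exact smul_pos_iff_of_pos_left (N.coeff_pos (hA _ hsc).2.2)) ⟨c, hc, hgt⟩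
      exact (Finset.sum_pos h2 hD).ne' hsum
  rcases Finset.mem_disjSum.1 hx with ⟨s, hs, rfl⟩ | ⟨c, hc, rfl⟩
  · obtain ⟨c, hc, hsc⟩ := (hL (fun s => ∃ c ∈ D, (s, c) ∈ A) (fun _ => True)
      (fun s _ c hc hsc => ⟨fun _ => trivial, fun _ => ⟨c, hc, hsc⟩⟩)
      ⟨hD.choose, hD.choose_spec, trivial⟩).1 s hs
    exact hf (by
      have := hprice s hs c hc hsc
      rwa [hz0 c hc, mul_zero] at this)
  · exact hf (hz0 c hc)

/-- Independent arcs of an optimal solution of a rigid planning problem do not form cycles. -/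
theorem Rigid.isAcyclic (hr : Rigid N R D m) (h : IsBest N R D η m)
    (hli : LinearIndepOn ℝ (column N D) (arcSet fun s c => 0 < η s c)) :
    (subgraphOn (fun s c => 0 < η s c) R D).IsAcyclic := by
  have hcompat : ∀ s c, 0 < η s c → s ∈ R ∧ c ∈ D ∧ N.compat s c := fun s c hpos => by
    by_contra hsc
    exact hpos.ne' (h.off s c hsc)
  have hclosed : ∀ s c, 0 < η s c → (s ∈ R ↔ c ∈ D) := fun s c hpos =>
    ⟨fun _ => (hcompat s c hpos).2.1, fun _ => (hcompat s c hpos).1⟩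
  -- Every positive arc is a bridge. Compare the prices `y₀`, `z₀`, tight on all arcs and nonzero,
  -- with prices `y`, `z` tight on all arcs except this one.
  have key : ∀ (s : S) (c : C) (hs : s ∈ R) (hc : c ∈ D), 0 < η s c →
      (subgraphOn (fun s c => 0 < η s c) R D).IsBridge s(⟨Sum.inl s, hs⟩, ⟨Sum.inr c, hc⟩) := by
    intro s c hs hc hpos
    rw [SimpleGraph.isBridge_iff]
    intro hreach
    obtain ⟨y₀, z₀, hprice₀, c', hc', hne'⟩ := exists_price
      (hr.notMem_span h (component_subset (G := fun s c => 0 < η s c) (D := D) (c₀ := c))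
        ⟨c, self_mem_component hc⟩)
    have hz₀ : z₀ c ≠ 0 := component_induction hclosed (q := fun c => z₀ c ≠ 0)
      (fun s _ a _ b _ hsa hsb hqa hqb => hqa (by
        have h1 := hprice₀ s a hsa
        rw [hprice₀ s b hsb, hqb, mul_zero] at h1
        exact (mul_eq_zero.1 h1.symm).resolve_left
          (N.coeff_pos (hcompat s a hsa).2.2).ne')) hc' (self_mem_component hc) hne'
    have hmem : Var.arc s c ∈ arcSet fun s c => 0 < η s c := mem_arcSet.2 ⟨s, c, hpos, rfl⟩
    obtain ⟨f, hf, hker⟩ := Submodule.exists_le_ker_of_notMem (hli.notMem_span hmem)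
    set y : S → ℝ := fun s => f (Pi.single (Sum.inl s) 1) with hy
    set z : C → ℝ := fun c => f (Pi.single (Sum.inr c) 1) with hz
    rw [column_arc_eq, map_sub, map_smul, smul_eq_mul] at hf
    have hprice : ∀ s' c', 0 < η s' c' → (s', c') ≠ (s, c) →
        y s' = N.speed s' c' / N.frac c' * z c' := fun s' c' hpos' hne => by
      have h1 := hker (Submodule.subset_span ⟨Var.arc s' c',
        ⟨mem_arcSet.2 ⟨s', c', hpos', rfl⟩, fun heq => hne (by simpa using heq)⟩, rfl⟩)
      rw [LinearMap.mem_ker, column_arc_eq, map_sub, map_smul, smul_eq_mul, sub_eq_zero] at h1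
      exact h1
    -- Along a path that avoids the arc the two price systems stay proportional. This makes `y`, `z`
    -- tight on the arc too, contrary to their choice.
    have hfin : y s * z₀ c = z c * y₀ s := by
      refine reachable_induction (r := fun v : {x : S ⊕ C |
        Sum.elim (fun s => s ∈ R) (fun c => c ∈ D) x} =>
          Sum.elim (fun s' => y s' * z₀ c = z c * y₀ s') (fun c' => z c' * z₀ c = z c * z₀ c') v.1)
        ?_ hreach.symm rfl
      rintro ⟨u, hu⟩ ⟨v, hv⟩ hadj hr
      obtain ⟨hadj, hne⟩ := SimpleGraph.deleteEdges_adj.1 hadj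
      have hadj' : (bipartite fun s c => 0 < η s c).Adj u v := hadj
      obtain ⟨s', c', hpos', ⟨rfl, rfl⟩ | ⟨rfl, rfl⟩⟩ := bipartite_adj_cases hadj'
      · have hne' : (s', c') ≠ (s, c) := by
          intro heq
          cases heq
          exact hne rfl
        have hg := N.coeff_pos (hcompat s' c' hpos').2.2
        have h1 : y s' * z₀ c = z c * y₀ s' := hr
        rw [hprice s' c' hpos' hne', hprice₀ s' c' hpos'] at h1
        refine mul_left_cancel₀ hg.ne' ?_
        linear_combination h1
      · have hne' : (s', c') ≠ (s, c) := by
          intro heq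
          cases heq
          exact hne Sym2.eq_swap
        have h1 : z c' * z₀ c = z c * z₀ c' := hr
        change y s' * z₀ c = z c * y₀ s'
        rw [hprice s' c' hpos' hne', hprice₀ s' c' hpos']
        linear_combination (N.speed s' c' / N.frac c') * h1
    rw [hprice₀ s c hpos] at hfin
    refine hf (sub_eq_zero.2 (mul_right_cancel₀ hz₀ ?_))
    change y s * z₀ c = N.speed s c / N.frac c * z c * z₀ c
    rw [hfin]
    ring
  rw [SimpleGraph.isAcyclic_iff_forall_adj_isBridge]
  rintro ⟨u, hu⟩ ⟨v, hv⟩ hadj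
  have hadj' : (bipartite fun s c => 0 < η s c).Adj u v := hadj
  obtain ⟨s, c, hpos, ⟨rfl, rfl⟩ | ⟨rfl, rfl⟩⟩ := bipartite_adj_cases hadj'
  · exact key s c hu hv hpos
  · rw [Sym2.eq_swap]
    exact key s c hv hu hpos

/-- If the compatibility graph of a rigid planning problem is connected, there is an optimal basic
solution with a basic tree. -/
theorem Rigid.exists_isOptimalBasic_isTree (hr : Rigid N R D m) (h : IsBest N R D η m)
    (hD : D.Nonempty) (hconn : (subgraphOn N.compat R D).Connected) :
    ∃ B' η', IsOptimalBasic N R D B' η' m 0 ∧ (subgraphOn (basicArc B') R D).IsTree := by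
  classical
  obtain ⟨η', h', hli⟩ := h.exists_linearIndepOn
  have hcompat : ∀ s c, 0 < η' s c → s ∈ R ∧ c ∈ D ∧ N.compat s c := fun s c hpos => by
    by_contra hsc
    exact hpos.ne' (h'.off s c hsc)
  have hle : subgraphOn (fun s c => 0 < η' s c) R D ≤ subgraphOn N.compat R D := by
    rintro ⟨u, hu⟩ ⟨v, hv⟩ hadj
    have hadj' : (bipartite fun s c => 0 < η' s c).Adj u v := hadj
    obtain ⟨s, c, hpos, ⟨rfl, rfl⟩ | ⟨rfl, rfl⟩⟩ := bipartite_adj_cases hadj'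
    · exact bipartite_adj_inl_inr.2 (hcompat s c hpos).2.2
    · exact (bipartite_adj_inl_inr.2 (hcompat s c hpos).2.2 :
        (bipartite N.compat).Adj (Sum.inl s) (Sum.inr c)).symm
  -- The forest of positive arcs is completed to a spanning tree by compatible arcs with `η' = 0`.
  obtain ⟨F, hF1, hF2, hF⟩ := hconn.exists_isTree_le_of_le_of_isAcyclic hle (hr.isAcyclic h' hli)
  set A : Finset (S × C) := Finset.univ.filter fun p => ∃ (hs : p.1 ∈ R) (hc : p.2 ∈ D),
    F.Adj ⟨Sum.inl p.1, hs⟩ ⟨Sum.inr p.2, hc⟩ with hA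
  have hmemA : ∀ s c, (s, c) ∈ A ↔ ∃ (hs : s ∈ R) (hc : c ∈ D),
    F.Adj ⟨Sum.inl s, hs⟩ ⟨Sum.inr c, hc⟩ := fun s c => by simp [hA]
  have hgraph : subgraphOn (fun s c => (s, c) ∈ A) R D = F := by
    ext ⟨u, hu⟩ ⟨v, hv⟩
    constructor
    · intro hadj
      have hadj' : (bipartite fun s c => (s, c) ∈ A).Adj u v := hadj
      obtain ⟨s, c, hsc, ⟨rfl, rfl⟩ | ⟨rfl, rfl⟩⟩ := bipartite_adj_cases hadj'
      · exact ((hmemA s c).1 hsc).2.2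
      · exact ((hmemA s c).1 hsc).2.2.symm
    · intro hadj
      have hadj' : (bipartite N.compat).Adj u v := hF2 hadj
      obtain ⟨s, c, -, ⟨rfl, rfl⟩ | ⟨rfl, rfl⟩⟩ := bipartite_adj_cases hadj'
      · exact bipartite_adj_inl_inr.2 ((hmemA s c).2 ⟨hu, hv, hadj⟩)
      · exact (bipartite_adj_inl_inr.2 ((hmemA s c).2 ⟨hv, hu, hadj.symm⟩) :
          (bipartite fun s c => (s, c) ∈ A).Adj (Sum.inl s) (Sum.inr c)).symm
  have hcompatA : ∀ p ∈ A, p.1 ∈ R ∧ p.2 ∈ D ∧ N.compat p.1 p.2 := fun p hp => by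
    obtain ⟨hs, hc, hadj⟩ := (hmemA p.1 p.2).1 hp
    exact ⟨hs, hc, bipartite_adj_inl_inr.1 (hF2 hadj)⟩
  have hcard : A.card + 1 = R.card + D.card := by
    have h1 := (SimpleGraph.isTree_iff_connected_and_card.1 hF).2
    rw [card_nodes, ← hgraph, card_edgeSet_subgraphOn] at h1
    rw [← h1, ← Fintype.card_coe, ← Nat.card_eq_fintype_card]
    congr 1
    refine Nat.card_congr (Equiv.subtypeEquivRight fun p => ⟨fun hp => ?_, fun hp => hp.2.2⟩)
    exact ⟨(hcompatA p hp).1, (hcompatA p hp).2.1, hp⟩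
  have hbasic : basicArc (arcBasis A) = fun s c => (s, c) ∈ A := by
    funext s c
    exact propext arc_mem_arcBasis
  have hL : Linked (fun s c => (s, c) ∈ A) R D := linked_of_connected (hgraph ▸ hF.connected)
  refine ⟨arcBasis A, η', ⟨isBasis_arcBasis hcompatA hL hD hcard, hr.isOptimal h',
    fun s c hsc => ?_, fun _ _ => rfl⟩, by rw [hbasic, hgraph]; exact hF⟩
  by_contra hne
  have hpos : 0 < η' s c := lt_of_le_of_ne (h'.nonneg s c) (Ne.symm hne)
  obtain ⟨hs, hc, -⟩ := hcompat s c hpos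
  exact hsc (arc_mem_arcBasis.2 ((hmemA s c).2 ⟨hs, hc, hF1 (bipartite_adj_inl_inr.2 hpos)⟩))

end Bases

end FCFS

namespace FCFS

set_option linter.unusedSectionVars false

/-! ## The subsystem without slacks -/

section Basic

variable {S C : Type*} [Fintype S] [DecidableEq S] [Fintype C] [DecidableEq C] {N : Network S C}
  {R R₁ : Finset S} {D D₁ : Finset C} {B : Finset (Var S C)} {η : S → C → ℝ} {m : ℝ} {θ : C → ℝ}

/-- The basis yields prices that are tight on the whole connected graph of basic arcs and hence
nowhere zero. Deleting the vanishing arcs splits this graph, but the same prices serve every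
component. -/
theorem IsOptimalBasic.critical (h : IsOptimalBasic N R D B η m 0) (hL : Linked (basicArc B) R D)
    (hD : D.Nonempty) (hm : 0 < m) :
    Critical N (fun s c => basicArc B s c ∧ η s c ≠ 0) R D η m := by
  have hbest := h.optimal.isBest hD
  obtain ⟨y, z, hprice, hz⟩ := exists_price (h.basis.notMem_span (E := basicArc B) fun _ _ => id)
  obtain ⟨y, z, -, hz, hprice⟩ := exists_pos_price
    (fun s c hG => N.coeff_pos (h.basis.arc_mem s c hG).2.2)
    (fun s _ c _ hG => hprice s c hG) hL hz
  have hbasic : ∀ s c, η s c ≠ 0 → basicArc B s c := fun s c hne => by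
    by_contra hB
    exact hne (h.arc_nonbasic s c hB)
  refine hbest.critical (fun c hc => ?_) hm hD (fun s c hG => (h.basis.arc_mem s c hG.1).2.2)
    (fun s c hG => ?_) (fun s _ c _ => ?_) fun K hK hne => ?_
  · have h1 := h.optimal.1.slack_eq hc
    rw [Pi.zero_apply] at h1
    linarith
  · obtain ⟨hs, hc, -⟩ := h.basis.arc_mem s c hG.1
    exact iff_of_true hs hc
  · exact ⟨fun hG => (hbest.nonneg s c).lt_of_ne' hG.2, fun hpos => ⟨hbasic s c hpos.ne', hpos.ne'⟩⟩
  · obtain ⟨c, hc⟩ := hne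
    exact ⟨y, z, fun s hs c hc hpos => hprice s hs c hc (hbasic s c hpos.ne'), c, hc,
      (hz c (hK hc)).ne'⟩

open Classical in
/-- The basic arcs between the servers in `R` and the types in `D`. -/
noncomputable def arcsBetween (B : Finset (Var S C)) (R : Finset S) (D : Finset C) :
    Finset (S × C) :=
  Finset.univ.filter fun p => p.1 ∈ R ∧ p.2 ∈ D ∧ basicArc B p.1 p.2

theorem mem_arcsBetween {s : S} {c : C} :
    (s, c) ∈ arcsBetween B R D ↔ s ∈ R ∧ c ∈ D ∧ basicArc B s c := by
  simp [arcsBetween]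

theorem arcsBetween_mono (hD : D₁ ⊆ D) : arcsBetween B R D₁ ⊆ arcsBetween B R D := by
  rintro ⟨s, c⟩ h
  obtain ⟨hs, hc, hB⟩ := mem_arcsBetween.1 h
  exact mem_arcsBetween.2 ⟨hs, hD hc, hB⟩

theorem card_edgeSet_basicArc :
    Nat.card (subgraphOn (basicArc B) R D).edgeSet = (arcsBetween B R D).card := by
  rw [card_edgeSet_subgraphOn, ← Fintype.card_coe, ← Nat.card_eq_fintype_card]
  exact Nat.card_congr (Equiv.subtypeEquivRight fun p => (mem_arcsBetween (s := p.1) (c := p.2)).symm)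

theorem card_le_card_arcsBetween (hconn : (subgraphOn (basicArc B) R D).Connected) :
    R.card + D.card ≤ (arcsBetween B R D).card + 1 := by
  have h1 := hconn.card_vert_le_card_edgeSet_add_one
  rwa [card_nodes, card_edgeSet_basicArc] at h1

/-- The rate, the basic arcs at the servers in `R₁` and the slacks of the types outside `D₁` have
independent columns, supported in the rows of `R₁` and `D`. There are at most as many columns as
rows. -/
theorem IsBasis.card_arcsBetween_le (hB : IsBasis N R D B) (hD : D₁ ⊆ D)
    (hslack : ∀ c ∈ D, c ∉ D₁ → Var.slack c ∈ B) :
    (arcsBetween B R₁ D).card + 1 ≤ R₁.card + D₁.card := by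
  classical
  set Q : Finset (Var S C) := arcBasis (arcsBetween B R₁ D) ∪ (D \ D₁).image Var.slack with hQ
  have hQB : Q ⊆ B := by
    intro v hv
    rcases Finset.mem_union.1 hv with hv | hv
    · rcases v with _ | ⟨s, c⟩ | c
      · exact hB.rate_mem
      · exact (mem_arcsBetween.1 (arc_mem_arcBasis.1 hv)).2.2
      · exact absurd hv slack_notMem_arcBasis
    · obtain ⟨c, hc, rfl⟩ := Finset.mem_image.1 hv
      exact hslack c (Finset.mem_sdiff.1 hc).1 (Finset.mem_sdiff.1 hc).2
  have hcard : Q.card = (arcsBetween B R₁ D).card + 1 + (D \ D₁).card := by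
    rw [hQ, Finset.card_union_of_disjoint, card_arcBasis, Finset.card_image_of_injective]
    · intro c c' hcc
      simpa using hcc
    · rw [Finset.disjoint_left]
      rintro _ h1 h2
      obtain ⟨c, -, rfl⟩ := Finset.mem_image.1 h2
      exact slack_notMem_arcBasis h1
  have hle := card_le_of_linearIndepOn (X := R₁.disjSum D) (hB.indep.mono (Finset.coe_subset.2 hQB)) (by
    rintro (_ | ⟨s, c⟩ | c) hv
    · exact column_rate_mem fun c hc => Finset.inr_mem_disjSum.2 hc
    · rcases Finset.mem_union.1 hv with hv | hv
      · obtain ⟨hs, hc, -⟩ := mem_arcsBetween.1 (arc_mem_arcBasis.1 hv)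
        exact column_arc_mem (Finset.inl_mem_disjSum.2 hs) (Finset.inr_mem_disjSum.2 hc)
      · simp at hv
    · exact column_slack_mem (Finset.inr_mem_disjSum.2 (hB.slack_mem c (hQB hv))))
  rw [hcard, Finset.card_disjSum, ← Finset.card_sdiff_add_card_eq_card hD] at hle
  omega

/-- If the basic arcs connect a subsystem and the slacks of all other types are basic, the basic arcs
form a tree on the subsystem, and no other basic arc starts from its servers. -/
theorem IsBasis.card_arcsBetween_eq (hB : IsBasis N R D B) (hD : D₁ ⊆ D)
    (hslack : ∀ c ∈ D, c ∉ D₁ → Var.slack c ∈ B)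
    (hconn : (subgraphOn (basicArc B) R₁ D₁).Connected) :
    (arcsBetween B R₁ D₁).card + 1 = R₁.card + D₁.card ∧
      ∀ s ∈ R₁, ∀ c, basicArc B s c → c ∈ D₁ := by
  have h1 := card_le_card_arcsBetween hconn
  have h2 := hB.card_arcsBetween_le (R₁ := R₁) hD hslack
  have h3 := Finset.card_le_card (arcsBetween_mono (B := B) (R := R₁) hD)
  -- Connectedness bounds the number of arcs inside the subsystem from below by the same number, so
  -- no basic arc of its servers leaves it.
  have heq := Finset.eq_of_subset_of_card_le (arcsBetween_mono (B := B) (R := R₁) hD) (by omega)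
  refine ⟨by omega, fun s hs c hsc => ?_⟩
  have h4 : (s, c) ∈ arcsBetween B R₁ D := mem_arcsBetween.2 ⟨hs, (hB.arc_mem s c hsc).2.1, hsc⟩
  rw [← heq] at h4
  exact (mem_arcsBetween.1 h4).2.1

theorem basicArc_arcsBetween {s : S} {c : C} :
    basicArc (arcBasis (arcsBetween B R D)) s c ↔ basicArc B s c ∧ s ∈ R ∧ c ∈ D := by
  rw [basicArc, arc_mem_arcBasis, mem_arcsBetween]
  tauto

theorem subgraphOn_congr {E E' : S → C → Prop} (h : ∀ s ∈ R, ∀ c ∈ D, (E s c ↔ E' s c)) :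
    subgraphOn E R D = subgraphOn E' R D := by
  ext ⟨u, hu⟩ ⟨v, hv⟩
  have key : ∀ {E E' : S → C → Prop}, (∀ s ∈ R, ∀ c ∈ D, (E s c ↔ E' s c)) →
      (bipartite E).Adj u v → (bipartite E').Adj u v := by
    intro E E' h hadj
    obtain ⟨s, c, hE, ⟨rfl, rfl⟩ | ⟨rfl, rfl⟩⟩ := bipartite_adj_cases hadj
    · exact bipartite_adj_inl_inr.2 ((h s hu c hv).1 hE)
    · exact (bipartite_adj_inl_inr.2 ((h s hv c hu).1 hE)).symm
  exact ⟨key h, key fun s hs c hc => (h s hs c hc).symm⟩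

/-- A subsystem that is not connected to the rest by positive arcs, whose other types have a larger
rate, determines the optimal value. -/
theorem IsBest.restrict (h : IsBest N R D η m) (hR : R₁ ⊆ R) (hD : D₁ ⊆ D)
    (hsep : ∀ s ∈ R, ∀ c ∈ D, η s c ≠ 0 → (s ∈ R₁ ↔ c ∈ D₁))
    (hlt : ∀ c ∈ D, c ∉ D₁ → m < rateOf N R η c) :
    IsBest N R₁ D₁ (restrict R₁ D₁ η) m ∧
      IsAlloc N (R \ R₁) (D \ D₁) (restrict (R \ R₁) (D \ D₁) η) ∧
      ∀ c ∈ D \ D₁, m < rateOf N (R \ R₁) (restrict (R \ R₁) (D \ D₁) η) c := by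
  have hsep₁ : ∀ s ∈ R₁, ∀ c ∈ D, c ∉ D₁ → η s c = 0 := fun s hs c hc hc' => by
    by_contra hne
    exact hc' ((hsep s (hR hs) c hc hne).1 hs)
  have hsep₂ : ∀ s ∈ R \ R₁, ∀ c ∈ D, c ∉ D \ D₁ → η s c = 0 := fun s hs c hc hc' => by
    by_contra hne
    obtain ⟨hs, hs₁⟩ := Finset.mem_sdiff.1 hs
    exact hc' (Finset.mem_sdiff.2 ⟨hc, fun hc₁ => hs₁ ((hsep s hs c hc hne).2 hc₁)⟩)
  have hrest := h.toIsAlloc.restrict Finset.sdiff_subset Finset.sdiff_subset hsep₂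
  have hrate : ∀ c ∈ D \ D₁, m < rateOf N (R \ R₁) (FCFS.restrict (R \ R₁) (D \ D₁) η) c := by
    intro c hc
    obtain ⟨hcD, hc₁⟩ := Finset.mem_sdiff.1 hc
    rw [rateOf_restrict Finset.sdiff_subset hc fun s hs hs' =>
      hsep₁ s (by simpa [hs] using hs') c hcD hc₁]
    exact hlt c hcD hc₁
  refine ⟨⟨h.toIsAlloc.restrict hR hD hsep₁, fun c hc => ?_, fun η' hη' => ?_⟩, hrest, hrate⟩
  · rw [rateOf_restrict hR hc fun s hs hs' => by
      by_contra hne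
      exact hs' ((hsep s hs c (hD hc) hne).2 hc)]
    exact h.le_rate c (hD hc)
  -- Combined with the rest of `η`, where all rates exceed `m`, the allocation `η'` leaves some type
  -- at rate at most `m`; this type lies in the subsystem.
  · obtain ⟨c, hc, hle⟩ := h.exists_le _ (hη'.add hrest hR hD)
    by_cases hc₁ : c ∈ D₁
    · rw [hη'.rateOf_add_left hrest hR hc₁] at hle
      exact ⟨c, hc₁, hle⟩
    · rw [hη'.rateOf_add_right hrest hc₁] at hle
      exact absurd (hrate c (Finset.mem_sdiff.2 ⟨hc, hc₁⟩)) (not_lt.2 hle)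

end Basic

end FCFS

namespace FCFS

set_option linter.unusedSectionVars false

section Subsystem

variable {S C Ω : Type*} [Fintype S] [DecidableEq S] [Fintype C] [DecidableEq C]
  [MeasurableSpace Ω] {P : Measure Ω} [IsProbabilityMeasure P] {N : Network S C}
  {R R₁ : Finset S} {D D₁ : Finset C} {B : Finset (Var S C)} {η : S → C → ℝ} {m : ℝ} {θ : C → ℝ}

theorem IsOptimalBasic.basicArc_of_ne (h : IsOptimalBasic N R D B η m θ) {s : S} {c : C}
    (hne : η s c ≠ 0) : basicArc B s c := by
  by_contra hB
  exact hne (h.arc_nonbasic s c hB)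

theorem IsOptimalBasic.slack_mem_of_ne (h : IsOptimalBasic N R D B η m θ) {c : C}
    (hne : θ c ≠ 0) : Var.slack c ∈ B := by
  by_contra hB
  exact hne (h.slack_nonbasic c hB)

theorem IsBest.isOptimal_zero (h : IsBest N R D η m) (hrate : ∀ c ∈ D, rateOf N R η c = m) :
    IsOptimal N R D η m 0 := by
  have h1 := h.isOptimal
  have h2 : slackOf N R D η m = 0 := by
    funext c
    by_cases hc : c ∈ D
    · rw [slackOf_mem hc, hrate c hc, sub_self, Pi.zero_apply]
    · exact h1.1.slack_off c hc
  rwa [h2] at h1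

theorem IsOptimal.exists_slack_eq_zero (h : IsOptimal N R D η m θ) (hD : D.Nonempty) :
    ∃ c ∈ D, θ c = 0 := by
  obtain ⟨c, hc, hle⟩ := (h.isBest hD).exists_le η h.1.isAlloc
  refine ⟨c, hc, le_antisymm ?_ (h.1.slack_nonneg c)⟩
  rw [h.1.slack_eq hc]
  linarith

/-- The positive arcs do not join the subsystem without slacks to the rest. -/
theorem IsOptimalBasic.separated (h : IsOptimalBasic N R D B η m θ) (hD₁ : D₁ ⊆ D)
    (hθ : ∀ c ∈ D, c ∉ D₁ → θ c ≠ 0)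
    (hconn : (subgraphOn (basicArc B) (serversOf N R D₁) D₁).Connected) {s : S} {c : C}
    (hne : η s c ≠ 0) : s ∈ serversOf N R D₁ ↔ c ∈ D₁ := by
  have hB := h.basicArc_of_ne hne
  obtain ⟨hs, -, hG⟩ := h.basis.arc_mem s c hB
  refine ⟨fun hs₁ => ?_, fun hc => mem_serversOf.2 ⟨hs, c, hc, hG⟩⟩
  exact (h.basis.card_arcsBetween_eq hD₁ (fun c hc hc' => h.slack_mem_of_ne (hθ c hc hc'))
    hconn).2 s hs₁ c hB

theorem IsOptimalBasic.restrict_isBest (h : IsOptimalBasic N R D B η m θ) (hD₁ : D₁ ⊆ D)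
    (hθ : ∀ c ∈ D, c ∈ D₁ ↔ θ c = 0)
    (hconn : (subgraphOn (basicArc B) (serversOf N R D₁) D₁).Connected) (hD : D.Nonempty) :
    IsBest N (serversOf N R D₁) D₁ (restrict (serversOf N R D₁) D₁ η) m ∧
      IsAlloc N (R \ serversOf N R D₁) (D \ D₁) (restrict (R \ serversOf N R D₁) (D \ D₁) η) ∧
      ∀ c ∈ D \ D₁, m < rateOf N (R \ serversOf N R D₁)
        (restrict (R \ serversOf N R D₁) (D \ D₁) η) c := by
  refine (h.optimal.isBest hD).restrict serversOf_subset hD₁ (fun s _ c _ => h.separated hD₁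
    (fun c hc hc' h0 => hc' ((hθ c hc).2 h0)) hconn) fun c hc hc₁ => ?_
  have h1 := h.optimal.1.slack_eq hc
  have h2 := (h.optimal.1.slack_nonneg c).lt_of_ne' fun h0 => hc₁ ((hθ c hc).2 h0)
  linarith

/-- The subsystem without slacks has an optimal basic solution with a basic tree. -/
theorem IsOptimalBasic.subsystem (h : IsOptimalBasic N R D B η m θ) (hD₁ : D₁ ⊆ D)
    (hθ : ∀ c ∈ D, c ∈ D₁ ↔ θ c = 0)
    (hconn : (subgraphOn (basicArc B) (serversOf N R D₁) D₁).Connected) (hD : D.Nonempty) :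
    IsOptimalBasic N (serversOf N R D₁) D₁ (arcBasis (arcsBetween B (serversOf N R D₁) D₁))
      (restrict (serversOf N R D₁) D₁ η) m 0 ∧
    (subgraphOn (basicArc (arcBasis (arcsBetween B (serversOf N R D₁) D₁)))
      (serversOf N R D₁) D₁).IsTree := by
  have hgraph : subgraphOn (basicArc (arcBasis (arcsBetween B (serversOf N R D₁) D₁)))
      (serversOf N R D₁) D₁ = subgraphOn (basicArc B) (serversOf N R D₁) D₁ :=
    subgraphOn_congr fun s hs c hc => by rw [basicArc_arcsBetween]; tauto
  have hne : D₁.Nonempty := by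
    obtain ⟨c, hc, h0⟩ := h.optimal.exists_slack_eq_zero hD
    exact ⟨c, (hθ c hc).2 h0⟩
  have hcard := (h.basis.card_arcsBetween_eq hD₁ (fun c hc hc' =>
    h.slack_mem_of_ne fun h0 => hc' ((hθ c hc).2 h0)) hconn).1
  refine ⟨⟨isBasis_arcBasis ?_ (Linked.mono (linked_of_connected hconn) fun s hs c hc hB =>
    mem_arcsBetween.2 ⟨hs, hc, hB⟩) hne hcard, (h.restrict_isBest hD₁ hθ hconn hD).1.isOptimal_zero
      fun c hc => ?_, fun s c hsc => ?_, fun _ _ => rfl⟩, ?_⟩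
  · rintro ⟨s, c⟩ hp
    obtain ⟨hs, hc, hB⟩ := mem_arcsBetween.1 hp
    exact ⟨hs, hc, (h.basis.arc_mem s c hB).2.2⟩
  · rw [rateOf_restrict serversOf_subset hc fun s _ hs => by
      by_contra hne
      exact hs ((h.separated hD₁ (fun c hc hc' h0 => hc' ((hθ c hc).2 h0)) hconn hne).2 hc)]
    have h1 := h.optimal.1.slack_eq (hD₁ hc)
    rw [(hθ c (hD₁ hc)).1 hc] at h1
    linarith
  · by_cases hmem : s ∈ serversOf N R D₁ ∧ c ∈ D₁
    · rw [restrict_mem hmem.1 hmem.2]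
      by_contra hne
      exact hsc (arc_mem_arcBasis.2 (mem_arcsBetween.2 ⟨hmem.1, hmem.2, h.basicArc_of_ne hne⟩))
    · exact if_neg hmem
  · rw [hgraph]
    refine SimpleGraph.isTree_iff_connected_and_card.2 ⟨hconn, ?_⟩
    rw [card_edgeSet_basicArc, card_nodes, hcard]

/-- The rest of the system has a larger rate. -/
theorem IsOptimalBasic.exists_rest (h : IsOptimalBasic N R D B η m θ) (hD₁ : D₁ ⊆ D)
    (hθ : ∀ c ∈ D, c ∈ D₁ ↔ θ c = 0)
    (hconn : (subgraphOn (basicArc B) (serversOf N R D₁) D₁).Connected)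
    (hne : (D \ D₁).Nonempty) :
    ∃ m₂, IsOptimalValue N (R \ serversOf N R D₁) (D \ D₁) m₂ ∧ m < m₂ := by
  obtain ⟨-, hA, hlt⟩ := h.restrict_isBest hD₁ hθ hconn (hne.mono Finset.sdiff_subset)
  obtain ⟨η₂, m₂, h₂⟩ := exists_isBest hne fun s hs => hA.exists_compat hs
  obtain ⟨m', hm', hle⟩ := exists_lt_of_forall_lt hne hlt
  exact ⟨m₂, h₂.isOptimalValue, hm'.trans_le (h₂.le (hA.isFeasible hle))⟩

/-- If the complementary dual solution is feasible, only the types without slack are forced. -/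
theorem DualFeasible.forced_eq (hdual : DualFeasible N R D B) (h : IsOptimalBasic N R D B η m θ)
    (hD₁ : D₁ ⊆ D) (hθ : ∀ c ∈ D, c ∈ D₁ ↔ θ c = 0)
    (hL : Linked (basicArc B) R₁ D₁) (hD : D.Nonempty) : forced N R D m = D₁ := by
  obtain ⟨y, z, hz, hsum, hle, htight, hcomp⟩ := hdual
  have hbest := h.optimal.isBest hD
  have hcomp' : ∀ c, θ c ≠ 0 → z c = 0 := fun c hc => hcomp c (h.slack_mem_of_ne hc)
  -- The prices sum to one, so one of them is positive. By complementary slackness its type has no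
  -- slack, and along the basic arcs positivity spreads over `D₁`.
  have hzpos : ∀ c ∈ D₁, 0 < z c := by
    refine (hL (fun s => 0 < y s) (fun c => 0 < z c) (fun s hs c hc hB => ?_) ?_).2
    · rw [htight s c hB]
      exact smul_pos_iff_of_pos_left (N.coeff_pos (h.basis.arc_mem s c hB).2.2)
    · obtain ⟨c, hc, hne⟩ := Finset.exists_ne_zero_of_sum_ne_zero (hsum.trans_ne one_ne_zero)
      refine ⟨c, (hθ c hc).2 ?_, (hz c hc).lt_of_ne' hne⟩
      by_contra h0
      exact hne (hcomp' c h0)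
  have hswap : ∀ η' : S → C → ℝ, ∑ c ∈ D, z c * rateOf N R η' c =
      ∑ s ∈ R, ∑ c ∈ D, N.speed s c / N.frac c * z c * η' s c := fun η' => by
    rw [Finset.sum_comm]
    refine Finset.sum_congr rfl fun c _ => ?_
    rw [rateOf, Finset.mul_sum]
    exact Finset.sum_congr rfl fun s _ => by ring
  have hy : ∀ η', IsAlloc N R D η' → ∑ s ∈ R, y s = ∑ s ∈ R, ∑ c ∈ D, y s * η' s c :=
    fun η' hη' => Finset.sum_congr rfl fun s hs => by rw [← Finset.mul_sum, hη'.server s hs, mul_one]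
  have hval : ∑ c ∈ D, z c * rateOf N R η c = m := by
    rw [← mul_one m, ← hsum, Finset.mul_sum]
    refine Finset.sum_congr rfl fun c hc => ?_
    rcases eq_or_ne (θ c) 0 with h0 | h0
    · rw [show rateOf N R η c = m by have := h.optimal.1.slack_eq hc; linarith, mul_comm]
    · rw [hcomp' c h0, zero_mul, mul_zero]
  have hval' : ∑ c ∈ D, z c * rateOf N R η c = ∑ s ∈ R, y s := by
    rw [hswap, hy η hbest.toIsAlloc]
    refine Finset.sum_congr rfl fun s _ => Finset.sum_congr rfl fun c _ => ?_
    rcases eq_or_ne (η s c) 0 with h0 | h0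
    · rw [h0, mul_zero, mul_zero]
    · rw [htight s c (h.basicArc_of_ne h0)]
  refine Finset.Subset.antisymm (fun c hc => ?_) fun c hc => mem_forced.2 ⟨hD₁ hc, fun η' hη' => ?_⟩
  · obtain ⟨hcD, hall⟩ := mem_forced.1 hc
    rw [hθ c hcD, h.optimal.1.slack_eq hcD, hall η hbest, sub_self]
  -- Weak duality for another optimal allocation. As all its rates are at least `m`, equality must
  -- hold for each type, which fixes the rate wherever the price is positive.
  · have h1 : ∑ c ∈ D, z c * rateOf N R η' c ≤ ∑ c ∈ D, z c * m := by
      rw [← Finset.sum_mul, hsum, one_mul, ← hval, hval', hswap, hy η' hη'.toIsAlloc]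
      refine Finset.sum_le_sum fun s hs => Finset.sum_le_sum fun c hc => ?_
      by_cases hG : N.compat s c
      · exact mul_le_mul_of_nonneg_right (hle s hs c hc hG) (hη'.nonneg s c)
      · rw [hη'.off s c fun h => hG h.2.2, mul_zero, mul_zero]
    have h2 : ∀ c ∈ D, z c * m ≤ z c * rateOf N R η' c := fun c hc =>
      mul_le_mul_of_nonneg_left (hη'.le_rate c hc) (hz c hc)
    have h3 := (Finset.sum_eq_sum_iff_of_le h2).1 (le_antisymm (Finset.sum_le_sum h2) h1) c (hD₁ hc)
    exact (mul_left_cancel₀ (hzpos c hc).ne' h3).symm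

end Subsystem

/-! ### Pooling and throughput of the blocks -/

section Blocks

variable {S C Ω : Type*} [Fintype S] [DecidableEq S] [Fintype C] [DecidableEq C]
  [MeasurableSpace Ω] {P : Measure Ω} [IsProbabilityMeasure P] {N : Network S C}
  {d : List (Block S C)} {b : Block S C} {η : S → C → ℝ} {m : ℝ} {η' : Block S C → S → C → ℝ}

/-- The first block of the decomposition. -/
theorem IsDecomposition.exists_cons {R : Finset S} {D : Finset C} (hd : IsDecomposition N R D d)
    (h : IsBest N R D η m) (hD : D.Nonempty) :
    ∃ d', d = ⟨serversOf N R (forced N R D m), forced N R D m, m⟩ :: d' := by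
  rcases d with _ | ⟨⟨T, W, r⟩, d'⟩
  · rw [hd.2] at hD
    simp at hD
  · obtain ⟨-, -, hT, hr, -⟩ := isDecomposition_cons.1 hd
    have hW := hd.types_eq
    obtain ⟨η₁, hη₁⟩ := hr.exists_isBest hD
    have hrm : r = m := hη₁.unique h
    dsimp only at hT hW
    subst hrm
    subst hT
    exact ⟨d', by rw [← hW]⟩

/-- Positive arcs stay within their block, so the union graph restricted to a block is that of its
own solution. Rigidity provides prices for each component, even if the block is not connected. -/
theorem IsDecomposition.critical {R : Finset S} {D : Finset C} (hd : IsDecomposition N R D d)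
    (hR : ∀ s ∈ R, ∃ c ∈ D, N.compat s c) (hD : ∀ c ∈ D, ∃ s ∈ R, N.compat s c)
    (hη : ∀ b ∈ d, IsBest N b.servers b.types (η' b) b.rate) (hb : b ∈ d) :
    Critical N (fun s c => ∃ b' ∈ d, 0 < η' b' s c) b.servers b.types (η' b) b.rate := by
  obtain ⟨hne, hrig, -⟩ := hd.block hb
  have hmem : ∀ b' ∈ d, ∀ s c, 0 < η' b' s c → s ∈ b'.servers ∧ c ∈ b'.types ∧ N.compat s c :=
    fun b' hb' s c hpos => by
      by_contra hsc
      exact hpos.ne' ((hη b' hb').off s c hsc)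
  refine (hη b hb).critical (hrig _ (hη b hb)) (hd.rate_pos hR hD hb) hne ?_ ?_ ?_ ?_
  · rintro s c ⟨b', hb', hpos⟩
    exact (hmem b' hb' s c hpos).2.2
  · rintro s c ⟨b', hb', hpos⟩
    obtain ⟨hs, hc, -⟩ := hmem b' hb' s c hpos
    constructor
    · intro hs'
      rwa [hd.disjoint hb hb' (Or.inl ⟨s, hs', hs⟩)]
    · intro hc'
      rwa [hd.disjoint hb hb' (Or.inr ⟨c, hc', hc⟩)]
  · intro s hs c _
    refine ⟨?_, fun hpos => ⟨b, hb, hpos⟩⟩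
    rintro ⟨b', hb', hpos⟩
    rwa [hd.disjoint hb hb' (Or.inl ⟨s, hs, (hmem b' hb' s c hpos).1⟩)]
  · intro K hK hKne
    obtain ⟨y, z, hprice, hz⟩ := exists_price (hrig.notMem_span (hη b hb) hK hKne)
    exact ⟨y, z, fun s _ c _ hpos => hprice s c hpos, hz⟩

/-- Once the servers of earlier blocks are excluded, the servers that can work for the types of the
block are exactly its own. -/
theorem IsDecomposition.maximumThroughput {R : Finset S} {D : Finset C} {d₁ d₂ : List (Block S C)}
    (hd : IsDecomposition N R D (d₁ ++ b :: d₂)) (hR : ∀ s, s ∈ R)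
    {G : S → C → Prop} (h : Critical N G b.servers b.types η b.rate) :
    MaximumThroughput N P G b.servers
      (fun s c => N.compat s c ∧ ∀ b' ∈ d₁, s ∉ b'.servers) b.types b.rate := by
  obtain ⟨-, -, η₁, hη₁⟩ := hd.block (b := b) (by simp)
  obtain ⟨R', D', hR', -, h'⟩ := hd.append
  have hserv : b.servers = serversOf N R' b.types := (isDecomposition_cons.1 h').2.2.1
  refine h.maximumThroughput (fun s c hH => hH.1) (fun s c hc hH => ?_) (fun s hs c _ hG => ?_)
    fun _ _ _ hf => hη₁.le hf
  · rw [hserv]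
    exact mem_serversOf.2 ⟨(hR' s).2 ⟨hR s, hH.2⟩, c, hc, hH.1⟩
  · rw [hserv] at hs
    exact ⟨hG, ((hR' s).1 (mem_serversOf.1 hs).1).2⟩

end Blocks

end FCFS

/-! ### The theorem -/

open FCFS in
theorem mainTheorem1 {S C Ω : Type*} [Fintype S] [DecidableEq S] [Fintype C] [DecidableEq C]
    [MeasurableSpace Ω] (P : Measure Ω) [IsProbabilityMeasure P] (N : Network S C)
    (B : Finset (Var S C)) (η : S → C → ℝ) (μ : ℝ) (θ : C → ℝ)
    (hopt : IsOptimalBasic N Finset.univ Finset.univ B η μ θ) :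
    -- no slack, basic tree with positive arcs
    ((∀ c, θ c = 0) → (bipartite (basicArc B)).IsTree →
      (∀ s c, basicArc B s c → 0 < η s c) →
        CompletePooling N P (basicArc B) Finset.univ ∧
        MaximumThroughput N P (basicArc B) Finset.univ N.compat Finset.univ μ) ∧
    -- no slack, basic tree with some vanishing arcs
    ((∀ c, θ c = 0) → (bipartite (basicArc B)).IsTree →
      (∃ s c, basicArc B s c ∧ η s c = 0) →
        WeakPooling N P (fun s c => basicArc B s c ∧ η s c ≠ 0) Finset.univ ∧
        MaximumThroughput N P (fun s c => basicArc B s c ∧ η s c ≠ 0) Finset.univ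
          N.compat Finset.univ μ) ∧
    -- positive slacks: the types without slack and their servers form a subsystem
    (∀ (C₁ : Finset C) (S₁ : Finset S),
      (∃ c, 0 < θ c) → (∀ c, c ∈ C₁ ↔ θ c = 0) → S₁ = serversOf N Finset.univ C₁ →
      (subgraphOn (basicArc B) S₁ C₁).Connected →
        (∀ s c, 0 < η s c → (s ∈ S₁ ↔ c ∈ C₁)) ∧
        (∃ B₁ : Finset (Var S C),
          (∀ s c, basicArc B₁ s c ↔ basicArc B s c ∧ s ∈ S₁ ∧ c ∈ C₁) ∧
          IsOptimalBasic N S₁ C₁ B₁ (fun s c => if s ∈ S₁ ∧ c ∈ C₁ then η s c else 0) μ 0 ∧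
          (subgraphOn (basicArc B₁) S₁ C₁).IsTree ∧
          ((∀ s c, basicArc B₁ s c → 0 < η s c) →
            CompletePooling N P (fun s c => basicArc B₁ s c ∧ η s c ≠ 0) S₁) ∧
          WeakPooling N P (fun s c => basicArc B₁ s c ∧ η s c ≠ 0) S₁ ∧
          MovesAtRate N P (fun s c => basicArc B₁ s c ∧ η s c ≠ 0) S₁ μ ∧
          MaximumThroughput N P (fun s c => basicArc B₁ s c ∧ η s c ≠ 0) S₁
            N.compat C₁ μ) ∧
        (∃ μ₂, IsOptimalValue N (Finset.univ \ S₁) (Finset.univ \ C₁) μ₂ ∧ μ < μ₂)) ∧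
    -- the decomposition into subsystems with increasing rates
    (∃ d : List (Block S C), IsDecomposition N Finset.univ Finset.univ d ∧
      (∀ d', IsDecomposition N Finset.univ Finset.univ d' → d' = d) ∧
      ((∃ c, 0 < θ c) → 2 ≤ d.length) ∧
      (∀ (C₁ : Finset C) (S₁ : Finset S),
        (∃ c, 0 < θ c) → (∀ c, c ∈ C₁ ↔ θ c = 0) → S₁ = serversOf N Finset.univ C₁ →
        (subgraphOn (basicArc B) S₁ C₁).Connected → DualFeasible N Finset.univ Finset.univ B →
          d.head? = some ⟨S₁, C₁, μ⟩) ∧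
      (∀ b ∈ d, (∃ B' η', IsOptimalBasic N b.servers b.types B' η' b.rate 0) ∧
        ((subgraphOn N.compat b.servers b.types).Connected →
          ∃ B' η', IsOptimalBasic N b.servers b.types B' η' b.rate 0 ∧
            (subgraphOn (basicArc B') b.servers b.types).IsTree)) ∧
      (∀ (B' : Block S C → Finset (Var S C)) (η' : Block S C → S → C → ℝ),
        (∀ b ∈ d, IsOptimalBasic N b.servers b.types (B' b) (η' b) b.rate 0) →
        ∀ d₁ b d₂, d = d₁ ++ b :: d₂ →
          ((subgraphOn (fun s c => 0 < η' b s c) b.servers b.types).Connected →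
            CompletePooling N P (fun s c => ∃ b' ∈ d, 0 < η' b' s c) b.servers) ∧
          WeakPooling N P (fun s c => ∃ b' ∈ d, 0 < η' b' s c) b.servers ∧
          MovesAtRate N P (fun s c => ∃ b' ∈ d, 0 < η' b' s c) b.servers b.rate ∧
          MaximumThroughput N P (fun s c => ∃ b' ∈ d, 0 < η' b' s c) b.servers
            (fun s c => N.compat s c ∧ ∀ b' ∈ d₁, s ∉ b'.servers) b.types b.rate)) := by
  have hC := N.nonempty_types
  have hne : (Finset.univ : Finset C).Nonempty := Finset.univ_nonempty
  have hbest := hopt.optimal.isBest hne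
  have hD : ∀ c ∈ (Finset.univ : Finset C), ∃ s ∈ Finset.univ, N.compat s c := fun c _ => by
    obtain ⟨s, hs⟩ := N.has_server c
    exact ⟨s, Finset.mem_univ s, hs⟩
  have hR : ∀ s ∈ (Finset.univ : Finset S), ∃ c ∈ Finset.univ, N.compat s c :=
    fun s hs => hbest.exists_compat hs
  have hμ := hbest.pos hD
  have hwhole : (∀ c, θ c = 0) → (bipartite (basicArc B)).IsTree →
      Critical N (fun s c => basicArc B s c ∧ η s c ≠ 0) Finset.univ Finset.univ η μ := by
    intro hθ htree
    obtain rfl : θ = 0 := funext hθ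
    exact hopt.critical (linked_of_bipartite_connected htree.connected) hne hμ
  have hmax : ∀ {G : S → C → Prop}, Critical N G Finset.univ Finset.univ η μ →
      MaximumThroughput N P G Finset.univ N.compat Finset.univ μ := fun hG =>
    hG.maximumThroughput (fun _ _ => id) (fun s _ _ _ => Finset.mem_univ s)
      (fun _ _ _ _ => id) fun _ _ _ hf => hbest.le hf
  refine ⟨fun hθ htree hpos => ?_, fun hθ htree _ => ?_, fun C₁ S₁ hpos hC₁ hS₁ hconn => ?_, ?_⟩
  · have hG : (fun s c => basicArc B s c ∧ η s c ≠ 0) = basicArc B := by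
      funext s c
      exact propext ⟨And.left, fun h => ⟨h, (hpos s c h).ne'⟩⟩
    have hcrit := hG ▸ hwhole hθ htree
    exact ⟨hcrit.completePooling (linked_of_bipartite_connected htree.connected), hmax hcrit⟩
  · exact ⟨(hwhole hθ htree).weakPooling, hmax (hwhole hθ htree)⟩
  · subst hS₁
    have hsub : C₁ ⊆ Finset.univ := Finset.subset_univ C₁
    have hθ : ∀ c ∈ Finset.univ, c ∈ C₁ ↔ θ c = 0 := fun c _ => hC₁ c
    have hne₁ : C₁.Nonempty := by
      obtain ⟨c, -, hc⟩ := hopt.optimal.exists_slack_eq_zero hne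
      exact ⟨c, (hC₁ c).2 hc⟩
    have hrest : (Finset.univ \ C₁).Nonempty := by
      obtain ⟨c, hc⟩ := hpos
      exact ⟨c, Finset.mem_sdiff.2 ⟨Finset.mem_univ c, fun h => hc.ne' ((hC₁ c).1 h)⟩⟩
    obtain ⟨hbasic, htree⟩ := hopt.subsystem hsub hθ hconn hne
    have hrestrict : restrict (serversOf N Finset.univ C₁) C₁ η =
        fun s c => if s ∈ serversOf N Finset.univ C₁ ∧ c ∈ C₁ then η s c else 0 := by
      funext s c
      rw [restrict]
      congr
    have hL := linked_of_connected htree.connected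
    have hbest₁ := (hopt.restrict_isBest hsub hθ hconn hne).1
    have hcrit := hbasic.critical hL hne₁ hμ
    -- On the arcs of the tree the restricted allocation agrees with `η`, so both describe the same
    -- graph.
    have hG : (fun s c => basicArc (arcBasis (arcsBetween B (serversOf N Finset.univ C₁) C₁)) s c ∧
        restrict (serversOf N Finset.univ C₁) C₁ η s c ≠ 0) = fun s c =>
        basicArc (arcBasis (arcsBetween B (serversOf N Finset.univ C₁) C₁)) s c ∧ η s c ≠ 0 := by
      funext s c
      refine propext (and_congr_right fun h => ?_)
      obtain ⟨-, hs, hc⟩ := basicArc_arcsBetween.1 h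
      rw [restrict_mem hs hc]
    rw [hG] at hcrit
    refine ⟨fun s c h => hopt.separated hsub (fun c _ hc h0 => hc ((hC₁ c).2 h0)) hconn h.ne',
      ⟨_, fun s c => basicArc_arcsBetween, hrestrict ▸ hbasic, htree, fun hall => ?_,
        hcrit.weakPooling, hcrit.movesAtRate, ?_⟩, hopt.exists_rest hsub hθ hconn hrest⟩
    · exact hcrit.completePooling (hL.mono fun s _ c _ h => ⟨h, (hall s c h).ne'⟩)
    · exact hcrit.maximumThroughput (fun _ _ => id)
        (fun s c hc hG => mem_serversOf.2 ⟨Finset.mem_univ s, c, hc, hG⟩) (fun _ _ _ _ => id)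
        fun _ _ _ hf => hbest₁.le hf
  · obtain ⟨d, hd⟩ := exists_isDecomposition N Finset.univ Finset.univ hR hD
    obtain ⟨d', hd'⟩ := hd.exists_cons hbest hne
    refine ⟨d, hd, fun _ h => hd.unique h, fun hpos => ?_, fun C₁ S₁ hpos hC₁ hS₁ hconn hdual => ?_,
      fun b hb => ?_, fun B' η' hB' d₁ b d₂ hsplit => ?_⟩
    · by_contra hlen
      obtain rfl : d' = [] := by
        rw [hd', List.length_cons] at hlen
        exact List.eq_nil_of_length_eq_zero (by omega)
      rw [hd'] at hd
      -- A single block would mean that all types are forced, and then no optimal solution has a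
      -- positive slack.
      have hall : Finset.univ ⊆ forced N Finset.univ Finset.univ μ :=
        Finset.sdiff_eq_empty_iff_subset.1 (isDecomposition_cons.1 hd).2.2.2.2.2.2.2.2
      obtain ⟨c, hc⟩ := hpos
      rw [hopt.optimal.1.slack_eq (Finset.mem_univ c),
        (mem_forced.1 (hall (Finset.mem_univ c))).2 η hbest, sub_self] at hc
      exact lt_irrefl 0 hc
    · subst hS₁
      rw [hd', hdual.forced_eq hopt (Finset.subset_univ C₁) (fun c _ => hC₁ c)
        (linked_of_connected hconn) hne, List.head?_cons]
    · obtain ⟨hbne, hrig, η₁, hη₁⟩ := hd.block hb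
      exact ⟨hrig.exists_isOptimalBasic hη₁ hbne, hrig.exists_isOptimalBasic_isTree hη₁ hbne⟩
    · have hb : b ∈ d := by simp [hsplit]
      have hcrit := hd.critical hR hD (fun b hb => (hB' b hb).optimal.isBest (hd.block hb).1) hb
      refine ⟨fun hconn => hcrit.completePooling ((linked_of_connected hconn).mono
        fun s _ c _ h => ⟨b, hb, h⟩), hcrit.weakPooling, hcrit.movesAtRate, ?_⟩
      rw [hsplit] at hd
      exact hd.maximumThroughput Finset.mem_univ hcrit
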